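/- Let $n\ge 2$. **Notation.** For $1\le i\le n-1$ let $\alpha_i=\mathrm{diag}(0,\dots,1,-1,\dots,0)$ ($1$ in position $i$) and $\mathrm h_i=\mathrm{diag}((n-i)\mathbf 1_i,-i\mathbf 1_{n-i})$; let $P_{ab}=(-1)^a\delta_{a,n+1-b}$, $J_{ab}=\delta_{a,n+1-b}$, $\sigma=\mathrm{diag}(1,-1,1,\dots)$, $F_i=\mathbf 1+\mathbb E_{i+1,i}$ and $M^\star=PMP^{-1}$. The coordinates are $\xi_{abc}=\log x_{abc}\in\mathbb C$ ($a,b,c\ge1$, $a+b+c=n$), $\zeta_j=\log z_j\in\mathbb C$ ($1\le j\le n-1$), and $\gamma_j=\log c_j\in\mathbb C$ ($1\le j\le\lfloor n/2\rfloor$), the toric variables, extended by $c_{n+1-j}=1/c_j$ (and $c_{(n+1)/2}=1$ for $n$ odd). Products of matrices are taken in the order written. Put $$N_k=\Big(\prod_{i=k}^{n-2}x_{n-i-1,\,i-k+1,\,k}^{-\mathrm h_{i+1}}F_i\Big)F_{n-1},\qquad A(\{x_{abc}\})=\sigma\,N_{n-1}\cdots N_1\,J,$$ let $A_1=A(\{x_{abc}\})$,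 let $A_2$, $A_3$ be $A$ with $x_{abc}$ replaced by $x_{cab}$, resp. $x_{bca}$, and $$D=\prod_j z_j^{\alpha_j},\qquad Q=(-1)^{\frac{n+1}2}\prod_{a+b+c=n} x_{abc}^{\frac12(\mathrm h_c^\star-\mathrm h_a)}\prod_j z_j^{-\frac{\alpha_j}2}P,\qquad (-1)^{1/2}=\sqrt{-1},$$ $$S=\big(Q A_1 D A_3^{-t}Q^t\big)^{-1},\quad M_0=D^{-1}A_2DA_2^{-t},\quad \Lambda=\mathrm{diag}(m_1,\dots,m_n)=(-1)^{n+1}\prod_j z_j^{\alpha_j-\alpha_j^\star}\prod_{a+b+c=n} x_{abc}^{\mathrm h_b-\mathrm h_b^\star},$$ with $\mu_j=\log m_j$. The *regular locus* is the set of $(\xi,\zeta,\gamma)$ with $m_1,\dots,m_n$ pairwise distinct. On it let $C_0$ be the lower triangular matrix with diagonal $c$ such that $C_0^{-1}M_0C_0=\Lambda^{-1}$. **The graph form.** For a graph on an oriented surface with jump matrices (an edge traversed backwards carries the inverse matrix), set $\Omega=\sum_v\sum_{k=1}^{n_v-1}\mathrm{Tr}(K_k^{-1}dK_k\wedge J_k^{-1}dJ_k)$,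 $K_k=J_1\cdots J_k$, where $J_1,\dots,J_{n_v}$ are the outgoing jumps at $v$ in counterclockwise order. The graph $\Sigma$ has the vertices (with outgoing jumps) $q_0:(S,Q,A_1,D,A_3^{-t},Q^{t})$; $q_1:(S^{-t},Q^{-t},A_1^{-t},D^{-1},A_3,Q^{-1})$; $f_0:(A_3^{-1},A_2^{-1},A_1^{-1})$; $f_1:(A_3^{t},A_2^{t},A_1^{t})$; $s:(A_2,D,A_2^{-t},M_0^{-1},D^{-1})$; $\beta:(C_0^{-1},M_0,C_0,\Lambda)$. $\Omega(\Sigma)$ is its form, and $\{,\}_\Sigma$ the bracket whose Poisson tensor is the inverse transposed of the coefficient matrix of $\Omega(\Sigma)$. **Ugaglia's bracket** on upper unipotent matrices $S=(s_{ij})$ is the skew bracket, a derivation in each argument, with $\{s_{ik},s_{i\ell}\}_U=2s_{k\ell}-s_{ik}s_{i\ell}$ ($i<k<\ell$); $\{s_{ik},s_{jk}\}_U=2s_{ij}-s_{ik}s_{jk}$ ($i<j<k$); $\{s_{ik},s_{k\ell}\}_U=s_{ik}s_{k\ell}-2s_{i\ell}$ ($i<k<\ell$); $\{s_{ik},s_{j\ell}\}_U=0$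 for $i<k<j<\ell$ and for $i<j<\ell<k$; $\{s_{ik},s_{j\ell}\}_U=2(s_{ij}s_{k\ell}-s_{i\ell}s_{jk})$ ($i<j<k<\ell$). **Statement.** 1. Let $U=\mathrm{diag}(u_1,\dots,u_n)$ with $\mathrm{Re}\,u_1<\dots<\mathrm{Re}\,u_n$ and $V\in\mathbb C^{n\times n}$, $V^t=-V$. Suppose $\Psi_{up},\Psi_{low}$ solve $\Psi'=(U+V/z)\Psi$ on $\mathbb C$ cut along the closed negative, resp. positive, imaginary half-line from $0$, and $\Psi e^{-zU}\sim\mathbf 1+\sum_{j\ge1}Y_jz^{-j}$ (the same series) as $z\to\infty$ in the closed upper, resp. lower, half-plane. If $\Psi_{up}=\Psi_{low}S_+$ on $\mathbb R_+$ and $\Psi_{low}=\Psi_{up}S_-$ on $\mathbb R_-$, then $S_+$ is upper unipotent, $S_-=S_+^{-t}$, and $S_+^{-t}S_+$ and $e^{2\pi iV}$ have the same characteristic polynomial. 2. At every point of the chart: $A_1A_2A_3=\mathbf 1$; $S$ is upper unipotent; for a diagonal matrix $d$, $dPA_1DA_3^{-t}(dP)^t$ has unit diagonal if and only if $d^2=(QP^{-1})^2$;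 $M_0$ is lower triangular with diagonal $\Lambda^{-1}$; $m_{n+1-j}=1/m_j$; $SS^{-t}=Q^{-t}A_3^tM_0A_3^{-t}Q^t$; and $S^{-t}S$ has characteristic polynomial $\prod_j(X-m_j)$. 3. The regular locus is open and dense. On it $C_0$ exists and is unique, at each vertex of $\Sigma$ the product of the listed jumps is $\mathbf 1$, and $(\xi,\zeta)$ are local coordinates on the space of upper unipotent matrices through $S$ (the differential of $S$ is onto that space, and its kernel is spanned by the $\partial_{\gamma_j}$), and $(\xi,\zeta,\gamma)\mapsto(S,C_0)$ is an immersion. 4. On the regular locus $\Omega(\Sigma)=2\omega_f+2\omega_{q_0}+\omega_\beta+\omega_s$, where, with $\mathbb G_{jk}=\mathrm{Tr}(\mathrm h_j\mathrm h_k)$ and $H$ the Heaviside function, $H(0)=\frac12$, $$\omega_f=\frac12\sum F_{ijk;i'j'k'}\,d\xi_{ijk}\wedge d\xi_{i'j'k'},$$ $$F_{ijk;i'j'k'}=(\mathbb G_{i,n-j'}-\mathbb G_{i',n-j})H(\Delta i\Delta j)+(\mathbb G_{j,n-k'}-\mathbb G_{j',n-k})H(\Delta j\Delta k)+(\mathbb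 G_{k,n-i'}-\mathbb G_{k',n-i})H(\Delta k\Delta i),$$ $$\omega_{q_0}=\sum_j\sum_{a+b+c=n}\mathrm{Tr}\big(\alpha_j(\mathrm h_a+\mathrm h_c^\star)\big)\,d\xi_{abc}\wedge d\zeta_j+\frac12\sum\mathrm{Tr}\big(\mathrm h_c^\star\mathrm h_{a'}-\mathrm h_a\mathrm h_{c'}^\star\big)\,d\xi_{abc}\wedge d\xi_{a'b'c'},$$ $$\omega_\beta=4\sum_{j=1}^{\lfloor n/2\rfloor}d\gamma_j\wedge d\mu_j,\qquad \omega_s=2\sum_j\sum_{a+b+c=n}\mathrm{Tr}(\alpha_j\mathrm h_b^\star)\,d\xi_{abc}\wedge d\zeta_j$$ (sums without bounds run over all ordered pairs of triples, $\Delta i=i'-i$, etc.). This form, which has constant coefficients, is nondegenerate, hence symplectic, and $x_{abc},z_j,c_j$ are log-canonical: the bracket $\{,\}_\Sigma$ of any two of them is a constant times their product. 5. On the regular locus the Hamiltonian vector field of $\mu_j$, $1\le j\le\lfloor n/2\rfloor$, is $\frac14\partial_{\gamma_j}$, i.e. $\Omega(\Sigma)(\frac14\partial_{\gamma_j},\cdot)=d\mu_j$;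 $S$ is invariant under the translations of the $\gamma_j$; and the reduced bracket, that is $\{,\}_\Sigma$ on functions of $S$, satisfies $$\{f,g\}_U=-8\,\{f,g\}_\Sigma$$ for all $f,g$ differentiable at the point $S$. A function $f$ is in involution with every $g$ for $\{,\}_U$ at $S$ if and only if the differential of $f\circ S$ there is a linear combination of $d\mu_1,\dots,d\mu_{\lfloor n/2\rfloor}$; so the Casimirs are $m_1,\dots,m_{\lfloor n/2\rfloor}$. -/

import Mathlib

open Matrix Complex

noncomputable section

namespace FrobeniusStokes

/-! ### Two-forms attached to a graph with jump matrices -/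

section GraphForm

variable {X : Type*} [NormedAddCommGroup X] [NormedSpace ℂ X]
variable {ι : Type*} [Fintype ι] [DecidableEq ι]

/-- Entrywise directional derivative of a matrix-valued function. -/
def mder (J : X → Matrix ι ι ℂ) (p u : X) : Matrix ι ι ℂ :=
  Matrix.of fun i j => fderiv ℂ (fun q => J q i j) p u

/-- The two-form `Tr (K⁻¹ dK ∧ J⁻¹ dJ)`. -/
def traceWedge (K J : X → Matrix ι ι ℂ) (p u v : X) : ℂ :=
  Matrix.trace (((K p)⁻¹ * mder K p u) * ((J p)⁻¹ * mder J p v))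
    - Matrix.trace (((K p)⁻¹ * mder K p v) * ((J p)⁻¹ * mder J p u))

/-- The two-form `df ∧ dg` of two scalar functions. -/
def wedge (f g : X → ℂ) (p u v : X) : ℂ :=
  fderiv ℂ f p u * fderiv ℂ g p v - fderiv ℂ f p v * fderiv ℂ g p u

/-- The contribution `∑_{k=1}^{m-1} Tr (K_k⁻¹ dK_k ∧ J_k⁻¹ dJ_k)`, `K_k = J_1 ⋯ J_k`, of a vertex
whose edges, directed outwards and listed counterclockwise, carry `J_1, …, J_m`. -/
def starForm (Js : List (X → Matrix ι ι ℂ)) (p u v : X) : ℂ :=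
  ∑ k ∈ Finset.range (Js.length - 1),
    traceWedge (fun q => ((Js.take (k + 1)).map fun J => J q).prod)
      (Js.getD k fun _ => 1) p u v

/-- The jump matrix read in the direction leaving the vertex: for a half-edge `(e, true)` the
edge `e` is oriented away from the vertex, for `(e, false)` towards it. -/
def outJump {E : Type*} (J : E → X → Matrix ι ι ℂ) (h : E × Bool) : X → Matrix ι ι ℂ :=
  fun q => if h.2 then J h.1 q else (J h.1 q)⁻¹

/-- The standard two-form of a graph on an oriented surface, the graph being given by the list of
its vertices and each vertex by the counterclockwise list of its half-edges. -/
def graphForm {E : Type*} (vertices : List (List (E × Bool))) (J : E → X → Matrix ι ι ℂ)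
    (p u v : X) : ℂ :=
  (vertices.map fun star => starForm (star.map (outJump J)) p u v).sum

/-- At each vertex the counterclockwise product of the outgoing jump matrices is `1`. -/
def VertexConditions {E : Type*} (vertices : List (List (E × Bool)))
    (J : E → X → Matrix ι ι ℂ) (p : X) : Prop :=
  ∀ star ∈ vertices, (star.map fun h => outJump J h p).prod = 1

end GraphForm

/-! ### Coordinates -/

/-- Triples of positive integers with sum `n`. -/
def triples (n : ℕ) : Finset (ℕ × ℕ × ℕ) :=
  (Finset.range n ×ˢ Finset.range n ×ˢ Finset.range n).filter
    fun t => 0 < t.1 ∧ 0 < t.2.1 ∧ 0 < t.2.2 ∧ t.1 + t.2.1 + t.2.2 = n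

/-- Labels of the coordinates: `ξ_{abc}`, then `ζ_1, …, ζ_{n-1}`, then `γ_1, …, γ_{⌊n/2⌋}`. -/
abbrev Coord (n : ℕ) : Type := (triples n : Finset (ℕ × ℕ × ℕ)) ⊕ (Fin (n - 1) ⊕ Fin (n / 2))

/-- The space of logarithmic coordinates. -/
abbrev Chart (n : ℕ) : Type := Coord n → ℂ

variable {n : ℕ}

/-- `ξ_{abc} = log x_{abc}` (and `0` if `(a, b, c)` is not a label). -/
def xi (a b c : ℕ) (p : Chart n) : ℂ :=
  if h : (a, b, c) ∈ triples n then p (Sum.inl ⟨(a, b, c), h⟩) else 0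

/-- `ζ_k = log z_k`; the index is shifted by one, so `k : Fin (n - 1)` stands for `k + 1`. -/
def zeta (k : Fin (n - 1)) (p : Chart n) : ℂ := p (Sum.inr (Sum.inl k))

/-- `γ_k = log c_k`, with the same shift of the index. -/
def gam (k : Fin (n / 2)) (p : Chart n) : ℂ := p (Sum.inr (Sum.inr k))

/-- Diagonal of `α_i = diag (0, …, 1, -1, …, 0)`, `1` in position `i` (`i = 1, …, n - 1`). -/
def alpha (n i : ℕ) (j : Fin n) : ℂ :=
  if (j : ℕ) + 1 = i then 1 else if (j : ℕ) = i then -1 else 0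

/-- Diagonal of `h_i = diag ((n - i) 1_i, -i 1_{n-i})`. -/
def hvec (n i : ℕ) (j : Fin n) : ℂ := if (j : ℕ) < i then (n : ℂ) - i else -(i : ℂ)

/-- `M ↦ P M P⁻¹` on diagonal matrices: the reversal of the diagonal. -/
def dstar (v : Fin n → ℂ) : Fin n → ℂ := fun j => v (Fin.rev j)

/-- The trace of the product of two diagonal matrices. -/
def dtr (v w : Fin n → ℂ) : ℂ := ∑ j, v j * w j

/-! ### The jump matrices -/

/-- `diag (1, -1, 1, …)`. -/
def sigmaMat (n : ℕ) : Matrix (Fin n) (Fin n) ℂ := diagonal fun j => (-1) ^ (j : ℕ)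

/-- The matrix with ones on the antidiagonal. -/
def flipMat (n : ℕ) : Matrix (Fin n) (Fin n) ℂ :=
  Matrix.of fun a b => if b = Fin.rev a then 1 else 0

/-- `P_{ab} = (-1)^a δ_{a, n+1-b}` (indices from `1` to `n`). -/
def Pmat (n : ℕ) : Matrix (Fin n) (Fin n) ℂ :=
  Matrix.of fun a b => if b = Fin.rev a then (-1) ^ ((a : ℕ) + 1) else 0

/-- `F_i = 1 + E_{i+1, i}` (indices from `1` to `n`). -/
def Fmat (n i : ℕ) : Matrix (Fin n) (Fin n) ℂ :=
  1 + Matrix.of (fun a b : Fin n => if (a : ℕ) = i ∧ (b : ℕ) + 1 = i then (1 : ℂ) else 0)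

/-- `N_k = (∏_{i=k}^{n-2} y_{n-i-1, i-k+1, k} ^ (-h_{i+1}) F_i) F_{n-1}`, where `y` is given by its
logarithm. -/
def Nmat (n : ℕ) (y : ℕ → ℕ → ℕ → ℂ) (k : ℕ) : Matrix (Fin n) (Fin n) ℂ :=
  ((List.range' k (n - 1 - k)).map fun i =>
      diagonal (fun j => exp (-(y (n - i - 1) (i - k + 1) k * hvec n (i + 1) j))) *
        Fmat n i).prod * Fmat n (n - 1)

/-- The Fock–Goncharov matrix `A (y) = σ N_{n-1} ⋯ N_1 · (antidiagonal)`. -/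
def fockGoncharov (n : ℕ) (y : ℕ → ℕ → ℕ → ℂ) : Matrix (Fin n) (Fin n) ℂ :=
  sigmaMat n * ((List.range' 1 (n - 1)).reverse.map (Nmat n y)).prod * flipMat n

def A1 (p : Chart n) : Matrix (Fin n) (Fin n) ℂ := fockGoncharov n fun a b c => xi a b c p

def A2 (p : Chart n) : Matrix (Fin n) (Fin n) ℂ := fockGoncharov n fun a b c => xi c a b p

def A3 (p : Chart n) : Matrix (Fin n) (Fin n) ℂ := fockGoncharov n fun a b c => xi b c a p

/-- `D = diag (z_1, z_2 / z_1, …, 1 / z_{n-1})`. -/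
def Dmat (p : Chart n) : Matrix (Fin n) (Fin n) ℂ :=
  diagonal fun j => exp (∑ k : Fin (n - 1), zeta k p * alpha n (k + 1) j)

/-- The diagonal of
`(-1)^{(n+1)/2} ∏ x_{abc} ^ ((h_c^⋆ - h_a) / 2) ∏ z_j ^ (-α_j / 2)`. -/
def qdiag (p : Chart n) (j : Fin n) : ℂ :=
  I ^ (n + 1) *
    exp ((1 / 2) * (∑ t ∈ triples n, xi t.1 t.2.1 t.2.2 p *
          (dstar (hvec n t.2.2) j - hvec n t.1 j)
        - ∑ k : Fin (n - 1), zeta k p * alpha n (k + 1) j))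

def Qmat (p : Chart n) : Matrix (Fin n) (Fin n) ℂ := diagonal (qdiag p) * Pmat n

/-- The Stokes matrix: the solution of `S Q A₁ D A₃^{-t} Q^t = 1`. -/
def Smat (p : Chart n) : Matrix (Fin n) (Fin n) ℂ :=
  (Qmat p * A1 p * Dmat p * ((A3 p)⁻¹)ᵀ * (Qmat p)ᵀ)⁻¹

/-- The local monodromy `M₀ = D⁻¹ A₂ D A₂^{-t}`. -/
def M0 (p : Chart n) : Matrix (Fin n) (Fin n) ℂ := (Dmat p)⁻¹ * A2 p * Dmat p * ((A2 p)⁻¹)ᵀ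

/-- `μ_j = ∑ ζ_k (α_k - α_k^⋆)_j + ∑ ξ_{abc} (h_b - h_b^⋆)_j`, the logarithm of `m_j` up to the
constant `log (-1)^{n+1}`. -/
def mu (j : Fin n) (p : Chart n) : ℂ :=
  (∑ k : Fin (n - 1), zeta k p * (alpha n (k + 1) j - dstar (alpha n (k + 1)) j))
    + ∑ t ∈ triples n, xi t.1 t.2.1 t.2.2 p * (hvec n t.2.1 j - dstar (hvec n t.2.1) j)

/-- `m_j`, the diagonal entries of `Λ = (-1)^{n+1} ∏ z_j^{α_j-α_j^⋆} ∏ x_{abc}^{h_b-h_b^⋆}`. -/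
def mval (p : Chart n) (j : Fin n) : ℂ := (-1) ^ (n + 1) * exp (mu j p)

def Lam (p : Chart n) : Matrix (Fin n) (Fin n) ℂ := diagonal (mval p)

/-- The toric variables `c_1, …, c_n`, subject to `c_{n+1-j} = 1 / c_j`. -/
def cval (p : Chart n) (j : Fin n) : ℂ :=
  if h : (j : ℕ) < n / 2 then exp (gam ⟨j, h⟩ p)
  else if h : (Fin.rev j : ℕ) < n / 2 then exp (-gam ⟨Fin.rev j, h⟩ p)
  else 1

/-- The lower triangular matrix with diagonal `c` that diagonalises `M₀`: its `j`-th column is `c_j`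
times the spectral projector of `M₀` for the eigenvalue `1 / m_j` applied to the `j`-th basis
vector. -/
def C0 (p : Chart n) : Matrix (Fin n) (Fin n) ℂ :=
  Matrix.of fun i j => cval p j *
    (Polynomial.aeval (M0 p)
      (Lagrange.basis Finset.univ (fun k => (mval p k)⁻¹) j)) i j

/-- Where the eigenvalues `m_1, …, m_n` are pairwise distinct. -/
def regularLocus (n : ℕ) : Set (Chart n) := {p | Function.Injective (mval p)}

/-! ### The Stokes graph -/

/-- The edges: the rays `S`, `S^{-t}`; the arcs `Q`, `Q^{-t}`; the edges carrying `A_i` and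
`A_i^{-t}`; those carrying `D` and `D⁻¹`; the edge `M₀`; the circle around `0` carrying `C₀`; and
the edge from the circle to `0` carrying `Λ`. -/
inductive Edge where
  | stokesR | stokesL
  | arcTop | arcBot
  | a1 | a2 | a3
  | a1' | a2' | a3'
  | dR | dL
  | mono | circle | inner

/-- The jump matrices. -/
def jump : Edge → Chart n → Matrix (Fin n) (Fin n) ℂ
  | .stokesR => fun p => Smat p
  | .stokesL => fun p => ((Smat p)⁻¹)ᵀ
  | .arcTop => fun p => Qmat p
  | .arcBot => fun p => ((Qmat p)⁻¹)ᵀ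
  | .a1 => fun p => A1 p
  | .a2 => fun p => A2 p
  | .a3 => fun p => A3 p
  | .a1' => fun p => ((A1 p)⁻¹)ᵀ
  | .a2' => fun p => ((A2 p)⁻¹)ᵀ
  | .a3' => fun p => ((A3 p)⁻¹)ᵀ
  | .dR => fun p => Dmat p
  | .dL => fun p => (Dmat p)⁻¹
  | .mono => fun p => M0 p
  | .circle => fun p => C0 p
  | .inner => fun p => Lam p

/-- The vertices `q₀, q₁, f₀, f₁, s, β` with their half-edges in counterclockwise order. -/
def stokesGraph : List (List (Edge × Bool)) :=
  [ [(.stokesR, true), (.arcTop, true), (.a1, true), (.dR, true), (.a3', true), (.arcBot, false)],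
    [(.stokesL, true), (.arcBot, true), (.a1', true), (.dL, true), (.a3, true), (.arcTop, false)],
    [(.a3, false), (.a2, false), (.a1, false)],
    [(.a3', false), (.a2', false), (.a1', false)],
    [(.a2, true), (.dL, false), (.a2', true), (.mono, false), (.dR, false)],
    [(.circle, false), (.mono, true), (.circle, true), (.inner, true)] ]

/-- The extended symplectic form `Ω(Σ)`. -/
def OmegaSigma (p u v : Chart n) : ℂ := graphForm stokesGraph jump p u v

/-! ### The explicit expression -/

/-- The Heaviside function with `H 0 = 1 / 2`. -/
def heaviside (m : ℤ) : ℂ := if 0 < m then 1 else if m = 0 then 1 / 2 else 0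

/-- `G_{jk} = Tr (h_j h_k)`. -/
def Gco (n j k : ℕ) : ℂ := dtr (hvec n j) (hvec n k)

/-- The coefficients `F_{ijk; i'j'k'}`. -/
def Fco (n : ℕ) (t t' : ℕ × ℕ × ℕ) : ℂ :=
  let di : ℤ := (t'.1 : ℤ) - t.1
  let dj : ℤ := (t'.2.1 : ℤ) - t.2.1
  let dk : ℤ := (t'.2.2 : ℤ) - t.2.2
  (Gco n t.1 (n - t'.2.1) - Gco n t'.1 (n - t.2.1)) * heaviside (di * dj)
    + (Gco n t.2.1 (n - t'.2.2) - Gco n t'.2.1 (n - t.2.2)) * heaviside (dj * dk)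
    + (Gco n t.2.2 (n - t'.1) - Gco n t'.2.2 (n - t.1)) * heaviside (dk * di)

def omegaF (p u v : Chart n) : ℂ :=
  (1 / 2) * ∑ t ∈ triples n, ∑ t' ∈ triples n,
    Fco n t t' * wedge (xi t.1 t.2.1 t.2.2) (xi t'.1 t'.2.1 t'.2.2) p u v

def omegaQ (p u v : Chart n) : ℂ :=
  (∑ k : Fin (n - 1), ∑ t ∈ triples n,
      dtr (alpha n (k + 1)) (hvec n t.1 + dstar (hvec n t.2.2)) *
        wedge (xi t.1 t.2.1 t.2.2) (zeta k) p u v)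
    + (1 / 2) * ∑ t ∈ triples n, ∑ t' ∈ triples n,
        (dtr (dstar (hvec n t.2.2)) (hvec n t'.1) - dtr (hvec n t.1) (dstar (hvec n t'.2.2))) *
          wedge (xi t.1 t.2.1 t.2.2) (xi t'.1 t'.2.1 t'.2.2) p u v

/-- The index `j ≤ ⌊n/2⌋` seen in `{1, …, n}`. -/
def halfIdx (k : Fin (n / 2)) : Fin n := ⟨k, lt_of_lt_of_le k.2 (Nat.div_le_self n 2)⟩

def omegaBeta (p u v : Chart n) : ℂ :=
  4 * ∑ k : Fin (n / 2), wedge (gam k) (mu (halfIdx k)) p u v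

def omegaS (p u v : Chart n) : ℂ :=
  2 * ∑ k : Fin (n - 1), ∑ t ∈ triples n,
    dtr (alpha n (k + 1)) (dstar (hvec n t.2.1)) *
      wedge (xi t.1 t.2.1 t.2.2) (zeta k) p u v

def omegaExplicit (p u v : Chart n) : ℂ :=
  2 * omegaF p u v + 2 * omegaQ p u v + omegaBeta p u v + omegaS p u v

/-! ### Poisson brackets -/

/-- The `i`-th coordinate vector. -/
def basisVec (i : Coord n) : Chart n := Pi.single i 1

/-- The matrix `ω_{ij}` of a two-form in the logarithmic coordinates. -/
def formMatrix (Ω : Chart n → Chart n → Chart n → ℂ) (p : Chart n) :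
    Matrix (Coord n) (Coord n) ℂ :=
  Matrix.of fun i j => Ω p (basisVec i) (basisVec j)

/-- The Poisson bracket induced by a two-form: the Poisson tensor is the inverse transposed of the
matrix of the form. -/
def poisson (Ω : Chart n → Chart n → Chart n → ℂ) (f g : Chart n → ℂ) (p : Chart n) : ℂ :=
  ∑ i, ∑ j, ((formMatrix Ω p)⁻¹)ᵀ i j *
    fderiv ℂ f p (basisVec i) * fderiv ℂ g p (basisVec j)

/-- Labels of the entries `s_{ij}`, `i < j`, of an upper unipotent matrix. -/
abbrev StokesIdx (n : ℕ) : Type := {a : Fin n × Fin n // a.1 < a.2}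

/-- The manifold of Stokes matrices, in the coordinates `s_{ij}`, `i < j`. -/
abbrev StokesSpace (n : ℕ) : Type := StokesIdx n → ℂ

def stokesCoords (S : Matrix (Fin n) (Fin n) ℂ) : StokesSpace n := fun a => S a.1.1 a.1.2

def entry (s : StokesSpace n) (i j : Fin n) : ℂ := if h : i < j then s ⟨(i, j), h⟩ else 0

/-- The listed brackets `{s_{ik}, s_{jl}}`; it is `0` for the pairs that are only obtained from the
list by skew-symmetry. -/
def ugagliaHalf (s : StokesSpace n) (i k j l : Fin n) : ℂ :=
  if i = j ∧ k < l then 2 * entry s k l - entry s i k * entry s i l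
  else if k = l ∧ i < j then 2 * entry s i j - entry s i k * entry s j k
  else if k = j then entry s i k * entry s k l - 2 * entry s i l
  else if i < j ∧ j < k ∧ k < l then
    2 * (entry s i j * entry s k l - entry s i l * entry s j k)
  else 0

/-- `{s_a, s_b}_U`, extended by skew-symmetry. -/
def ugagliaTensor (s : StokesSpace n) (a b : StokesIdx n) : ℂ :=
  ugagliaHalf s a.1.1 a.1.2 b.1.1 b.1.2 - ugagliaHalf s b.1.1 b.1.2 a.1.1 a.1.2

/-- Ugaglia's bracket of two functions of the Stokes matrix. -/
def ugaglia (f g : StokesSpace n → ℂ) (s : StokesSpace n) : ℂ :=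
  ∑ a, ∑ b, ugagliaTensor s a b *
    fderiv ℂ f s (Pi.single a 1) * fderiv ℂ g s (Pi.single b 1)

/-! ### Stokes matrices of the differential equation -/

def IsUpperUnipotent (S : Matrix (Fin n) (Fin n) ℂ) : Prop :=
  S.IsUpperTriangular ∧ ∀ i, S i i = 1

/-- `Ψ` solves `Ψ' = (U + V/z) Ψ`, `U = diag u`, on the plane cut along the half-line of the
imaginary axis where `ε Im z ≤ 0`, and `Ψ e^{-zU}` has the asymptotic expansion `∑ Y_k z^{-k}` in
the closed half-plane `ε Im z ≥ 0`. -/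
structure IsSectorialSolution (u : Fin n → ℂ) (V : Matrix (Fin n) (Fin n) ℂ)
    (Y : ℕ → Matrix (Fin n) (Fin n) ℂ) (ε : ℝ) (Ψ : ℂ → Matrix (Fin n) (Fin n) ℂ) : Prop where
  ode : ∀ z : ℂ, (z.re ≠ 0 ∨ 0 < ε * z.im) → ∀ i j,
    HasDerivAt (fun w => Ψ w i j) (((diagonal u + z⁻¹ • V) * Ψ z) i j) z
  asymp : ∀ N : ℕ, ∀ i j,
    (fun z : ℂ => (Ψ z * diagonal (fun k => exp (-(z * u k)))
        - ∑ k ∈ Finset.range (N + 1), (z⁻¹) ^ k • Y k) i j)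
      =O[Bornology.cobounded ℂ ⊓ Filter.principal {z : ℂ | 0 ≤ ε * z.im}]
        fun z : ℂ => (z⁻¹) ^ (N + 1)

/-- `Sp` and `Sm` are the Stokes matrices of `Ψ' = (U + V/z) Ψ` on the positive and on the negative
half-line, both oriented towards infinity: `Ψ_left = Ψ_right S`. -/
def IsStokesPair (u : Fin n → ℂ) (V Sp Sm : Matrix (Fin n) (Fin n) ℂ) : Prop :=
  ∃ (Y : ℕ → Matrix (Fin n) (Fin n) ℂ) (Ψup Ψlow : ℂ → Matrix (Fin n) (Fin n) ℂ),
    Y 0 = 1 ∧ IsSectorialSolution u V Y 1 Ψup ∧ IsSectorialSolution u V Y (-1) Ψlow ∧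
    (∀ r : ℝ, 0 < r → Ψup r = Ψlow r * Sp) ∧ (∀ r : ℝ, r < 0 → Ψlow r = Ψup r * Sm)

end FrobeniusStokes

end

/-! The two-form of a graph is a group cocycle in disguise. For invertible matrix functions, c(x, y)
= Tr(x⁻¹dx ∧ dy y⁻¹) satisfies the cocycle identity, so it defines a central extension `Ext` of the
group of jets (a matrix with two logarithmic derivatives). The k-th summand at a vertex is
c(J_1⋯J_{k-1}, J_k); hence the form of a vertex is the central component of the product of the
normalized lifts of its jumps (`starForm_eq`). To compute Ω(Σ) is to lift every vertex relation to
`Ext`; the jet component of the lifted relation is the vertex condition itself.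

Constant matrices do not contribute to c, and for triangular jets c only sees the logarithmic
diagonals (`c_tri`). Each Fock–Goncharov matrix has the form A = σBWσ with B lower triangular and W
an antidiagonal constant. At q₀ and s the antidiagonals cancel and all factors become triangular
(`stokes_word`, `monodromy_val`); at β they are triangular from the start (`beta_vertex`). The
vertices f are different: A₁A₂A₃ = 1 and its central value are `word_relation` and `fg_relation`,
proved by induction on n. The coordinates with c = 1 are peeled off the word; `strip_relation` turns
them into a Coxeter element and a torus element, up to a unipotent matrix supported in the first
row. What remains is block triangular, with the word of smaller size as lower block. So the word is
scalar up to a first-row unipotent, and comparison with the cyclically rotated word removes the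
latter (`rad_eq_one`). The central terms add up to `theta`, which `heaviside_gcoef` matches with the
coefficients F. The vertices q₁, f₁ are images of q₀, f₀ under g ↦ g^{-t}, which preserves c.

For the geometry, all vertex relations are multiplied into one, S S^{-t} = G⁻¹Λ⁻¹G, whose central
defect is exactly Ω(Σ) (`glue_relation`). A variation dS = ES + SE^t conjugates S S^{-t}, so
contracting Ω with it gives explicit traces (`Glued.contraction`). For E = 0, together with the
rigidity of triangular words (`Lw_rigid`) and a dimension count, this yields the kernel and the
image of dS. For an E adapted to an entry s_{jl} it yields the Hamiltonian field of s_{jl}, up to a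
factor and a vector along the fibres, and ES + SE^t is then a multiple of Ugaglia's tensor
(`stokes_hamiltonian`). Nondegeneracy, the reduced bracket and the Casimirs follow by linear
algebra.

For the differential equation, skew-symmetry of V makes Ψ_low(-z)^t Ψ_up(z) constant, and the
asymptotics make it 1. Hence S_+ = Ψ_up(-r)^t Ψ_up(r), which is upper unipotent by decay as r → ∞;
as r → 0 the matrix Ψ_up(-r)Ψ_up(r)⁻¹ tends to e^{πiV}, which gives the characteristic polynomial
(`stokes_pair`). -/

noncomputable section

namespace FrobeniusStokes

/-! ### Jets of invertible matrices and their central extension -/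

section Jets

variable {ι : Type*} [Fintype ι] [DecidableEq ι]

/-- An invertible matrix together with two logarithmic derivatives `g⁻¹ dg`. -/
@[ext]
structure Jet (ι : Type*) [Fintype ι] [DecidableEq ι] where
  g : (Matrix ι ι ℂ)ˣ
  a : Fin 2 → Matrix ι ι ℂ

namespace Jet

/-- The inverse matrix of a jet. -/
def gi (x : Jet ι) : Matrix ι ι ℂ := ((x.g⁻¹ : (Matrix ι ι ℂ)ˣ) : Matrix ι ι ℂ)

/-- The underlying matrix of a jet. -/
def m (x : Jet ι) : Matrix ι ι ℂ := (x.g : Matrix ι ι ℂ)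

@[simp] lemma m_mul_gi (x : Jet ι) : x.m * x.gi = 1 := x.g.mul_inv
@[simp] lemma gi_mul_m (x : Jet ι) : x.gi * x.m = 1 := x.g.inv_mul
@[simp] lemma m_mul_gi_assoc (x : Jet ι) (M : Matrix ι ι ℂ) : x.m * (x.gi * M) = M := by
  rw [← mul_assoc, m_mul_gi, one_mul]
@[simp] lemma gi_mul_m_assoc (x : Jet ι) (M : Matrix ι ι ℂ) : x.gi * (x.m * M) = M := by
  rw [← mul_assoc, gi_mul_m, one_mul]

lemma ext_m {x y : Jet ι} (h : x.m = y.m) (ha : ∀ k, x.a k = y.a k) : x = y :=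
  Jet.ext (Units.ext h) (funext ha)

instance : One (Jet ι) := ⟨⟨1, 0⟩⟩
instance : Mul (Jet ι) := ⟨fun x y => ⟨x.g * y.g, fun k => y.gi * x.a k * y.m + y.a k⟩⟩
instance : Inv (Jet ι) := ⟨fun x => ⟨x.g⁻¹, fun k => -(x.m * x.a k * x.gi)⟩⟩

@[simp] lemma one_m : (1 : Jet ι).m = 1 := rfl
@[simp] lemma one_gi : (1 : Jet ι).gi = 1 := by
  change (((1 : (Matrix ι ι ℂ)ˣ)⁻¹ : (Matrix ι ι ℂ)ˣ) : Matrix ι ι ℂ) = 1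
  rw [inv_one]; rfl
@[simp] lemma one_a (k : Fin 2) : (1 : Jet ι).a k = 0 := rfl
@[simp] lemma mul_m (x y : Jet ι) : (x * y).m = x.m * y.m := rfl
@[simp] lemma mul_gi (x y : Jet ι) : (x * y).gi = y.gi * x.gi := by
  change (((x.g * y.g)⁻¹ : (Matrix ι ι ℂ)ˣ) : Matrix ι ι ℂ) = _
  rw [_root_.mul_inv_rev]; rfl
@[simp] lemma mul_a (x y : Jet ι) (k : Fin 2) : (x * y).a k = y.gi * x.a k * y.m + y.a k := rfl
@[simp] lemma inv_m (x : Jet ι) : (x⁻¹).m = x.gi := rfl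
@[simp] lemma inv_gi (x : Jet ι) : (x⁻¹).gi = x.m := by
  change (((x.g⁻¹)⁻¹ : (Matrix ι ι ℂ)ˣ) : Matrix ι ι ℂ) = _
  rw [inv_inv]; rfl
@[simp] lemma inv_a (x : Jet ι) (k : Fin 2) : (x⁻¹).a k = -(x.m * x.a k * x.gi) := rfl

instance : Group (Jet ι) := Group.ofLeftAxioms
  (fun x y z => ext_m (by simp [mul_assoc]) fun k => by simp [mul_assoc, mul_add, add_mul, add_assoc])
  (fun x => ext_m (by simp) fun k => by simp)
  (fun x => ext_m (by simp) fun k => by simp [mul_assoc])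

/-- The cocycle `Tr (x⁻¹ dx ∧ dy y⁻¹)`. -/
def c (x y : Jet ι) : ℂ :=
  trace (y.gi * x.a 0 * y.m * y.a 1) - trace (y.gi * x.a 1 * y.m * y.a 0)

lemma trace_conj (y : Jet ι) (M : Matrix ι ι ℂ) : trace (y.gi * M * y.m) = trace M := by
  rw [trace_mul_comm, ← mul_assoc, m_mul_gi, one_mul]

/-- The logarithmic derivative of a product is a conjugate of the first one plus the second, and the
trace is invariant under conjugation by z; the cross terms on the two sides then agree. This is
associativity in the extension. -/
lemma c_cocycle (x y z : Jet ι) : c x y + c (x * y) z = c y z + c x (y * z) := by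
  have h : ∀ k l, trace (z.gi * (y.gi * x.a k * y.m) * z.m * (z.gi * y.a l * z.m))
      = trace (y.gi * x.a k * y.m * y.a l) := fun k l => by
    rw [← trace_conj z (y.gi * x.a k * y.m * y.a l)]; simp [mul_assoc]
  have h1 := h 0 1
  have h2 := h 1 0
  simp only [c, mul_a, mul_m, mul_gi, mul_add, add_mul, trace_add, mul_assoc] at *
  linear_combination -h1 + h2

@[simp] lemma c_one_left (x : Jet ι) : c 1 x = 0 := by simp [c]
@[simp] lemma c_one_right (x : Jet ι) : c x 1 = 0 := by simp [c]

/-- The logarithmic derivatives of x⁻¹ are minus conjugates of those of x, so the pairing is the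
trace of a commutator. This makes normalized lifts compatible with inverses and kills the last
summand at a vertex. -/
lemma c_inv_right (x : Jet ι) : c x x⁻¹ = 0 := by
  have h : ∀ k l, trace (x.m * (x.a k * x.a l * x.gi)) = trace (x.a k * x.a l) := fun k l => by
    rw [trace_mul_comm]; simp [mul_assoc]
  simp only [c, inv_gi, inv_m, inv_a, mul_neg, trace_neg, mul_assoc, gi_mul_m_assoc]
  have h1 := h 0 1
  have h2 := h 1 0
  have h3 := trace_mul_comm (x.a 0) (x.a 1)
  simp only [mul_assoc] at h1 h2
  rw [h1, h2, h3]; ring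

lemma c_inv_left (x : Jet ι) : c x⁻¹ x = 0 := by
  simpa using c_inv_right x⁻¹

/-- Constant matrices. -/
def kap : (Matrix ι ι ℂ)ˣ →* Jet ι where
  toFun g := ⟨g, 0⟩
  map_one' := rfl
  map_mul' x y := ext_m rfl fun k => by simp

@[simp] lemma kap_m (u : (Matrix ι ι ℂ)ˣ) : (kap u).m = u := rfl
@[simp] lemma kap_gi (u : (Matrix ι ι ℂ)ˣ) : (kap u).gi = (u⁻¹ : (Matrix ι ι ℂ)ˣ) := rfl
@[simp] lemma kap_a (u : (Matrix ι ι ℂ)ˣ) (k : Fin 2) : (kap u).a k = 0 := rfl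
@[simp] lemma c_kap_left (u : (Matrix ι ι ℂ)ˣ) (x : Jet ι) : c (kap u) x = 0 := by simp [c]
@[simp] lemma c_kap_right (u : (Matrix ι ι ℂ)ˣ) (x : Jet ι) : c x (kap u) = 0 := by simp [c]

/-- The automorphism `g ↦ (g⁻¹)ᵀ`. -/
def tinv : Jet ι →* Jet ι where
  toFun x := ⟨⟨x.giᵀ, x.mᵀ, by rw [← transpose_mul]; simp, by rw [← transpose_mul]; simp⟩,
    fun k => -(x.a k)ᵀ⟩
  map_one' := ext_m (by change (1 : Jet ι).giᵀ = 1; simp)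
    (by intro k; change -((1 : Jet ι).a k)ᵀ = 0; simp)
  map_mul' x y := ext_m
    (by change (x * y).giᵀ = x.giᵀ * y.giᵀ; simp)
    (by intro k
        change -((x * y).a k)ᵀ = y.mᵀ * (-(x.a k)ᵀ) * y.giᵀ + -(y.a k)ᵀ
        simp [mul_assoc]; abel)

@[simp] lemma tinv_m (x : Jet ι) : (tinv x).m = x.giᵀ := rfl
@[simp] lemma tinv_gi (x : Jet ι) : (tinv x).gi = x.mᵀ := rfl
@[simp] lemma tinv_a (x : Jet ι) (k : Fin 2) : (tinv x).a k = -(x.a k)ᵀ := rfl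

@[simp] lemma tinv_tinv (x : Jet ι) : tinv (tinv x) = x := ext_m (by simp) (by simp)

/-- Transposition reverses the products inside the traces, cyclicity restores their order, and the
two signs cancel. Hence a vertex and its image under g ↦ g^{-t} carry the same form: the source of
the factors 2 in front of `omegaF` and `omegaQ`. -/
lemma c_tinv (x y : Jet ι) : c (tinv x) (tinv y) = c x y := by
  have h : ∀ k l, trace (y.mᵀ * (x.a k)ᵀ * y.giᵀ * (y.a l)ᵀ) = trace (y.gi * x.a k * y.m * y.a l) :=
    fun k l => by
      rw [← trace_transpose]
      simp only [transpose_mul, transpose_transpose]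
      rw [trace_mul_comm]; simp [mul_assoc]
  simp [c, h]

end Jet

/-- The central extension of the group of jets by the cocycle `c`. -/
@[ext]
structure Ext (ι : Type*) [Fintype ι] [DecidableEq ι] where
  j : Jet ι
  s : ℂ

namespace Ext

open Jet

instance : One (Ext ι) := ⟨⟨1, 0⟩⟩
instance : Mul (Ext ι) := ⟨fun x y => ⟨x.j * y.j, x.s + y.s + c x.j y.j⟩⟩
instance : Inv (Ext ι) := ⟨fun x => ⟨x.j⁻¹, -x.s⟩⟩

@[simp] lemma one_j : (1 : Ext ι).j = 1 := rfl
@[simp] lemma one_s : (1 : Ext ι).s = 0 := rfl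
@[simp] lemma mul_j (x y : Ext ι) : (x * y).j = x.j * y.j := rfl
@[simp] lemma mul_s (x y : Ext ι) : (x * y).s = x.s + y.s + c x.j y.j := rfl
@[simp] lemma inv_j (x : Ext ι) : (x⁻¹).j = x.j⁻¹ := rfl
@[simp] lemma inv_s (x : Ext ι) : (x⁻¹).s = -x.s := rfl

instance : Group (Ext ι) := Group.ofLeftAxioms
  (fun x y z => Ext.ext (by simp [mul_assoc]) (by
    have := c_cocycle x.j y.j z.j
    simp only [mul_j, mul_s]; linear_combination this))
  (fun x => Ext.ext (by simp) (by simp))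
  (fun x => Ext.ext (by simp) (by simp [c_inv_left]))

/-- The normalized lift of a jet. -/
def io (x : Jet ι) : Ext ι := ⟨x, 0⟩

/-- The centre. -/
def z (s : ℂ) : Ext ι := ⟨1, s⟩

@[simp] lemma io_j (x : Jet ι) : (io x).j = x := rfl
@[simp] lemma io_s (x : Jet ι) : (io x).s = 0 := rfl
@[simp] lemma z_j (s : ℂ) : (z s : Ext ι).j = 1 := rfl
@[simp] lemma z_s (s : ℂ) : (z s : Ext ι).s = s := rfl
@[simp] lemma io_one : io (1 : Jet ι) = 1 := rfl
@[simp] lemma z_zero : (z 0 : Ext ι) = 1 := rfl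

lemma z_add (s t : ℂ) : (z (s + t) : Ext ι) = z s * z t := Ext.ext (by simp) (by simp)
lemma z_neg (s : ℂ) : (z (-s) : Ext ι) = (z s)⁻¹ := Ext.ext (by simp) (by simp)
lemma z_comm (s : ℂ) (x : Ext ι) : z s * x = x * z s :=
  Ext.ext (by simp) (by simp [add_comm])

lemma io_inv (x : Jet ι) : io x⁻¹ = (io x)⁻¹ := Ext.ext (by simp) (by simp)

lemma io_mul (x y : Jet ι) : io (x * y) = io x * io y * z (-c x y) :=
  Ext.ext (by simp) (by simp)

lemma io_mul_io (x y : Jet ι) : io x * io y = io (x * y) * z (c x y) :=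
  Ext.ext (by simp) (by simp)

/-- Constants have no logarithmic derivative, so they may be split off from a lift without a central
term. -/
lemma io_mul_kap (x : Jet ι) (u : (Matrix ι ι ℂ)ˣ) : io (x * kap u) = io x * io (kap u) :=
  Ext.ext (by simp) (by simp)

lemma io_kap_mul (x : Jet ι) (u : (Matrix ι ι ℂ)ˣ) : io (kap u * x) = io (kap u) * io x :=
  Ext.ext (by simp) (by simp)

lemma eq_io_mul_z (x : Ext ι) : x = io x.j * z x.s := Ext.ext (by simp) (by simp)

lemma eq_z_iff (x : Ext ι) (s : ℂ) : x = z s ↔ x.j = 1 ∧ x.s = s :=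
  ⟨fun h => by simp [h], fun h => Ext.ext h.1 h.2⟩

/-- The automorphism induced by `g ↦ (g⁻¹)ᵀ`. -/
def etinv : Ext ι →* Ext ι where
  toFun x := ⟨tinv x.j, x.s⟩
  map_one' := Ext.ext (by simp) (by simp)
  map_mul' x y := Ext.ext (by simp) (by simp [c_tinv])

@[simp] lemma etinv_io (x : Jet ι) : etinv (io x) = io (tinv x) := rfl
@[simp] lemma etinv_z (s : ℂ) : etinv (z s : Ext ι) = z s := Ext.ext (by simp [etinv]) rfl

end Ext

/-! ### Triangular jets -/

/-- Jets of scalars: a logarithm with two derivatives. -/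
abbrev LogJet : Type := ℂ × (Fin 2 → ℂ)

/-- The symplectic pairing of the derivatives. -/
def br (y y' : LogJet) : ℂ := y.2 0 * y'.2 1 - y.2 1 * y'.2 0

lemma br_self (y : LogJet) : br y y = 0 := by simp [br]; ring
lemma br_swap (y y' : LogJet) : br y y' = -br y' y := by simp [br]; ring
@[simp] lemma br_add_left (x y w : LogJet) : br (x + y) w = br x w + br y w := by simp [br]; ring
@[simp] lemma br_add_right (x y w : LogJet) : br w (x + y) = br w x + br w y := by simp [br]; ring
@[simp] lemma br_neg_left (x w : LogJet) : br (-x) w = -br x w := by simp [br]; ring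
@[simp] lemma br_neg_right (x w : LogJet) : br w (-x) = -br w x := by simp [br]; ring
@[simp] lemma br_smul_left (r : ℂ) (x w : LogJet) : br (r • x) w = r * br x w := by
  simp [br]; ring
@[simp] lemma br_smul_right (r : ℂ) (x w : LogJet) : br w (r • x) = r * br w x := by
  simp [br]; ring
@[simp] lemma br_zero_left (w : LogJet) : br 0 w = 0 := by simp [br]
@[simp] lemma br_zero_right (w : LogJet) : br w 0 = 0 := by simp [br]
@[simp] lemma br_sum_left {κ : Type*} (s : Finset κ) (f : κ → LogJet) (w : LogJet) :
    br (∑ i ∈ s, f i) w = ∑ i ∈ s, br (f i) w := by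
  classical
  induction s using Finset.induction_on with
  | empty => simp
  | insert a s ha ih => simp [Finset.sum_insert ha, ih]
@[simp] lemma br_sum_right {κ : Type*} (s : Finset κ) (f : κ → LogJet) (w : LogJet) :
    br w (∑ i ∈ s, f i) = ∑ i ∈ s, br w (f i) := by
  rw [br_swap, br_sum_left, ← Finset.sum_neg_distrib]
  exact Finset.sum_congr rfl fun i _ => (br_swap _ _).symm

open Jet

/-- The diagonal jet with logarithm `Y`. -/
def tor (Y : ι → LogJet) : Jet ι where
  g := ⟨diagonal fun i => exp (Y i).1, diagonal fun i => exp (-(Y i).1),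
    by rw [diagonal_mul_diagonal]; simp [← Complex.exp_add],
    by rw [diagonal_mul_diagonal]; simp [← Complex.exp_add]⟩
  a k := diagonal fun i => (Y i).2 k

@[simp] lemma tor_m (Y : ι → LogJet) : (tor Y).m = diagonal fun i => exp (Y i).1 := rfl
@[simp] lemma tor_gi (Y : ι → LogJet) : (tor Y).gi = diagonal fun i => exp (-(Y i).1) := rfl
@[simp] lemma tor_a (Y : ι → LogJet) (k : Fin 2) : (tor Y).a k = diagonal fun i => (Y i).2 k := rfl

lemma tor_add (Y Y' : ι → LogJet) : tor (Y + Y') = tor Y * tor Y' := by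
  refine ext_m ?_ fun k => ?_
  · simp [← Complex.exp_add]
  · simp only [tor_a, mul_a, tor_gi, tor_m, diagonal_mul_diagonal, diagonal_add]
    congr 1; funext i
    have : exp (-(Y' i).1) * exp ((Y' i).1) = 1 := by rw [← Complex.exp_add]; simp
    simp only [Pi.add_apply, Prod.snd_add]
    linear_combination (-((Y i).2 k)) * this

@[simp] lemma tor_zero : tor (0 : ι → LogJet) = 1 := by
  refine ext_m ?_ fun k => ?_
  · simp
  · simp

lemma tor_neg (Y : ι → LogJet) : tor (-Y) = (tor Y)⁻¹ := by
  rw [eq_inv_iff_mul_eq_one, ← tor_add]; simp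

lemma tor_comm (Y Y' : ι → LogJet) : tor Y * tor Y' = tor Y' * tor Y := by
  rw [← tor_add, ← tor_add, add_comm]

lemma c_tor (Y Y' : ι → LogJet) : c (tor Y) (tor Y') = ∑ i, br (Y i) (Y' i) := by
  simp only [c, tor_a, tor_gi, tor_m, diagonal_mul_diagonal, trace_diagonal,
    ← Finset.sum_sub_distrib]
  refine Finset.sum_congr rfl fun i _ => ?_
  have : exp (-(Y' i).1) * exp ((Y' i).1) = 1 := by rw [← Complex.exp_add]; simp
  simp only [br]
  linear_combination ((Y i).2 0 * (Y' i).2 1 - (Y i).2 1 * (Y' i).2 0) * this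

section Triangular

variable {α : Type*} [LinearOrder α]

/-- The group of triangular jets, for the order defined by `b`. -/
def Tri (b : ι → α) : Subgroup (Jet ι) where
  carrier := {x | x.m.BlockTriangular b ∧ x.gi.BlockTriangular b ∧ ∀ k, (x.a k).BlockTriangular b}
  one_mem' := ⟨by simpa using blockTriangular_one, by simpa using blockTriangular_one,
    fun k => by simp⟩
  mul_mem' := by
    rintro x y ⟨h1, h2, h3⟩ ⟨h1', h2', h3'⟩
    exact ⟨by simpa using h1.mul h1', by simpa using h2'.mul h2,
      fun k => by simpa using ((h2'.mul (h3 k)).mul h1').add (h3' k)⟩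
  inv_mem' := by
    rintro x ⟨h1, h2, h3⟩
    exact ⟨by simpa using h2, by simpa using h1,
      fun k => by simpa using ((h1.mul (h3 k)).mul h2).neg⟩

lemma BlockTriangular.mul_diag {b : ι → α} (hb : Function.Injective b) {M N : Matrix ι ι ℂ}
    (hM : M.BlockTriangular b) (hN : N.BlockTriangular b) (i : ι) :
    (M * N) i i = M i i * N i i := by
  rw [Matrix.mul_apply, Finset.sum_eq_single i]
  · intro j _ hj
    rcases lt_trichotomy (b j) (b i) with h | h | h
    · rw [hM h, zero_mul]
    · exact absurd (hb h) hj
    · rw [hN h, mul_zero]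
  · simp

/-- For an injective order the blocks have size one, taking diagonals is multiplicative on
triangular matrices, and conjugation leaves the diagonal in place. -/
lemma tri_a_diag {b : ι → α} (hb : Function.Injective b) {x y : Jet ι} (hx : x ∈ Tri b)
    (hy : y ∈ Tri b) (k : Fin 2) (i : ι) : (y.gi * x.a k * y.m) i i = x.a k i i := by
  have h := BlockTriangular.mul_diag hb hy.2.1 hy.1 i
  rw [gi_mul_m, one_apply_eq] at h
  rw [BlockTriangular.mul_diag hb (hy.2.1.mul (hx.2.2 k)) hy.1,
    BlockTriangular.mul_diag hb hy.2.1 (hx.2.2 k)]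
  linear_combination (-(x.a k i i)) * h

lemma tri_mul_a_diag {b : ι → α} (hb : Function.Injective b) {x y : Jet ι} (hx : x ∈ Tri b)
    (hy : y ∈ Tri b) (k : Fin 2) (i : ι) : (x * y).a k i i = x.a k i i + y.a k i i := by
  rw [mul_a, Matrix.add_apply, tri_a_diag hb hx hy]

/-- The diagonal of the logarithmic derivatives of a jet. -/
def dg (x : Jet ι) (i : ι) : LogJet := (0, fun k => x.a k i i)

lemma dg_mul {b : ι → α} (hb : Function.Injective b) {x y : Jet ι} (hx : x ∈ Tri b)
    (hy : y ∈ Tri b) : dg (x * y) = dg x + dg y := by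
  funext i
  refine Prod.ext (by simp [dg]) ?_
  funext k
  exact tri_mul_a_diag hb hx hy k i

/-- Only diagonal entries survive in the trace of a product of triangular matrices, so the
nonabelian cocycle becomes the pairing of the logarithmic diagonals. Most explicit central values
below come from here. -/
lemma c_tri {b : ι → α} (hb : Function.Injective b) {x y : Jet ι} (hx : x ∈ Tri b)
    (hy : y ∈ Tri b) : c x y = ∑ i, br (dg x i) (dg y i) := by
  simp only [c, Matrix.trace, Matrix.diag_apply, ← Finset.sum_sub_distrib]
  refine Finset.sum_congr rfl fun i _ => ?_
  have h : ∀ k, (y.gi * x.a k * y.m).BlockTriangular b := fun k =>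
    (hy.2.1.mul (hx.2.2 k)).mul hy.1
  rw [BlockTriangular.mul_diag hb (h 0) (hy.2.2 1), BlockTriangular.mul_diag hb (h 1) (hy.2.2 0),
    tri_a_diag hb hx hy, tri_a_diag hb hx hy]
  rfl

lemma tor_mem_tri (b : ι → α) (Y : ι → LogJet) : tor Y ∈ Tri b :=
  ⟨blockTriangular_diagonal _, blockTriangular_diagonal _, fun _ => blockTriangular_diagonal _⟩

lemma kap_mem_tri {b : ι → α} (u : (Matrix ι ι ℂ)ˣ) (h : (u : Matrix ι ι ℂ).BlockTriangular b)
    (h' : ((u⁻¹ : (Matrix ι ι ℂ)ˣ) : Matrix ι ι ℂ).BlockTriangular b) : kap u ∈ Tri b :=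
  ⟨h, h', fun _ => blockTriangular_zero⟩

@[simp] lemma dg_kap (u : (Matrix ι ι ℂ)ˣ) : dg (kap u) = 0 := by
  funext i; simp [dg]; rfl

lemma br_dg_tor_left (Y : ι → LogJet) (i : ι) (w : LogJet) : br (dg (tor Y) i) w = br (Y i) w := by
  simp [dg, br]

lemma br_dg_tor_right (Y : ι → LogJet) (i : ι) (w : LogJet) : br w (dg (tor Y) i) = br w (Y i) := by
  simp [dg, br]

end Triangular

end Jets

section

open Jet Ext

/-! ### Elementary matrices -/

/-- The matrix unit with indices from `0`. -/
def elm (n i j : ℕ) : Matrix (Fin n) (Fin n) ℂ :=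
  Matrix.of fun a b => if (a : ℕ) = i ∧ (b : ℕ) = j then 1 else 0

lemma elm_apply (n i j : ℕ) (a b : Fin n) :
    elm n i j a b = if (a : ℕ) = i ∧ (b : ℕ) = j then 1 else 0 := rfl

lemma elm_mul_elm (n i j k l : ℕ) :
    elm n i j * elm n k l = if j = k ∧ j < n then elm n i l else 0 := by
  ext a b
  rw [Matrix.mul_apply]
  simp only [elm_apply]
  split_ifs with h
  · rw [Finset.sum_eq_single ⟨j, h.2⟩]
    · simp only [elm_apply]; simp [h.1, ← ite_and, and_comm]
    · intro q _ hq
      have : ¬ (q : ℕ) = j := fun h' => hq (Fin.ext h')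
      simp [this]
    · simp
  · refine Finset.sum_eq_zero fun q _ => ?_
    have hq := q.2
    by_cases h1 : (q : ℕ) = j
    · have : ¬ (q : ℕ) = k := fun h2 => h ⟨by omega, by omega⟩
      simp [this]
    · simp [h1]

lemma elm_mul_elm_ne {n i j k l : ℕ} (h : j ≠ k) : elm n i j * elm n k l = 0 := by
  rw [elm_mul_elm, if_neg (by tauto)]

lemma diagonal_mul_elm {n : ℕ} (d : Fin n → ℂ) (i : Fin n) (j : ℕ) :
    diagonal d * elm n i j = d i • elm n i j := by
  ext a b
  simp only [diagonal_mul, elm_apply, Matrix.smul_apply, smul_eq_mul]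
  by_cases h : (a : ℕ) = i
  · rw [Fin.ext h]
  · simp [h]

lemma elm_mul_diagonal {n : ℕ} (d : Fin n → ℂ) (i : ℕ) (j : Fin n) :
    elm n i j * diagonal d = d j • elm n i j := by
  ext a b
  simp only [mul_diagonal, elm_apply, Matrix.smul_apply, smul_eq_mul]
  by_cases h : (b : ℕ) = j
  · rw [Fin.ext h, mul_comm]
  · simp [h]

lemma sum_elm (n : ℕ) (M : Matrix (Fin n) (Fin n) ℂ) : M = ∑ j : Fin n, M * elm n j j := by
  ext a b
  rw [Matrix.sum_apply, Finset.sum_eq_single b]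
  · rw [Matrix.mul_apply, Finset.sum_eq_single b]
    · simp [elm_apply]
    · intro q _ hq
      simp [elm_apply, Fin.val_inj, hq]
    · simp
  · intro q _ hq
    rw [Matrix.mul_apply]
    refine Finset.sum_eq_zero fun r _ => ?_
    have : ¬ (b : ℕ) = q := fun h => hq (Fin.ext h.symm)
    simp [elm_apply, this]
  · simp

/-- The unipotent matrix `1 + c E_{ij}`. -/
def root (n i j : ℕ) (h : i ≠ j) (c : ℂ) : (Matrix (Fin n) (Fin n) ℂ)ˣ where
  val := 1 + c • elm n i j
  inv := 1 - c • elm n i j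
  val_inv := by
    have := elm_mul_elm_ne (n := n) (i := i) (l := j) h.symm
    simp [mul_sub, add_mul, this]
  inv_val := by
    have := elm_mul_elm_ne (n := n) (i := i) (l := j) h.symm
    simp [mul_add, sub_mul, this]

@[simp] lemma root_val (n i j : ℕ) (h : i ≠ j) (c : ℂ) :
    ((root n i j h c : (Matrix (Fin n) (Fin n) ℂ)ˣ) : Matrix (Fin n) (Fin n) ℂ)
      = 1 + c • elm n i j := rfl
@[simp] lemma root_inv (n i j : ℕ) (h : i ≠ j) (c : ℂ) :
    (((root n i j h c)⁻¹ : (Matrix (Fin n) (Fin n) ℂ)ˣ) : Matrix (Fin n) (Fin n) ℂ)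
      = 1 - c • elm n i j := rfl

/-- `F_{i+1}`. -/
def fu (n i : ℕ) : (Matrix (Fin n) (Fin n) ℂ)ˣ := root n (i + 1) i (by omega) 1

/-- `1 - E_{i+1,i+2}`. -/
def eu (n i : ℕ) : (Matrix (Fin n) (Fin n) ℂ)ˣ := root n i (i + 1) (by omega) (-1)

lemma root_comm {n i j k l : ℕ} (h : i ≠ j) (h' : k ≠ l) (c d : ℂ) (h1 : j ≠ k) (h2 : l ≠ i) :
    root n i j h c * root n k l h' d = root n k l h' d * root n i j h c := by
  apply Units.ext
  have e1 := elm_mul_elm_ne (n := n) (i := i) (l := l) h1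
  have e2 := elm_mul_elm_ne (n := n) (i := k) (l := j) h2
  simp [mul_add, add_mul, e1, e2]
  abel

/-- The torus element takes equal values at the two places involved, hence acts as a scalar where
the root element acts. -/
lemma tor_root_comm {n i j : ℕ} (h : i ≠ j) (c : ℂ) (Y : Fin n → LogJet)
    (hY : ∀ a b : Fin n, (a : ℕ) = i → (b : ℕ) = j → Y a = Y b) :
    tor Y * kap (root n i j h c) = kap (root n i j h c) * tor Y := by
  have key : ∀ d : LogJet → ℂ, diagonal (fun a => d (Y a)) * elm n i j
      = elm n i j * diagonal (fun a => d (Y a)) := by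
    intro d
    ext a b
    simp only [diagonal_mul, mul_diagonal, elm_apply]
    split_ifs with h'
    · rw [hY a b h'.1 h'.2]; ring
    · simp
  have sq : elm n i j * elm n i j = 0 := elm_mul_elm_ne h.symm
  refine ext_m ?_ fun k => ?_
  · have := key fun y => exp y.1
    simp [mul_add, add_mul, this]
  · have h2 := key fun y => y.2 k
    simp only [mul_a, kap_gi, root_inv, tor_a, kap_m, root_val, kap_a, add_zero, mul_zero,
      zero_mul, zero_add, sub_mul, mul_add, mul_one, one_mul, smul_mul_assoc, mul_smul_comm,
      mul_assoc, h2]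
    rw [← mul_assoc (elm n i j) (elm n i j), sq]
    simp

lemma fu_mem (n i : ℕ) : kap (fu n i) ∈ Tri (OrderDual.toDual : Fin n → (Fin n)ᵒᵈ) := by
  refine kap_mem_tri _ ?_ ?_ <;> intro a b hab <;> (replace hab : a < b := hab)
  all_goals
    have h1 : a ≠ b := hab.ne
    have h2 : ¬ ((a : ℕ) = i + 1 ∧ (b : ℕ) = i) := by
      have : (a : ℕ) < b := hab
      omega
    simp [-Matrix.coe_units_inv, fu, elm_apply, one_apply_ne h1, h2]

lemma eu_mem (n i : ℕ) : kap (eu n i) ∈ Tri (id : Fin n → Fin n) := by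
  refine kap_mem_tri _ ?_ ?_ <;> intro a b hab <;> (replace hab : b < a := hab)
  all_goals
    have h1 : a ≠ b := hab.ne'
    have h2 : ¬ ((a : ℕ) = i ∧ (b : ℕ) = i + 1) := by
      have : (b : ℕ) < a := hab
      omega
    simp [-Matrix.coe_units_inv, eu, elm_apply, one_apply_ne h1, h2]

/-! ### Ordered products -/

section Products

variable {G H : Type*} [Group G] [Group H]

/-- `f 0 * f 1 * ⋯ * f (m - 1)`. -/
def prodUp (f : ℕ → G) : ℕ → G
  | 0 => 1
  | m + 1 => prodUp f m * f m

/-- `f (m - 1) * ⋯ * f 1 * f 0`. -/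
def prodDn (f : ℕ → G) : ℕ → G
  | 0 => 1
  | m + 1 => f m * prodDn f m

@[simp] lemma prodUp_zero (f : ℕ → G) : prodUp f 0 = 1 := rfl
@[simp] lemma prodDn_zero (f : ℕ → G) : prodDn f 0 = 1 := rfl
lemma prodUp_succ (f : ℕ → G) (m : ℕ) : prodUp f (m + 1) = prodUp f m * f m := rfl
lemma prodDn_succ (f : ℕ → G) (m : ℕ) : prodDn f (m + 1) = f m * prodDn f m := rfl

lemma prodUp_succ' (f : ℕ → G) (m : ℕ) :
    prodUp f (m + 1) = f 0 * prodUp (fun i => f (i + 1)) m := by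
  induction m with
  | zero => simp [prodUp]
  | succ m ih => rw [prodUp_succ, ih, prodUp_succ, mul_assoc]

lemma prodDn_succ' (f : ℕ → G) (m : ℕ) :
    prodDn f (m + 1) = prodDn (fun i => f (i + 1)) m * f 0 := by
  induction m with
  | zero => simp [prodDn]
  | succ m ih => rw [prodDn_succ, ih, prodDn_succ, mul_assoc]

lemma prodUp_congr {f g : ℕ → G} {m : ℕ} (h : ∀ i < m, f i = g i) : prodUp f m = prodUp g m := by
  induction m with
  | zero => rfl
  | succ m ih => rw [prodUp_succ, prodUp_succ, ih fun i hi => h i (by omega), h m (by omega)]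

lemma prodDn_congr {f g : ℕ → G} {m : ℕ} (h : ∀ i < m, f i = g i) : prodDn f m = prodDn g m := by
  induction m with
  | zero => rfl
  | succ m ih => rw [prodDn_succ, prodDn_succ, ih fun i hi => h i (by omega), h m (by omega)]

lemma map_prodUp (φ : G →* H) (f : ℕ → G) (m : ℕ) : φ (prodUp f m) = prodUp (fun i => φ (f i)) m := by
  induction m with
  | zero => simp
  | succ m ih => rw [prodUp_succ, prodUp_succ, map_mul, ih]

lemma map_prodDn (φ : G →* H) (f : ℕ → G) (m : ℕ) : φ (prodDn f m) = prodDn (fun i => φ (f i)) m := by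
  induction m with
  | zero => simp
  | succ m ih => rw [prodDn_succ, prodDn_succ, map_mul, ih]

lemma prodUp_mem (S : Subgroup G) {f : ℕ → G} {m : ℕ} (h : ∀ i < m, f i ∈ S) : prodUp f m ∈ S := by
  induction m with
  | zero => exact S.one_mem
  | succ m ih => exact S.mul_mem (ih fun i hi => h i (by omega)) (h m (by omega))

lemma prodDn_mem (S : Subgroup G) {f : ℕ → G} {m : ℕ} (h : ∀ i < m, f i ∈ S) : prodDn f m ∈ S := by
  induction m with
  | zero => exact S.one_mem
  | succ m ih => exact S.mul_mem (h m (by omega)) (ih fun i hi => h i (by omega))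

lemma commute_prodUp {x : G} {f : ℕ → G} {m : ℕ} (h : ∀ i < m, x * f i = f i * x) :
    x * prodUp f m = prodUp f m * x := by
  induction m with
  | zero => simp
  | succ m ih =>
    rw [prodUp_succ, ← mul_assoc, ih fun i hi => h i (by omega), mul_assoc, h m (by omega),
      mul_assoc]

lemma commute_prodDn {x : G} {f : ℕ → G} {m : ℕ} (h : ∀ i < m, x * f i = f i * x) :
    x * prodDn f m = prodDn f m * x := by
  induction m with
  | zero => simp
  | succ m ih =>
    rw [prodDn_succ, ← mul_assoc, h m (by omega), mul_assoc, ih fun i hi => h i (by omega),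
      mul_assoc]

/-- Separation of the first factors. -/
lemma prodDn_mul (f g : ℕ → G) (m : ℕ) (h : ∀ k < m, ∀ i < k, g k * f i = f i * g k) :
    prodDn (fun k => f k * g k) m = prodDn f m * prodDn g m := by
  induction m with
  | zero => simp
  | succ m ih =>
    rw [prodDn_succ, prodDn_succ, prodDn_succ, ih fun k hk => h k (by omega)]
    have := commute_prodDn (x := g m) (f := f) (m := m) fun i hi => h m (by omega) i hi
    rw [mul_assoc, ← mul_assoc (g m), this]; simp only [mul_assoc]

lemma prodUp_mul (f g : ℕ → G) (m : ℕ) (h : ∀ k < m, ∀ i < k, g i * f k = f k * g i) :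
    prodUp (fun k => f k * g k) m = prodUp f m * prodUp g m := by
  induction m with
  | zero => simp
  | succ m ih =>
    rw [prodUp_succ, prodUp_succ, prodUp_succ, ih fun k hk => h k (by omega)]
    have := commute_prodUp (x := f m) (f := g) (m := m) fun i hi => (h m (by omega) i hi).symm
    rw [mul_assoc, ← mul_assoc (prodUp g m), ← this]; simp only [mul_assoc]

/-- Shift of the grouping of the factors. -/
lemma prodUp_regroup (b e : ℕ → G) (m : ℕ) :
    prodUp (fun q => b q * e q) m * b m = b 0 * prodUp (fun q => e q * b (q + 1)) m := by
  induction m with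
  | zero => simp
  | succ m ih => rw [prodUp_succ, prodUp_succ, ← mul_assoc (b 0), ← ih]; simp only [mul_assoc]

lemma prodUp_flip (f : ℕ → G) (m : ℕ) : prodUp f m = prodDn (fun q => f (m - 1 - q)) m := by
  induction m with
  | zero => simp
  | succ m ih =>
    rw [prodUp_succ, ih, prodDn_succ']
    simp only [Nat.add_sub_cancel, Nat.sub_zero]
    congr 1
    exact prodDn_congr fun i hi => by congr 1; omega

end Products

/-! ### Block triangular jets -/

/-- `x` is block upper triangular for the partition `1 + n`, with lower right block `y`. -/
structure Blk {n : ℕ} (x : Jet (Fin (n + 1))) (y : Jet (Fin n)) : Prop where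
  m0 : ∀ i : Fin n, x.m i.succ 0 = 0
  gi0 : ∀ i : Fin n, x.gi i.succ 0 = 0
  a0 : ∀ (k : Fin 2) (i : Fin n), x.a k i.succ 0 = 0
  m : x.m.submatrix Fin.succ Fin.succ = y.m
  gi : x.gi.submatrix Fin.succ Fin.succ = y.gi
  a : ∀ k, (x.a k).submatrix Fin.succ Fin.succ = y.a k

namespace Blk

variable {n : ℕ} {x x' : Jet (Fin (n + 1))} {y y' : Jet (Fin n)}

section Aux

variable {M N : Matrix (Fin (n + 1)) (Fin (n + 1)) ℂ}

lemma mul_succ_zero (hM : ∀ i : Fin n, M i.succ 0 = 0) (hN : ∀ i : Fin n, N i.succ 0 = 0)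
    (i : Fin n) : (M * N) i.succ 0 = 0 := by
  rw [Matrix.mul_apply, Fin.sum_univ_succ]; simp [hM, hN]

lemma mul_zero_zero (hN : ∀ i : Fin n, N i.succ 0 = 0) : (M * N) 0 0 = M 0 0 * N 0 0 := by
  rw [Matrix.mul_apply, Fin.sum_univ_succ]; simp [hN]

lemma mul_submatrix (hM : ∀ i : Fin n, M i.succ 0 = 0) :
    (M * N).submatrix Fin.succ Fin.succ
      = M.submatrix Fin.succ Fin.succ * N.submatrix Fin.succ Fin.succ := by
  ext i j
  simp [Matrix.mul_apply, Fin.sum_univ_succ, hM]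

lemma trace_mul_blk (hM : ∀ i : Fin n, M i.succ 0 = 0) (hN : ∀ i : Fin n, N i.succ 0 = 0) :
    trace (M * N) = M 0 0 * N 0 0
      + trace (M.submatrix Fin.succ Fin.succ * N.submatrix Fin.succ Fin.succ) := by
  rw [← mul_submatrix hM, Matrix.trace, Fin.sum_univ_succ]
  simp only [diag_apply, mul_zero_zero hN]
  rfl

end Aux

lemma one : Blk (1 : Jet (Fin (n + 1))) (1 : Jet (Fin n)) where
  m0 i := by simp
  gi0 i := by simp
  a0 k i := by simp
  m := by rw [one_m, one_m]; exact submatrix_one _ (Fin.succ_injective n)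
  gi := by rw [one_gi, one_gi]; exact submatrix_one _ (Fin.succ_injective n)
  a k := by simp

lemma mul (h : Blk x y) (h' : Blk x' y') : Blk (x * x') (y * y') where
  m0 := mul_succ_zero h.m0 h'.m0
  gi0 := by rw [mul_gi]; exact mul_succ_zero h'.gi0 h.gi0
  a0 k i := by
    rw [mul_a, Matrix.add_apply, mul_succ_zero (mul_succ_zero h'.gi0 (h.a0 k)) h'.m0, h'.a0,
      add_zero]
  m := by rw [mul_m, mul_submatrix h.m0, h.m, h'.m]; rfl
  gi := by rw [mul_gi, mul_gi, mul_submatrix h'.gi0, h.gi, h'.gi]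
  a k := by
    rw [mul_a, submatrix_add, Pi.add_apply, Pi.add_apply,
      mul_submatrix (mul_succ_zero h'.gi0 (h.a0 k)), mul_submatrix h'.gi0, h.a, h'.a, h'.m, h'.gi]
    rfl

lemma m00_mul (h' : Blk x' y') : (x * x').m 0 0 = x.m 0 0 * x'.m 0 0 := mul_zero_zero h'.m0

lemma m00_gi00 (h : Blk x y) : x.gi 0 0 * x.m 0 0 = 1 := by
  rw [← mul_zero_zero h.m0, gi_mul_m, one_apply_eq]

lemma conj00 (h : Blk x y) (h' : Blk x' y') (k : Fin 2) :
    (x'.gi * x.a k * x'.m) 0 0 = x.a k 0 0 := by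
  rw [mul_zero_zero h'.m0, mul_zero_zero (h.a0 k)]
  linear_combination x.a k 0 0 * h'.m00_gi00

lemma dg0_mul (h : Blk x y) (h' : Blk x' y') : dg (x * x') 0 = dg x 0 + dg x' 0 := by
  refine Prod.ext (by simp [dg]) ?_
  funext k
  simp [dg, ← conj00 h h' k]

/-- The trace of a product of block triangular matrices is the product of the corners plus the trace
over the lower blocks. A central value therefore splits into the one of the smaller size and a
pairing of corners; the induction on the size rests on this. -/
lemma c_eq (h : Blk x y) (h' : Blk x' y') : c x x' = c y y' + br (dg x 0) (dg x' 0) := by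
  have hk : ∀ k, (x'.gi * x.a k * x'.m).submatrix Fin.succ Fin.succ = y'.gi * y.a k * y'.m :=
    fun k => by
      rw [mul_submatrix (mul_succ_zero h'.gi0 (h.a0 k)), mul_submatrix h'.gi0, h'.gi, h'.m, h.a]
  have h0 : ∀ k (i : Fin n), (x'.gi * x.a k * x'.m) i.succ 0 = 0 := fun k =>
    mul_succ_zero (mul_succ_zero h'.gi0 (h.a0 k)) h'.m0
  simp only [c]
  rw [trace_mul_blk (h0 0) (h'.a0 1), trace_mul_blk (h0 1) (h'.a0 0), hk, hk, h'.a, h'.a,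
    conj00 h h', conj00 h h']
  simp only [br, dg]; ring

lemma tor (Y : Fin (n + 1) → LogJet) : Blk (FrobeniusStokes.tor Y)
    (FrobeniusStokes.tor fun i => Y i.succ) where
  m0 i := by simp
  gi0 i := by simp
  a0 k i := by simp
  m := by rw [tor_m, tor_m, submatrix_diagonal _ _ (Fin.succ_injective n)]; rfl
  gi := by rw [tor_gi, tor_gi, submatrix_diagonal _ _ (Fin.succ_injective n)]; rfl
  a k := by rw [tor_a, tor_a, submatrix_diagonal _ _ (Fin.succ_injective n)]; rfl

lemma elm_submatrix (i j : ℕ) :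
    (elm (n + 1) (i + 1) (j + 1)).submatrix Fin.succ Fin.succ = elm n i j := by
  ext a b; simp [elm_apply]

lemma root (i j : ℕ) (h : i ≠ j) (c : ℂ) :
    Blk (kap (FrobeniusStokes.root (n + 1) (i + 1) (j + 1) (by omega) c))
      (kap (FrobeniusStokes.root n i j h c)) where
  m0 a := by simp [elm_apply]
  gi0 a := by simp [-Matrix.coe_units_inv, elm_apply]
  a0 k i := by simp
  m := by
    rw [kap_m, kap_m, root_val, root_val, submatrix_add, Pi.add_apply, Pi.add_apply,
      submatrix_smul, Pi.smul_apply, Pi.smul_apply, elm_submatrix,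
      submatrix_one _ (Fin.succ_injective n)]
  gi := by
    rw [kap_gi, kap_gi, root_inv, root_inv, submatrix_sub, Pi.sub_apply, Pi.sub_apply,
      submatrix_smul, Pi.smul_apply, Pi.smul_apply, elm_submatrix,
      submatrix_one _ (Fin.succ_injective n)]
  a k := by simp

/-- Elements of the first row group. -/
lemma root_row (j : ℕ) (c : ℂ) :
    Blk (kap (FrobeniusStokes.root (n + 1) 0 (j + 1) (by omega) c)) (1 : Jet (Fin n)) where
  m0 a := by simp [elm_apply]
  gi0 a := by simp [-Matrix.coe_units_inv, elm_apply]
  a0 k i := by simp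
  m := by
    rw [kap_m, root_val, submatrix_add, Pi.add_apply, Pi.add_apply,
      submatrix_one _ (Fin.succ_injective n)]
    ext a b; simp [elm_apply]
  gi := by
    rw [kap_gi, root_inv, submatrix_sub, Pi.sub_apply, Pi.sub_apply,
      submatrix_one _ (Fin.succ_injective n)]
    ext a b; simp [elm_apply]
  a k := by simp

end Blk

end

section

open Jet Ext

/-! ### The strip relation -/

lemma sum_fin_lt (n a : ℕ) (h : a ≤ n) (x : ℂ) :
    ∑ j : Fin n, (if (j : ℕ) < a then x else 0) = a * x := by
  rw [Fin.sum_univ_eq_sum_range (fun j => if j < a then x else 0) n, ← Finset.sum_filter]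
  have : (Finset.range n).filter (fun j => j < a) = Finset.range a := by
    ext j; simp; omega
  rw [this]; simp

lemma sum_fin_ge (n a : ℕ) (h : a ≤ n) (x : ℂ) :
    ∑ j : Fin n, (if (j : ℕ) < a then 0 else x) = ((n : ℂ) - a) * x := by
  have h1 := sum_fin_lt n a h x
  have h2 : ∑ j : Fin n, (if (j : ℕ) < a then x else 0) + ∑ j : Fin n, (if (j : ℕ) < a then 0 else x)
      = n * x := by
    rw [← Finset.sum_add_distrib, Finset.sum_congr rfl (g := fun _ => x)
      (fun j _ => by split_ifs <;> simp)]
    simp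
  linear_combination h2 - h1

lemma sum_fin_eq (n a : ℕ) (h : a < n) (x : ℂ) :
    ∑ j : Fin n, (if (j : ℕ) = a then x else 0) = x := by
  rw [Finset.sum_eq_single ⟨a, h⟩]
  · simp
  · intro b _ hb
    rw [if_neg fun h' => hb (Fin.ext h')]
  · simp

/-- `y` on the first `i` places. -/
def low (n i : ℕ) (y : LogJet) : Fin n → LogJet := fun j => if (j : ℕ) < i then y else 0

/-- `y` after the first `i` places. -/
def hi (n i : ℕ) (y : LogJet) : Fin n → LogJet := fun j => if (j : ℕ) < i then 0 else y

/-- The factor `x^{-ϖ_{i+2}} F_{i+1}`. -/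
def letter (n i : ℕ) (y : LogJet) : Jet (Fin n) := tor (low n (i + 2) (-y)) * kap (fu n i)

lemma letter_mem (n i : ℕ) (y : LogJet) :
    letter n i y ∈ Tri (OrderDual.toDual : Fin n → (Fin n)ᵒᵈ) :=
  Subgroup.mul_mem _ (tor_mem_tri _ _) (fu_mem n i)

lemma toDual_inj (n : ℕ) : Function.Injective (OrderDual.toDual : Fin n → (Fin n)ᵒᵈ) :=
  OrderDual.toDual.injective

/-- Jets with trivial diagonal blocks for the partition `1 + n`. -/
structure Rad {n : ℕ} (r : Jet (Fin (n + 1))) : Prop where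
  blk : Blk r 1
  m00 : r.m 0 0 = 1
  dg0 : dg r 0 = 0

lemma Rad.mul {n : ℕ} {r r' : Jet (Fin (n + 1))} (h : Rad r) (h' : Rad r') : Rad (r * r') where
  blk := by simpa using h.blk.mul h'.blk
  m00 := by rw [h'.blk.m00_mul, h.m00, h'.m00, one_mul]
  dg0 := by rw [h.blk.dg0_mul h'.blk, h.dg0, h'.dg0, add_zero]

/-- Lower blocks and logarithmic corners are trivial, so elements of the radical lift without
central terms. -/
lemma Rad.io_mul {n : ℕ} {r r' : Jet (Fin (n + 1))} (h : Rad r) (h' : Rad r') :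
    io (r * r') = io r * io r' := by
  rw [Ext.io_mul, h.blk.c_eq h'.blk, h.dg0]; simp

/-- A one-parameter unipotent jet. -/
def rootJ (n i j : ℕ) (h : i ≠ j) (x : ℂ) (α : Fin 2 → ℂ) : Jet (Fin n) :=
  ⟨root n i j h x, fun k => α k • elm n i j⟩

/-- Crossing the torus multiplies the coefficient of E_{ij} by e^{Y_i - Y_j}, which is no longer
constant; this is why `rootJ` carries a derivative along E_{ij}. -/
lemma tor_mul_root {n : ℕ} (Y : Fin n → LogJet) (i j : Fin n) (h : (i : ℕ) ≠ j) :
    tor Y * kap (root n i j h 1)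
      = rootJ n i j h (exp ((Y i).1 - (Y j).1))
          (fun k => ((Y i).2 k - (Y j).2 k) * exp ((Y i).1 - (Y j).1)) * tor Y := by
  have sq : elm n i j * elm n i j = 0 := elm_mul_elm_ne (Ne.symm h)
  refine ext_m ?_ fun k => ?_
  · change (diagonal fun i => exp (Y i).1) * (1 + (1 : ℂ) • elm n i j)
      = (1 + exp ((Y i).1 - (Y j).1) • elm n i j) * diagonal fun i => exp (Y i).1
    rw [mul_add, add_mul, mul_one, one_mul, mul_smul_comm, diagonal_mul_elm, smul_mul_assoc,
      elm_mul_diagonal, smul_smul, smul_smul, one_mul, ← Complex.exp_add]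
    simp
  · rw [mul_a, mul_a]
    change (1 - (1 : ℂ) • elm n i j) * (diagonal fun i => (Y i).2 k) * (1 + (1 : ℂ) • elm n i j) + 0
      = (diagonal fun i => exp (-(Y i).1)) *
        ((((Y i).2 k - (Y j).2 k) * exp ((Y i).1 - (Y j).1)) • elm n i j) *
        (diagonal fun i => exp (Y i).1) + diagonal fun i => (Y i).2 k
    have e1 : exp (-(Y i).1) * exp ((Y i).1 - (Y j).1) * exp (Y j).1 = 1 := by
      rw [← Complex.exp_add, ← Complex.exp_add, ← Complex.exp_zero]; congr 1; ring
    rw [one_smul, sub_mul, one_mul, elm_mul_diagonal, mul_add, mul_one, sub_mul, diagonal_mul_elm,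
      smul_mul_assoc, sq, mul_smul_comm, diagonal_mul_elm, smul_mul_assoc, smul_mul_assoc,
      elm_mul_diagonal, smul_smul, smul_smul]
    have e2 : ((Y i).2 k - (Y j).2 k) * exp ((Y i).1 - (Y j).1) * exp (-(Y i).1) * exp (Y j).1
        = (Y i).2 k - (Y j).2 k := by
      linear_combination ((Y i).2 k - (Y j).2 k) * e1
    rw [e2]
    module

lemma dg_rootJ (n i j : ℕ) (h : i ≠ j) (x : ℂ) (α : Fin 2 → ℂ) : dg (rootJ n i j h x α) = 0 := by
  funext a
  refine Prod.ext rfl (funext fun k => ?_)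
  have : ¬ ((a : ℕ) = i ∧ (a : ℕ) = j) := fun h' => h (h'.1.symm.trans h'.2)
  simp [dg, rootJ, elm_apply, this]

lemma rootJ_upper (n p : ℕ) (x : ℂ) (α : Fin 2 → ℂ) :
    rootJ n p (p + 1) (by omega) x α ∈ Tri (id : Fin n → Fin n) := by
  have key : ∀ c : ℂ, (c • elm n p (p + 1)).BlockTriangular (id : Fin n → Fin n) := by
    intro c a b hab
    have h2 : ¬ ((a : ℕ) = p ∧ (b : ℕ) = p + 1) := by
      have : (b : ℕ) < a := hab
      omega
    simp [elm_apply, h2]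
  exact ⟨blockTriangular_one.add (key x), blockTriangular_one.sub (key x), fun k => key (α k)⟩

/-- The signed transposition `F E` up to the unipotent factor. -/
def sp (n p : ℕ) : (Matrix (Fin n) (Fin n) ℂ)ˣ :=
  root n p (p + 1) (by omega) (-1) * fu n p * eu n p

/-- The identity (1 + f)(1 - e) = (1 + e)s in SL₂, with s the signed transposition: a lower letter
meeting an upper one produces a Weyl group element and a unipotent. -/
lemma fu_mul_eu (n p : ℕ) : fu n p * eu n p = root n p (p + 1) (by omega) 1 * sp n p := by
  have : root n p (p + 1) (by omega) 1 * root n p (p + 1) (by omega) (-1) = 1 := by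
    apply Units.ext
    have sq : elm n p (p + 1) * elm n p (p + 1) = 0 := elm_mul_elm_ne (by omega)
    simp [mul_add, add_mul, sq]
  rw [sp, ← mul_assoc, ← mul_assoc, this, one_mul]

section Sp

variable {n p : ℕ} (hp : p + 1 < n)

lemma sp_mul_elm (q r : ℕ) (hp : p + 1 < n) : (sp n p : Matrix (Fin n) (Fin n) ℂ) * elm n q r =
    if q = p then elm n (p + 1) r else if q = p + 1 then -elm n p r else elm n q r := by
  simp only [sp, Units.val_mul, fu, eu, root_val, mul_assoc, add_mul, one_mul, smul_mul_assoc,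
    mul_add, mul_smul_comm, elm_mul_elm]
  by_cases h1 : q = p
  · subst h1; simp [hp, show q < n by omega, elm_mul_elm]
  · by_cases h2 : q = p + 1
    · subst h2; simp [show p < n by omega, hp, elm_mul_elm]
    · simp [h1, h2, Ne.symm h1, Ne.symm h2, elm_mul_elm]

lemma elm_mul_sp_inv (q r : ℕ) (h1 : q ≠ p) (h2 : q ≠ p + 1) :
    elm n r q * ((sp n p)⁻¹ : (Matrix (Fin n) (Fin n) ℂ)ˣ) = elm n r q := by
  have : ((sp n p)⁻¹ : (Matrix (Fin n) (Fin n) ℂ)ˣ)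
      = (eu n p)⁻¹ * ((fu n p)⁻¹ * (root n p (p + 1) (by omega) (-1))⁻¹) := by
    rw [sp, _root_.mul_inv_rev, _root_.mul_inv_rev]
  rw [this]
  simp only [Units.val_mul, fu, eu, root_inv, ← mul_assoc, mul_sub, sub_mul, mul_one,
    mul_smul_comm, smul_mul_assoc, elm_mul_elm]
  simp [h1, h2, elm_mul_elm]

end Sp

/-- `s_1 ⋯ s_p`. -/
def cox (n p : ℕ) : (Matrix (Fin n) (Fin n) ℂ)ˣ := prodUp (sp n) p

/-- Matrix units make the signed cycle visible: the basis vectors below p move up by one, and the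
p-th returns to the first place with the sign of p transpositions. -/
lemma cox_mul_elm (n p : ℕ) (hp : p < n) (q r : ℕ) :
    (cox n p : Matrix (Fin n) (Fin n) ℂ) * elm n q r =
      if q < p then elm n (q + 1) r else if q = p then (-1 : ℂ) ^ p • elm n 0 r else elm n q r := by
  induction p generalizing q with
  | zero =>
    simp only [cox, prodUp_zero, Units.val_one, one_mul, Nat.not_lt_zero, if_false]
    split_ifs with h
    · simp [h]
    · rfl
  | succ p ih =>
    have ih := ih (by omega)
    rw [cox, prodUp_succ, ← cox, Units.val_mul, mul_assoc, sp_mul_elm _ _ hp]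
    by_cases h1 : q = p
    · subst h1
      rw [if_pos rfl, ih, if_neg (by omega), if_neg (by omega), if_pos (by omega)]
    · by_cases h2 : q = p + 1
      · subst h2
        rw [if_neg h1, if_pos rfl, mul_neg, ih, if_neg (by omega), if_pos rfl, if_neg (by omega),
          if_pos rfl, pow_succ]
        simp
      · rw [if_neg h1, if_neg h2, ih]
        by_cases h3 : q < p
        · rw [if_pos h3, if_pos (by omega)]
        · rw [if_neg h3, if_neg h1, if_neg (by omega), if_neg h2]

lemma elm_mul_cox_inv (n p : ℕ) (q r : ℕ) (h : p < q) :
    elm n r q * ((cox n p)⁻¹ : (Matrix (Fin n) (Fin n) ℂ)ˣ) = elm n r q := by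
  induction p with
  | zero => simp [cox]
  | succ p ih =>
    have : (cox n (p + 1))⁻¹ = (sp n p)⁻¹ * (cox n p)⁻¹ := by
      rw [cox, prodUp_succ, _root_.mul_inv_rev, ← cox]
    rw [this, Units.val_mul, ← mul_assoc, elm_mul_sp_inv _ _ (by omega) (by omega), ih (by omega)]

/-- Conjugation by the Coxeter elements moves the root subgroups into the first row. -/
lemma cox_conj_rootJ (n p : ℕ) (hp : p + 1 < n + 1) (x : ℂ) (α : Fin 2 → ℂ) :
    Rad (kap (cox (n + 1) p) * rootJ (n + 1) p (p + 1) (by omega) x α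
      * (kap (cox (n + 1) p))⁻¹) := by
  set C : (Matrix (Fin (n + 1)) (Fin (n + 1)) ℂ)ˣ := cox (n + 1) p with hC
  set ε : ℂ := (-1) ^ p
  -- The Coxeter element takes the p-th basis vector to ±(the first one), and on the right its
  -- inverse does not see the place p + 1.
  have key : (C : Matrix _ _ ℂ) * elm (n + 1) p (p + 1) * ((C⁻¹ : (Matrix _ _ ℂ)ˣ) : Matrix _ _ ℂ)
      = ε • elm (n + 1) 0 (p + 1) := by
    rw [hC, cox_mul_elm _ _ (by omega), if_neg (by omega), if_pos rfl, smul_mul_assoc,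
      elm_mul_cox_inv _ _ _ _ (by omega)]
  have hCC := C.mul_inv
  have e : kap C * rootJ (n + 1) p (p + 1) (by omega) x α * (kap C)⁻¹
      = rootJ (n + 1) 0 (p + 1) (by omega) (x * ε) (fun k => α k * ε) := by
    rw [← map_inv]
    refine ext_m ?_ fun k => ?_
    · change (C : Matrix _ _ ℂ) * (1 + x • elm (n + 1) p (p + 1))
        * ((C⁻¹ : (Matrix _ _ ℂ)ˣ) : Matrix _ _ ℂ) = 1 + (x * ε) • elm (n + 1) 0 (p + 1)
      rw [mul_add, add_mul, mul_one, hCC, mul_smul_comm, smul_mul_assoc, key, smul_smul]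
    · rw [mul_a, mul_a, kap_gi, kap_m, kap_a, kap_a, inv_inv, mul_zero, zero_mul, zero_add,
        add_zero]
      change (C : Matrix _ _ ℂ) * (α k • elm (n + 1) p (p + 1))
        * ((C⁻¹ : (Matrix _ _ ℂ)ˣ) : Matrix _ _ ℂ) = (α k * ε) • elm (n + 1) 0 (p + 1)
      rw [mul_smul_comm, smul_mul_assoc, key, smul_smul]
  rw [e]
  have e0 : ∀ c : ℂ, ∀ i : Fin n, (c • elm (n + 1) 0 (p + 1)) i.succ 0 = 0 := fun c i => by
    simp [elm_apply]
  have e1 : ∀ c : ℂ, (c • elm (n + 1) 0 (p + 1)).submatrix Fin.succ Fin.succ = 0 := fun c => by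
    ext a b; simp [elm_apply]
  refine ⟨⟨fun i => ?_, fun i => ?_, fun k i => e0 _ i, ?_, ?_, fun k => e1 _⟩, ?_, ?_⟩
  · change (1 + _ • elm (n + 1) 0 (p + 1) : Matrix _ _ ℂ) i.succ 0 = 0
    rw [Matrix.add_apply, e0]; simp
  · change (1 - _ • elm (n + 1) 0 (p + 1) : Matrix _ _ ℂ) i.succ 0 = 0
    rw [Matrix.sub_apply, e0]; simp
  · change (1 + _ • elm (n + 1) 0 (p + 1) : Matrix _ _ ℂ).submatrix Fin.succ Fin.succ = 1
    rw [submatrix_add, Pi.add_apply, Pi.add_apply, e1, submatrix_one _ (Fin.succ_injective n),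
      add_zero]
  · rw [one_gi]
    change (1 - _ • elm (n + 1) 0 (p + 1) : Matrix _ _ ℂ).submatrix Fin.succ Fin.succ = 1
    rw [submatrix_sub, Pi.sub_apply, Pi.sub_apply, e1, submatrix_one _ (Fin.succ_injective n),
      sub_zero]
  · change (1 + _ • elm (n + 1) 0 (p + 1) : Matrix _ _ ℂ) 0 0 = 1
    simp [elm_apply]
  · rw [dg_rootJ]; rfl

/-- Exchange of two indices in a torus element. -/
lemma tor_mul_sp {n p : ℕ} (hp : p + 1 < n) (Y Y' : Fin n → LogJet)
    (h1 : Y ⟨p, by omega⟩ = Y' ⟨p + 1, hp⟩) (h2 : Y ⟨p + 1, hp⟩ = Y' ⟨p, by omega⟩)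
    (h3 : ∀ j : Fin n, (j : ℕ) ≠ p → (j : ℕ) ≠ p + 1 → Y j = Y' j) :
    tor Y * kap (sp n p) = kap (sp n p) * tor Y' := by
  have key : ∀ d : LogJet → ℂ, (diagonal fun a => d (Y a)) * (sp n p : Matrix (Fin n) (Fin n) ℂ)
      = (sp n p : Matrix (Fin n) (Fin n) ℂ) * diagonal fun a => d (Y' a) := by
    intro d
    rw [sum_elm n ((diagonal fun a => d (Y a)) * _), sum_elm n (_ * diagonal _)]
    refine Finset.sum_congr rfl fun j _ => ?_
    rw [mul_assoc, mul_assoc, diagonal_mul_elm, mul_smul_comm, sp_mul_elm _ _ hp]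
    split_ifs with e1 e2
    · have : j = ⟨p, by omega⟩ := Fin.ext e1
      rw [this, show p + 1 = ((⟨p + 1, hp⟩ : Fin n) : ℕ) from rfl, diagonal_mul_elm, h2]
    · have : j = ⟨p + 1, hp⟩ := Fin.ext e2
      rw [mul_neg, this]
      have := diagonal_mul_elm (fun a => d (Y a)) (⟨p, by omega⟩ : Fin n) (p + 1)
      simp only at this
      rw [this, h1, smul_neg]
    · rw [diagonal_mul_elm, h3 j e1 e2]
  refine ext_m (key fun y => exp y.1) fun k => ?_
  have h := key fun y => y.2 k
  rw [mul_a, mul_a, kap_a, mul_zero, zero_mul, add_zero, zero_add, kap_gi, kap_m, tor_a,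
    tor_a, mul_assoc, h, ← mul_assoc, Units.inv_mul, one_mul]

section Strip

variable {n : ℕ} (Y : ℕ → LogJet)

/-- `∏_{i < p} x_i^{-ϖ_{i+2}} F_{i+1}`. -/
def nPart (n : ℕ) (Y : ℕ → LogJet) (p : ℕ) : Jet (Fin n) := prodUp (fun i => letter n i (Y i)) p

/-- `∏_{i < p} (1 - E_{i+1,i+2}) x_i^{-(1 - ϖ_{i+1})}`. -/
def uPart (n : ℕ) (Y : ℕ → LogJet) (p : ℕ) : Jet (Fin n) :=
  prodUp (fun i => kap (eu n i) * tor (hi n (i + 1) (-(Y i)))) p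

lemma nPart_mem (p : ℕ) : nPart n Y p ∈ Tri (OrderDual.toDual : Fin n → (Fin n)ᵒᵈ) :=
  prodUp_mem _ fun i _ => letter_mem n i _

lemma uPart_mem (p : ℕ) : uPart n Y p ∈ Tri (id : Fin n → Fin n) :=
  prodUp_mem _ fun i _ => Subgroup.mul_mem _ (eu_mem n i) (tor_mem_tri _ _)

lemma br_dg_letter (i : ℕ) (y : LogJet) (j : Fin n) (w : LogJet) :
    br (dg (letter n i y) j) w = br (low n (i + 2) (-y) j) w := by
  rw [letter, dg_mul (toDual_inj n) (tor_mem_tri _ _) (fu_mem n i), dg_kap, add_zero,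
    br_dg_tor_left]

lemma br_dg_nPart (p : ℕ) (j : Fin n) (w : LogJet) :
    br (dg (nPart n Y p) j) w = ∑ i ∈ Finset.range p, br (low n (i + 2) (-(Y i)) j) w := by
  induction p with
  | zero => simp [nPart, dg, br]
  | succ p ih =>
    have e : nPart n Y (p + 1) = nPart n Y p * letter n p (Y p) := rfl
    rw [e, dg_mul (toDual_inj n) (nPart_mem Y p) (letter_mem n p _), Pi.add_apply, br_add_left, ih,
      br_dg_letter, Finset.sum_range_succ]

lemma br_dg_uPart (p : ℕ) (j : Fin n) (w : LogJet) :
    br (dg (uPart n Y p) j) w = ∑ i ∈ Finset.range p, br (hi n (i + 1) (-(Y i)) j) w := by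
  induction p with
  | zero => simp [uPart, dg, br]
  | succ p ih =>
    have e : uPart n Y (p + 1) = uPart n Y p * (kap (eu n p) * tor (hi n (p + 1) (-(Y p)))) := rfl
    rw [e, dg_mul Function.injective_id (uPart_mem Y p)
      (Subgroup.mul_mem _ (eu_mem n p) (tor_mem_tri _ _)), Pi.add_apply, br_add_left, ih,
      dg_mul Function.injective_id (eu_mem n p) (tor_mem_tri _ _), dg_kap, zero_add,
      br_dg_tor_left, Finset.sum_range_succ]

lemma c_nPart (p : ℕ) (hp : p + 1 < n) :
    c (nPart n Y p) (letter n p (Y p))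
      = ∑ i ∈ Finset.range p, ((i : ℂ) + 2) * br (Y i) (Y p) := by
  rw [c_tri (toDual_inj n) (nPart_mem Y p) (letter_mem n p _)]
  simp only [br_dg_nPart]
  rw [Finset.sum_comm]
  refine Finset.sum_congr rfl fun i hi => ?_
  rw [Finset.mem_range] at hi
  have : ((i : ℂ) + 2) = ((i + 2 : ℕ) : ℂ) := by push_cast; ring
  rw [this, ← sum_fin_lt n (i + 2) (by omega)]
  refine Finset.sum_congr rfl fun j _ => ?_
  rw [br_swap, br_dg_letter, br_swap, neg_neg]
  by_cases h : (j : ℕ) < i + 2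
  · simp [low, h, show (j : ℕ) < p + 2 by omega]
  · simp [low, h]

lemma c_uPart (p : ℕ) (hp : p + 1 < n) :
    c (uPart n Y p) (kap (eu n p) * tor (hi n (p + 1) (-(Y p))))
      = ∑ i ∈ Finset.range p, ((n : ℂ) - (p + 1)) * br (Y i) (Y p) := by
  rw [c_tri Function.injective_id (uPart_mem Y p)
    (Subgroup.mul_mem _ (eu_mem n p) (tor_mem_tri _ _))]
  simp only [br_dg_uPart]
  rw [Finset.sum_comm]
  refine Finset.sum_congr rfl fun i hi' => ?_
  rw [Finset.mem_range] at hi'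
  have : ((p : ℂ) + 1) = ((p + 1 : ℕ) : ℂ) := by push_cast; ring
  rw [this, ← sum_fin_ge n (p + 1) (by omega)]
  refine Finset.sum_congr rfl fun j _ => ?_
  rw [dg_mul Function.injective_id (eu_mem n p) (tor_mem_tri _ _), dg_kap, zero_add,
    br_dg_tor_right]
  by_cases h : (j : ℕ) < p + 1
  · simp [hi, h]
  · simp [hi, h, show ¬ (j : ℕ) < i + 1 by omega]

lemma c_low_uPart (p : ℕ) (hp : p + 1 < n) :
    c (tor (low n (p + 2) (-(Y p)))) (uPart n Y p)
      = -∑ i ∈ Finset.range p, ((p : ℂ) + 1 - i) * br (Y i) (Y p) := by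
  rw [c_tri Function.injective_id (tor_mem_tri _ _) (uPart_mem Y p),
    ← Finset.sum_neg_distrib]
  simp only [br_dg_tor_left]
  have h1 : ∀ j : Fin n, br (low n (p + 2) (-(Y p)) j) (dg (uPart n Y p) j)
      = ∑ i ∈ Finset.range p, -br (hi n (i + 1) (-(Y i)) j) (low n (p + 2) (-(Y p)) j) := by
    intro j; rw [br_swap, br_dg_uPart, Finset.sum_neg_distrib]
  simp only [h1]
  rw [Finset.sum_comm]
  refine Finset.sum_congr rfl fun i hi' => ?_
  rw [Finset.mem_range] at hi'
  rw [Finset.sum_neg_distrib, neg_inj]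
  have h2 := sum_fin_lt n (i + 1) (by omega) (br (Y i) (Y p))
  have h3 := sum_fin_lt n (p + 2) (by omega) (br (Y i) (Y p))
  have h4 : ∑ j : Fin n, br (hi n (i + 1) (-(Y i)) j) (low n (p + 2) (-(Y p)) j)
      = ∑ j : Fin n, ((if (j : ℕ) < p + 2 then br (Y i) (Y p) else 0)
        - (if (j : ℕ) < i + 1 then br (Y i) (Y p) else 0)) := by
    refine Finset.sum_congr rfl fun j _ => ?_
    by_cases e1 : (j : ℕ) < i + 1
    · simp [low, hi, e1, show (j : ℕ) < p + 2 by omega]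
    · by_cases e2 : (j : ℕ) < p + 2 <;> simp [low, hi, e1, e2]
  rw [h4, Finset.sum_sub_distrib, h2, h3]
  push_cast; ring

lemma uPart_comm_low (p : ℕ) :
    tor (low n (p + 2) (-(Y p))) * uPart n Y p = uPart n Y p * tor (low n (p + 2) (-(Y p))) := by
  refine commute_prodUp fun i hi' => ?_
  rw [← mul_assoc, eu, tor_root_comm, mul_assoc, tor_comm, mul_assoc]
  intro a b ha hb
  simp [low, show (a : ℕ) < p + 2 by omega, show (b : ℕ) < p + 2 by omega]

lemma uPart_comm_fu (p : ℕ) : kap (fu n p) * uPart n Y p = uPart n Y p * kap (fu n p) := by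
  refine commute_prodUp fun i hi' => ?_
  have h1 : tor (hi n (i + 1) (-(Y i))) * kap (fu n p) = kap (fu n p) * tor (hi n (i + 1) (-(Y i))) := by
    rw [fu, tor_root_comm]
    intro a b ha hb
    simp [hi, show ¬ (a : ℕ) < i + 1 by omega, show ¬ (b : ℕ) < i + 1 by omega]
  have h2 : fu n p * eu n i = eu n i * fu n p := root_comm _ _ _ _ (by omega) (by omega)
  rw [← mul_assoc, ← map_mul, h2, map_mul, mul_assoc, mul_assoc, h1]

/-- The torus part of the strip relation. -/
def stripTor (n : ℕ) (Y : ℕ → LogJet) (p : ℕ) : Fin n → LogJet := fun j =>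
  -((if (j : ℕ) = p then (2 : ℂ) else 1) • ∑ i ∈ Finset.range p, Y i)

/-- The central part of the strip relation. -/
def stripC (Y : ℕ → LogJet) (p : ℕ) : ℂ :=
  ∑ q ∈ Finset.range p, ∑ i ∈ Finset.range q, ((i : ℂ) - q) * br (Y i) (Y q)

/-- Induction on p. The new torus A and root element F commute with the first p factors of `uPart`,
so the old relation applies inside, and F E splits into a root element and a signed transposition.
The root element crosses torus and Coxeter element to the left and lands in the radical; the
transposition lengthens the Coxeter element and permutes the torus. -/
lemma strip_relation (p : ℕ) (hp : p < n + 1) : ∃ r : Jet (Fin (n + 1)), Rad r ∧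
    io (nPart (n + 1) Y p) * io (uPart (n + 1) Y p)
      = io r * io (kap (cox (n + 1) p)) * io (tor (stripTor (n + 1) Y p)) * z (stripC Y p) := by
  induction p with
  | zero =>
    refine ⟨1, ⟨Blk.one, by simp, by simp [dg]; rfl⟩, ?_⟩
    have : stripTor (n + 1) Y 0 = 0 := by funext j; simp [stripTor]
    simp [nPart, uPart, cox, stripC, this]
  | succ p ih =>
    set N := n + 1 with hN
    obtain ⟨r, hr, ih⟩ := ih (by omega)
    set A := tor (low N (p + 2) (-(Y p))) with hA
    set B := tor (hi N (p + 1) (-(Y p))) with hB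
    set v : Fin N → LogJet := stripTor N Y p + low N (p + 2) (-(Y p)) with hv
    -- The torus after the transposition: the doubled place moves from p to p + 1, while `low` is
    -- unchanged because both places lie below p + 2.
    set v' : Fin N → LogJet := fun j => -((if (j : ℕ) = p + 1 then (2 : ℂ) else 1) •
      ∑ i ∈ Finset.range p, Y i) + low N (p + 2) (-(Y p)) j with hv'
    set R := rootJ N p (p + 1) (by omega)
      (exp ((v ⟨p, by omega⟩).1 - (v ⟨p + 1, hp⟩).1))
      (fun k => ((v ⟨p, by omega⟩).2 k - (v ⟨p + 1, hp⟩).2 k) *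
        exp ((v ⟨p, by omega⟩).1 - (v ⟨p + 1, hp⟩).1)) with hR
    have hrad : Rad (kap (cox N p) * R * (kap (cox N p))⁻¹) := cox_conj_rootJ n p hp _ _
    refine ⟨r * (kap (cox N p) * R * (kap (cox N p))⁻¹), hr.mul hrad, ?_⟩
    have e1 : io (nPart N Y (p + 1)) = io (nPart N Y p) * (io A * io (kap (fu N p)))
        * z (-c (nPart N Y p) (letter N p (Y p))) := by
      rw [← io_mul_kap]; exact io_mul _ _
    have e2 : io (uPart N Y (p + 1)) = io (uPart N Y p) * (io (kap (eu N p)) * io B)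
        * z (-c (uPart N Y p) (kap (eu N p) * B)) := by
      rw [← io_kap_mul]; exact io_mul _ _
    have e3 : io (kap (fu N p)) * io (uPart N Y p) = io (uPart N Y p) * io (kap (fu N p)) := by
      rw [← io_kap_mul, ← io_mul_kap, uPart_comm_fu]
    -- A and `uPart` commute, so their lifts commute up to the difference of the two cocycles; for
    -- triangular jets these are opposite, hence the factor 2.
    have e4 : io A * io (uPart N Y p) = io (uPart N Y p) * io A
        * z (2 * c A (uPart N Y p)) := by
      have hc : c (uPart N Y p) A = -c A (uPart N Y p) := by
        rw [c_tri Function.injective_id (uPart_mem Y p) (tor_mem_tri _ _),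
          c_tri Function.injective_id (tor_mem_tri _ _) (uPart_mem Y p), ← Finset.sum_neg_distrib]
        exact Finset.sum_congr rfl fun i _ => br_swap _ _
      rw [io_mul_io, io_mul_io, ← uPart_comm_low, hc, mul_assoc, ← z_add]
      congr 2; ring
    have e5 : io (tor (stripTor N Y p)) * io A = io (tor v)
        * z (∑ j, br (stripTor N Y p j) (low N (p + 2) (-(Y p)) j)) := by
      rw [io_mul_io, hv, tor_add, c_tor]
    have e6 : io (kap (fu N p)) * io (kap (eu N p))
        = io (kap (root N p (p + 1) (by omega) 1)) * io (kap (sp N p)) := by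
      rw [← io_mul_kap, ← io_mul_kap, ← map_mul, ← map_mul, fu_mul_eu]
    have e7 : io (tor v) * io (kap (root N p (p + 1) (by omega) 1)) = io R * io (tor v) := by
      have hc : c R (tor v) = 0 := by
        rw [c_tri Function.injective_id (rootJ_upper _ _ _ _) (tor_mem_tri _ _), dg_rootJ]
        simp
      have h7 := tor_mul_root v ⟨p, by omega⟩ ⟨p + 1, hp⟩ (by simp)
      simp only at h7
      rw [← io_mul_kap, h7, io_mul, hc]
      simp [hR]
    have e8 : io (kap (cox N p)) * io R
        = io (kap (cox N p) * R * (kap (cox N p))⁻¹) * io (kap (cox N p)) := by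
      rw [← map_inv, io_mul_kap, io_kap_mul, map_inv, io_inv]; group
    have e9 : io (tor v) * io (kap (sp N p)) = io (kap (sp N p)) * io (tor v') := by
      rw [← io_mul_kap, ← io_kap_mul, tor_mul_sp hp v v']
      · simp [hv, hv', stripTor, low]
      · simp [hv, hv', stripTor, low]
      · intro j h1 h2
        simp [hv, hv', stripTor, h1, h2]
    have e10 : io (tor v') * io B = io (tor (stripTor N Y (p + 1)))
        * z (∑ j, br (v' j) (hi N (p + 1) (-(Y p)) j)) := by
      rw [io_mul_io, hB, ← tor_add, c_tor]
      congr 3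
      funext j
      simp only [hv', stripTor, low, hi, Pi.add_apply, Finset.sum_range_succ]
      by_cases h1 : (j : ℕ) = p + 1
      · simp [h1]; module
      · by_cases h2 : (j : ℕ) < p + 1
        · simp [h1, h2, show (j : ℕ) < p + 2 by omega]; abel
        · simp [h1, h2, show ¬ (j : ℕ) < p + 2 by omega]; abel
    have e11 : io (kap (cox N p)) * io (kap (sp N p)) = io (kap (cox N (p + 1))) := by
      rw [← io_mul_kap, ← map_mul]; rfl
    have s1 : ∑ j, br (stripTor N Y p j) (low N (p + 2) (-(Y p)) j)
        = ∑ i ∈ Finset.range p, ((p : ℂ) + 3) * br (Y i) (Y p) := by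
      rw [← Finset.mul_sum, ← br_sum_left]
      set T := ∑ i ∈ Finset.range p, Y i
      have h1 := sum_fin_lt N (p + 2) (by omega) (br T (Y p))
      have h2 := sum_fin_eq N p (by omega) (br T (Y p))
      have h3 : ∀ j : Fin N, br (stripTor N Y p j) (low N (p + 2) (-(Y p)) j)
          = (if (j : ℕ) < p + 2 then br T (Y p) else 0) + if (j : ℕ) = p then br T (Y p) else 0 := by
        intro j
        by_cases e1 : (j : ℕ) = p
        · simp [stripTor, low, e1, T]; ring
        · by_cases e2 : (j : ℕ) < p + 2 <;> simp [stripTor, low, e1, e2, T]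
      rw [Finset.sum_congr rfl fun j _ => h3 j, Finset.sum_add_distrib, h1, h2]
      push_cast; ring
    have s2 : ∑ j, br (v' j) (hi N (p + 1) (-(Y p)) j)
        = ∑ i ∈ Finset.range p, ((N : ℂ) - p) * br (Y i) (Y p) := by
      rw [← Finset.mul_sum, ← br_sum_left]
      set T := ∑ i ∈ Finset.range p, Y i
      have h1 := sum_fin_ge N (p + 1) (by omega) (br T (Y p))
      have h2 := sum_fin_eq N (p + 1) (by omega) (br T (Y p))
      have h3 : ∀ j : Fin N, br (v' j) (hi N (p + 1) (-(Y p)) j)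
          = (if (j : ℕ) < p + 1 then 0 else br T (Y p))
            + if (j : ℕ) = p + 1 then br T (Y p) else 0 := by
        intro j
        by_cases e1 : (j : ℕ) = p + 1
        · simp [hv', low, hi, e1, br_self]; ring
        · by_cases e2 : (j : ℕ) < p + 1
          · simp [hi, e1, e2]
          · simp [hv', low, hi, e1, e2, show ¬ (j : ℕ) < p + 2 by omega]
      rw [Finset.sum_congr rfl fun j _ => h3 j, Finset.sum_add_distrib, h1, h2]
      push_cast; ring
    -- For N the matrix size, the coefficient of br(Y_i, Y_p) is -(i+2) - (N-p-1) - 2(p+1-i) + (p+3)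
    -- + (N-p) = i - p, the new row of `stripC`.
    have st : -c (nPart N Y p) (letter N p (Y p)) + -c (uPart N Y p) (kap (eu N p) * B)
          + 2 * c A (uPart N Y p) + (∑ j, br (stripTor N Y p j) (low N (p + 2) (-(Y p)) j))
          + (∑ j, br (v' j) (hi N (p + 1) (-(Y p)) j)) + stripC Y p = stripC Y (p + 1) := by
      rw [c_nPart Y p hp, c_uPart Y p hp, c_low_uPart Y p hp, s1, s2, stripC, stripC,
        Finset.sum_range_succ _ p]
      simp only [← sub_eq_add_neg, mul_neg, Finset.mul_sum]
      rw [← Finset.sum_neg_distrib, ← Finset.sum_sub_distrib, ← Finset.sum_sub_distrib,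
        ← Finset.sum_add_distrib, ← Finset.sum_add_distrib, add_comm]
      congr 1
      exact Finset.sum_congr rfl fun i _ => by ring
    rw [← st, e1, e2, hr.io_mul hrad]
    simp only [z_add]
    generalize c (nPart N Y p) (letter N p (Y p)) = t1
    generalize c (uPart N Y p) (kap (eu N p) * B) = t2
    generalize 2 * c A (uPart N Y p) = t3 at *
    generalize (∑ j, br (stripTor N Y p j) (low N (p + 2) (-(Y p)) j)) = t4 at *
    generalize (∑ j, br (v' j) (hi N (p + 1) (-(Y p)) j)) = t5 at *
    generalize stripC Y p = t6 at *
    have mv : ∀ (t : ℂ) (X W : Ext (Fin N)), X * z t * W = X * W * z t := fun t X W => by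
      rw [mul_assoc, z_comm, mul_assoc]
    calc io (nPart N Y p) * (io A * io (kap (fu N p))) * z (-t1)
          * (io (uPart N Y p) * (io (kap (eu N p)) * io B) * z (-t2))
        = io (nPart N Y p) * (io A * (io (kap (fu N p)) * io (uPart N Y p)) * io (kap (eu N p)) * io B)
            * (z (-t1) * z (-t2)) := by
          simp only [mul_assoc, ← mul_assoc (z (-t1)), z_comm (-t1)]
      _ = (io (nPart N Y p) * io (uPart N Y p)) * io A * (io (kap (fu N p)) * io (kap (eu N p))) * io B
            * (z (-t1) * z (-t2) * z t3) := by
          rw [e3, ← mul_assoc (io A), e4]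
          simp only [mul_assoc, ← mul_assoc (z t3), z_comm t3]
      _ = io r * io (kap (cox N p)) * (io (tor v) * io (kap (root N p (p + 1) (by omega) 1)))
            * io (kap (sp N p)) * io B * (z (-t1) * z (-t2) * z t3 * z t4 * z t6) := by
          rw [ih, mv t6 _ (io A), mv t6 _ (io (kap (fu N p)) * io (kap (eu N p))), mv t6 _ (io B),
            mul_assoc _ (io (tor (stripTor N Y p))) (io A), e5, e6, ← mul_assoc _ (io (tor v)) (z t4),
            mv t4, mv t4]
          simp only [mul_assoc, ← z_add]
          congr 7; ring
      _ = io r * (io (kap (cox N p)) * io R) * (io (tor v)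
            * io (kap (sp N p))) * io B * (z (-t1) * z (-t2) * z t3 * z t4 * z t6) := by
          rw [e7]; simp only [mul_assoc]
      _ = io r * io (kap (cox N p) * R * (kap (cox N p))⁻¹)
            * (io (kap (cox N p)) * io (kap (sp N p))) * (io (tor v') * io B)
            * (z (-t1) * z (-t2) * z t3 * z t4 * z t6) := by
          rw [e8, e9]; simp only [mul_assoc]
      _ = _ := by
          rw [e11, e10]
          simp only [mul_assoc, ← z_add]
          rw [show t5 + (-t1 + -t2 + t3 + t4 + t6) = -t1 + -t2 + t3 + t4 + t5 + t6 by ring]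

end Strip

end

section

open Jet Ext

/-! ### Sums over triples -/

lemma mem_triples {n a b c : ℕ} :
    (a, b, c) ∈ triples n ↔ 0 < a ∧ 0 < b ∧ 0 < c ∧ a + b + c = n := by
  simp only [triples, Finset.mem_filter, Finset.mem_product, Finset.mem_range]
  omega

/-- Sum over the triples of positive integers with sum `n`. -/
def tsm {A : Type*} [AddCommMonoid A] (n : ℕ) (f : ℕ → ℕ → ℕ → A) : A :=
  ∑ t ∈ triples n, f t.1 t.2.1 t.2.2

section Tsm

variable {A : Type*} [AddCommMonoid A]

lemma tsm_congr {n : ℕ} {f g : ℕ → ℕ → ℕ → A}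
    (h : ∀ a b c, 0 < a → 0 < b → 0 < c → a + b + c = n → f a b c = g a b c) :
    tsm n f = tsm n g :=
  Finset.sum_congr rfl fun ⟨a, b, c⟩ ht => by
    obtain ⟨h1, h2, h3, h4⟩ := mem_triples.1 ht
    exact h a b c h1 h2 h3 h4

lemma tsm_cyc (n : ℕ) (f : ℕ → ℕ → ℕ → A) : tsm n (fun a b c => f c a b) = tsm n f := by
  refine Finset.sum_bij' (fun t _ => (t.2.2, t.1, t.2.1)) (fun t _ => (t.2.1, t.2.2, t.1))
    ?_ ?_ ?_ ?_ ?_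
  · rintro ⟨a, b, c⟩ h
    have := mem_triples.1 h
    have h' : (c, a, b) ∈ triples n := mem_triples.2 (by omega)
    exact h'
  · rintro ⟨a, b, c⟩ h
    have := mem_triples.1 h
    have h' : (b, c, a) ∈ triples n := mem_triples.2 (by omega)
    exact h'
  all_goals intros; rfl

/-- The right-hand side also runs over points with a = 0 (at j = m - 1 - k), which correspond to the
bare letter closing each N_k; the summand has to vanish there. -/
lemma tsm_eq (m : ℕ) (f : ℕ → ℕ → ℕ → A) (h : ∀ b c, f 0 b c = 0) :
    tsm (m + 1) f
      = ∑ k ∈ Finset.range m, ∑ j ∈ Finset.range (m - k), f (m - 1 - k - j) (j + 1) (k + 1) := by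
  classical
  rw [Finset.sum_sigma', tsm]
  symm
  refine Finset.sum_bij_ne_zero (fun x _ _ => (m - 1 - x.1 - x.2, x.2 + 1, x.1 + 1)) ?_ ?_ ?_ ?_
  · rintro ⟨k, j⟩ hx h0
    simp only [Finset.mem_sigma, Finset.mem_range] at hx
    have : m - 1 - k - j ≠ 0 := fun h1 => h0 (by simp only [h1, h])
    exact mem_triples.2 (by dsimp only; omega)
  · rintro ⟨k, j⟩ _ _ ⟨k', j'⟩ _ _ e
    simp only [Prod.mk.injEq, Nat.add_right_cancel_iff] at e
    obtain ⟨-, rfl, rfl⟩ := e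
    rfl
  · rintro ⟨a, b, c⟩ hx h0
    have h1 := mem_triples.1 hx
    have e1 : m - 1 - (c - 1) - (b - 1) = a := by omega
    have e2 : b - 1 + 1 = b := by omega
    have e3 : c - 1 + 1 = c := by omega
    refine ⟨⟨c - 1, b - 1⟩, ?_, ?_, ?_⟩
    · simp only [Finset.mem_sigma, Finset.mem_range]; omega
    · simpa only [e1, e2, e3] using h0
    · simp only [e1, e2, e3]
  · rintro ⟨k, j⟩ _ _
    rfl

lemma tsm_succ (m : ℕ) (f : ℕ → ℕ → ℕ → A) (h : ∀ b c, f 0 b c = 0) :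
    tsm (m + 2) f = tsm (m + 1) (fun a b c => f a b (c + 1))
      + ∑ j ∈ Finset.range (m + 1), f (m - j) (j + 1) 1 := by
  rw [tsm_eq (m + 1) f h, tsm_eq m _ (by simpa using fun b c => h b (c + 1)),
    Finset.sum_range_succ']
  congr 1
  refine Finset.sum_congr rfl fun k _ => ?_
  rw [show m + 1 - (k + 1) = m - k by omega]
  refine Finset.sum_congr rfl fun j _ => ?_
  rw [show m + 1 - 1 - (k + 1) - j = m - 1 - k - j by omega]

end Tsm

/-- Families of coordinates that vanish outside the interior of the triangle. -/
def Bd (y : ℕ → ℕ → ℕ → LogJet) : Prop := ∀ a b, y 0 a b = 0 ∧ y a 0 b = 0 ∧ y a b 0 = 0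

/-- Cyclic permutation of the coordinates. -/
def cy (y : ℕ → ℕ → ℕ → LogJet) : ℕ → ℕ → ℕ → LogJet := fun a b c => y c a b

/-- Removal of the strip `c = 1`. -/
def sh (y : ℕ → ℕ → ℕ → LogJet) : ℕ → ℕ → ℕ → LogJet :=
  fun a b c => if c = 0 then 0 else y a b (c + 1)

lemma Bd.cy {y : ℕ → ℕ → ℕ → LogJet} (h : Bd y) : Bd (cy y) := fun a b =>
  ⟨(h b a).2.1.trans rfl |> fun _ => by simpa [FrobeniusStokes.cy] using (h b a).2.1,
    by simpa [FrobeniusStokes.cy] using (h b a).2.2,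
    by simpa [FrobeniusStokes.cy] using (h a b).1⟩

lemma Bd.sh {y : ℕ → ℕ → ℕ → LogJet} (h : Bd y) : Bd (sh y) := fun a b => by
  refine ⟨?_, ?_, by simp [FrobeniusStokes.sh]⟩
  · simp only [FrobeniusStokes.sh]; split_ifs
    · rfl
    · exact (h _ _).1
  · simp only [FrobeniusStokes.sh]; split_ifs
    · rfl
    · exact (h _ _).2.1

/-! ### The words -/

/-- The matrix `(antidiagonal) σ`. -/
def wu (m : ℕ) : (Matrix (Fin (m + 1)) (Fin (m + 1)) ℂ)ˣ where
  val := Matrix.of fun a b => if b = Fin.rev a then (-1) ^ (b : ℕ) else 0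
  inv := Matrix.of fun a b => if b = Fin.rev a then (-1) ^ (a : ℕ) else 0
  val_inv := by
    ext a b
    rw [Matrix.mul_apply, Finset.sum_eq_single (Fin.rev a)]
    · simp [one_apply, ← mul_pow, eq_comm]
    · intro c _ hc; simp [hc]
    · simp
  inv_val := by
    ext a b
    rw [Matrix.mul_apply, Finset.sum_eq_single (Fin.rev a)]
    · by_cases h : a = b
      · subst h; simp [← mul_pow]
      · simp [one_apply, h, Ne.symm h]
    · intro c _ hc; simp [hc]
    · simp

lemma wu_mul_elm (m q r : ℕ) (hq : q ≤ m) :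
    (wu m : Matrix (Fin (m + 1)) (Fin (m + 1)) ℂ) * elm (m + 1) q r
      = (-1 : ℂ) ^ q • elm (m + 1) (m - q) r := by
  ext a b
  rw [Matrix.mul_apply, Finset.sum_eq_single (Fin.rev a)]
  · simp only [wu, of_apply, elm_apply, Matrix.smul_apply, smul_eq_mul, Fin.val_rev, if_true]
    by_cases h : (a : ℕ) = m - q
    · have : m + 1 - (↑a + 1) = q := by omega
      simp [h, show m + 1 - (m - q + 1) = q by omega]
    · have : ¬ m + 1 - ((a : ℕ) + 1) = q := by omega
      have h' : ¬ m - (a : ℕ) = q := by omega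
      simp [h, h']
  · intro c _ hc; simp [wu, hc]
  · simp

lemma elm_mul_wu_inv (m q r : ℕ) (hq : q ≤ m) :
    elm (m + 1) r q * (((wu m)⁻¹ : (Matrix (Fin (m + 1)) (Fin (m + 1)) ℂ)ˣ) : Matrix _ _ ℂ)
      = (-1 : ℂ) ^ q • elm (m + 1) r (m - q) := by
  ext a b
  rw [Matrix.mul_apply, Finset.sum_eq_single ⟨q, by omega⟩]
  · change _ * (if b = Fin.rev ⟨q, _⟩ then (-1 : ℂ) ^ q else 0) = _
    have : b = Fin.rev ⟨q, by omega⟩ ↔ (b : ℕ) = m - q := by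
      rw [Fin.ext_iff, Fin.val_rev]; simp only; omega
    simp only [elm_apply, this, Matrix.smul_apply, smul_eq_mul]
    by_cases h1 : (a : ℕ) = r <;> by_cases h2 : (b : ℕ) = m - q <;> simp [h1, h2]
  · intro c _ hc
    have : ¬ (c : ℕ) = q := fun h => hc (Fin.ext h)
    simp [elm_apply, this]
  · simp

/-- The antidiagonal reverses the basis and makes lower root elements upper; the alternating signs
turn the coefficient 1 into -1. -/
lemma wu_conj_fu (m i : ℕ) (hi : i < m) :
    wu m * fu (m + 1) i * (wu m)⁻¹ = eu (m + 1) (m - 1 - i) := by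
  apply Units.ext
  have h := (wu m).mul_inv
  rw [Units.val_mul, Units.val_mul, fu, eu, root_val, root_val, mul_add, mul_one, add_mul, h,
    one_smul, wu_mul_elm _ _ _ (by omega), smul_mul_assoc, elm_mul_wu_inv _ _ _ (by omega),
    smul_smul, ← pow_add, show i + 1 + i = 2 * i + 1 by ring, pow_succ, pow_mul,
    show m - (i + 1) = m - 1 - i by omega, show m - i = m - 1 - i + 1 by omega]
  simp

lemma wu_mul_wu (m : ℕ) : wu m * wu m = (-1) ^ m := by
  apply Units.ext
  rw [Units.val_mul, sum_elm (m + 1) ((wu m : Matrix (Fin (m + 1)) (Fin (m + 1)) ℂ) * wu m),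
    sum_elm (m + 1) (((-1) ^ m : (Matrix (Fin (m + 1)) (Fin (m + 1)) ℂ)ˣ) : Matrix _ _ ℂ)]
  refine Finset.sum_congr rfl fun j _ => ?_
  have hj : (j : ℕ) ≤ m := by omega
  rw [mul_assoc, wu_mul_elm _ _ _ hj, mul_smul_comm, wu_mul_elm _ _ _ (by omega), smul_smul,
    ← pow_add, show (j : ℕ) + (m - j) = m by omega, show m - (m - (j : ℕ)) = j by omega]
  rcases Nat.even_or_odd m with h | h <;> simp [h.neg_one_pow]

lemma wu_mul_tor (m : ℕ) (Y : Fin (m + 1) → LogJet) :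
    kap (wu m) * tor Y = tor (fun j => Y (Fin.rev j)) * kap (wu m) := by
  have key : ∀ d : LogJet → ℂ, (wu m : Matrix (Fin (m + 1)) (Fin (m + 1)) ℂ)
      * (diagonal fun a => d (Y a)) = (diagonal fun a => d (Y (Fin.rev a))) * wu m := by
    intro d
    ext a b
    rw [mul_diagonal, diagonal_mul]
    simp only [wu, of_apply]
    split_ifs with h
    · rw [h]; ring
    · simp
  refine ext_m (key fun y => exp y.1) fun k => ?_
  have h := key fun y => y.2 k
  have h2 : (diagonal fun a => (Y a).2 k)
      = (((wu m)⁻¹ : (Matrix (Fin (m + 1)) (Fin (m + 1)) ℂ)ˣ) : Matrix _ _ ℂ)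
      * ((diagonal fun a => (Y (Fin.rev a)).2 k) * (wu m : Matrix _ _ ℂ)) := by
    rw [← h, ← mul_assoc, Units.inv_mul, one_mul]
  rw [mul_a, mul_a, kap_a, mul_zero, zero_mul, add_zero, zero_add, kap_gi, kap_m, tor_a,
    tor_a, mul_assoc]
  exact h2

/-- Scalar jets. -/
def scal (n : ℕ) (y : LogJet) : Jet (Fin n) := tor fun _ => y

lemma scal_add (n : ℕ) (y y' : LogJet) : scal n (y + y') = scal n y * scal n y' := tor_add _ _

@[simp] lemma scal_zero (n : ℕ) : scal n 0 = 1 := tor_zero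

lemma scal_neg (n : ℕ) (y : LogJet) : scal n (-y) = (scal n y)⁻¹ := tor_neg _

lemma scal_comm {n : ℕ} (y : LogJet) (x : Jet (Fin n)) : scal n y * x = x * scal n y := by
  have key : ∀ (d : ℂ) (M : Matrix (Fin n) (Fin n) ℂ),
      (diagonal fun _ => d) * M = M * diagonal fun _ => d := fun d M => by
    ext a b; rw [mul_diagonal, diagonal_mul, mul_comm]
  refine ext_m (key _ _) fun k => ?_
  have h : (diagonal fun _ : Fin n => exp (-y.1)) * (diagonal fun _ : Fin n => exp y.1) = 1 := by
    rw [diagonal_mul_diagonal]; simp [← Complex.exp_add]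
  simp only [mul_a, scal, tor_a, tor_gi, tor_m]
  rw [mul_assoc, key (y.2 k), gi_mul_m_assoc, key (exp (-y.1)), mul_assoc, h, mul_one, add_comm]

/-- The trace of the logarithmic derivatives. -/
def trdg {n : ℕ} (x : Jet (Fin n)) : LogJet := ∑ j, dg x j

/-- A scalar is central among jets, but its lift is not central: the cocycle pairs its derivative
with the trace of the other logarithmic derivative. Scalars moved through a word leave such terms
behind. -/
lemma c_scal_left {n : ℕ} (y : LogJet) (x : Jet (Fin n)) : c (scal n y) x = br y (trdg x) := by
  have key : ∀ k l, trace (x.gi * (scal n y).a k * x.m * x.a l) = y.2 k * trace (x.a l) := by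
    intro k l
    have : (scal n y).a k = y.2 k • (1 : Matrix (Fin n) (Fin n) ℂ) := by
      simp [scal, smul_one_eq_diagonal]
    rw [this, mul_smul_comm, mul_one, smul_mul_assoc, gi_mul_m, smul_mul_assoc, one_mul,
      trace_smul, smul_eq_mul]
  rw [c, key, key, trdg, br_sum_right]
  simp only [br, dg, Matrix.trace, diag_apply, Finset.mul_sum, ← Finset.sum_sub_distrib]

lemma c_scal_right {n : ℕ} (y : LogJet) (x : Jet (Fin n)) : c x (scal n y) = -br y (trdg x) := by
  have key : ∀ k l, trace ((scal n y).gi * x.a k * (scal n y).m * (scal n y).a l)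
      = y.2 l * trace (x.a k) := by
    intro k l
    have : (scal n y).a l = y.2 l • (1 : Matrix (Fin n) (Fin n) ℂ) := by
      simp [scal, smul_one_eq_diagonal]
    rw [this, mul_smul_comm, mul_one, trace_smul, Jet.trace_conj, smul_eq_mul]
  rw [c, key, key, trdg, br_sum_right]
  simp only [br, dg, Matrix.trace, diag_apply, Finset.mul_sum, Finset.sum_sub_distrib]
  ring

end

section

open Jet Ext

/-! ### Blocks with a logarithm of the corner -/

/-- The inverse is block triangular as well: its first column below the corner is annihilated by the
invertible lower block. -/
lemma Blk.of_m {n : ℕ} {x : Jet (Fin (n + 1))} {y : Jet (Fin n)} (h0 : ∀ i : Fin n, x.m i.succ 0 = 0)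
    (ha : ∀ (k : Fin 2) (i : Fin n), x.a k i.succ 0 = 0)
    (hm : x.m.submatrix Fin.succ Fin.succ = y.m)
    (hma : ∀ k, (x.a k).submatrix Fin.succ Fin.succ = y.a k) : Blk x y := by
  have hg : ∀ i : Fin n, x.gi i.succ 0 = 0 := by
    have h1 : y.m *ᵥ (fun i => x.gi i.succ 0) = 0 := by
      funext i
      have h2 := congrFun (congrFun x.m_mul_gi i.succ) 0
      rw [Matrix.mul_apply, Fin.sum_univ_succ, h0, zero_mul, zero_add,
        one_apply_ne (Fin.succ_ne_zero i)] at h2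
      rw [← hm]
      exact h2
    have h3 := congrArg (y.gi *ᵥ ·) h1
    simp only [mulVec_mulVec, gi_mul_m, one_mulVec, mulVec_zero] at h3
    exact congrFun h3
  refine ⟨h0, hg, ha, hm, ?_, hma⟩
  have h4 : x.gi.submatrix Fin.succ Fin.succ * x.m.submatrix Fin.succ Fin.succ = 1 := by
    rw [← Blk.mul_submatrix hg, gi_mul_m]; exact submatrix_one _ (Fin.succ_injective n)
  rw [hm] at h4
  calc _ = x.gi.submatrix Fin.succ Fin.succ * (y.m * y.gi) := by rw [m_mul_gi, mul_one]
    _ = y.gi := by rw [← mul_assoc, h4, one_mul]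

/-- `x` is block triangular with lower block `y` and corner `ε e^ℓ`. -/
structure BlkL {n : ℕ} (x : Jet (Fin (n + 1))) (y : Jet (Fin n)) (l : LogJet) (ε : ℂ) : Prop where
  blk : Blk x y
  m00 : x.m 0 0 = ε * exp l.1
  a00 : ∀ k, x.a k 0 0 = l.2 k

namespace BlkL

variable {n : ℕ} {x x' : Jet (Fin (n + 1))} {y y' : Jet (Fin n)} {l l' : LogJet} {ε ε' : ℂ}

lemma one : BlkL (1 : Jet (Fin (n + 1))) (1 : Jet (Fin n)) 0 1 := ⟨Blk.one, by simp, by simp⟩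

lemma mul (h : BlkL x y l ε) (h' : BlkL x' y' l' ε') : BlkL (x * x') (y * y') (l + l') (ε * ε') where
  blk := h.blk.mul h'.blk
  m00 := by rw [h'.blk.m00_mul, h.m00, h'.m00, Prod.fst_add, Complex.exp_add]; ring
  a00 k := by
    rw [mul_a, Matrix.add_apply, Blk.conj00 h.blk h'.blk, h.a00, h'.a00]; rfl

lemma mul' (h : BlkL x y l 1) (h' : BlkL x' y' l' 1) : BlkL (x * x') (y * y') (l + l') 1 := by
  simpa using h.mul h'

lemma tor (Y : Fin (n + 1) → LogJet) : BlkL (FrobeniusStokes.tor Y)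
    (FrobeniusStokes.tor fun i => Y i.succ) (Y 0) 1 := ⟨Blk.tor Y, by simp, by simp⟩

lemma prodUp {f : ℕ → Jet (Fin (n + 1))} {g : ℕ → Jet (Fin n)} {l : ℕ → LogJet} {m : ℕ}
    (h : ∀ i < m, BlkL (f i) (g i) (l i) 1) :
    BlkL (FrobeniusStokes.prodUp f m) (FrobeniusStokes.prodUp g m) (∑ i ∈ Finset.range m, l i) 1 := by
  induction m with
  | zero => exact one
  | succ m ih =>
    rw [Finset.sum_range_succ]
    exact (ih fun i hi => h i (by omega)).mul' (h m (by omega))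

lemma prodDn {f : ℕ → Jet (Fin (n + 1))} {g : ℕ → Jet (Fin n)} {l : ℕ → LogJet} {m : ℕ}
    (h : ∀ i < m, BlkL (f i) (g i) (l i) 1) :
    BlkL (FrobeniusStokes.prodDn f m) (FrobeniusStokes.prodDn g m) (∑ i ∈ Finset.range m, l i) 1 := by
  induction m with
  | zero => exact one
  | succ m ih =>
    rw [Finset.sum_range_succ, add_comm _ (l m)]
    exact (h m (by omega)).mul' (ih fun i hi => h i (by omega))

lemma fu (i : ℕ) : BlkL (kap (FrobeniusStokes.fu (n + 1) (i + 1))) (kap (FrobeniusStokes.fu n i)) 0 1 :=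
  ⟨Blk.root (i + 1) i (by omega) 1, by simp [FrobeniusStokes.fu, elm_apply], by simp⟩

lemma eu (i : ℕ) : BlkL (kap (FrobeniusStokes.eu (n + 1) (i + 1))) (kap (FrobeniusStokes.eu n i)) 0 1 :=
  ⟨Blk.root i (i + 1) (by omega) (-1), by simp [FrobeniusStokes.eu, elm_apply], by simp⟩

lemma eu_zero : BlkL (kap (FrobeniusStokes.eu (n + 1) 0)) (1 : Jet (Fin n)) 0 1 :=
  ⟨Blk.root_row 0 (-1), by simp [FrobeniusStokes.eu, elm_apply], by simp⟩

lemma letter (i : ℕ) (v : LogJet) :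
    BlkL (FrobeniusStokes.letter (n + 1) (i + 1) v) (FrobeniusStokes.letter n i v) (-v) 1 := by
  have h := (tor (low (n + 1) (i + 1 + 2) (-v))).mul' (fu (n := n) i)
  have e1 : low (n + 1) (i + 1 + 2) (-v) 0 + 0 = -v := by simp [low]
  have e2 : (fun j : Fin n => low (n + 1) (i + 1 + 2) (-v) j.succ) = low n (i + 2) (-v) := by
    funext j; simp only [low, Fin.val_succ]; congr 1; simp only [eq_iff_iff]; omega
  rwa [e1, e2] at h

end BlkL

/-- `BlkL` in the central extension. -/
structure BlkE {n : ℕ} (X : Ext (Fin (n + 1))) (Y : Ext (Fin n)) (l : LogJet) (ε e : ℂ) : Prop where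
  j : BlkL X.j Y.j l ε
  s : X.s = Y.s + e

lemma BlkL.io {n : ℕ} {x : Jet (Fin (n + 1))} {y : Jet (Fin n)} {l : LogJet} {ε : ℂ}
    (h : BlkL x y l ε) : BlkE (io x) (io y) l ε 0 := ⟨h, by simp⟩

lemma BlkE.mul {n : ℕ} {X X' : Ext (Fin (n + 1))} {Y Y' : Ext (Fin n)} {l l' : LogJet}
    {ε ε' e e' : ℂ} (h : BlkE X Y l ε e) (h' : BlkE X' Y' l' ε' e') :
    BlkE (X * X') (Y * Y') (l + l') (ε * ε') (e + e' + br l l') where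
  j := h.j.mul h'.j
  s := by
    have : br (dg X.j 0) (dg X'.j 0) = br l l' := by simp [br, dg, h.j.a00, h'.j.a00]
    rw [mul_s, mul_s, h.j.blk.c_eq h'.j.blk, h.s, h'.s, this]; ring

/-! ### Diagonals of words -/

/-- The pairing of diagonals. -/
def brv {n : ℕ} (u v : Fin n → LogJet) : ℂ := ∑ i, br (u i) (v i)

lemma brv_sum_left {n : ℕ} {α : Type*} (s : Finset α) (u : α → Fin n → LogJet) (v : Fin n → LogJet) :
    brv (∑ a ∈ s, u a) v = ∑ a ∈ s, brv (u a) v := by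
  simp only [brv, Finset.sum_apply, br_sum_left]
  rw [Finset.sum_comm]

lemma brv_sum_right {n : ℕ} {α : Type*} (s : Finset α) (u : α → Fin n → LogJet)
    (v : Fin n → LogJet) : brv v (∑ a ∈ s, u a) = ∑ a ∈ s, brv v (u a) := by
  simp only [brv, Finset.sum_apply, br_sum_right]
  rw [Finset.sum_comm]

lemma brv_low_low {n p q : ℕ} (hp : p ≤ n) (y y' : LogJet) :
    brv (low n p y) (low n q y') = (min p q : ℕ) * br y y' := by
  have : ∀ j : Fin n, br (low n p y j) (low n q y' j)
      = if (j : ℕ) < min p q then br y y' else 0 := by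
    intro j
    by_cases h1 : (j : ℕ) < p <;> by_cases h2 : (j : ℕ) < q <;> simp [low, h1, h2, br]
  simp only [brv, this]
  exact sum_fin_lt n _ (by omega) _

section DgProd

variable {ι α : Type*} [Fintype ι] [DecidableEq ι] [LinearOrder α] {b : ι → α}

lemma dg_one : dg (1 : Jet ι) = 0 := by funext i; simp [dg]; rfl

lemma dg_prodUp (hb : Function.Injective b) {f : ℕ → Jet ι} {m : ℕ} (h : ∀ i < m, f i ∈ Tri b) :
    dg (prodUp f m) = ∑ i ∈ Finset.range m, dg (f i) := by
  induction m with
  | zero => simp [dg_one]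
  | succ m ih =>
    rw [prodUp_succ, dg_mul hb (prodUp_mem _ fun i hi => h i (by omega)) (h m (by omega)),
      ih fun i hi => h i (by omega), Finset.sum_range_succ]

lemma dg_prodDn (hb : Function.Injective b) {f : ℕ → Jet ι} {m : ℕ} (h : ∀ i < m, f i ∈ Tri b) :
    dg (prodDn f m) = ∑ i ∈ Finset.range m, dg (f i) := by
  induction m with
  | zero => simp [dg_one]
  | succ m ih =>
    rw [prodDn_succ, dg_mul hb (h m (by omega)) (prodDn_mem _ fun i hi => h i (by omega)),
      ih fun i hi => h i (by omega), Finset.sum_range_succ, add_comm]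

end DgProd

lemma dg_letter (n i : ℕ) (y : LogJet) : dg (letter n i y) = dg (tor (low n (i + 2) (-y))) := by
  rw [letter, dg_mul (toDual_inj n) (tor_mem_tri _ _) (fu_mem n i), dg_kap, add_zero]

lemma brv_dg_tor_left {n : ℕ} (Y v : Fin n → LogJet) : brv (dg (tor Y)) v = brv Y v := by
  simp only [brv, br_dg_tor_left]

lemma brv_dg_tor_right {n : ℕ} (Y v : Fin n → LogJet) : brv v (dg (tor Y)) = brv v Y := by
  simp only [brv, br_dg_tor_right]

/-! ### The words and their peeling -/

/-- The factors `N_{k+1}`, for the size `m + 1`, with the row index and the matrix size free. -/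
def Nk (m n s : ℕ) (y : ℕ → ℕ → ℕ → LogJet) (k : ℕ) : Jet (Fin n) :=
  prodUp (fun j => letter n (s + k + j) (y (m - 1 - k - j) (j + 1) (k + 1))) (m - k)

/-- The word `N_m ⋯ N_1`, moved by `s` along the diagonal of matrices of size `n`. -/
def Lw (m n s : ℕ) (y : ℕ → ℕ → ℕ → LogJet) : Jet (Fin n) := prodDn (Nk m n s y) m

lemma Nk_mem (m n s : ℕ) (y : ℕ → ℕ → ℕ → LogJet) (k : ℕ) :
    Nk m n s y k ∈ Tri (OrderDual.toDual : Fin n → (Fin n)ᵒᵈ) :=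
  prodUp_mem _ fun _ _ => letter_mem _ _ _

lemma Lw_mem (m n s : ℕ) (y : ℕ → ℕ → ℕ → LogJet) :
    Lw m n s y ∈ Tri (OrderDual.toDual : Fin n → (Fin n)ᵒᵈ) :=
  prodDn_mem _ fun _ _ => Nk_mem _ _ _ _ _

lemma dg_Lw (m n s : ℕ) (y : ℕ → ℕ → ℕ → LogJet) :
    dg (Lw m n s y) = ∑ k ∈ Finset.range m, ∑ j ∈ Finset.range (m - k),
      dg (tor (low n (s + k + j + 2) (-(y (m - 1 - k - j) (j + 1) (k + 1))))) := by
  rw [Lw, dg_prodDn (toDual_inj n) fun _ _ => Nk_mem _ _ _ _ _]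
  refine Finset.sum_congr rfl fun k _ => ?_
  rw [Nk, dg_prodUp (toDual_inj n) fun _ _ => letter_mem _ _ _]
  exact Finset.sum_congr rfl fun j _ => dg_letter _ _ _

/-- With a = m - 1 - k - j, the torus of a letter acts on k + j + 2 = m + 1 - a places (before the
shift by s). This depends on the first index only, so the diagonal of a word is a sum over triples.
-/
lemma brv_dg_Lw_left (m n s : ℕ) {y : ℕ → ℕ → ℕ → LogJet} (hy : Bd y) (v : Fin n → LogJet) :
    brv (dg (Lw m n s y)) v
      = -tsm (m + 1) fun a b c => brv (low n (s + (m + 1 - a)) (y a b c)) v := by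
  have h0 : ∀ i : ℕ, low n i 0 = 0 := fun i => by funext j; simp [low]
  have hn : ∀ (i : ℕ) (w : LogJet), brv (low n i (-w)) v = -brv (low n i w) v := fun i w => by
    simp only [brv, ← Finset.sum_neg_distrib]
    refine Finset.sum_congr rfl fun j _ => ?_
    simp only [low]; split_ifs
    · exact br_neg_left _ _
    · simp [br]
  rw [dg_Lw, brv_sum_left, tsm_eq m _ (fun b c => by rw [(hy b c).1, h0]; simp [brv, br]),
    ← Finset.sum_neg_distrib]
  refine Finset.sum_congr rfl fun k hk => ?_
  rw [brv_sum_left, ← Finset.sum_neg_distrib]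
  refine Finset.sum_congr rfl fun j hj => ?_
  rw [Finset.mem_range] at hk hj
  rw [brv_dg_tor_left, hn, show s + k + j + 2 = s + (m + 1 - (m - 1 - k - j)) by omega]

lemma brv_swap {n : ℕ} (u v : Fin n → LogJet) : brv u v = -brv v u := by
  simp only [brv, ← Finset.sum_neg_distrib]
  exact Finset.sum_congr rfl fun i _ => br_swap _ _

lemma BlkL.Lw (m n s : ℕ) {y : ℕ → ℕ → ℕ → LogJet} (hy : Bd y) :
    BlkL (Lw m (n + 1) (s + 1) y) (FrobeniusStokes.Lw m n s y) (-tsm (m + 1) y) 1 := by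
  have h : -tsm (m + 1) y = ∑ k ∈ Finset.range m, ∑ j ∈ Finset.range (m - k),
      -(y (m - 1 - k - j) (j + 1) (k + 1)) := by
    rw [tsm_eq m y fun b c => (hy b c).1]; simp only [Finset.sum_neg_distrib]
  rw [h]
  refine BlkL.prodDn fun k _ => BlkL.prodUp fun j _ => ?_
  rw [show s + 1 + k + j = s + k + j + 1 by ring]
  exact BlkL.letter _ _

/-- At distance two the torus of either letter does not separate the places of the other root, and
the two root elements commute. -/
lemma letter_comm {n p i : ℕ} (h : i + 2 ≤ p) (v w : LogJet) :
    letter n p v * letter n i w = letter n i w * letter n p v := by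
  have h1 : tor (low n (p + 2) (-v)) * kap (fu n i) = kap (fu n i) * tor (low n (p + 2) (-v)) :=
    tor_root_comm _ _ _ fun a b ha hb => by
      simp [low, show (a : ℕ) < p + 2 by omega, show (b : ℕ) < p + 2 by omega]
  have h2 : tor (low n (i + 2) (-w)) * kap (fu n p) = kap (fu n p) * tor (low n (i + 2) (-w)) :=
    tor_root_comm _ _ _ fun a b ha hb => by
      simp [low, show ¬ (a : ℕ) < i + 2 by omega, show ¬ (b : ℕ) < i + 2 by omega]
  have h3 : fu n p * fu n i = fu n i * fu n p := root_comm _ _ _ _ (by omega) (by omega)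
  have h4 : kap (fu n p) * kap (fu n i) = kap (fu n i) * kap (fu n p) := by
    rw [← map_mul, h3, map_mul]
  simp only [letter]
  calc _ = tor (low n (p + 2) (-v)) * (kap (fu n p) * tor (low n (i + 2) (-w))) * kap (fu n i) := by
        simp only [mul_assoc]
    _ = (tor (low n (p + 2) (-v)) * tor (low n (i + 2) (-w))) * (kap (fu n p) * kap (fu n i)) := by
        rw [← h2]; simp only [mul_assoc]
    _ = tor (low n (i + 2) (-w)) * (tor (low n (p + 2) (-v)) * kap (fu n i)) * kap (fu n p) := by
        rw [tor_comm, h4]; simp only [mul_assoc]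
    _ = _ := by rw [h1]; simp only [mul_assoc]

/-- The coordinates with `c = 1`. -/
def stripY (m : ℕ) (y : ℕ → ℕ → ℕ → LogJet) (q : ℕ) : LogJet := y (m - q) (q + 1) 1

/-- For y itself the strip c = 1 is the whole rightmost factor N_1. -/
lemma Lw_peel_right (m n s : ℕ) (y : ℕ → ℕ → ℕ → LogJet) :
    Lw (m + 1) n s y = Lw m n (s + 1) (sh y) *
      prodUp (fun q => letter n (s + q) (stripY m y q)) (m + 1) := by
  rw [Lw, prodDn_succ']
  congr 1
  refine prodDn_congr fun k _ => ?_
  simp only [Nk]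
  rw [show m + 1 - (k + 1) = m - k by omega]
  refine prodUp_congr fun j _ => ?_
  rw [show s + (k + 1) + j = s + 1 + k + j by ring,
    show m + 1 - 1 - (k + 1) - j = m - 1 - k - j by omega]
  simp [sh]

/-- The first letters of the factors. -/
def headW (m n s : ℕ) (y : ℕ → ℕ → ℕ → LogJet) : Jet (Fin n) :=
  prodDn (fun k => letter n (s + k) (y (k + 1) (m - k) 1)) (m + 1)

/-- After one rotation the strip c = 1 consists of the first letters of the factors. Each commutes
with the tails of the factors to its left, so they can be collected in front. -/
lemma Lw_peel_left (m n s : ℕ) (y : ℕ → ℕ → ℕ → LogJet) :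
    Lw (m + 1) n s (cy y) = headW m n s y * Lw m n (s + 1) (cy (sh y)) := by
  have h : ∀ k < m + 1, Nk (m + 1) n s (cy y) k
      = letter n (s + k) (y (k + 1) (m - k) 1) * Nk m n (s + 1) (cy (sh y)) k := by
    intro k hk
    simp only [Nk]
    rw [show m + 1 - k = m - k + 1 by omega, prodUp_succ']
    congr 1
    refine prodUp_congr fun j _ => ?_
    rw [show s + k + (j + 1) = s + 1 + k + j by ring,
      show m + 1 - 1 - k - (j + 1) = m - 1 - k - j by omega]
    simp [cy, sh]
  rw [Lw, prodDn_congr h, prodDn_mul, headW]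
  · congr 1
    rw [prodDn_succ]
    simp [Nk, Lw]
  · intro k _ i hi
    exact (commute_prodUp fun j _ => (letter_comm (by omega) _ _).symm).symm

end

section

open Jet Ext

/-! ### Conjugation by the antidiagonal -/

/-- The upper triangular letters. -/
def uletter (n i : ℕ) (y : LogJet) : Jet (Fin n) := tor (hi n i (-y)) * kap (eu n i)

lemma conj_letter (m i : ℕ) (hm : i < m) (v : LogJet) :
    kap (wu m) * letter (m + 1) i v * (kap (wu m))⁻¹ = uletter (m + 1) (m - 1 - i) v := by
  have h1 : (fun j : Fin (m + 1) => low (m + 1) (i + 2) (-v) (Fin.rev j))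
      = hi (m + 1) (m - 1 - i) (-v) := by
    funext j
    simp only [low, hi, Fin.val_rev]
    by_cases h : (j : ℕ) < m - 1 - i
    · rw [if_neg (by omega), if_pos h]
    · rw [if_pos (by omega), if_neg h]
  have h2 : kap (wu m) * kap (fu (m + 1) i) * (kap (wu m))⁻¹ = kap (eu (m + 1) (m - 1 - i)) := by
    rw [← map_mul, ← map_inv, ← map_mul, wu_conj_fu m i hm]
  rw [letter, ← mul_assoc, wu_mul_tor, h1, uletter, ← h2]
  simp only [mul_assoc]

lemma conj_Nk (m : ℕ) (y : ℕ → ℕ → ℕ → LogJet) (k : ℕ) (hk : k < m) :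
    kap (wu m) * Nk m (m + 1) 0 y k * (kap (wu m))⁻¹
      = prodUp (fun j => uletter (m + 1) (m - 1 - k - j) (y (m - 1 - k - j) (j + 1) (k + 1)))
          (m - k) := by
  have := map_prodUp (MulAut.conj (kap (wu m))).toMonoidHom
    (fun j => letter (m + 1) (0 + k + j) (y (m - 1 - k - j) (j + 1) (k + 1))) (m - k)
  simp only [MulEquiv.coe_toMonoidHom, MulAut.conj_apply] at this
  rw [Nk, this]
  refine prodUp_congr fun j hj => ?_
  rw [conj_letter m _ (by omega)]
  congr 1; omega

lemma conj_Lw (m : ℕ) (y : ℕ → ℕ → ℕ → LogJet) :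
    kap (wu m) * Lw m (m + 1) 0 y * (kap (wu m))⁻¹
      = prodDn (fun k => prodUp (fun j => uletter (m + 1) (m - 1 - k - j)
          (y (m - 1 - k - j) (j + 1) (k + 1))) (m - k)) m := by
  have := map_prodDn (MulAut.conj (kap (wu m))).toMonoidHom (Nk m (m + 1) 0 y) m
  simp only [MulEquiv.coe_toMonoidHom, MulAut.conj_apply] at this
  rw [Lw, this]
  exact prodDn_congr fun k hk => conj_Nk m y k hk

/-- Conjugation makes the head upper triangular with torus before root, whereas `uPart` has root
before torus. The regrouping is exact because the torus factors at both ends are trivial, the last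
one because its coordinate lies on the boundary of the triangle. -/
lemma conj_headW (m : ℕ) {y : ℕ → ℕ → ℕ → LogJet} (hy : Bd y) :
    kap (wu (m + 1)) * headW m (m + 2) 0 y * (kap (wu (m + 1)))⁻¹
      = uPart (m + 2) (stripY m y) (m + 1) := by
  have := map_prodDn (MulAut.conj (kap (wu (m + 1)))).toMonoidHom
    (fun k => letter (m + 2) (0 + k) (y (k + 1) (m - k) 1)) (m + 1)
  simp only [MulEquiv.coe_toMonoidHom, MulAut.conj_apply] at this
  have hb : ∀ i, hi (m + 2) i 0 = 0 := fun i => by funext j; simp [hi]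
  set b : ℕ → Jet (Fin (m + 2)) := fun q =>
    tor (hi (m + 2) q (-(if q = 0 then 0 else stripY m y (q - 1)))) with hbdef
  have b0 : b 0 = 1 := by simp [hbdef, hb]
  have b1 : b (m + 1) = 1 := by
    have : stripY m y m = 0 := by simp [stripY, (hy _ _).1]
    simp [hbdef, this, hb]
  have hreg := prodUp_regroup b (fun q => kap (eu (m + 2) q)) (m + 1)
  rw [b0, b1, mul_one, one_mul] at hreg
  rw [headW, this, uPart]
  have e1 : prodUp (fun i => kap (eu (m + 2) i) * tor (hi (m + 2) (i + 1) (-(stripY m y i)))) (m + 1)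
      = prodUp (fun q => kap (eu (m + 2) q) * b (q + 1)) (m + 1) := by
    refine prodUp_congr fun q _ => ?_
    simp [hbdef]
  rw [e1, ← hreg, prodUp_flip]
  refine prodDn_congr fun k hk => ?_
  rw [conj_letter (m + 1) _ (by omega), uletter, show m + 1 - 1 - (0 + k) = m - k by omega,
    show m + 1 - 1 - k = m - k by omega]
  congr 4
  split_ifs with h
  · rw [h, (hy _ _).2.1]
  · rw [stripY, show m - (m - k - 1) = k + 1 by omega, show m - k - 1 + 1 = m - k by omega]

lemma BlkL.uletter {n : ℕ} (i : ℕ) (v : LogJet) :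
    BlkL (uletter (n + 1) (i + 1) v) (FrobeniusStokes.uletter n i v) 0 1 := by
  have h := (BlkL.tor (hi (n + 1) (i + 1) (-v))).mul' (BlkL.eu (n := n) i)
  have e1 : hi (n + 1) (i + 1) (-v) 0 + 0 = 0 := by simp [hi]
  have e2 : (fun j : Fin n => hi (n + 1) (i + 1) (-v) j.succ) = hi n i (-v) := by
    funext j; simp [hi]
  rwa [e1, e2] at h

/-- The torus of the letter with index 0 covers all places and is therefore scalar. -/
lemma uletter_zero {n : ℕ} (v : LogJet) : uletter n 0 v = uletter n 0 0 * scal n (-v) := by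
  have : ∀ v, tor (hi n 0 v) = scal n v := fun v => by
    congr 1
  rw [uletter, uletter, this, this, neg_zero, scal_zero, one_mul, scal_comm]

lemma prodUp_scal {n : ℕ} (f : ℕ → LogJet) (m : ℕ) :
    prodUp (fun i => scal n (f i)) m = scal n (∑ i ∈ Finset.range m, f i) := by
  induction m with
  | zero => simp
  | succ m ih => rw [prodUp_succ, ih, Finset.sum_range_succ, scal_add]

lemma prodDn_scal {n : ℕ} (f : ℕ → LogJet) (m : ℕ) :
    prodDn (fun i => scal n (f i)) m = scal n (∑ i ∈ Finset.range m, f i) := by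
  induction m with
  | zero => simp
  | succ m ih => rw [prodDn_succ, ih, Finset.sum_range_succ, add_comm, scal_add]

/-- After two rotations the strip is a = 1, one letter before the end of each row. In the lower
block the last letter of a row becomes trivial, and the letter before it becomes the closing letter
of a row of the smaller word, with a torus on all places: the strip contributes only a scalar. -/
lemma BlkL.conj_Lw (m : ℕ) {y : ℕ → ℕ → ℕ → LogJet} (hy : Bd y) :
    BlkL (kap (wu (m + 1)) * FrobeniusStokes.Lw (m + 1) (m + 2) 0 (cy (cy y)) * (kap (wu (m + 1)))⁻¹)
      (kap (wu m) * FrobeniusStokes.Lw m (m + 1) 0 (cy (cy (sh y))) * (kap (wu m))⁻¹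
        * scal (m + 1) (-∑ q ∈ Finset.range (m + 1), stripY m y q)) 0 1 := by
  have h0 : FrobeniusStokes.uletter (m + 2) 0 0 = kap (FrobeniusStokes.eu (m + 2) 0) := by
    have : hi (m + 2) 0 0 = 0 := by funext j; simp [hi]
    rw [FrobeniusStokes.uletter, neg_zero, this]; simp
  rw [FrobeniusStokes.conj_Lw, FrobeniusStokes.conj_Lw]
  -- the rows of the large word
  have hrow : ∀ k < m + 1, BlkL (FrobeniusStokes.prodUp (fun j => FrobeniusStokes.uletter (m + 2)
      (m + 1 - 1 - k - j) (cy (cy y) (m + 1 - 1 - k - j) (j + 1) (k + 1))) (m + 1 - k))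
      (FrobeniusStokes.prodUp (fun j => FrobeniusStokes.uletter (m + 1) (m - 1 - k - j)
        (cy (cy (sh y)) (m - 1 - k - j) (j + 1) (k + 1))) (m - k) * scal (m + 1) (-stripY m y k))
      0 1 := by
    intro k hk
    have e1 : stripY m y k = ∑ j ∈ Finset.range (m - k),
        if m - 1 - k - j = 0 then stripY m y k else 0 := by
      by_cases hkm : k = m
      · subst hkm; simp [stripY, (hy _ _).1]
      · rw [Finset.sum_eq_single (m - 1 - k)]
        · simp
        · intro j hj hne
          rw [Finset.mem_range] at hj
          rw [if_neg (by omega)]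
        · intro hj; exact absurd (Finset.mem_range.2 (by omega)) hj
    have e2 : scal (m + 1) (-stripY m y k) = FrobeniusStokes.prodUp (fun j => scal (m + 1)
        (-(if m - 1 - k - j = 0 then stripY m y k else 0))) (m - k) := by
      rw [prodUp_scal, Finset.sum_neg_distrib, ← e1]
    rw [e2, ← prodUp_mul _ _ _ fun _ _ _ _ => scal_comm _ _, show m + 1 - k = m - k + 1 by omega,
      prodUp_succ]
    have hlast : BlkL (FrobeniusStokes.uletter (m + 2) (m + 1 - 1 - k - (m - k))
        (cy (cy y) (m + 1 - 1 - k - (m - k)) (m - k + 1) (k + 1))) (1 : Jet (Fin (m + 1))) 0 1 := by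
      rw [show m + 1 - 1 - k - (m - k) = 0 by omega, show cy (cy y) 0 (m - k + 1) (k + 1) = 0
        from (hy.cy.cy _ _).1, h0]
      exact BlkL.eu_zero
    have hmain := BlkL.prodUp (m := m - k) (l := fun _ => 0)
      (f := fun j => FrobeniusStokes.uletter (m + 2) (m + 1 - 1 - k - j)
        (cy (cy y) (m + 1 - 1 - k - j) (j + 1) (k + 1)))
      (g := fun j => FrobeniusStokes.uletter (m + 1) (m - 1 - k - j)
        (cy (cy (sh y)) (m - 1 - k - j) (j + 1) (k + 1))
        * scal (m + 1) (-(if m - 1 - k - j = 0 then stripY m y k else 0))) (by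
      intro j hj
      have hl := BlkL.uletter (n := m + 1) (m - 1 - k - j)
        (cy (cy y) (m + 1 - 1 - k - j) (j + 1) (k + 1))
      rw [show m - 1 - k - j + 1 = m + 1 - 1 - k - j by omega] at hl
      convert hl using 1
      split_ifs with h
      · rw [h, show cy (cy (sh y)) 0 (j + 1) (k + 1) = 0 from (hy.sh.cy.cy _ _).1,
          ← uletter_zero]
        congr 1
        simp only [stripY, cy]
        rw [show m + 1 - 1 - k - j = 1 by omega, show m - k = j + 1 by omega]
      · rw [neg_zero, scal_zero, mul_one]
        congr 1
        simp only [cy, sh, if_neg h]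
        rw [show m - 1 - k - j + 1 = m + 1 - 1 - k - j by omega])
    simpa using hmain.mul' hlast
  have hall := BlkL.prodDn (m := m + 1) (l := fun _ => 0) hrow
  have e3 : FrobeniusStokes.prodDn (fun k => FrobeniusStokes.prodUp (fun j =>
        FrobeniusStokes.uletter (m + 1) (m - 1 - k - j)
        (cy (cy (sh y)) (m - 1 - k - j) (j + 1) (k + 1))) (m - k) * scal (m + 1) (-stripY m y k)) (m + 1)
      = FrobeniusStokes.prodDn (fun k => FrobeniusStokes.prodUp (fun j =>
        FrobeniusStokes.uletter (m + 1) (m - 1 - k - j)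
        (cy (cy (sh y)) (m - 1 - k - j) (j + 1) (k + 1))) (m - k)) m
        * scal (m + 1) (-∑ q ∈ Finset.range (m + 1), stripY m y q) := by
    rw [prodDn_mul _ _ _ fun _ _ _ _ => scal_comm _ _, prodDn_scal, Finset.sum_neg_distrib,
      prodDn_succ]
    simp
  rw [e3] at hall
  simpa using hall

/-! ### The reflection of the corner -/

lemma mul_elm_self_apply {n : ℕ} (M : Matrix (Fin n) (Fin n) ℂ) (a b : Fin n) :
    (M * elm n b b) a b = M a b := by
  rw [Matrix.mul_apply, Finset.sum_eq_single b]
  · simp [elm_apply]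
  · intro c _ hc; simp [elm_apply, Fin.val_inj, hc]
  · simp

/-- The antidiagonal sends the first basis vector to the last and the Coxeter cycle sends it back:
the composite preserves the first line up to sign, and on the quotient it is minus the smaller
antidiagonal. -/
lemma BlkL.cox_wu (m : ℕ) :
    BlkL (kap (cox (m + 2) (m + 1) * wu (m + 1))) (kap (wu m * -1)) 0 ((-1) ^ (m + 1)) := by
  have h0 : ∀ a : Fin (m + 2), (kap (cox (m + 2) (m + 1) * wu (m + 1))).m a 0
      = (-1) ^ (m + 1) * elm (m + 2) 0 0 a 0 := by
    intro a
    rw [kap_m, ← mul_elm_self_apply (cox (m + 2) (m + 1) * wu (m + 1) :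
      (Matrix (Fin (m + 2)) (Fin (m + 2)) ℂ)ˣ).val a 0, Units.val_mul, mul_assoc, Fin.val_zero,
      wu_mul_elm _ _ _ (by omega), mul_smul_comm, cox_mul_elm _ _ (by omega), if_neg (by omega),
      if_pos (by omega)]
    simp
  have h1 : ∀ (a : Fin (m + 2)) (q : Fin (m + 1)),
      (kap (cox (m + 2) (m + 1) * wu (m + 1))).m a q.succ
      = (-1) ^ ((q : ℕ) + 1) * elm (m + 2) (m - q + 1) (q + 1) a q.succ := by
    intro a q
    rw [kap_m, ← mul_elm_self_apply (cox (m + 2) (m + 1) * wu (m + 1) :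
      (Matrix (Fin (m + 2)) (Fin (m + 2)) ℂ)ˣ).val a q.succ, Units.val_mul, mul_assoc, Fin.val_succ,
      wu_mul_elm _ _ _ (by omega), mul_smul_comm, cox_mul_elm _ _ (by omega), if_pos (by omega),
      show m + 1 - ((q : ℕ) + 1) + 1 = m - q + 1 by omega]
    simp
  refine ⟨Blk.of_m ?_ ?_ ?_ ?_, ?_, ?_⟩
  · intro i; rw [h0]; simp [elm_apply]
  · intro k i; simp
  · ext a q
    rw [submatrix_apply, h1, kap_m,
      ← mul_elm_self_apply (wu m * -1 : (Matrix (Fin (m + 1)) (Fin (m + 1)) ℂ)ˣ).val a q, Units.val_mul, Units.val_neg,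
      Units.val_one, mul_neg, mul_one, neg_mul, wu_mul_elm _ _ _ (by omega), pow_succ]
    simp only [elm_apply, Matrix.neg_apply, Matrix.smul_apply, Fin.val_succ, smul_eq_mul,
      Nat.add_right_cancel_iff]
    split_ifs <;> simp
  · intro k; simp
  · rw [h0]; simp [elm_apply]
  · simp

end

section

open Jet Ext

/-! ### The central value of the word relation -/

/-- The coefficient of the central value. -/
def gcoef (i j k : ℤ) : ℤ :=
  if 0 ≤ k then min i 0 - min j 0 - 2 * k else max i 0 - max j 0 - 2 * k

/-- For k ≠ 0 the sign change exchanges the two branches, since min(-i, 0) = -max(i, 0). -/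
lemma gcoef_neg {i j k : ℤ} (h : k ≠ 0) : gcoef (-i) (-j) (-k) = -gcoef i j k := by
  simp only [gcoef]; split_ifs <;> omega

/-- The central value. -/
def theta (m : ℕ) (y : ℕ → ℕ → ℕ → LogJet) : ℂ :=
  (1 / 2) * tsm (m + 1) fun a b c => tsm (m + 1) fun a' b' c' =>
    (gcoef ((a' : ℤ) - a) ((b' : ℤ) - b) ((c' : ℤ) - c) : ℂ) * br (y a b c) (y a' b' c')

lemma tsm_zero_fun {A : Type*} [AddCommMonoid A] (n : ℕ) : tsm n (fun _ _ _ => (0 : A)) = 0 := by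
  simp [tsm]

lemma tsm_sum {A α : Type*} [AddCommMonoid A] (n : ℕ) (s : Finset α) (f : α → ℕ → ℕ → ℕ → A) :
    tsm n (fun a b c => ∑ q ∈ s, f q a b c) = ∑ q ∈ s, tsm n (f q) := by
  simp only [tsm]; rw [Finset.sum_comm]

lemma tsm_add {A : Type*} [AddCommMonoid A] (n : ℕ) (f g : ℕ → ℕ → ℕ → A) :
    tsm n (fun a b c => f a b c + g a b c) = tsm n f + tsm n g := by
  simp only [tsm]; rw [Finset.sum_add_distrib]

lemma tsm_mul_left (n : ℕ) (r : ℂ) (f : ℕ → ℕ → ℕ → ℂ) :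
    tsm n (fun a b c => r * f a b c) = r * tsm n f := by
  simp only [tsm]; rw [Finset.mul_sum]

lemma sum_triangle (N : ℕ) (f : ℕ → ℕ → ℂ) (h : ∀ i j, f i j = f j i) (h0 : ∀ i, f i i = 0) :
    ∑ i ∈ Finset.range N, ∑ j ∈ Finset.range N, f i j
      = 2 * ∑ q ∈ Finset.range N, ∑ i ∈ Finset.range q, f i q := by
  induction N with
  | zero => simp
  | succ N ih =>
    rw [Finset.sum_range_succ, Finset.sum_range_succ (fun q => ∑ i ∈ Finset.range q, f i q)]
    simp only [Finset.sum_range_succ (fun j => f _ j)]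
    rw [Finset.sum_add_distrib, ih, h0, add_zero]
    have : ∑ j ∈ Finset.range N, f N j = ∑ j ∈ Finset.range N, f j N :=
      Finset.sum_congr rfl fun _ _ => h _ _
    rw [this]; ring

/-- Both sums are split into the strip and the rest. The two mixed sums agree because `gcoef` and
`br` both change sign when the points are exchanged; inside the strip the coefficient is i - q and
produces `stripC`. -/
lemma theta_succ (m : ℕ) {y : ℕ → ℕ → ℕ → LogJet} (hy : Bd y) :
    theta (m + 1) y = theta m (sh y) + stripC (stripY m y) (m + 1)
      + ∑ q ∈ Finset.range (m + 1), tsm (m + 1) fun a b c =>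
        (gcoef ((a : ℤ) - (m - q : ℕ)) ((b : ℤ) - (q + 1 : ℕ)) c : ℂ)
          * br (stripY m y q) (sh y a b c) := by
  have hsh : ∀ a b c, 0 < c → y a b (c + 1) = sh y a b c := fun a b c hc => by
    simp [sh, hc.ne']
  have inner : ∀ (a b c : ℕ), tsm (m + 2) (fun a' b' c' =>
      (gcoef ((a' : ℤ) - a) ((b' : ℤ) - b) ((c' : ℤ) - c) : ℂ) * br (y a b c) (y a' b' c'))
      = tsm (m + 1) (fun a' b' c' =>
        (gcoef ((a' : ℤ) - a) ((b' : ℤ) - b) (((c' + 1 : ℕ) : ℤ) - c) : ℂ)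
          * br (y a b c) (sh y a' b' c'))
      + ∑ q ∈ Finset.range (m + 1), (gcoef (((m - q : ℕ) : ℤ) - a) (((q + 1 : ℕ) : ℤ) - b)
          (((1 : ℕ) : ℤ) - c) : ℂ) * br (y a b c) (stripY m y q) := by
    intro a b c
    rw [tsm_succ m _ fun b' c' => by rw [(hy _ _).1, br_zero_right, mul_zero]]
    congr 1
    exact tsm_congr fun a' b' c' _ _ hc _ => by rw [hsh a' b' c' hc]
  have h1 : tsm (m + 2) (fun a b c => tsm (m + 2) fun a' b' c' =>
      (gcoef ((a' : ℤ) - a) ((b' : ℤ) - b) ((c' : ℤ) - c) : ℂ) * br (y a b c) (y a' b' c'))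
      = tsm (m + 1) (fun a b c => tsm (m + 1) fun a' b' c' =>
          (gcoef ((a' : ℤ) - a) ((b' : ℤ) - b) ((c' : ℤ) - c) : ℂ) * br (sh y a b c) (sh y a' b' c'))
        + tsm (m + 1) (fun a b c => ∑ q ∈ Finset.range (m + 1),
          (gcoef ((a : ℤ) - (m - q : ℕ)) ((b : ℤ) - (q + 1 : ℕ)) c : ℂ)
            * br (stripY m y q) (sh y a b c))
        + (∑ q ∈ Finset.range (m + 1), tsm (m + 1) (fun a b c =>
          (gcoef ((a : ℤ) - (m - q : ℕ)) ((b : ℤ) - (q + 1 : ℕ)) c : ℂ)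
            * br (stripY m y q) (sh y a b c))
        + ∑ i ∈ Finset.range (m + 1), ∑ q ∈ Finset.range (m + 1),
            ((i : ℂ) - q) * br (stripY m y i) (stripY m y q)) := by
    rw [tsm_succ m _ fun b c => by
      rw [(hy _ _).1]; simp only [br_zero_left, mul_zero, tsm_zero_fun]]
    congr 1
    · rw [← tsm_add]
      refine tsm_congr fun a b c _ _ hc _ => ?_
      rw [inner, hsh a b c hc]
      congr 1
      · refine tsm_congr fun a' b' c' _ _ _ _ => ?_
        congr 3; push_cast; ring
      · refine Finset.sum_congr rfl fun q _ => ?_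
        rw [br_swap, show (((m - q : ℕ) : ℤ) - a) = -((a : ℤ) - (m - q : ℕ)) by ring,
          show (((q + 1 : ℕ) : ℤ) - b) = -((b : ℤ) - (q + 1 : ℕ)) by ring,
          show (((1 : ℕ) : ℤ) - (c + 1 : ℕ)) = -(c : ℤ) by push_cast; ring,
          gcoef_neg (by omega)]
        push_cast; ring
    · rw [← Finset.sum_add_distrib]
      refine Finset.sum_congr rfl fun i hi => ?_
      have e : y (m - i) (i + 1) 1 = stripY m y i := rfl
      rw [inner, e]
      congr 1
      · refine tsm_congr fun a' b' c' _ _ _ _ => ?_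
        congr 3; push_cast; ring
      · refine Finset.sum_congr rfl fun q hq => ?_
        rw [Finset.mem_range] at hi hq
        congr 1
        have : gcoef (((m - q : ℕ) : ℤ) - (m - i : ℕ)) (((q + 1 : ℕ) : ℤ) - (i + 1 : ℕ))
          (((1 : ℕ) : ℤ) - (1 : ℕ)) = i - q := by
          simp only [gcoef]; split_ifs <;> omega
        rw [this]; push_cast; rfl
  have h2 := sum_triangle (m + 1) (fun i q => ((i : ℂ) - q) * br (stripY m y i) (stripY m y q))
    (fun i j => by rw [br_swap]; ring) (fun i => by simp)
  rw [theta, h1, h2, tsm_sum, theta, stripC]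
  ring

/-! ### Cocycles of the peeled words -/

lemma c_eq_brv {n : ℕ} {α : Type*} [LinearOrder α] {b : Fin n → α} (hb : Function.Injective b)
    {x x' : Jet (Fin n)} (hx : x ∈ Tri b) (hy : x' ∈ Tri b) : c x x' = brv (dg x) (dg x') :=
  c_tri hb hx hy

lemma c_peel_right (m : ℕ) {y : ℕ → ℕ → ℕ → LogJet} (hy : Bd y) :
    c (Lw m (m + 2) 1 (sh y)) (nPart (m + 2) (stripY m y) (m + 1))
      = -∑ q ∈ Finset.range (m + 1), tsm (m + 1) fun a b c =>
        ((min (m + 2 - a) (q + 2) : ℕ) : ℂ) * br (stripY m y q) (sh y a b c) := by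
  rw [c_eq_brv (toDual_inj _) (Lw_mem _ _ _ _) (nPart_mem _ _), nPart,
    dg_prodUp (toDual_inj _) fun _ _ => letter_mem _ _ _, brv_sum_right, ← Finset.sum_neg_distrib]
  refine Finset.sum_congr rfl fun q hq => ?_
  rw [Finset.mem_range] at hq
  rw [dg_letter, brv_dg_tor_right, brv_dg_Lw_left _ _ _ hy.sh]
  congr 1
  refine tsm_congr fun a b c ha hb hc h => ?_
  rw [brv_low_low (by omega), br_swap, br_neg_left, neg_neg,
    show 1 + (m + 1 - a) = m + 2 - a by omega]

lemma headW_mem (m n s : ℕ) (y : ℕ → ℕ → ℕ → LogJet) :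
    headW m n s y ∈ Tri (OrderDual.toDual : Fin n → (Fin n)ᵒᵈ) :=
  prodDn_mem _ fun _ _ => letter_mem _ _ _

lemma c_peel_left (m : ℕ) {y : ℕ → ℕ → ℕ → LogJet} (hy : Bd y) :
    c (headW m (m + 2) 0 y) (Lw m (m + 2) 1 (cy (sh y)))
      = ∑ q ∈ Finset.range (m + 1), tsm (m + 1) fun a b c =>
        ((min (m + 1 - q) (m + 2 - b) : ℕ) : ℂ) * br (stripY m y q) (sh y a b c) := by
  rw [c_eq_brv (toDual_inj _) (headW_mem _ _ _ _) (Lw_mem _ _ _ _), headW,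
    dg_prodDn (toDual_inj _) fun _ _ => letter_mem _ _ _, brv_sum_left]
  have key : ∀ k < m + 1, brv (dg (letter (m + 2) (0 + k) (y (k + 1) (m - k) 1)))
      (dg (Lw m (m + 2) 1 (cy (sh y))))
      = tsm (m + 1) fun a b c => ((min (k + 2) (m + 2 - b) : ℕ) : ℂ)
        * br (y (k + 1) (m - k) 1) (sh y a b c) := by
    intro k hk
    rw [dg_letter, brv_dg_tor_left, brv_swap, brv_dg_Lw_left _ _ _ hy.sh.cy, neg_neg,
      ← tsm_cyc (m + 1) (fun a b c => ((min (k + 2) (m + 2 - b) : ℕ) : ℂ)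
        * br (y (k + 1) (m - k) 1) (sh y a b c))]
    refine tsm_congr fun a b c ha hb hc h => ?_
    rw [brv_low_low (by omega), br_swap, br_neg_left, neg_neg,
      show 1 + (m + 1 - a) = m + 2 - a by omega, min_comm, zero_add]
    rfl
  rw [Finset.sum_congr rfl fun k hk => key k (Finset.mem_range.1 hk), Finset.sum_range_succ,
    Finset.sum_range_succ]
  -- The extreme terms sit on the boundary of the triangle. Without them the head letters k match
  -- the strip coordinates q = m - 1 - k.
  have e1 : tsm (m + 1) (fun a b c => ((min (m + 2) (m + 2 - b) : ℕ) : ℂ)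
      * br (y (m + 1) (m - m) 1) (sh y a b c)) = 0 := by
    rw [Nat.sub_self, (hy _ _).2.1]; simp only [br_zero_left, mul_zero, tsm_zero_fun]
  have e2 : tsm (m + 1) (fun a b c => ((min (m + 1 - m) (m + 2 - b) : ℕ) : ℂ)
      * br (stripY m y m) (sh y a b c)) = 0 := by
    rw [stripY, Nat.sub_self, (hy _ _).1]; simp only [br_zero_left, mul_zero, tsm_zero_fun]
  rw [e1, e2, add_zero, add_zero, ← Finset.sum_range_reflect]
  refine Finset.sum_congr rfl fun q hq => ?_
  rw [Finset.mem_range] at hq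
  rw [stripY, show m - 1 - q + 1 = m - q by omega, show m - (m - 1 - q) = q + 1 by omega,
    show m - 1 - q + 2 = m + 1 - q by omega]

lemma br_trdg {n : ℕ} (w : LogJet) (x : Jet (Fin n)) :
    br w (trdg x) = brv (fun _ => w) (dg x) := by
  rw [trdg, br_sum_right]; rfl

lemma br_trdg_Lw (m : ℕ) {y : ℕ → ℕ → ℕ → LogJet} (hy : Bd y) (w : LogJet) :
    br w (trdg (Lw m (m + 1) 0 y))
      = -tsm (m + 1) fun a b c => ((m : ℂ) + 1 - a) * br w (y a b c) := by
  have e : (fun _ : Fin (m + 1) => w) = low (m + 1) (m + 1) w := by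
    funext j; simp only [low, if_pos j.2]
  rw [br_trdg, brv_swap, brv_dg_Lw_left _ _ _ hy, neg_neg, e]
  conv_rhs => rw [← neg_one_mul, ← tsm_mul_left]
  refine tsm_congr fun a b c ha hb hc h => ?_
  rw [brv_low_low (by omega), br_swap, Nat.min_eq_left (by omega), zero_add,
    Nat.cast_sub (by omega)]
  push_cast; ring

end

section

open Jet Ext

/-! ### The word relation -/

/-- The signs. -/
def sg (n k : ℕ) : Jet (Fin n) := kap ((-1 : (Matrix (Fin n) (Fin n) ℂ)ˣ) ^ k)

lemma sg_comm {n k : ℕ} (x : Jet (Fin n)) : sg n k * x = x * sg n k := by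
  rcases Nat.even_or_odd k with h | h
  · simp [sg, h.neg_one_pow]
  · rw [sg, h.neg_one_pow]
    have hm : (kap (-1 : (Matrix (Fin n) (Fin n) ℂ)ˣ)).m = -1 := by simp
    have hg : (kap (-1 : (Matrix (Fin n) (Fin n) ℂ)ˣ)).gi = -1 := by
      rw [kap_gi, inv_neg_one]; simp
    exact ext_m (by rw [mul_m, mul_m, hm]; simp) fun k => by rw [mul_a, mul_a, hm, hg]; simp

lemma io_sg_comm {n k : ℕ} (X : Ext (Fin n)) : io (sg n k) * X = X * io (sg n k) :=
  Ext.ext (sg_comm _) (by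
    rw [mul_s, mul_s, io_j, sg, c_kap_left, c_kap_right]; ring)

lemma io_sg_mul (n k l : ℕ) : io (sg n k) * io (sg n l) = io (sg n (k + l)) := by
  rw [sg, sg, ← io_mul_kap, ← map_mul, ← pow_add]; rfl

lemma sg_even {n k : ℕ} (h : Even k) : sg n k = 1 := by simp [sg, h.neg_one_pow]

lemma io_scal_comm {n : ℕ} (v : LogJet) (x : Jet (Fin n)) :
    io (scal n v) * io x = io x * io (scal n v) * z (2 * br v (trdg x)) := by
  rw [io_mul_io, io_mul_io, scal_comm, c_scal_left, c_scal_right, mul_assoc, ← z_add]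
  congr 2; ring

/-- The word with the antidiagonal, in the central extension. -/
def wordE (m : ℕ) (y : ℕ → ℕ → ℕ → LogJet) : Ext (Fin (m + 1)) :=
  io (Lw m (m + 1) 0 y) * io (kap (wu m)) * io (Lw m (m + 1) 0 (cy y)) * io (kap (wu m))
    * io (Lw m (m + 1) 0 (cy (cy y))) * io (kap (wu m))

/-- The same word, as a jet. -/
lemma wordE_j (m : ℕ) (y : ℕ → ℕ → ℕ → LogJet) : (wordE m y).j =
    (Lw m (m + 1) 0 y * kap (wu m)) * (Lw m (m + 1) 0 (cy y) * kap (wu m))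
      * (Lw m (m + 1) 0 (cy (cy y)) * kap (wu m)) := by
  simp [wordE, mul_assoc]

section Group

variable {G : Type*} [Group G]

lemma move_central {z : G} (hz : ∀ x, z * x = x * z) (x y : G) : z * (x * y) = x * (z * y) := by
  rw [← mul_assoc, hz, mul_assoc]

/-- Core of the peeling: the antidiagonal carries the head of the second word to U, which then
stands next to the strip N of the first word, and the strip relation replaces N U. -/
lemma peel_group {R1 N W Wp R2 L3 U r kc T T' U3 z0 z1 z2 : G} (h0 : ∀ x, z0 * x = x * z0)
    (h1 : ∀ x, z1 * x = x * z1) (h2 : ∀ x, z2 * x = x * z2) (hN : N * U = r * kc * T * z0)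
    (hW : W * Wp = U * W) (hU : W * L3 = U3 * W) (hT : T * W = W * T') :
    (R1 * N * z1) * W * (Wp * R2 * z2) * W * L3 * W
      = R1 * r * (kc * W) * T' * R2 * U3 * (W * W) * (z0 * z1 * z2) := by
  calc _ = R1 * N * (W * Wp) * R2 * (W * L3) * W * z1 * z2 := by
        have a1 := move_central h1
        have a2 := move_central h2
        simp only [mul_assoc, a1, h1 W]
        simp only [a2, h2 z1]
    _ = R1 * (N * U) * W * R2 * U3 * W * W * z1 * z2 := by rw [hW, hU]; simp only [mul_assoc]
    _ = R1 * r * kc * (T * W) * R2 * U3 * W * W * z0 * z1 * z2 := by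
        have a0 := move_central h0
        rw [hN]
        simp only [mul_assoc, a0, h0 z1]
    _ = _ := by rw [hT]; simp only [mul_assoc]

end Group

/-- The peeled form of the word. -/
lemma wordE_peel (m : ℕ) {y : ℕ → ℕ → ℕ → LogJet} (hy : Bd y) :
    ∃ r : Jet (Fin (m + 2)), Rad r ∧
    wordE (m + 1) y = io (Lw m (m + 2) 1 (sh y)) * io r
        * io (kap (cox (m + 2) (m + 1) * wu (m + 1)))
        * io (tor fun j => stripTor (m + 2) (stripY m y) (m + 1) (Fin.rev j))
        * io (Lw m (m + 2) 1 (cy (sh y)))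
        * io (kap (wu (m + 1)) * Lw (m + 1) (m + 2) 0 (cy (cy y)) * (kap (wu (m + 1)))⁻¹)
        * io (sg (m + 2) (m + 1))
        * z (stripC (stripY m y) (m + 1)
          - c (Lw m (m + 2) 1 (sh y)) (nPart (m + 2) (stripY m y) (m + 1))
          - c (headW m (m + 2) 0 y) (Lw m (m + 2) 1 (cy (sh y)))) := by
  obtain ⟨r, hr, hrel⟩ := strip_relation (n := m + 1) (Y := stripY m y) (m + 1) (by omega)
  refine ⟨r, hr, ?_⟩
  have hN : prodUp (fun q => letter (m + 2) (0 + q) (stripY m y q)) (m + 1)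
      = nPart (m + 2) (stripY m y) (m + 1) := by simp only [nPart, zero_add]
  have hL1 := io_mul (Lw m (m + 2) 1 (sh y)) (nPart (m + 2) (stripY m y) (m + 1))
  have hL2 := io_mul (headW m (m + 2) 0 y) (Lw m (m + 2) 1 (cy (sh y)))
  rw [← hN, ← Lw_peel_right m (m + 2) 0 y, hN] at hL1
  rw [← Lw_peel_left m (m + 2) 0 y] at hL2
  set W : Ext (Fin (m + 2)) := io (kap (wu (m + 1)))
  have hW : W * io (headW m (m + 2) 0 y) = io (uPart (m + 2) (stripY m y) (m + 1)) * W := by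
    rw [← conj_headW m hy, ← io_kap_mul, ← io_mul_kap]
    congr 1; simp [mul_assoc]
  have hU : W * io (Lw (m + 1) (m + 2) 0 (cy (cy y)))
      = io (kap (wu (m + 1)) * Lw (m + 1) (m + 2) 0 (cy (cy y)) * (kap (wu (m + 1)))⁻¹) * W := by
    rw [← io_kap_mul, ← io_mul_kap]
    congr 1; simp [mul_assoc]
  have hWW : W * W = io (sg (m + 2) (m + 1)) := by
    rw [← io_mul_kap, ← map_mul, wu_mul_wu]; rfl
  have hT : io (tor (stripTor (m + 2) (stripY m y) (m + 1))) * W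
      = W * io (tor fun j => stripTor (m + 2) (stripY m y) (m + 1) (Fin.rev j)) := by
    rw [← io_mul_kap, ← io_kap_mul, wu_mul_tor]
    congr 2; simp
  have hK : io (kap (cox (m + 2) (m + 1) * wu (m + 1))) = io (kap (cox (m + 2) (m + 1))) * W := by
    rw [map_mul, io_kap_mul]
  rw [wordE, hL1, hL2, hK, ← hWW, sub_eq_add_neg, sub_eq_add_neg, z_add, z_add]
  exact peel_group (z_comm _) (z_comm _) (z_comm _) hrel hW hU hT

end

/-! ### Reassembling the word of smaller size in the lower block -/

section

open Jet Ext

lemma trdg_conj {n : ℕ} (u : (Matrix (Fin n) (Fin n) ℂ)ˣ) (x : Jet (Fin n)) :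
    trdg (kap u * x * (kap u)⁻¹) = trdg x := by
  have key : ∀ x : Jet (Fin n), trdg x = (0, fun k => trace (x.a k)) := fun x => by
    refine Prod.ext ?_ ?_
    · simp [trdg, dg, Prod.fst_sum]
    · funext k; simp [trdg, dg, Prod.snd_sum, Matrix.trace]
  rw [key, key]
  refine Prod.ext rfl (funext fun k => ?_)
  have : (kap u * x * (kap u)⁻¹).a k
      = (kap u⁻¹).gi * x.a k * (kap u⁻¹).m := by
    rw [← map_inv, mul_a, mul_a, kap_a, kap_a]; simp
  simp only [this, Jet.trace_conj]

lemma br_trdg_scal {n : ℕ} (v w : LogJet) : br w (trdg (scal n v)) = n * br w v := by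
  rw [br_trdg, scal, brv_dg_tor_right]
  simp [brv]

lemma io_scal_mul_self {n : ℕ} (v : LogJet) :
    io (scal n v) * io (scal n v) = io (scal n (v + v)) := by
  rw [io_mul_io, c_scal_left, br_trdg_scal, br_self, mul_zero, scal_add]
  exact mul_one _

section Group

variable {G : Type*} [Group G]

lemma block_group {L1 W L2 L3 s ν E z1 z2 z3 : G} (hν : ∀ x, ν * x = x * ν) (hE : ∀ x, E * x = x * E)
    (h1 : ∀ x, z1 * x = x * z1) (h2 : ∀ x, z2 * x = x * z2) (h3 : ∀ x, z3 * x = x * z3)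
    (hs : s * L2 = L2 * s * z1) (hX : s * (W * L3 * W⁻¹) = (W * L3 * W⁻¹) * s * z2)
    (hνE : ν * E = W * W) :
    L1 * 1 * (W * ν) * s * L2 * ((W * L3 * W⁻¹) * s * z3) * E
      = (L1 * W * L2 * W * L3 * W) * (s * s) * (z1 * z2 * z3) := by
  have hc : ∀ x, (ν * E) * x = x * (ν * E) := fun x => by
    rw [mul_assoc, hE, ← mul_assoc, hν, mul_assoc]
  generalize hXd : W * L3 * W⁻¹ = X at *
  have hXW : X * (ν * E) = W * L3 * W := by
    rw [hνE, ← hXd]; group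
  have aν := move_central hν
  have a1 := move_central h1
  have a2 := move_central h2
  have a3 := move_central h3
  calc _ = L1 * W * (s * L2) * X * s * (ν * E) * z3 := by
        simp only [mul_assoc, one_mul, aν, h3 E]
    _ = L1 * W * L2 * (s * X) * s * (ν * E) * z1 * z3 := by
        rw [hs]; simp only [mul_assoc, a1, h1 z3]
    _ = L1 * W * L2 * X * (s * s * (ν * E)) * z1 * z2 * z3 := by
        rw [hX]; simp only [mul_assoc, a2]
    _ = L1 * W * L2 * (X * (ν * E)) * (s * s) * z1 * z2 * z3 := by
        rw [← hc]; simp only [mul_assoc]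
    _ = _ := by rw [hXW]; simp only [mul_assoc]

end Group

section StokesRecursion

variable {m : ℕ} {y : ℕ → ℕ → ℕ → LogJet}

/-- Sum of the strip `c = 1`. -/
def stripS (m : ℕ) (y : ℕ → ℕ → ℕ → LogJet) : LogJet := ∑ q ∈ Finset.range (m + 1), stripY m y q

/-- The lower blocks of the peeled factors are the three smaller words up to scalars and signs. The
signs combine to W², which supplies the missing antidiagonal of the conjugated third word; the
scalars are collected at the price of central terms. -/
lemma block_word (ih : wordE m (sh y)
      = io (scal (m + 1) (-(2 : ℂ) • tsm (m + 1) (sh y))) * z (theta m (sh y))) :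
    io (Lw m (m + 1) 0 (sh y)) * io 1 * io (kap (wu m * -1)) * io (scal (m + 1) (-stripS m y))
        * io (Lw m (m + 1) 0 (cy (sh y)))
        * io (kap (wu m) * Lw m (m + 1) 0 (cy (cy (sh y))) * (kap (wu m))⁻¹
            * scal (m + 1) (-stripS m y)) * io (sg (m + 1) (m + 1))
      = io (scal (m + 1) (-(2 : ℂ) • (tsm (m + 1) (sh y) + stripS m y)))
        * z (theta m (sh y) - 2 * br (stripS m y) (trdg (Lw m (m + 1) 0 (cy (sh y))))
          - 3 * br (stripS m y) (trdg (Lw m (m + 1) 0 (cy (cy (sh y)))))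
          + 4 * (m + 1) * br (tsm (m + 1) (sh y)) (stripS m y)) := by
  set v := -stripS m y with hv
  set W : Ext (Fin (m + 1)) := io (kap (wu m)) with hWd
  set X := kap (wu m) * Lw m (m + 1) 0 (cy (cy (sh y))) * (kap (wu m))⁻¹ with hXd
  have hX : io X = W * io (Lw m (m + 1) 0 (cy (cy (sh y)))) * W⁻¹ := by
    rw [hXd, hWd, ← io_inv, ← map_inv, io_mul_kap, io_kap_mul]
  have e1 : io (kap (wu m * -1)) = W * io (sg (m + 1) 1) := by
    rw [map_mul, io_mul_kap, sg, pow_one]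
  have e2 := io_mul X (scal (m + 1) v)
  have e3 := io_scal_comm v (Lw m (m + 1) 0 (cy (sh y)))
  have e4 := io_scal_comm v X
  have e5 : io (sg (m + 1) 1) * io (sg (m + 1) (m + 1)) = W * W := by
    rw [io_sg_mul, ← io_mul_kap, ← map_mul, wu_mul_wu, sg, show 1 + (m + 1) = m + 2 by ring,
      pow_add]
    simp
  rw [hX] at e2 e4
  rw [e1, e2, io_one, block_group io_sg_comm io_sg_comm (z_comm _) (z_comm _) (z_comm _) e3 e4 e5,
    io_scal_mul_self]
  have e6 : io (Lw m (m + 1) 0 (sh y)) * W * io (Lw m (m + 1) 0 (cy (sh y))) * W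
      * io (Lw m (m + 1) 0 (cy (cy (sh y)))) * W = wordE m (sh y) := rfl
  rw [e6, ih, c_scal_right, hXd, trdg_conj, mul_assoc (io _), z_comm, ← mul_assoc, ← mul_assoc,
    ← mul_assoc (io (scal _ _)) (io _) (z _),
    io_mul_io, c_scal_left, br_trdg_scal, ← scal_add, mul_assoc, mul_assoc, mul_assoc]
  simp only [← z_add, mul_assoc]
  congr 2
  · congr 1
    rw [hv]; module
  · rw [hv]
    simp only [br_neg_left, br_add_right, br_smul_left, br_neg_right]
    push_cast
    ring

end StokesRecursion

end

section

open Jet Ext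

/-! ### Cyclic rotation -/

/-- The corner of x is zero and the lower rows of r' are those of 1, so x r' has the first row of x.
Hence (r - 1)x has zero first row, thus so has r - 1, and r - 1 is supported in that row. The
logarithmic derivatives are treated in the same way. -/
lemma rad_eq_one {n : ℕ} {r r' x : Jet (Fin (n + 1))} (h : Rad r) (h' : Rad r')
    (hx : x.m 0 0 = 0) (he : r * x = x * r') : r = 1 := by
  -- multiplication on the right by a matrix whose lower rows are those of `1`
  have key1 : ∀ j, (x.m * r'.m) 0 j = x.m 0 j := by
    intro j
    rw [Matrix.mul_apply, Fin.sum_univ_succ, hx, zero_mul, zero_add]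
    refine Fin.cases ?_ (fun j => ?_) j
    · rw [hx]; exact Finset.sum_eq_zero fun i _ => by rw [h'.blk.m0, mul_zero]
    · have e : ∀ i : Fin n, r'.m i.succ j.succ = (1 : Matrix (Fin n) (Fin n) ℂ) i j := fun i =>
        congrFun (congrFun h'.blk.m i) j
      simp [e, one_apply]
  have key2 : ∀ k j, (x.m * r'.a k) 0 j = 0 := by
    intro k j
    rw [Matrix.mul_apply, Fin.sum_univ_succ, hx, zero_mul, zero_add]
    refine Fin.cases ?_ (fun j => ?_) j
    · exact Finset.sum_eq_zero fun i _ => by rw [h'.blk.a0, mul_zero]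
    · refine Finset.sum_eq_zero fun i _ => ?_
      have e : r'.a k i.succ j.succ = (0 : Matrix (Fin n) (Fin n) ℂ) i j :=
        congrFun (congrFun (h'.blk.a k) i) j
      rw [e]; simp
  have hm : r.m = 1 := by
    have h1 : r.m * x.m = x.m * r'.m := congrArg Jet.m he
    have h2 : ∀ j, ((r.m - 1) * x.m) 0 j = 0 := fun j => by
      rw [sub_mul, h1, one_mul, Matrix.sub_apply, key1, sub_self]
    have h3 : ∀ j, (r.m - 1) 0 j = 0 := fun j => by
      have : (r.m - 1) * x.m * x.gi = r.m - 1 := by rw [mul_assoc, m_mul_gi, mul_one]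
      rw [← this, Matrix.mul_apply]
      exact Finset.sum_eq_zero fun i _ => by rw [h2, zero_mul]
    have h4 : r.m - 1 = 0 := by
      ext i j
      refine Fin.cases (h3 j) (fun i => ?_) i
      refine Fin.cases ?_ (fun j => ?_) j
      · simp [h.blk.m0, one_apply]
      · have e : r.m i.succ j.succ = (1 : Matrix (Fin n) (Fin n) ℂ) i j :=
          congrFun (congrFun h.blk.m i) j
        simp [e, one_apply]
    exact sub_eq_zero.1 h4
  have hm' : r'.m = 1 := by
    have h1 : r.m * x.m = x.m * r'.m := congrArg Jet.m he
    have h2 : x.gi * (r.m * x.m) = x.gi * (x.m * r'.m) := by rw [h1]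
    rw [hm, one_mul, gi_mul_m, gi_mul_m_assoc] at h2
    exact h2.symm
  refine ext_m hm fun k => ?_
  have hg' : r'.gi = 1 := by
    have := r'.gi_mul_m
    rwa [hm', mul_one] at this
  have h1 : x.gi * r.a k * x.m = r'.a k := by
    have := congrArg (fun j => Jet.a j k) he
    simp only [mul_a, hg', hm', one_mul, mul_one] at this
    rw [add_comm (x.gi * r.a k * x.m)] at this
    exact add_left_cancel this
  have h2 : r.a k * x.m = x.m * r'.a k := by rw [← h1]; simp [mul_assoc]
  have h3 : ∀ j, r.a k 0 j = 0 := fun j => by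
    have : r.a k * x.m * x.gi = r.a k := by rw [mul_assoc, m_mul_gi, mul_one]
    rw [← this, Matrix.mul_apply]
    exact Finset.sum_eq_zero fun i _ => by rw [h2, key2, zero_mul]
  ext i j
  refine Fin.cases (h3 j) (fun i => ?_) i
  refine Fin.cases (h.blk.a0 k i) (fun j => ?_) j
  exact congrFun (congrFun (h.blk.a k) i) j

/-! ### The relation -/

lemma Rad.blkL {n : ℕ} {r : Jet (Fin (n + 1))} (h : Rad r) : BlkL r 1 0 1 :=
  ⟨h.blk, by simp [h.m00], fun k => congrFun (congrArg Prod.snd h.dg0) k⟩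

lemma BlkL.sg (n k : ℕ) :
    BlkL (FrobeniusStokes.sg (n + 1) k) (FrobeniusStokes.sg n k) 0 ((-1) ^ k) := by
  rcases Nat.even_or_odd k with h | h
  · rw [sg_even h, sg_even h, h.neg_one_pow]; exact BlkL.one
  · rw [h.neg_one_pow]
    simp only [FrobeniusStokes.sg, h.neg_one_pow]
    refine ⟨Blk.of_m ?_ ?_ ?_ ?_, ?_, ?_⟩
    · intro i; simp [one_apply]
    · intro k i; simp
    · ext i j; simp [one_apply]
    · intro k; simp
    · simp
    · simp

variable {m : ℕ} {y : ℕ → ℕ → ℕ → LogJet}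

lemma tsm_strip (hy : Bd y) : tsm (m + 2) y = tsm (m + 1) (sh y) + stripS m y := by
  rw [tsm_succ m y fun b c => (hy b c).1]
  congr 1
  exact tsm_congr fun a b c _ _ hc _ => by simp [sh, hc.ne']

/-- The central values of the peeled word add up to the central value. -/
lemma theta_sum (hy : Bd y) :
    theta (m + 1) y = theta m (sh y) - 2 * br (stripS m y) (trdg (Lw m (m + 1) 0 (cy (sh y))))
          - 3 * br (stripS m y) (trdg (Lw m (m + 1) 0 (cy (cy (sh y)))))
          + 4 * (m + 1) * br (tsm (m + 1) (sh y)) (stripS m y)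
        + (stripC (stripY m y) (m + 1)
          - c (Lw m (m + 2) 1 (sh y)) (nPart (m + 2) (stripY m y) (m + 1))
          - c (headW m (m + 2) 0 y) (Lw m (m + 2) 1 (cy (sh y)))) := by
  have hT : br (tsm (m + 1) (sh y)) (stripS m y)
      = ∑ q ∈ Finset.range (m + 1), tsm (m + 1) fun a b c => -br (stripY m y q) (sh y a b c) := by
    rw [stripS, br_sum_right]
    refine Finset.sum_congr rfl fun q _ => ?_
    rw [br_swap, tsm, br_sum_right, ← Finset.sum_neg_distrib]; rfl
  have h2 : br (stripS m y) (trdg (Lw m (m + 1) 0 (cy (sh y))))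
      = ∑ q ∈ Finset.range (m + 1), tsm (m + 1) fun a b c =>
        -(((m : ℂ) + 1 - b) * br (stripY m y q) (sh y a b c)) := by
    rw [stripS, br_sum_left]
    refine Finset.sum_congr rfl fun q _ => ?_
    rw [br_trdg_Lw _ hy.sh.cy, ← tsm_cyc (m + 1) (fun a b c =>
      -(((m : ℂ) + 1 - b) * br (stripY m y q) (sh y a b c))), tsm, ← Finset.sum_neg_distrib]
    rfl
  have h3 : br (stripS m y) (trdg (Lw m (m + 1) 0 (cy (cy (sh y)))))
      = ∑ q ∈ Finset.range (m + 1), tsm (m + 1) fun a b c =>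
        -(((m : ℂ) + 1 - c) * br (stripY m y q) (sh y a b c)) := by
    rw [stripS, br_sum_left]
    refine Finset.sum_congr rfl fun q _ => ?_
    rw [br_trdg_Lw _ hy.sh.cy.cy, ← tsm_cyc (m + 1) (fun a b c =>
      -(((m : ℂ) + 1 - c) * br (stripY m y q) (sh y a b c))),
      ← tsm_cyc (m + 1) (fun a b c => -(((m : ℂ) + 1 - b) * br (stripY m y q) (sh y c a b))),
      tsm, ← Finset.sum_neg_distrib]
    rfl
  rw [theta_succ m hy, hT, h2, h3, c_peel_right m hy, c_peel_left m hy]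
  have key : ∀ q ∈ Finset.range (m + 1), tsm (m + 1) (fun a b c =>
        (gcoef ((a : ℤ) - (m - q : ℕ)) ((b : ℤ) - (q + 1 : ℕ)) c : ℂ)
          * br (stripY m y q) (sh y a b c))
      = -2 * tsm (m + 1) (fun a b c => -(((m : ℂ) + 1 - b) * br (stripY m y q) (sh y a b c)))
        - 3 * tsm (m + 1) (fun a b c => -(((m : ℂ) + 1 - c) * br (stripY m y q) (sh y a b c)))
        + 4 * (m + 1) * tsm (m + 1) (fun a b c => -br (stripY m y q) (sh y a b c))
        + tsm (m + 1) (fun a b c =>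
          ((min (m + 2 - a) (q + 2) : ℕ) : ℂ) * br (stripY m y q) (sh y a b c))
        - tsm (m + 1) (fun a b c =>
          ((min (m + 1 - q) (m + 2 - b) : ℕ) : ℂ) * br (stripY m y q) (sh y a b c)) := by
    intro q hq
    rw [Finset.mem_range] at hq
    simp only [tsm, Finset.mul_sum, ← Finset.sum_sub_distrib, ← Finset.sum_add_distrib]
    refine Finset.sum_congr rfl ?_
    rintro ⟨a, b, c⟩ ht
    obtain ⟨ha, hb, hc, h⟩ := mem_triples.1 ht
    dsimp only
    -- The arithmetic of the induction on a + b + c = m + 1: the piecewise linear coefficient is the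
    -- difference of the minima from the two peelings plus the linear terms left by the moved
    -- scalars.
    have hz : gcoef ((a : ℤ) - (m - q : ℕ)) ((b : ℤ) - (q + 1 : ℕ)) c
        = 2 * ((m : ℤ) + 1 - b) + 3 * ((m : ℤ) + 1 - c) - 4 * (m + 1)
          + ((min (m + 2 - a) (q + 2) : ℕ) : ℤ) - ((min (m + 1 - q) (m + 2 - b) : ℕ) : ℤ) := by
      simp only [gcoef]; split_ifs <;> omega
    rw [hz]
    simp only [Int.cast_add, Int.cast_sub, Int.cast_mul, Int.cast_natCast, Int.cast_ofNat,
      Int.cast_one]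
    ring
  rw [Finset.sum_congr rfl key]
  simp only [Finset.sum_add_distrib, Finset.sum_sub_distrib, ← Finset.mul_sum]
  ring

lemma wordE_zero (y : ℕ → ℕ → ℕ → LogJet) : wordE 0 y = 1 := by
  have : wu 0 = 1 := by
    apply Units.ext; ext a b
    fin_cases a; fin_cases b
    simp [wu]
  simp [wordE, Lw, this]

lemma io_mul_z_j {n : ℕ} (x : Jet (Fin n)) (s : ℂ) : (io x * z s).j = x := mul_one x

/-- The word is scalar up to the radical. -/
lemma wordE_rad (hy : Bd y) (ih : wordE m (sh y)
      = io (scal (m + 1) (-(2 : ℂ) • tsm (m + 1) (sh y))) * z (theta m (sh y))) :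
    Rad ((wordE (m + 1) y).j * scal (m + 2) ((2 : ℂ) • tsm (m + 2) y)) ∧
      (wordE (m + 1) y).s = theta (m + 1) y := by
  obtain ⟨r, hr, hw⟩ := wordE_peel m hy
  have b1 : BlkL (Lw m (m + 2) 1 (sh y)) (Lw m (m + 1) 0 (sh y)) (-tsm (m + 1) (sh y)) 1 :=
    BlkL.Lw m (m + 1) 0 hy.sh
  have b4 : BlkL (tor fun j => stripTor (m + 2) (stripY m y) (m + 1) (Fin.rev j))
      (scal (m + 1) (-stripS m y)) (-(2 : ℂ) • stripS m y) 1 := by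
    have := BlkL.tor (fun j => stripTor (m + 2) (stripY m y) (m + 1) (Fin.rev j))
    convert this using 1
    · rw [scal]
      congr 1
      funext i
      rw [stripTor, if_neg (by rw [Fin.val_rev, Fin.val_succ]; omega), one_smul, stripS]
    · rw [stripTor, if_pos (by rw [Fin.val_rev]; simp), stripS, neg_smul]
  have b5 : BlkL (Lw m (m + 2) 1 (cy (sh y))) (Lw m (m + 1) 0 (cy (sh y)))
      (-tsm (m + 1) (sh y)) 1 := by
    rw [← tsm_cyc]; exact BlkL.Lw m (m + 1) 0 hy.sh.cy
  have b6 := BlkL.conj_Lw m hy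
  have hB := ((((((b1.io.mul hr.blkL.io).mul (BlkL.cox_wu m).io).mul b4.io).mul b5.io).mul b6.io).mul
    (BlkL.sg (m + 1) (m + 1)).io)
  have hblk := block_word ih
  rw [stripS] at hblk
  rw [stripS, hblk] at hB
  have hT := tsm_strip (m := m) hy
  rw [stripS] at hT
  set P := io (Lw m (m + 2) 1 (sh y)) * io r * io (kap (cox (m + 2) (m + 1) * wu (m + 1)))
        * io (tor fun j => stripTor (m + 2) (stripY m y) (m + 1) (Fin.rev j))
        * io (Lw m (m + 2) 1 (cy (sh y)))
        * io (kap (wu (m + 1)) * Lw (m + 1) (m + 2) 0 (cy (cy y)) * (kap (wu (m + 1)))⁻¹)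
        * io (sg (m + 2) (m + 1)) with hP
  constructor
  · have hj : (wordE (m + 1) y).j = P.j := by rw [hw, mul_j, z_j, mul_one]
    have hs : BlkL (scal (m + 2) ((2 : ℂ) • tsm (m + 2) y)) (scal (m + 1) ((2 : ℂ) • tsm (m + 2) y))
      ((2 : ℂ) • tsm (m + 2) y) 1 := BlkL.tor _
    have h := hB.j.mul hs
    rw [io_mul_z_j, ← hT, ← scal_add] at h
    have e0 : -(2 : ℂ) • tsm (m + 2) y + (2 : ℂ) • tsm (m + 2) y = 0 := by module
    -- The corner has the same logarithm as the scalar lower block, -2 times the full sum over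
    -- triples; dividing by the scalar leaves an element of the radical.
    have e1 : -tsm (m + 1) (sh y) + 0 + 0 + -(2 : ℂ) • (∑ q ∈ Finset.range (m + 1), stripY m y q)
        + -tsm (m + 1) (sh y) + 0 + 0 + (2 : ℂ) • tsm (m + 2) y = 0 := by rw [hT]; module
    have e2 : (1 : ℂ) * 1 * (-1) ^ (m + 1) * 1 * 1 * 1 * (-1) ^ (m + 1) * 1 = 1 := by
      simp [← mul_pow]
    rw [e0, scal_zero, e1, e2] at h
    rw [hj]
    refine ⟨h.blk, by simpa using h.m00, ?_⟩
    refine Prod.ext rfl (funext fun k => ?_)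
    exact h.a00 k
  · rw [hw, mul_s, z_j, c_one_right, z_s, add_zero, hB.s, theta_sum hy, mul_s, io_s, z_s, z_j,
      c_one_right]
    simp only [stripS, br_add_left, br_neg_left, br_neg_right, br_smul_left,
      br_smul_right, br_zero_left, br_zero_right, br_self]
    rw [br_swap (tsm (m + 1) (sh y))]
    ring

lemma sh_bd_cy (y : ℕ → ℕ → ℕ → LogJet) : tsm (m + 1) (cy y) = tsm (m + 1) y := tsm_cyc _ y

/-- The word relation. -/
theorem word_relation (m : ℕ) : ∀ y : ℕ → ℕ → ℕ → LogJet, Bd y →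
    wordE m y = io (scal (m + 1) (-(2 : ℂ) • tsm (m + 1) y)) * z (theta m y) := by
  induction m with
  | zero =>
    intro y _
    have h : ∀ {A : Type} [AddCommMonoid A] (f : ℕ → ℕ → ℕ → A), tsm 1 f = 0 := by
      intro A _ f
      refine Finset.sum_eq_zero ?_
      rintro ⟨a, b, c⟩ ht
      have := mem_triples.1 ht
      omega
    rw [wordE_zero, theta, h, h]
    simp only [smul_zero, scal_zero, mul_zero, io_one, one_mul]
    rfl
  | succ m ih =>
    intro y hy
    obtain ⟨h1, hs⟩ := wordE_rad hy (ih _ hy.sh)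
    obtain ⟨h2, -⟩ := wordE_rad hy.cy (ih _ hy.cy.sh)
    rw [sh_bd_cy] at h2
    set t := (2 : ℂ) • tsm (m + 2) y with ht
    set A : ℕ → Jet (Fin (m + 2)) := fun i => Lw (m + 1) (m + 2) 0 (cy^[i] y) * kap (wu (m + 1))
      with hA
    -- The words of y and of its rotation are cyclic permutations of one another, so A 0 intertwines
    -- their radical parts.
    have e1 : (wordE (m + 1) y).j = A 0 * A 1 * A 2 := wordE_j _ _
    have e2 : (wordE (m + 1) (cy y)).j = A 1 * A 2 * A 0 := wordE_j _ _
    -- A lower triangular matrix times an antidiagonal one has zero corner as soon as the size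
    -- exceeds one.
    have h00 : (A 0).m 0 0 = 0 := by
      simp only [hA, mul_m, kap_m]
      rw [Matrix.mul_apply]
      refine Finset.sum_eq_zero fun k _ => ?_
      by_cases hk : k = 0
      · subst hk; simp [wu, Fin.ext_iff]
      · have h5 : (Lw (m + 1) (m + 2) 0 (cy^[0] y)).m 0 k = 0 :=
          (Lw_mem (m + 1) (m + 2) 0 (cy^[0] y)).1 (Fin.pos_of_ne_zero hk)
        rw [h5, zero_mul]
    have h3 : (wordE (m + 1) y).j * scal (m + 2) t = 1 := by
      refine rad_eq_one h1 h2 h00 ?_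
      rw [e1, e2, mul_assoc _ (scal _ _), scal_comm]
      simp only [mul_assoc]
    have h4 : (wordE (m + 1) y).j = scal (m + 2) (-t) := by
      rw [scal_neg]; exact eq_inv_of_mul_eq_one_left h3
    rw [eq_io_mul_z (wordE (m + 1) y), h4, hs, ht, neg_smul]

end

section

open Jet Ext

/-! ### Jets of matrix valued functions -/

section HasJet

variable {X : Type*} [NormedAddCommGroup X] [NormedSpace ℂ X]
variable {ι : Type*} [Fintype ι] [DecidableEq ι]

/-- `J` is differentiable at `p` and `x` records its value and its logarithmic derivatives in the
directions `w`. -/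
structure HasJet (p : X) (w : Fin 2 → X) (J : X → Matrix ι ι ℂ) (x : Jet ι) : Prop where
  val : J p = x.m
  diff : ∀ i j, DifferentiableAt ℂ (fun q => J q i j) p
  der : ∀ k, mder J p (w k) = x.m * x.a k

variable {p : X} {w : Fin 2 → X} {J K : X → Matrix ι ι ℂ} {x y : Jet ι}

lemma mder_mul (hJ : ∀ i j, DifferentiableAt ℂ (fun q => J q i j) p)
    (hK : ∀ i j, DifferentiableAt ℂ (fun q => K q i j) p) (u : X) :
    mder (fun q => J q * K q) p u = mder J p u * K p + J p * mder K p u := by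
  ext i j
  simp only [mder, of_apply, Matrix.add_apply, Matrix.mul_apply]
  rw [fderiv_fun_sum (A := fun l q => J q i l * K q l j) fun l _ => (hJ i l).mul (hK l j)]
  simp only [_root_.sum_apply]
  rw [← Finset.sum_add_distrib]
  refine Finset.sum_congr rfl fun l _ => ?_
  rw [fderiv_fun_mul (hJ i l) (hK l j)]
  simp only [_root_.add_apply, _root_.smul_apply, smul_eq_mul]
  ring

lemma diff_mul (hJ : ∀ i j, DifferentiableAt ℂ (fun q => J q i j) p)
    (hK : ∀ i j, DifferentiableAt ℂ (fun q => K q i j) p) (i j : ι) :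
    DifferentiableAt ℂ (fun q => (J q * K q) i j) p := by
  simp only [Matrix.mul_apply]
  exact DifferentiableAt.fun_sum fun l _ => (hJ i l).mul (hK l j)

lemma diff_det (hJ : ∀ i j, DifferentiableAt ℂ (fun q => J q i j) p) :
    DifferentiableAt ℂ (fun q => (J q).det) p := by
  simp only [det_apply]
  exact DifferentiableAt.fun_sum fun σ _ =>
    ((HasFDerivAt.finsetProd (g := fun i q => J q (σ i) i)
      fun i _ => (hJ (σ i) i).hasFDerivAt).differentiableAt).const_smul _

/-- Cramer's rule: the entries are quotients of determinants with nonvanishing denominator. -/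
lemma diff_inv (hJ : ∀ i j, DifferentiableAt ℂ (fun q => J q i j) p) (h : IsUnit (J p))
    (i j : ι) : DifferentiableAt ℂ (fun q => (J q)⁻¹ i j) p := by
  have h0 : (J p).det ≠ 0 := ((isUnit_iff_isUnit_det _).1 h).ne_zero
  have e : (fun q => (J q)⁻¹ i j)
      = fun q => ((J q).det)⁻¹ * ((J q).updateRow j (Pi.single i 1)).det := by
    funext q
    rw [Matrix.inv_def, Matrix.smul_apply, adjugate_apply, smul_eq_mul, Ring.inverse_eq_inv']
  rw [e]
  refine ((diff_det hJ).inv h0).mul (diff_det fun a b => ?_)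
  by_cases hab : a = j
  · subst hab; simp [updateRow_apply]
  · simp only [updateRow_apply, if_neg hab]; exact hJ a b

lemma HasJet.mul (hx : HasJet p w J x) (hy : HasJet p w K y) :
    HasJet p w (fun q => J q * K q) (x * y) where
  val := by rw [hx.val, hy.val, mul_m]
  diff := diff_mul hx.diff hy.diff
  der k := by
    rw [mder_mul hx.diff hy.diff, hx.der, hy.der, hx.val, hy.val, mul_m, mul_a, mul_add]
    simp only [mul_assoc, m_mul_gi_assoc]

lemma mder_const (M : Matrix ι ι ℂ) (u : X) : mder (fun _ => M) p u = 0 := by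
  ext i j; simp [mder]

lemma HasJet.kap (u : (Matrix ι ι ℂ)ˣ) : HasJet p w (fun _ => (u : Matrix ι ι ℂ)) (Jet.kap u) where
  val := rfl
  diff _ _ := differentiableAt_const _
  der k := by rw [mder_const]; simp

lemma HasJet.one : HasJet p w (fun _ => (1 : Matrix ι ι ℂ)) 1 := by
  simpa using HasJet.kap (p := p) (w := w) (1 : (Matrix ι ι ℂ)ˣ)

lemma inv_eq_gi (x : Jet ι) : x.m⁻¹ = x.gi := inv_eq_left_inv x.gi_mul_m

lemma isUnit_m (x : Jet ι) : IsUnit x.m := ⟨x.g, rfl⟩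

lemma HasJet.inv (hx : HasJet p w J x) : HasJet p w (fun q => (J q)⁻¹) x⁻¹ where
  val := by rw [hx.val, inv_eq_gi, inv_m]
  diff := diff_inv hx.diff (hx.val ▸ isUnit_m x)
  der k := by
    have hd := diff_inv hx.diff (hx.val ▸ isUnit_m x)
    have h1 := mder_mul hx.diff hd (w k)
    -- The product J J⁻¹ is 1 only near p, where the determinant stays nonzero; this is enough for
    -- the derivative.
    have h2 : mder (fun q => J q * (J q)⁻¹) p (w k) = 0 := by
      rw [← mder_const (p := p) (1 : Matrix ι ι ℂ) (w k)]
      have hev : ∀ᶠ q in nhds p, (J q).det ≠ 0 :=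
        (diff_det hx.diff).continuousAt.eventually_ne
          ((isUnit_iff_isUnit_det _).1 (hx.val ▸ isUnit_m x)).ne_zero
      ext i j
      simp only [mder, of_apply]
      rw [Filter.EventuallyEq.fderiv_eq]
      filter_upwards [hev] with q hq
      rw [mul_nonsing_inv _ (isUnit_iff_ne_zero.2 hq)]
    rw [h2, hx.der, hx.val, inv_eq_gi] at h1
    have h3 : x.m * mder (fun q => (J q)⁻¹) p (w k) = -(x.m * x.a k * x.gi) :=
      (neg_eq_of_add_eq_zero_right h1.symm).symm
    calc _ = x.gi * (x.m * mder (fun q => (J q)⁻¹) p (w k)) := by rw [gi_mul_m_assoc]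
      _ = _ := by rw [h3]; simp [mul_assoc]

/-- Transposition is not a homomorphism; writing it as the inverse of g ↦ g^{-t} keeps all
computations inside the group of jets. -/
lemma HasJet.transpose (hx : HasJet p w J x) : HasJet p w (fun q => (J q)ᵀ) (tinv x)⁻¹ where
  val := by rw [hx.val, inv_m, tinv_gi]
  diff i j := hx.diff j i
  der k := by
    have h : mder (fun q => (J q)ᵀ) p (w k) = (mder J p (w k))ᵀ := rfl
    rw [h, hx.der, inv_m, inv_a, tinv_gi, tinv_m, tinv_a, transpose_mul]
    have h2 : x.mᵀ * x.giᵀ = 1 := by rw [← transpose_mul, gi_mul_m, transpose_one]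
    simp only [mul_neg, neg_mul, neg_neg, ← mul_assoc, h2, one_mul]

lemma HasJet.invT (hx : HasJet p w J x) : HasJet p w (fun q => ((J q)⁻¹)ᵀ) (tinv x) := by
  simpa using hx.inv.transpose

lemma HasJet.listProd {α : Type*} (l : List α) {f : α → X → Matrix ι ι ℂ} {g : α → Jet ι}
    (h : ∀ i ∈ l, HasJet p w (f i) (g i)) :
    HasJet p w (fun q => (l.map fun i => f i q).prod) (l.map g).prod := by
  induction l with
  | nil => simpa using HasJet.one
  | cons a l ih =>
    simp only [List.map_cons, List.prod_cons]
    exact (h a (by simp)).mul (ih fun i hi => h i (by simp [hi]))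

/-- Value and derivatives of a scalar function. -/
def ev (p : X) (w : Fin 2 → X) (f : X → ℂ) : LogJet := (f p, fun k => fderiv ℂ f p (w k))

lemma wedge_eq_br (f g : X → ℂ) : wedge f g p (w 0) (w 1) = br (ev p w f) (ev p w g) := rfl

lemma HasJet.tor {f : ι → X → ℂ} (hf : ∀ i, DifferentiableAt ℂ (f i) p) :
    HasJet p w (fun q => diagonal fun i => exp (f i q)) (FrobeniusStokes.tor fun i => ev p w (f i)) where
  val := rfl
  diff i j := by
    by_cases h : i = j
    · subst h; simpa only [diagonal_apply_eq] using (hf i).cexp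
    · simpa only [diagonal_apply_ne _ h] using differentiableAt_const _
  der k := by
    rw [tor_m, tor_a, diagonal_mul_diagonal]
    ext i j
    by_cases h : i = j
    · subst h
      simp only [mder, of_apply, diagonal_apply_eq, ev]
      rw [((hf i).hasFDerivAt.cexp).fderiv]; simp
    · simp [mder, h]

lemma HasJet.of_isUnit (hJ : ∀ i j, DifferentiableAt ℂ (fun q => J q i j) p) (h : IsUnit (J p)) :
    ∃ x : Jet ι, HasJet p w J x :=
  ⟨⟨h.unit, fun k => (J p)⁻¹ * mder J p (w k)⟩, rfl, hJ, fun k => by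
    change _ = J p * ((J p)⁻¹ * _)
    rw [← mul_assoc, mul_nonsing_inv _ ((isUnit_iff_isUnit_det _).1 h), one_mul]⟩

lemma HasJet.congr (hx : HasJet p w J x) (h : J = K) : HasJet p w K x := h ▸ hx

/-- The logarithmic derivative of K_k = K_{k-1}J_k is that of K_{k-1}, conjugated, plus that of J_k,
and the latter pairs to zero with itself. So each summand at a vertex is a value of the cocycle. -/
lemma traceWedge_eq (hx : HasJet p w J x) (hy : HasJet p w K y) :
    traceWedge (fun q => J q * K q) K p (w 0) (w 1) = c x y := by
  have h := hx.mul hy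
  rw [traceWedge, h.val, hy.val, h.der, h.der, hy.der, hy.der, inv_eq_gi, inv_eq_gi]
  simp only [gi_mul_m_assoc, mul_a, add_mul, trace_add, c]
  rw [trace_mul_comm (y.a 0)]
  ring

/-- The form of a vertex is the central component of the product of the jets. -/
lemma starForm_eq (Js : List ((X → Matrix ι ι ℂ) × Jet ι)) (h : ∀ J ∈ Js, HasJet p w J.1 J.2)
    (h1 : (Js.map fun J => J.2).prod = 1) :
    starForm (Js.map Prod.fst) p (w 0) (w 1) = (Js.map fun J => io J.2).prod.s := by
  have hjet : ∀ l : List ((X → Matrix ι ι ℂ) × Jet ι), (∀ J ∈ l, HasJet p w J.1 J.2) →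
      HasJet p w (fun q => ((l.map Prod.fst).map fun J => J q).prod) (l.map fun J => J.2).prod := by
    intro l hl
    rw [show (fun q => ((l.map Prod.fst).map fun J => J q).prod)
      = fun q => (l.map fun J => J.1 q).prod by funext q; rw [List.map_map]; rfl]
    exact HasJet.listProd l hl
  have hj : ∀ l : List ((X → Matrix ι ι ℂ) × Jet ι),
      (l.map fun J => io J.2).prod.j = (l.map fun J => J.2).prod := by
    intro l
    induction l with
    | nil => rfl
    | cons a l ih => simp [ih]
  have key : ∀ N ≤ Js.length, ∑ k ∈ Finset.range N,
      traceWedge (fun q => (((Js.map Prod.fst).take (k + 1)).map fun J => J q).prod)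
        ((Js.map Prod.fst).getD k fun _ => 1) p (w 0) (w 1)
        = ((Js.take N).map fun J => io J.2).prod.s := by
    intro N hN
    induction N with
    | zero => simp
    | succ N ih =>
      rw [Finset.sum_range_succ, ih (by omega)]
      have e := List.take_succ_eq_append_getElem (l := Js) (i := N) (by omega)
      have hmem : Js[N] ∈ Js := List.getElem_mem _
      have e2 : (fun q => (((Js.map Prod.fst).take (N + 1)).map fun J => J q).prod)
          = fun q => (((Js.take N).map Prod.fst).map fun J => J q).prod * Js[N].1 q := by
        funext q
        rw [← List.map_take, e]
        simp only [List.map_append, List.prod_append, List.map_cons, List.map_nil, List.prod_cons,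
          List.prod_nil, mul_one]
      have e3 : (Js.map Prod.fst).getD N (fun _ => 1) = Js[N].1 := by
        rw [List.getD_eq_getElem _ _ (by simpa using hN), List.getElem_map]
      rw [e2, e3, traceWedge_eq (hjet _ fun J hJ => h J (List.mem_of_mem_take hJ)) (h _ hmem), e,
        List.map_append, List.prod_append, mul_s, hj]
      simp
  rw [starForm, List.length_map]
  cases hl : Js.length with
  | zero => rw [List.length_eq_zero_iff] at hl; subst hl; simp
  | succ N =>
    have hN := key (N + 1) (by omega)
    rw [List.take_of_length_le (by omega), Finset.sum_range_succ] at hN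
    -- The form of a vertex omits the last summand. Nothing is lost: the total product is 1, so that
    -- summand is c(J⁻¹, J) = 0.
    rw [← hN, Nat.add_sub_cancel, left_eq_add]
    have e := List.take_succ_eq_append_getElem (l := Js) (i := N) (by omega)
    have hmem : Js[N] ∈ Js := List.getElem_mem _
    have hl1 := hjet (Js.take N) fun J hJ => h J (List.mem_of_mem_take hJ)
    have hc := traceWedge_eq hl1 (h _ hmem)
    rw [List.take_of_length_le (by omega)] at e
    have e2 : (fun q => (((Js.map Prod.fst).take (N + 1)).map fun J => J q).prod)
        = fun q => (((Js.take N).map Prod.fst).map fun J => J q).prod * Js[N].1 q := by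
      funext q
      rw [List.take_of_length_le (by simp; omega)]
      conv_lhs => rw [e]
      simp only [List.map_append, List.prod_append, List.map_cons, List.map_nil, List.prod_cons,
        List.prod_nil, mul_one]
    have e3 : (Js.map Prod.fst).getD N (fun _ => 1) = Js[N].1 := by
      rw [List.getD_eq_getElem _ _ (by simp; omega), List.getElem_map]
    rw [e2, e3, hc]
    have e4 : ((Js.take N).map fun J => J.2).prod * Js[N].2 = 1 := by
      rw [← h1]; conv_rhs => rw [e]
      simp only [List.map_append, List.prod_append, List.map_cons, List.map_nil, List.prod_cons,
        List.prod_nil, mul_one]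
    rw [eq_inv_of_mul_eq_one_left e4, c_inv_left]

end HasJet

end

section

open Jet Ext

/-! ### Scalar matrices and linear coordinates -/

/-- Scalar matrices. -/
def scu (n : ℕ) : ℂˣ →* (Matrix (Fin n) (Fin n) ℂ)ˣ := Units.map (Matrix.scalar (Fin n)).toMonoidHom

lemma scu_val {n : ℕ} (a : ℂˣ) :
    (scu n a : Matrix (Fin n) (Fin n) ℂ) = (a : ℂ) • (1 : Matrix (Fin n) (Fin n) ℂ) := by
  rw [smul_one_eq_diagonal]; rfl

lemma scu_comm {n : ℕ} (a : ℂˣ) (x : Jet (Fin n)) : kap (scu n a) * x = x * kap (scu n a) := by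
  refine ext_m ?_ fun k => ?_
  · rw [mul_m, mul_m, kap_m, scu_val]; simp
  · rw [mul_a, mul_a, kap_a, kap_gi, ← map_inv, kap_m, scu_val, scu_val]; simp [smul_smul]

lemma tinv_scu {n : ℕ} (a : ℂˣ) : tinv (kap (scu n a)) = kap (scu n a⁻¹) := by
  refine ext_m ?_ fun k => by simp
  rw [tinv_m, kap_gi, ← map_inv, kap_m, scu_val]; simp

section Lin

variable {n : ℕ} (p : Chart n) (w : Fin 2 → Chart n)

/-- Values of a function at the point and at the directions. -/
def lev : (Chart n → ℂ) →ₗ[ℂ] LogJet where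
  toFun f := (f p, fun k => f (w k))
  map_add' _ _ := rfl
  map_smul' _ _ := rfl

variable {p w}

lemma IsLinearMap.diff {f : Chart n → ℂ} (h : IsLinearMap ℂ f) : DifferentiableAt ℂ f p :=
  (LinearMap.toContinuousLinearMap h.mk').differentiableAt

lemma IsLinearMap.fderiv_eq {f : Chart n → ℂ} (h : IsLinearMap ℂ f) (u : Chart n) :
    fderiv ℂ f p u = f u :=
  congrFun (congrArg DFunLike.coe (LinearMap.toContinuousLinearMap h.mk').fderiv) u

lemma ev_eq_lev {f : Chart n → ℂ} (h : IsLinearMap ℂ f) : ev p w f = lev p w f :=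
  Prod.ext rfl (funext fun _ => IsLinearMap.fderiv_eq h _)

lemma isLinearMap_xi (a b c : ℕ) : IsLinearMap ℂ (xi (n := n) a b c) where
  map_add u v := by simp only [xi]; split_ifs <;> simp
  map_smul r u := by simp only [xi]; split_ifs <;> simp

lemma isLinearMap_zeta (k : Fin (n - 1)) : IsLinearMap ℂ (zeta (n := n) k) := ⟨fun _ _ => rfl, fun _ _ => rfl⟩

lemma isLinearMap_gam (k : Fin (n / 2)) : IsLinearMap ℂ (gam (n := n) k) := ⟨fun _ _ => rfl, fun _ _ => rfl⟩

lemma isLinearMap_sum {α : Type*} (s : Finset α) {f : α → Chart n → ℂ}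
    (h : ∀ i ∈ s, IsLinearMap ℂ (f i)) (r : α → ℂ) :
    IsLinearMap ℂ (fun q => ∑ i ∈ s, f i q * r i) where
  map_add u v := by
    rw [← Finset.sum_add_distrib]
    exact Finset.sum_congr rfl fun i hi => by rw [(h i hi).map_add]; ring
  map_smul a u := by
    rw [Finset.smul_sum]
    exact Finset.sum_congr rfl fun i hi => by rw [(h i hi).map_smul]; simp [mul_assoc]

lemma lev_sum {α : Type*} (s : Finset α) (f : α → Chart n → ℂ) (r : α → ℂ) :
    lev p w (fun q => ∑ i ∈ s, f i q * r i) = ∑ i ∈ s, r i • lev p w (f i) := by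
  have : (fun q => ∑ i ∈ s, f i q * r i) = ∑ i ∈ s, r i • f i := by
    funext q; simp [mul_comm]
  rw [this, map_sum]
  simp only [map_smul]

lemma IsLinearMap.add' {f g : Chart n → ℂ} (hf : IsLinearMap ℂ f) (hg : IsLinearMap ℂ g) :
    IsLinearMap ℂ (fun q => f q + g q) :=
  ⟨fun u v => by rw [hf.map_add, hg.map_add]; ring,
    fun r u => by rw [hf.map_smul, hg.map_smul, smul_add]⟩

lemma IsLinearMap.mul_const {f : Chart n → ℂ} (hf : IsLinearMap ℂ f) (r : ℂ) :
    IsLinearMap ℂ (fun q => f q * r) :=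
  ⟨fun u v => by rw [hf.map_add]; ring, fun a u => by rw [hf.map_smul]; simp [mul_assoc]⟩

end Lin

/-! ### Jets of the Fock–Goncharov matrices -/

/-- `diag (1, -1, …)`. -/
def sigU (n : ℕ) : (Matrix (Fin n) (Fin n) ℂ)ˣ where
  val := sigmaMat n
  inv := sigmaMat n
  val_inv := by rw [sigmaMat, diagonal_mul_diagonal]; simp [← mul_pow]
  inv_val := by rw [sigmaMat, diagonal_mul_diagonal]; simp [← mul_pow]

lemma sigU_mul_sigU (n : ℕ) : sigU n * sigU n = 1 := Units.ext (sigU n).mul_inv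

lemma flipMat_eq (m : ℕ) :
    flipMat (m + 1) = ((wu m * sigU (m + 1) : (Matrix (Fin (m + 1)) (Fin (m + 1)) ℂ)ˣ) : Matrix _ _ ℂ) := by
  ext a b
  rw [Units.val_mul]
  change _ = ((wu m : Matrix (Fin (m + 1)) (Fin (m + 1)) ℂ)
    * (diagonal fun j : Fin (m + 1) => (-1 : ℂ) ^ (j : ℕ))) a b
  rw [mul_diagonal]
  simp only [flipMat, wu, of_apply]
  split_ifs <;> simp [← mul_pow]

lemma Fmat_eq (n i : ℕ) (hi : 0 < i) : Fmat n i = (fu n (i - 1) : Matrix (Fin n) (Fin n) ℂ) := by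
  rw [fu, root_val, Fmat]
  congr 1
  ext a b
  simp only [of_apply, Matrix.smul_apply, elm_apply, smul_eq_mul, one_mul]
  congr 1
  simp only [eq_iff_iff]; omega

/-- The jet of a Fock–Goncharov matrix. -/
def AJ (m : ℕ) (e : ℕ → ℕ → ℕ → LogJet) : Jet (Fin (m + 1)) :=
  scal (m + 1) (tsm (m + 1) fun a b c => ((m : ℂ) + 1 - a) • e a b c) *
    (kap (sigU (m + 1)) * (Lw m (m + 1) 0 (fun a b c => ((m : ℂ) + 1) • e a b c) * kap (wu m))
      * kap (sigU (m + 1)))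

section FG

variable {n : ℕ} {p : Chart n} {w : Fin 2 → Chart n}

lemma listProd_range' {G : Type*} [Group G] (f : ℕ → G) (s L : ℕ) :
    ((List.range' s L).map f).prod = prodUp (fun j => f (s + j)) L := by
  induction L with
  | zero => simp
  | succ L ih => rw [List.range'_concat, List.map_append, List.prod_append, ih, prodUp_succ]; simp

lemma listProd_range'_reverse {G : Type*} [Group G] (f : ℕ → G) (s L : ℕ) :
    ((List.range' s L).reverse.map f).prod = prodDn (fun j => f (s + j)) L := by
  induction L with
  | zero => simp
  | succ L ih => rw [List.range'_concat, List.reverse_append, List.map_append, List.prod_append,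
      ih, prodDn_succ]; simp

/-- h_i is n = m + 1 times the projection on the first i places, minus the scalar i. Letters
therefore see (m + 1)ξ, and the scalars are collected separately. -/
lemma tor_hvec (m i : ℕ) (X : LogJet) :
    tor (fun j : Fin (m + 1) => -(hvec (m + 1) i j) • X)
      = scal (m + 1) ((i : ℂ) • X) * tor (low (m + 1) i (-(((m : ℂ) + 1) • X))) := by
  rw [scal, ← tor_add]
  congr 1
  funext j
  simp only [hvec, low, Pi.add_apply]
  split_ifs
  · push_cast; module
  · module

/-- The closing F_{n-1}, which has no coordinate, is the letter with a = 0, where the coordinate is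
zero by convention; N_k becomes a uniform product of letters. -/
lemma HasJet.Nmat {m : ℕ} {x : ℕ → ℕ → ℕ → Chart n → ℂ} (hx : ∀ a b c, IsLinearMap ℂ (x a b c))
    (h0 : ∀ b c, x 0 b c = 0) (k : ℕ) (hk : k < m) :
    HasJet p w (fun q => FrobeniusStokes.Nmat (m + 1) (fun a b c => x a b c q) (1 + k))
      (scal (m + 1) (∑ j ∈ Finset.range (m - k),
          ((k + j + 2 : ℕ) : ℂ) • lev p w (x (m - 1 - k - j) (j + 1) (k + 1)))
        * Nk m (m + 1) 0 (fun a b c => ((m : ℂ) + 1) • lev p w (x a b c)) k) := by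
  have hl := HasJet.listProd (p := p) (w := w) (List.range' (1 + k) (m + 1 - 1 - (1 + k)))
    (f := fun i q => diagonal (fun j => exp (-(x (m + 1 - i - 1) (i - (1 + k) + 1) (1 + k) q
      * hvec (m + 1) (i + 1) j))) * Fmat (m + 1) i)
    (g := fun i => scal (m + 1) (((i + 1 : ℕ) : ℂ) • lev p w (x (m + 1 - i - 1) (i - (1 + k) + 1) (1 + k)))
      * letter (m + 1) (i - 1)
        (((m : ℂ) + 1) • lev p w (x (m + 1 - i - 1) (i - (1 + k) + 1) (1 + k)))) (by
    intro i hi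
    rw [List.mem_range'_1] at hi
    set f := x (m + 1 - i - 1) (i - (1 + k) + 1) (1 + k)
    have hf : IsLinearMap ℂ f := hx _ _ _
    rw [letter, ← mul_assoc, show i - 1 + 2 = i + 1 by omega, ← tor_hvec m (i + 1)]
    have e : (fun j : Fin (m + 1) => -(hvec (m + 1) (i + 1) j) • lev p w f)
        = fun j => ev p w (fun q => -(f q * hvec (m + 1) (i + 1) j)) := by
      funext j
      have hl : (fun q => -(f q * hvec (m + 1) (i + 1) j)) = -(hvec (m + 1) (i + 1) j) • f := by
        funext q; simp [mul_comm]
      rw [hl, ev_eq_lev, map_smul]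
      exact ⟨fun u v => by simp [hf.map_add]; ring, fun a u => by simp [hf.map_smul]; ring⟩
    rw [e]
    refine (HasJet.tor fun j => ?_).mul ((HasJet.kap (fu (m + 1) (i - 1))).congr ?_)
    · exact (IsLinearMap.diff (IsLinearMap.mul_const hf _)).neg
    · funext q; exact (Fmat_eq _ _ (by omega)).symm)
  have hF : HasJet p w (fun _ : Chart n => Fmat (m + 1) (m + 1 - 1)) (Jet.kap (fu (m + 1) (m - 1))) :=
    (HasJet.kap _).congr (funext fun q => (Fmat_eq _ _ (by omega)).symm)
  have h := hl.mul hF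
  refine cast (congrArg (HasJet p w _) ?_) h
  symm
  rw [listProd_range', ← prodUp_scal, Nk, ← prodUp_mul _ _ _ fun _ _ _ _ => (scal_comm _ _).symm,
    show m - k = m + 1 - 1 - (1 + k) + 1 by omega, prodUp_succ]
  congr 1
  · refine prodUp_congr fun j hj => ?_
    simp only [show m + 1 - (1 + k + j) - 1 = m - 1 - k - j by omega,
      show 1 + k + j - (1 + k) + 1 = j + 1 by omega, show 1 + k + j - 1 = 0 + k + j by omega,
      show 1 + k + j + 1 = k + j + 2 by omega]
    rw [add_comm 1 k]
  · simp only [show m - 1 - k - (m + 1 - 1 - (1 + k)) = 0 by omega, h0, map_zero, smul_zero,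
      scal_zero, one_mul, letter, neg_zero, show 0 + k + (m + 1 - 1 - (1 + k)) = m - 1 by omega]
    have : low (m + 1) (m - 1 + 2) 0 = 0 := by funext j; simp [low]
    rw [this, tor_zero, one_mul]

lemma HasJet.fockGoncharov {m : ℕ} {x : ℕ → ℕ → ℕ → Chart n → ℂ}
    (hx : ∀ a b c, IsLinearMap ℂ (x a b c)) (h0 : ∀ b c, x 0 b c = 0) :
    HasJet p w (fun q => FrobeniusStokes.fockGoncharov (m + 1) (fun a b c => x a b c q))
      (AJ m fun a b c => lev p w (x a b c)) := by
  have hl := HasJet.listProd (p := p) (w := w) (List.range' 1 (m + 1 - 1)).reverse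
    (f := fun k q => FrobeniusStokes.Nmat (m + 1) (fun a b c => x a b c q) k)
    (g := fun k => scal (m + 1) (∑ j ∈ Finset.range (m - (k - 1)),
          ((k - 1 + j + 2 : ℕ) : ℂ) • lev p w (x (m - 1 - (k - 1) - j) (j + 1) (k - 1 + 1)))
        * Nk m (m + 1) 0 (fun a b c => ((m : ℂ) + 1) • lev p w (x a b c)) (k - 1)) (by
    intro k hk
    rw [List.mem_reverse, List.mem_range'_1] at hk
    have := HasJet.Nmat (p := p) (w := w) hx h0 (k - 1) (m := m) (by omega)
    rwa [show 1 + (k - 1) = k by omega] at this)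
  have h := ((HasJet.kap (sigU (m + 1))).mul hl).mul ((HasJet.kap (wu m * sigU (m + 1))).congr
    (funext fun q : Chart n => (flipMat_eq m).symm))
  have e : AJ m (fun a b c => lev p w (x a b c)) = Jet.kap (sigU (m + 1)) *
      ((List.range' 1 (m + 1 - 1)).reverse.map fun k => scal (m + 1)
        (∑ j ∈ Finset.range (m - (k - 1)), ((k - 1 + j + 2 : ℕ) : ℂ) •
          lev p w (x (m - 1 - (k - 1) - j) (j + 1) (k - 1 + 1)))
        * Nk m (m + 1) 0 (fun a b c => ((m : ℂ) + 1) • lev p w (x a b c)) (k - 1)).prod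
      * Jet.kap (wu m * sigU (m + 1)) := by
    rw [listProd_range'_reverse, AJ, map_mul,
      prodDn_mul _ _ _ fun _ _ _ _ => (scal_comm _ _).symm]
    have e1 : tsm (m + 1) (fun a b c => ((m : ℂ) + 1 - a) • lev p w (x a b c))
        = ∑ k ∈ Finset.range (m + 1 - 1), ∑ j ∈ Finset.range (m - (1 + k - 1)),
          ((1 + k - 1 + j + 2 : ℕ) : ℂ) •
            lev p w (x (m - 1 - (1 + k - 1) - j) (j + 1) (1 + k - 1 + 1)) := by
      rw [tsm_eq m _ fun b c => by rw [h0]; simp]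
      refine Finset.sum_congr rfl fun k hk => ?_
      rw [Nat.add_sub_cancel_left]
      refine Finset.sum_congr rfl fun j hj => ?_
      rw [Finset.mem_range] at hk hj
      congr 1
      rw [show m - 1 - k - j = m - (k + j + 1) by omega, Nat.cast_sub (by omega)]
      push_cast; ring
    have e2 : prodDn (fun k => Nk m (m + 1) 0 (fun a b c => ((m : ℂ) + 1) • lev p w (x a b c))
        (1 + k - 1)) (m + 1 - 1) = Lw m (m + 1) 0 (fun a b c => ((m : ℂ) + 1) • lev p w (x a b c)) := by
      simp only [Nat.add_sub_cancel_left, Nat.add_sub_cancel]; rfl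
    rw [prodDn_scal, ← e1, e2, ← mul_assoc (Jet.kap _) (scal _ _), ← scal_comm]
    simp only [mul_assoc]
  rw [e]
  exact h

end FG

end

section

open Jet Ext

/-! ### Triangular jets with their diagonal -/

section DT

variable {ι : Type*} [Fintype ι] [DecidableEq ι] {α β : Type*} [LinearOrder α] [LinearOrder β]

/-- A triangular jet with diagonal `e^ℓ`. -/
structure DT (b : ι → α) (x : Jet ι) (l : ι → LogJet) : Prop where
  tri : x ∈ Tri b
  dm : ∀ i, x.m i i = exp (l i).1
  da : ∀ k i, x.a k i i = (l i).2 k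

variable {b : ι → α} {x y : Jet ι} {l l' : ι → LogJet}

lemma DT.one : DT b (1 : Jet ι) 0 := ⟨one_mem _, by simp, by simp⟩

lemma DT.mul (hb : Function.Injective b) (h : DT b x l) (h' : DT b y l') : DT b (x * y) (l + l') where
  tri := mul_mem h.tri h'.tri
  dm i := by
    rw [mul_m, BlockTriangular.mul_diag hb h.tri.1 h'.tri.1, h.dm, h'.dm, ← Complex.exp_add]; rfl
  da k i := by rw [tri_mul_a_diag hb h.tri h'.tri, h.da, h'.da]; rfl

lemma DT.inv (hb : Function.Injective b) (h : DT b x l) : DT b x⁻¹ (-l) where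
  tri := inv_mem h.tri
  dm i := by
    have h1 := BlockTriangular.mul_diag hb h.tri.1 h.tri.2.1 i
    rw [m_mul_gi, one_apply_eq, h.dm] at h1
    rw [inv_m, Pi.neg_apply, Prod.fst_neg, Complex.exp_neg]
    exact eq_inv_of_mul_eq_one_right h1.symm
  da k i := by
    have h1 := tri_mul_a_diag hb h.tri (inv_mem h.tri) k i
    rw [mul_inv_cancel, one_a, Matrix.zero_apply, h.da] at h1
    exact (neg_eq_of_add_eq_zero_right h1.symm).symm

lemma DT.tor (l : ι → LogJet) : DT b (tor l) l := ⟨tor_mem_tri b l, by simp, by simp⟩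

lemma DT.prodUp (hb : Function.Injective b) {f : ℕ → Jet ι} {l : ℕ → ι → LogJet} {m : ℕ}
    (h : ∀ i < m, DT b (f i) (l i)) :
    DT b (FrobeniusStokes.prodUp f m) (∑ i ∈ Finset.range m, l i) := by
  induction m with
  | zero => exact DT.one
  | succ m ih =>
    rw [Finset.sum_range_succ]; exact (ih fun i hi => h i (by omega)).mul hb (h m (by omega))

lemma DT.prodDn (hb : Function.Injective b) {f : ℕ → Jet ι} {l : ℕ → ι → LogJet} {m : ℕ}
    (h : ∀ i < m, DT b (f i) (l i)) :
    DT b (FrobeniusStokes.prodDn f m) (∑ i ∈ Finset.range m, l i) := by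
  induction m with
  | zero => exact DT.one
  | succ m ih =>
    rw [Finset.sum_range_succ, add_comm _ (l m)]
    exact (h m (by omega)).mul hb (ih fun i hi => h i (by omega))

/-- Meant for signed permutations: entries are permuted by f up to signs that are trivial on the
diagonal, and f translates the order b' into b. The antidiagonal exchanges upper and lower, σ
preserves both. -/
lemma DT.conj {b' : ι → β} (h : DT b x l) {u : (Matrix ι ι ℂ)ˣ} {f : ι → ι} {s : ι → ι → ℂ}
    (hu : ∀ M : Matrix ι ι ℂ, ∀ i j, ((u : Matrix ι ι ℂ) * M * (u⁻¹ : (Matrix ι ι ℂ)ˣ)) i j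
      = s i j * M (f i) (f j)) (hs : ∀ i, s i i = 1)
    (hf : ∀ i j, b' j < b' i → b (f j) < b (f i)) :
    DT b' (kap u * x * (kap u)⁻¹) (fun i => l (f i)) := by
  have ea : ∀ k, (kap u * x * (kap u)⁻¹).a k = (u : Matrix ι ι ℂ) * x.a k * (u⁻¹ : (Matrix ι ι ℂ)ˣ) := by
    intro k
    rw [← map_inv, mul_a, mul_a, kap_a, kap_a, kap_gi, kap_m, inv_inv]
    simp
  have em : (kap u * x * (kap u)⁻¹).m = (u : Matrix ι ι ℂ) * x.m * (u⁻¹ : (Matrix ι ι ℂ)ˣ) := rfl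
  have eg : (kap u * x * (kap u)⁻¹).gi = (u : Matrix ι ι ℂ) * x.gi * (u⁻¹ : (Matrix ι ι ℂ)ˣ) := by
    rw [mul_gi, mul_gi, inv_gi, kap_m, kap_gi, mul_assoc]
  refine ⟨⟨fun i j hij => ?_, fun i j hij => ?_, fun k i j hij => ?_⟩, fun i => ?_, fun k i => ?_⟩
  · rw [em, hu, h.tri.1 (hf _ _ hij), mul_zero]
  · rw [eg, hu, h.tri.2.1 (hf _ _ hij), mul_zero]
  · rw [ea, hu, h.tri.2.2 k (hf _ _ hij), mul_zero]
  · rw [em, hu, hs, one_mul, h.dm]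
  · rw [ea, hu, hs, one_mul, h.da]

end DT

section DTFin

variable {n : ℕ} {x y : Jet (Fin n)} {l l' : Fin n → LogJet}

/-- Upper triangular jets. -/
abbrev UT (x : Jet (Fin n)) (l : Fin n → LogJet) : Prop := DT (id : Fin n → Fin n) x l

/-- Lower triangular jets. -/
abbrev LT (x : Jet (Fin n)) (l : Fin n → LogJet) : Prop :=
  DT (OrderDual.toDual : Fin n → (Fin n)ᵒᵈ) x l

lemma LT.mul (h : LT x l) (h' : LT y l') : LT (x * y) (l + l') := DT.mul (toDual_inj n) h h'

lemma DT.c_eq {α : Type*} [LinearOrder α] {b : Fin n → α} (hb : Function.Injective b)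
    (h : DT b x l) (h' : DT b y l') : c x y = brv l l' := by
  rw [c_tri hb h.tri h'.tri]
  simp only [brv, br, dg, h.da, h'.da]

lemma LT.tinv (h : LT x l) : UT (Jet.tinv x) (-l) where
  tri := by
    refine ⟨fun i j hij => ?_, fun i j hij => ?_, fun k i j hij => ?_⟩
    · exact h.tri.2.1 (show OrderDual.toDual i < OrderDual.toDual j from hij)
    · exact h.tri.1 (show OrderDual.toDual i < OrderDual.toDual j from hij)
    · rw [tinv_a, Matrix.neg_apply, Matrix.transpose_apply,
        h.tri.2.2 k (show OrderDual.toDual i < OrderDual.toDual j from hij), neg_zero]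
  dm i := (DT.inv (toDual_inj n) h).dm i
  da k i := by rw [tinv_a, Matrix.neg_apply, Matrix.transpose_apply, h.da]; rfl

lemma wu_conj_apply {m : ℕ} (M : Matrix (Fin (m + 1)) (Fin (m + 1)) ℂ) (i j : Fin (m + 1)) :
    ((wu m : Matrix (Fin (m + 1)) (Fin (m + 1)) ℂ) * M
      * ((wu m)⁻¹ : (Matrix (Fin (m + 1)) (Fin (m + 1)) ℂ)ˣ)) i j
      = (-1 : ℂ) ^ ((Fin.rev i : ℕ) + (Fin.rev j : ℕ)) * M (Fin.rev i) (Fin.rev j) := by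
  rw [Matrix.mul_apply, Finset.sum_eq_single (Fin.rev j)]
  · rw [Matrix.mul_apply, Finset.sum_eq_single (Fin.rev i)]
    · change (if Fin.rev i = Fin.rev i then (-1 : ℂ) ^ (Fin.rev i : ℕ) else 0) * _
        * (if j = Fin.rev (Fin.rev j) then (-1 : ℂ) ^ (Fin.rev j : ℕ) else 0) = _
      rw [if_pos rfl, if_pos (Fin.rev_rev j).symm, pow_add]; ring
    · intro k _ hk
      change (if k = Fin.rev i then _ else _) * _ = _
      rw [if_neg hk, zero_mul]
    · simp
  · intro k _ hk
    change _ * (if j = Fin.rev k then _ else _) = _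
    rw [if_neg fun h => hk (by rw [h, Fin.rev_rev]), mul_zero]
  · simp

lemma LT.wconj {m : ℕ} {x : Jet (Fin (m + 1))} {l : Fin (m + 1) → LogJet} (h : LT x l) :
    UT (kap (wu m) * x * (kap (wu m))⁻¹) (fun i => l (Fin.rev i)) :=
  DT.conj h wu_conj_apply (fun i => by rw [← two_mul, pow_mul]; simp) fun i j hij => by
    change Fin.rev i < Fin.rev j; exact Fin.rev_lt_rev.2 hij

lemma UT.wconj {m : ℕ} {x : Jet (Fin (m + 1))} {l : Fin (m + 1) → LogJet} (h : UT x l) :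
    LT (kap (wu m) * x * (kap (wu m))⁻¹) (fun i => l (Fin.rev i)) :=
  DT.conj h wu_conj_apply (fun i => by rw [← two_mul, pow_mul]; simp) fun i j hij => by
    change Fin.rev j < Fin.rev i; exact Fin.rev_lt_rev.2 hij

lemma sigU_conj_apply (M : Matrix (Fin n) (Fin n) ℂ) (i j : Fin n) :
    ((sigU n : Matrix (Fin n) (Fin n) ℂ) * M * ((sigU n)⁻¹ : (Matrix (Fin n) (Fin n) ℂ)ˣ)) i j
      = (-1 : ℂ) ^ ((i : ℕ) + (j : ℕ)) * M i j := by
  change (sigmaMat n * M * sigmaMat n) i j = _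
  rw [sigmaMat, mul_diagonal, diagonal_mul, pow_add]; ring

lemma DT.sconj {α : Type*} [LinearOrder α] {b : Fin n → α} (h : DT b x l) :
    DT b (kap (sigU n) * x * (kap (sigU n))⁻¹) l :=
  DT.conj (f := id) h sigU_conj_apply (fun i => by rw [← two_mul, pow_mul]; simp) fun _ _ h => h

lemma LT.letter (i : ℕ) (v : LogJet) : LT (FrobeniusStokes.letter n i v) (low n (i + 2) (-v)) := by
  have h : LT (kap (fu n i)) 0 := by
    refine ⟨fu_mem n i, fun a => ?_, by simp⟩
    have : ¬ ((a : ℕ) = i + 1 ∧ (a : ℕ) = i) := by omega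
    simp [fu, elm_apply, this]
  rw [FrobeniusStokes.letter]
  simpa using LT.mul (DT.tor (low n (i + 2) (-v))) h

lemma LT.Lw (m n s : ℕ) {y : ℕ → ℕ → ℕ → LogJet} (hy : Bd y) :
    LT (FrobeniusStokes.Lw m n s y)
      (-tsm (m + 1) fun a b c => low n (s + (m + 1 - a)) (y a b c)) := by
  have h0 : ∀ i : ℕ, low n i 0 = 0 := fun i => by funext j; simp [low]
  have hn : ∀ (i : ℕ) (v : LogJet), low n i (-v) = -low n i v := fun i v => by
    funext j; simp only [low, Pi.neg_apply]; split_ifs <;> simp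
  have e : (-tsm (m + 1) fun a b c => low n (s + (m + 1 - a)) (y a b c))
      = ∑ k ∈ Finset.range m, ∑ j ∈ Finset.range (m - k),
        low n (s + k + j + 2) (-(y (m - 1 - k - j) (j + 1) (k + 1))) := by
    rw [tsm_eq m _ fun b c => by rw [(hy b c).1, h0], ← Finset.sum_neg_distrib]
    refine Finset.sum_congr rfl fun k hk => ?_
    rw [← Finset.sum_neg_distrib]
    refine Finset.sum_congr rfl fun j hj => ?_
    rw [Finset.mem_range] at hk hj
    rw [hn, show s + k + j + 2 = s + (m + 1 - (m - 1 - k - j)) by omega]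
  rw [e]
  exact DT.prodDn (toDual_inj n) fun k _ => DT.prodUp (toDual_inj n) fun j _ => LT.letter _ _

end DTFin

/-! ### The factors of the Fock–Goncharov matrices -/

/-- The lower triangular factor of a Fock–Goncharov matrix. -/
def BJ (m : ℕ) (e : ℕ → ℕ → ℕ → LogJet) : Jet (Fin (m + 1)) :=
  scal (m + 1) (tsm (m + 1) fun a b c => ((m : ℂ) + 1 - a) • e a b c) *
    Lw m (m + 1) 0 (fun a b c => ((m : ℂ) + 1) • e a b c)

lemma AJ_eq (m : ℕ) (e : ℕ → ℕ → ℕ → LogJet) :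
    AJ m e = kap (sigU (m + 1)) * BJ m e * kap (wu m) * kap (sigU (m + 1)) := by
  rw [AJ, BJ, ← mul_assoc (kap (sigU (m + 1))) (scal _ _), ← scal_comm]
  simp only [mul_assoc]

lemma Bd.smul {e : ℕ → ℕ → ℕ → LogJet} (h : Bd e) (r : ℂ) : Bd (fun a b c => r • e a b c) :=
  fun a b => ⟨by simp [(h a b).1], by simp [(h a b).2.1], by simp [(h a b).2.2]⟩

/-- The logarithm of the diagonal of the lower triangular factor. -/
def bdiag (m : ℕ) (e : ℕ → ℕ → ℕ → LogJet) (j : Fin (m + 1)) : LogJet :=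
  tsm (m + 1) fun a b c => dstar (hvec (m + 1) a) j • e a b c

/-- The scalar n - a and the weight -n on the first n - a places combine to h_a^⋆. -/
lemma LT.BJ (m : ℕ) {e : ℕ → ℕ → ℕ → LogJet} (he : Bd e) :
    LT (FrobeniusStokes.BJ m e) (bdiag m e) := by
  have h := LT.mul (DT.tor fun _ => tsm (m + 1) fun a b c => ((m : ℂ) + 1 - a) • e a b c)
    (LT.Lw m (m + 1) 0 (he.smul ((m : ℂ) + 1)))
  convert h using 1
  · rfl
  funext j
  rw [Pi.add_apply, Pi.neg_apply, ← sub_eq_add_neg, bdiag, tsm, tsm, tsm, Finset.sum_apply,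
    ← Finset.sum_sub_distrib]
  refine Finset.sum_congr rfl ?_
  rintro ⟨a, b, c⟩ ht
  have := mem_triples.1 ht
  simp only [dstar, hvec, low, Fin.val_rev]
  by_cases hj : (j : ℕ) < 0 + (m + 1 - a)
  · rw [if_pos hj, if_neg (by omega)]; module
  · rw [if_neg hj, if_pos (by omega)]; push_cast; module

lemma brv_add_left {n : ℕ} (u u' v : Fin n → LogJet) : brv (u + u') v = brv u v + brv u' v := by
  simp [brv, Finset.sum_add_distrib]

lemma brv_add_right {n : ℕ} (u u' v : Fin n → LogJet) : brv v (u + u') = brv v u + brv v u' := by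
  simp [brv, Finset.sum_add_distrib]

lemma brv_neg_left {n : ℕ} (u v : Fin n → LogJet) : brv (-u) v = -brv u v := by
  simp [brv]

lemma brv_neg_right {n : ℕ} (u v : Fin n → LogJet) : brv u (-v) = -brv u v := by
  simp [brv]

lemma brv_self {n : ℕ} (u : Fin n → LogJet) : brv u u = 0 := by simp [brv, br_self]

lemma brv_rev {n : ℕ} (u v : Fin n → LogJet) :
    brv (fun i => u (Fin.rev i)) (fun i => v (Fin.rev i)) = brv u v :=
  Fintype.sum_equiv Fin.revPerm _ _ fun _ => rfl

/-- Ext words with triangular factors. -/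
structure DE {α : Type*} [LinearOrder α] {n : ℕ} (b : Fin n → α) (X : Ext (Fin n))
    (l : Fin n → LogJet) (s : ℂ) : Prop where
  j : DT b X.j l
  s : X.s = s

lemma DT.io {α : Type*} [LinearOrder α] {n : ℕ} {b : Fin n → α} {x : Jet (Fin n)}
    {l : Fin n → LogJet} (h : DT b x l) : DE b (io x) l 0 := ⟨h, rfl⟩

lemma DE.mul {α : Type*} [LinearOrder α] {n : ℕ} {b : Fin n → α} (hb : Function.Injective b)
    {X Y : Ext (Fin n)} {l l' : Fin n → LogJet} {s s' : ℂ} (h : DE b X l s) (h' : DE b Y l' s') :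
    DE b (X * Y) (l + l') (s + s' + brv l l') :=
  ⟨h.j.mul hb h'.j, by rw [mul_s, h.s, h'.s, DT.c_eq hb h.j h'.j]⟩

end

section

open Jet Ext

/-! ### The relation between the three Fock–Goncharov matrices -/

/-- The scalar factor of a Fock–Goncharov matrix. -/
def ssum (m : ℕ) (e : ℕ → ℕ → ℕ → LogJet) : LogJet := tsm (m + 1) fun a b c => ((m : ℂ) + 1 - a) • e a b c

/-- The central value of the product of the three matrices. -/
def phi (m : ℕ) (e : ℕ → ℕ → ℕ → LogJet) : ℂ :=
  theta m (fun a b c => ((m : ℂ) + 1) • e a b c)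
    - ((m : ℂ) + 1) * (br (ssum m e) (ssum m (cy e)) + br (ssum m e) (ssum m (cy (cy e)))
      + br (ssum m (cy e)) (ssum m (cy (cy e))))

lemma trdg_conj_AJ (m : ℕ) {e : ℕ → ℕ → ℕ → LogJet} (he : Bd e) (v : LogJet) :
    br v (trdg (kap (sigU (m + 1)) * (Lw m (m + 1) 0 (fun a b c => ((m : ℂ) + 1) • e a b c)
      * kap (wu m)) * kap (sigU (m + 1)))) = -((m : ℂ) + 1) * br v (ssum m e) := by
  have h0 : ∀ (x y : Jet (Fin (m + 1))) (u : (Matrix (Fin (m + 1)) (Fin (m + 1)) ℂ)ˣ),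
      trdg (x * kap u) = trdg x := fun x _ u => by
    rw [show x * kap u = kap u⁻¹ * (kap u * x) * (kap u⁻¹)⁻¹ by simp, trdg_conj]
    simp only [trdg, dg, mul_a, kap_a, mul_zero, zero_mul, zero_add]
  have h1 : ∀ (x : Jet (Fin (m + 1))) (u : (Matrix (Fin (m + 1)) (Fin (m + 1)) ℂ)ˣ),
      trdg (kap u * x) = trdg x := fun x u => by
    simp only [trdg, dg, mul_a, kap_a, mul_zero, zero_mul, zero_add]
  rw [h0 _ 1, h1, h0 _ 1, br_trdg_Lw m (he.smul _), ssum, tsm, tsm, br_sum_right, Finset.mul_sum,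
    ← Finset.sum_neg_distrib]
  refine Finset.sum_congr rfl fun t _ => ?_
  rw [br_smul_right, br_smul_right]; ring

lemma fg_group {G : Type*} [Group G] {a1 a2 a3 g1 g2 g3 z21 z31 z32 : G} (h1 : ∀ x, z21 * x = x * z21)
    (h2 : ∀ x, z31 * x = x * z31) (h3 : ∀ x, z32 * x = x * z32) (h12 : g1 * a2 = a2 * g1 * z21)
    (h13 : g1 * a3 = a3 * g1 * z31) (h23 : g2 * a3 = a3 * g2 * z32) :
    (a1 * g1) * (a2 * g2) * (a3 * g3) = a1 * a2 * a3 * (g1 * g2 * g3) * (z21 * z31 * z32) := by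
  calc _ = a1 * (g1 * a2) * g2 * a3 * g3 := by simp only [mul_assoc]
    _ = a1 * a2 * g1 * (g2 * a3) * g3 * z21 := by rw [h12]; simp only [mul_assoc, move_central h1, h1 g3]
    _ = a1 * a2 * (g1 * a3) * g2 * g3 * z21 * z32 := by
        rw [h23]; simp only [mul_assoc, move_central h3, h3 z21]
    _ = _ := by rw [h13]; simp only [mul_assoc, move_central h2, h2 z32]

/-- The relation `A₁ A₂ A₃ = 1` in the central extension. -/
theorem fg_relation (m : ℕ) {e : ℕ → ℕ → ℕ → LogJet} (he : Bd e) :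
    io (AJ m e) * io (AJ m (cy e)) * io (AJ m (cy (cy e))) = z (phi m e) := by
  set G : (ℕ → ℕ → ℕ → LogJet) → Jet (Fin (m + 1)) := fun e =>
    kap (sigU (m + 1)) * (Lw m (m + 1) 0 (fun a b c => ((m : ℂ) + 1) • e a b c)
      * kap (wu m)) * kap (sigU (m + 1)) with hG
  have hA : ∀ {e}, Bd e → io (AJ m e) = io (scal (m + 1) (ssum m e)) * io (G e) := fun {e} he => by
    rw [show AJ m e = scal (m + 1) (ssum m e) * G e from rfl, io_mul, c_scal_left,
      trdg_conj_AJ m he, br_self, mul_zero, neg_zero, z_zero, mul_one]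
  have hc : ∀ {e}, Bd e → ∀ v, io (G e) * io (scal (m + 1) v)
      = io (scal (m + 1) v) * io (G e) * z (2 * ((m : ℂ) + 1) * br v (ssum m e)) := fun {e} he v => by
    rw [io_scal_comm, trdg_conj_AJ m he, mul_assoc, ← z_add]
    rw [show 2 * (-((m : ℂ) + 1) * br v (ssum m e)) + 2 * ((m : ℂ) + 1) * br v (ssum m e) = 0 by ring,
      z_zero, mul_one]
  have hGw : io (G e) * io (G (cy e)) * io (G (cy (cy e)))
      = io (kap (sigU (m + 1))) * wordE m (fun a b c => ((m : ℂ) + 1) • e a b c)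
        * io (kap (sigU (m + 1))) := by
    have hs : io (kap (sigU (m + 1))) * io (kap (sigU (m + 1))) = 1 := by
      rw [← io_mul_kap, ← map_mul, sigU_mul_sigU]; simp
    have hGi : ∀ e, io (G e) = io (kap (sigU (m + 1)))
        * (io (Lw m (m + 1) 0 (fun a b c => ((m : ℂ) + 1) • e a b c)) * io (kap (wu m)))
        * io (kap (sigU (m + 1))) := fun e => by rw [hG, io_mul_kap, io_kap_mul, io_mul_kap]
    have key : ∀ {K x y w : Ext (Fin (m + 1))}, K * K = 1 →
        K * x * K * (K * y * K) * (K * w * K) = K * (x * y * w) * K := fun {K x y w} h => by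
      have h2 : ∀ v, K * (K * v) = v := fun v => by rw [← mul_assoc, h, one_mul]
      simp only [mul_assoc, h2]
    rw [hGi, hGi, hGi, key hs, wordE]
    simp only [mul_assoc]
    rfl
  have hs : io (kap (sigU (m + 1))) * io (kap (sigU (m + 1))) = 1 := by
    rw [← io_mul_kap, ← map_mul, sigU_mul_sigU]; simp
  rw [word_relation m _ (he.smul _), mul_assoc (io (kap _)), ← z_comm, mul_assoc (z _),
    ← io_mul_kap, scal_comm, io_kap_mul, z_comm, ← mul_assoc, ← mul_assoc, hs, one_mul] at hGw
  set s1 := ssum m e with h1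
  set s2 := ssum m (cy e) with h2
  set s3 := ssum m (cy (cy e)) with h3
  rw [hA he, hA he.cy, hA he.cy.cy]
  rw [← h1, ← h2, ← h3]
  have hsc : ∀ v w, io (scal (m + 1) v) * io (scal (m + 1) w)
      = io (scal (m + 1) (v + w)) * z (((m : ℂ) + 1) * br v w) := fun v w => by
    rw [io_mul_io, c_scal_left, br_trdg_scal, scal_add]; push_cast; rfl
  -- Since (n - a) + (n - b) + (n - c) = 2n, the scalars of the three matrices cancel the scalar of
  -- the word.
  have hsum : s1 + s2 + s3 + -(2 : ℂ) • tsm (m + 1) (fun a b c => ((m : ℂ) + 1) • e a b c) = 0 := by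
    have e2 : s2 = tsm (m + 1) fun a b c => ((m : ℂ) + 1 - b) • e a b c :=
      tsm_cyc (m + 1) fun a b c => ((m : ℂ) + 1 - b) • e a b c
    have e3 : s3 = tsm (m + 1) fun a b c => ((m : ℂ) + 1 - c) • e a b c := by
      rw [← tsm_cyc, ← tsm_cyc (m + 1)]; rfl
    rw [e2, e3, h1, ssum, tsm, tsm, tsm, tsm, Finset.smul_sum, ← Finset.sum_add_distrib,
      ← Finset.sum_add_distrib, ← Finset.sum_add_distrib]
    refine Finset.sum_eq_zero ?_
    rintro ⟨a, b, c⟩ ht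
    have h := (mem_triples.1 ht).2.2.2
    have h' : (a : ℂ) + b + c = m + 1 := by exact_mod_cast h
    dsimp only
    rw [smul_smul, ← add_smul, ← add_smul, ← add_smul,
      show (m : ℂ) + 1 - a + (m + 1 - b) + (m + 1 - c) + -2 * (m + 1) = 0 by
        linear_combination -h', zero_smul]
  rw [fg_group (z_comm _) (z_comm _) (z_comm _) (hc he s2) (hc he s3) (hc he.cy s3), hGw, ← h1, ← h2]
  have e4 : -(2 : ℂ) • tsm (m + 1) (fun a b c => ((m : ℂ) + 1) • e a b c) = -(s1 + s2 + s3) :=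
    (neg_eq_of_add_eq_zero_right hsum).symm
  rw [e4]
  refine Ext.ext ?_ ?_
  · simp only [mul_j, io_j, z_j, mul_one, ← scal_add, add_neg_cancel, scal_zero]
  · simp only [mul_s, mul_j, io_j, io_s, z_j, z_s, mul_one, c_one_right, ← scal_add, c_scal_left,
      br_trdg_scal, br_neg_right, br_self, phi, ← h1, ← h2, ← h3, br_add_left, add_zero, zero_add]
    rw [br_swap s3 s1, br_swap s3 s2, br_swap s2 s1]
    push_cast; ring

/-! ### The form of the Fock–Goncharov vertices -/

/-- Each h_i is n times an indicator function minus the constant i; the product of two indicators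
gives the minimum. -/
lemma Gco_eq {n i k : ℕ} (hi : i ≤ n) (hk : k ≤ n) :
    Gco n i k = (n : ℂ) ^ 2 * (min i k : ℕ) - n * i * k := by
  have h : ∀ r : ℕ, r ≤ n → ∑ j : Fin n, (if (j : ℕ) < r then (1 : ℂ) else 0) = r := fun r hr => by
    rw [Fin.sum_univ_eq_sum_range (fun j => if j < r then (1 : ℂ) else 0), ← Finset.sum_filter,
      Finset.sum_const, show (Finset.range n).filter (· < r) = Finset.range r by
        ext a; simp only [Finset.mem_filter, Finset.mem_range]; omega]
    simp
  have e : ∀ j : Fin n, hvec n i j * hvec n k j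
      = (n : ℂ) ^ 2 * (if (j : ℕ) < min i k then (1 : ℂ) else 0)
        - n * k * (if (j : ℕ) < i then (1 : ℂ) else 0) - n * i * (if (j : ℕ) < k then (1 : ℂ) else 0)
        + i * k := by
    intro j
    by_cases h1 : (j : ℕ) < i <;> by_cases h2 : (j : ℕ) < k <;> simp [hvec, h1, h2] <;> ring
  rw [Gco, dtr, Finset.sum_congr rfl fun j _ => e j, Finset.sum_add_distrib, Finset.sum_sub_distrib,
    Finset.sum_sub_distrib, ← Finset.mul_sum, ← Finset.mul_sum, ← Finset.mul_sum, h _ hi, h _ hk,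
    h _ (min_le_of_left_le hi)]
  simp; ring

lemma heaviside_mul (x y : ℤ) : heaviside (x * y)
    = if 0 < x ∧ 0 < y ∨ x < 0 ∧ y < 0 then 1 else if x = 0 ∨ y = 0 then 1 / 2 else 0 := by
  simp only [heaviside, mul_pos_iff, mul_eq_zero]

/-- Where the Heaviside factor is nonzero, the two differences have the same sign or one of them
vanishes. Then both minima in G are attained at the first index, and the terms with n² cancel. -/
lemma Fterm {n i j i' j' : ℕ} (h : i + j ≤ n) (h' : i' + j' ≤ n) :
    (Gco n i (n - j') - Gco n i' (n - j)) * heaviside (((i' : ℤ) - i) * ((j' : ℤ) - j))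
      = n * ((i : ℂ) * j' - i' * j) * heaviside (((i' : ℤ) - i) * ((j' : ℤ) - j)) := by
  rw [Gco_eq (by omega) (by omega), Gco_eq (by omega) (by omega), heaviside_mul]
  split_ifs with h1 h2
  · rw [min_eq_left (by omega), min_eq_left (by omega), Nat.cast_sub (by omega),
      Nat.cast_sub (by omega)]; ring
  · rw [min_eq_left (by omega), min_eq_left (by omega), Nat.cast_sub (by omega),
      Nat.cast_sub (by omega)]; ring
  · simp

lemma heaviside_one {x y : ℤ} (h : 0 < x ∧ 0 < y ∨ x < 0 ∧ y < 0) : heaviside (x * y) = 1 := by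
  rw [heaviside_mul, if_pos h]

lemma heaviside_half {x y : ℤ} (h : x = 0 ∨ y = 0) : heaviside (x * y) = 1 / 2 := by
  rw [heaviside_mul, if_neg (by omega), if_pos h]

lemma heaviside_zero {x y : ℤ} (h : 0 < x ∧ y < 0 ∨ x < 0 ∧ 0 < y) : heaviside (x * y) = 0 := by
  rw [heaviside_mul, if_neg (by omega), if_neg (by omega)]

/-- Here x = i' - i, y = j' - j, -x - y = k' - k. On each sign pattern of the three differences both
sides are polynomials. The subtracted bracket is the antisymmetrized contribution of the scalars in
`phi`. -/
lemma heaviside_gcoef (x y : ℤ) (h : ¬ (x = 0 ∧ y = 0)) (i j k : ℂ) :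
    (i * y - j * x) * heaviside (x * y) + (j * (-x - y) - k * y) * heaviside (y * (-x - y))
      + (k * x - i * (-x - y)) * heaviside ((-x - y) * x)
      = -((i + j + k) * (gcoef x y (-x - y) : ℂ)
        - (((j + k) * (i + k - y) + (j + k) * (i + j + x + y) + (i + k) * (i + j + x + y))
        - ((j + k - x) * (i + k) + (j + k - x) * (i + j) + (i + k - y) * (i + j)))) := by
  simp only [gcoef]
  by_cases hx : 0 < x <;> by_cases hx' : x < 0 <;> by_cases hy : 0 < y <;> by_cases hy' : y < 0 <;>
    by_cases hz : 0 < x + y <;> by_cases hz' : x + y < 0 <;> first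
    | (exfalso; omega)
    | (simp (disch := omega) only [heaviside_one, heaviside_half, heaviside_zero, if_pos, if_neg,
          min_eq_left, min_eq_right, max_eq_left, max_eq_right]
       push_cast
       first
         | ring1
         | (have e : (x : ℂ) = 0 := by exact_mod_cast (show x = 0 by omega)
            rw [e]; ring1)
         | (have e : (y : ℂ) = 0 := by exact_mod_cast (show y = 0 by omega)
            rw [e]; ring1)
         | (have e : (y : ℂ) = -x := by exact_mod_cast (show y = -x by omega)
            rw [e]; ring1))

lemma Fco_eq {n i j k i' j' k' : ℕ} (h : i + j + k = n) (h' : i' + j' + k' = n)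
    (hne : ¬ (i = i' ∧ j = j')) :
    Fco n (i, j, k) (i', j', k') = -((n : ℂ) ^ 2 * (gcoef ((i' : ℤ) - i) ((j' : ℤ) - j) ((k' : ℤ) - k) : ℂ)
      - n * (((n - i : ℂ) * (n - j') + (n - i) * (n - k') + (n - j) * (n - k'))
        - ((n - i' : ℂ) * (n - j) + (n - i') * (n - k) + (n - j') * (n - k)))) := by
  rw [Fco]
  dsimp only
  rw [Fterm (by omega) (by omega), Fterm (by omega) (by omega), Fterm (by omega) (by omega)]
  have e : (n : ℂ) = i + j + k := by rw [← h]; push_cast; ring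
  have e' : (k' : ℂ) = i + j + k - i' - j' := by rw [← e, ← h']; push_cast; ring
  have hx : ((i' : ℤ) - i : ℤ) = (i' : ℂ) - i := by push_cast; ring
  have hy : ((j' : ℤ) - j : ℤ) = (j' : ℂ) - j := by push_cast; ring
  have hz : (k' : ℤ) - k = -((i' : ℤ) - i) - ((j' : ℤ) - j) := by omega
  have H := heaviside_gcoef ((i' : ℤ) - i) ((j' : ℤ) - j) (by omega) i j k
  rw [← hz, hx, hy] at H
  rw [e', e]
  linear_combination ((i : ℂ) + j + k) * H

end

/-! ### Cancellation of the antidiagonals at the Stokes vertices -/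

section

open Jet Ext

section Group

variable {G : Type*} [Group G]

/-- With A = K b W K the antidiagonals are brought together: b₁ is conjugated by W, which makes it
upper triangular in the application, and the leftover sign W² is absorbed by the scalar of Q through
E E κ = 1. -/
lemma stokes_group {K W E κ t b1 d b3 : G} (hE : ∀ x, E * x = x * E) (hκ : ∀ x, κ * x = x * κ)
    (hK : K * K = 1) (hW : W * W = κ) (hWK : W * K = κ * K * W) (hκ2 : κ * κ = 1) (h1 : E * E * κ = 1) :
    E * t * W * (K * b1 * W * K) * d * (K * b3 * W * K) * (E⁻¹ * t⁻¹ * W)⁻¹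
      = t * (K * (W * b1 * W⁻¹) * K⁻¹) * d * (K * b3 * K⁻¹) * t := by
  have hK' : K⁻¹ = K := inv_eq_of_mul_eq_one_right hK
  have hκx : ∀ x, κ * x * κ = x := fun x => by rw [hκ, mul_assoc, hκ2, mul_one]
  have e : W * K * W⁻¹ = κ * K := by rw [hWK]; group
  have hWi : W = κ * W⁻¹ := by rw [hκ, ← hW]; group
  calc _ = E * (t * (W * K) * b1 * W * K * d * K * b3 * (W * K * W⁻¹) * t) * E := by group
    _ = E * E * (t * (κ * (K * W * b1 * W * K * d * K * b3) * κ) * K * t) := by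
        rw [e, hWK, mul_assoc E, ← hE, mul_assoc E]; simp only [mul_assoc]
    _ = E * E * (t * K * W * b1 * (κ * W⁻¹) * K * d * K * b3 * K * t) := by
        rw [hκx, ← hWi]; simp only [mul_assoc]
    _ = (E * E * κ) * (t * K * W * b1 * W⁻¹ * K * d * K * b3 * K * t) := by
        simp only [mul_assoc, move_central hκ]
    _ = _ := by rw [h1, hK']; simp only [mul_assoc, one_mul]

/-- One antidiagonal crosses d and reverses it; it conjugates b', in the application the upper
triangular B₂^{-t}, back to lower triangular form. Only the sign κ = W² remains. -/
lemma monodromy_group {K W κ b d d' b' : G} (hκ : ∀ x, κ * x = x * κ)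
    (hK : K * K = 1) (hW : W * W = κ) (hd : K * d = d * K) (hd' : K * d' = d' * K)
    (hWd : W * d = d' * W) :
    (K * b * W * K) * d * (K * b' * W * K)
      = κ * ((K * b * K⁻¹) * d' * (K * (W * b' * W⁻¹) * K⁻¹)) := by
  have hK' : K⁻¹ = K := inv_eq_of_mul_eq_one_right hK
  have hKK : ∀ x, K * (K * x) = x := fun x => by rw [← mul_assoc, hK, one_mul]
  calc _ = K * b * W * (K * d) * K * b' * W * K := by simp only [mul_assoc]
    _ = K * b * (W * d) * b' * W * K := by rw [hd]; simp only [mul_assoc, hKK]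
    _ = K * b * d' * (W * b' * W⁻¹) * (W * W) * K := by rw [hWd]; group
    _ = K * b * (K * (K * d')) * (W * b' * W⁻¹) * (W * W) * K := by rw [hKK]
    _ = _ := by rw [hd', hW, hK']; simp only [mul_assoc, move_central hκ]

end Group

section Constants

variable {m : ℕ}

lemma tinv_kap_sigU (n : ℕ) : tinv (kap (sigU n)) = kap (sigU n) := by
  refine ext_m ?_ fun k => by simp
  change (sigmaMat n)ᵀ = sigmaMat n
  rw [sigmaMat, diagonal_transpose]

lemma tinv_kap_wu (m : ℕ) : tinv (kap (wu m)) = kap (wu m) := by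
  refine ext_m ?_ fun k => by simp
  change (Matrix.of fun a b : Fin (m + 1) => if b = Fin.rev a then (-1 : ℂ) ^ (a : ℕ) else 0)ᵀ
    = Matrix.of fun a b => if b = Fin.rev a then (-1 : ℂ) ^ (b : ℕ) else 0
  ext a b
  simp only [transpose_apply, of_apply]
  by_cases h : b = Fin.rev a
  · rw [if_pos h, if_pos (by rw [h, Fin.rev_rev])]
  · rw [if_neg h, if_neg fun h' => h (by rw [h', Fin.rev_rev])]

lemma tinv_tor {n : ℕ} (Y : Fin n → LogJet) : tinv (tor Y) = tor (-Y) := by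
  refine ext_m ?_ fun k => ?_
  · simp [diagonal_transpose]
  · rw [tinv_a, tor_a, tor_a, diagonal_transpose, diagonal_neg]; rfl

lemma kap_scu_pow (k : ℕ) :
    kap (scu (m + 1) ((-1) ^ k)) = sg (m + 1) k := by
  rw [sg, map_pow]
  congr 2
  apply Units.ext
  rw [scu_val]; simp

lemma wu_mul_sigU (m : ℕ) : wu m * sigU (m + 1) = scu (m + 1) ((-1) ^ m) * sigU (m + 1) * wu m := by
  apply Units.ext
  rw [Units.val_mul, Units.val_mul, Units.val_mul, scu_val]
  ext a b
  change ((wu m : Matrix (Fin (m + 1)) (Fin (m + 1)) ℂ) * sigmaMat (m + 1)) a b = (((_ : ℂ) • 1 * sigmaMat (m + 1)) * (wu m : Matrix (Fin (m + 1)) (Fin (m + 1)) ℂ)) a b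
  rw [smul_mul_assoc, one_mul, smul_mul_assoc, Matrix.smul_apply, sigmaMat, mul_diagonal, diagonal_mul]
  simp only [wu, of_apply, smul_eq_mul]
  split_ifs with h
  · subst h
    rw [Fin.val_rev, show m + 1 - ((a : ℕ) + 1) = m - a by omega]
    have h1 : (-1 : ℂ) ^ m = (-1) ^ (a : ℕ) * (-1) ^ (m - (a : ℕ)) := by
      rw [← pow_add]; congr 1; omega
    have h2 : (-1 : ℂ) ^ (a : ℕ) * (-1) ^ (a : ℕ) = 1 := by rw [← mul_pow]; simp
    push_cast
    rw [h1]
    linear_combination (-((-1 : ℂ) ^ (m - (a : ℕ)) * (-1) ^ (m - (a : ℕ)))) * h2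
  · simp

end Constants

/-! ### Jets of the jump matrices -/

section Jumps

variable {m : ℕ} (p : Chart (m + 1)) (w : Fin 2 → Chart (m + 1))

def XJ (a b c : ℕ) : LogJet := lev p w (xi a b c)

lemma xi_eq_zero {n a b c : ℕ} (h : ¬ (0 < a ∧ 0 < b ∧ 0 < c)) : xi (n := n) a b c = 0 := by
  funext q
  rw [xi, dif_neg fun h' => h ⟨(mem_triples.1 h').1, (mem_triples.1 h').2.1, (mem_triples.1 h').2.2.1⟩]
  rfl

lemma XJ_bd : Bd (XJ p w) := fun a b => by
  refine ⟨?_, ?_, ?_⟩ <;> rw [XJ, xi_eq_zero (by omega), map_zero]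

def dJ (j : Fin (m + 1)) : LogJet := ∑ k : Fin m, alpha (m + 1) (k + 1) j • lev p w (zeta k)

def l1J : Fin (m + 1) → LogJet := bdiag m (XJ p w)
def l2J : Fin (m + 1) → LogJet := bdiag m (cy (XJ p w))
def l3J : Fin (m + 1) → LogJet := bdiag m (cy (cy (XJ p w)))

lemma l2J_eq (j : Fin (m + 1)) :
    l2J p w j = tsm (m + 1) fun a b c => dstar (hvec (m + 1) b) j • XJ p w a b c :=
  tsm_cyc (m + 1) fun a b c => dstar (hvec (m + 1) b) j • XJ p w a b c

lemma l3J_eq (j : Fin (m + 1)) :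
    l3J p w j = tsm (m + 1) fun a b c => dstar (hvec (m + 1) c) j • XJ p w a b c := by
  rw [← tsm_cyc, ← tsm_cyc (m + 1)]; rfl

def qJ (j : Fin (m + 1)) : LogJet := (1 / 2 : ℂ) • (l3J p w j - l1J p w (Fin.rev j) - dJ p w j)

def muJ (j : Fin (m + 1)) : LogJet :=
  dJ p w j - dJ p w (Fin.rev j) + l2J p w (Fin.rev j) - l2J p w j

/-- The constant in `Q`. -/
def qsign (m : ℕ) : ℂˣ := (Units.mk0 I I_ne_zero) ^ (m + 2) * (-1) ^ (m + 1)

def QJ : Jet (Fin (m + 1)) := kap (scu (m + 1) (qsign m)) * tor (qJ p w) * kap (wu m)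
def DJ : Jet (Fin (m + 1)) := tor (dJ p w)
def A1J : Jet (Fin (m + 1)) := AJ m (XJ p w)
def A2J : Jet (Fin (m + 1)) := AJ m (cy (XJ p w))
def A3J : Jet (Fin (m + 1)) := AJ m (cy (cy (XJ p w)))
def NJ : Jet (Fin (m + 1)) := QJ p w * A1J p w * DJ p w * tinv (A3J p w) * (tinv (QJ p w))⁻¹
def M0J : Jet (Fin (m + 1)) := (DJ p w)⁻¹ * A2J p w * DJ p w * tinv (A2J p w)
def LamJ : Jet (Fin (m + 1)) := kap (scu (m + 1) ((-1) ^ (m + 2))) * tor (muJ p w)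

variable {p w}

lemma HasJet.A1 : HasJet p w A1 (A1J p w) := HasJet.fockGoncharov (fun _ _ _ => isLinearMap_xi _ _ _)
  fun _ _ => xi_eq_zero (by omega)

lemma HasJet.A2 : HasJet p w A2 (A2J p w) := HasJet.fockGoncharov
  (x := fun a b c => xi c a b) (fun _ _ _ => isLinearMap_xi _ _ _) fun _ _ => xi_eq_zero (by omega)

lemma HasJet.A3 : HasJet p w A3 (A3J p w) := HasJet.fockGoncharov
  (x := fun a b c => xi b c a) (fun _ _ _ => isLinearMap_xi _ _ _) fun _ _ => xi_eq_zero (by omega)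

lemma isLinearMap_dlog (j : Fin (m + 1)) :
    IsLinearMap ℂ (fun q : Chart (m + 1) => ∑ k : Fin (m + 1 - 1), zeta k q * alpha (m + 1) (k + 1) j) :=
  isLinearMap_sum _ (fun k _ => isLinearMap_zeta k) _

lemma isLinearMap_xlog (r : ℕ × ℕ × ℕ → ℂ) :
    IsLinearMap ℂ (fun q : Chart (m + 1) => ∑ t ∈ triples (m + 1), xi t.1 t.2.1 t.2.2 q * r t) :=
  isLinearMap_sum _ (fun _ _ => isLinearMap_xi _ _ _) _

lemma dJ_eq (j : Fin (m + 1)) :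
    lev p w (fun q => ∑ k : Fin (m + 1 - 1), zeta k q * alpha (m + 1) (k + 1) j) = dJ p w j := lev_sum _ _ _

lemma HasJet.D : HasJet p w Dmat (DJ p w) := by
  have h := HasJet.tor (p := p) (w := w) (f := fun (j : Fin (m + 1)) q =>
    ∑ k : Fin (m + 1 - 1), zeta k q * alpha (m + 1) (k + 1) j)
    fun j => IsLinearMap.diff (isLinearMap_dlog j)
  have e : (fun j => ev p w (fun q => ∑ k : Fin (m + 1 - 1), zeta k q * alpha (m + 1) (k + 1) j))
    = dJ p w := funext fun j => by rw [ev_eq_lev (isLinearMap_dlog j), dJ_eq]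
  rw [e] at h
  exact h

/-- The logarithm of the diagonal of `Q`. -/
def qlog (j : Fin (m + 1)) (q : Chart (m + 1)) : ℂ :=
  (1 / 2) * (∑ t ∈ triples (m + 1), xi t.1 t.2.1 t.2.2 q *
          (dstar (hvec (m + 1) t.2.2) j - hvec (m + 1) t.1 j)
        - ∑ k : Fin (m + 1 - 1), zeta k q * alpha (m + 1) (k + 1) j)

lemma isLinearMap_qlog (j : Fin (m + 1)) : IsLinearMap ℂ (qlog j) := by
  have h1 := isLinearMap_xlog (m := m) (fun t => dstar (hvec (m + 1) t.2.2) j - hvec (m + 1) t.1 j)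
  have h2 := isLinearMap_dlog j
  exact (((1 / 2 : ℂ)) • (h1.mk' - h2.mk')).isLinear

lemma qlog_eq (j : Fin (m + 1)) : lev p w (qlog j) = qJ p w j := by
  have : qlog j = (1 / 2 : ℂ) • ((fun q => ∑ t ∈ triples (m + 1), xi t.1 t.2.1 t.2.2 q *
          (dstar (hvec (m + 1) t.2.2) j - hvec (m + 1) t.1 j))
        - fun q => ∑ k : Fin (m + 1 - 1), zeta k q * alpha (m + 1) (k + 1) j) := rfl
  rw [this, map_smul, map_sub, lev_sum, dJ_eq, qJ, l3J_eq, l1J, bdiag, tsm, tsm, ← Finset.sum_sub_distrib]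
  congr 2
  refine Finset.sum_congr rfl fun t _ => ?_
  rw [sub_smul]
  simp only [dstar, Fin.rev_rev]; rfl

lemma Pmat_eq (m : ℕ) : Pmat (m + 1) = (-1 : ℂ) ^ (m + 1) • (wu m : Matrix (Fin (m + 1)) (Fin (m + 1)) ℂ) := by
  ext a b
  simp only [Pmat, wu, of_apply, Matrix.smul_apply, smul_eq_mul]
  split_ifs with h
  · subst h
    have h1 : (-1 : ℂ) ^ (m + 1) = (-1) ^ ((a : ℕ) + 1) * (-1) ^ (m + 1 - ((a : ℕ) + 1)) := by
      rw [← pow_add]; congr 1; omega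
    rw [Fin.val_rev, h1, mul_assoc, ← mul_pow]; simp
  · simp

lemma HasJet.Q : HasJet p w Qmat (QJ p w) := by
  have h := HasJet.tor (p := p) (w := w) (f := fun (j : Fin (m + 1)) q => qlog j q)
    fun j => IsLinearMap.diff (isLinearMap_qlog j)
  have e : (fun j => ev p w (fun q => qlog j q)) = qJ p w := funext fun j => by
    rw [← qlog_eq, ← ev_eq_lev (isLinearMap_qlog j)]
  rw [e] at h
  refine (((HasJet.kap (scu (m + 1) (qsign m))).mul h).mul (HasJet.kap (wu m))).congr (funext fun q => ?_)
  rw [Qmat, Pmat_eq, scu_val, smul_mul_assoc, one_mul, smul_mul_assoc, mul_smul_comm]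
  have : (diagonal (qdiag q) : Matrix (Fin (m + 1)) (Fin (m + 1)) ℂ)
      = (I ^ (m + 2)) • diagonal fun i => exp (qlog i q) := by
    rw [← diagonal_smul]; rfl
  rw [this, smul_mul_assoc, smul_smul]
  congr 1
  simp only [qsign]; push_cast; simp; ring

lemma HasJet.N : HasJet p w (fun q => Qmat q * FrobeniusStokes.A1 q * Dmat q * ((FrobeniusStokes.A3 q)⁻¹)ᵀ * (Qmat q)ᵀ) (NJ p w) :=
  (((HasJet.Q.mul HasJet.A1).mul HasJet.D).mul HasJet.A3.invT).mul HasJet.Q.transpose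

lemma HasJet.S : HasJet p w Smat (NJ p w)⁻¹ := HasJet.N.inv

lemma HasJet.M0 : HasJet p w M0 (M0J p w) := ((HasJet.D.inv.mul HasJet.A2).mul HasJet.D).mul HasJet.A2.invT

lemma isLinearMap_mu (j : Fin (m + 1)) : IsLinearMap ℂ (mu (n := m + 1) j) :=
  IsLinearMap.add' (isLinearMap_sum _ (fun k _ => isLinearMap_zeta k) _) (isLinearMap_xlog _)

lemma mu_eq (j : Fin (m + 1)) : lev p w (mu j) = muJ p w j := by
  have : mu (n := m + 1) j = (fun q => ∑ k : Fin (m + 1 - 1), zeta k q * (alpha (m + 1) (k + 1) j - dstar (alpha (m + 1) (k + 1)) j))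
    + fun q => ∑ t ∈ triples (m + 1), xi t.1 t.2.1 t.2.2 q * (hvec (m + 1) t.2.1 j - dstar (hvec (m + 1) t.2.1) j) := rfl
  rw [this, map_add, lev_sum, lev_sum, muJ, l2J_eq, l2J_eq, dJ, dJ, tsm, tsm, ← Finset.sum_sub_distrib,
    add_sub_assoc, ← Finset.sum_sub_distrib]
  congr 1
  · refine Finset.sum_congr rfl fun k _ => ?_
    rw [sub_smul]; rfl
  · refine Finset.sum_congr rfl fun t _ => ?_
    rw [sub_smul]
    simp only [dstar, Fin.rev_rev]; rfl

lemma HasJet.Lam : HasJet p w Lam (LamJ p w) := by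
  have h := HasJet.tor (p := p) (w := w) (f := fun (j : Fin (m + 1)) q => mu j q)
    fun j => IsLinearMap.diff (isLinearMap_mu j)
  have e : (fun j => ev p w (fun q => mu j q)) = muJ p w := funext fun j => by
    rw [← mu_eq, ← ev_eq_lev (isLinearMap_mu j)]
  rw [e] at h
  refine ((HasJet.kap (scu (m + 1) ((-1) ^ (m + 2)))).mul h).congr (funext fun q => ?_)
  rw [scu_val, smul_mul_assoc, one_mul, ← diagonal_smul, FrobeniusStokes.Lam]
  refine congrArg _ (funext fun j => ?_)
  simp [mval]

end Jumps

end

/-! ### Central values at the Stokes vertices -/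

section

open Jet Ext

section Words

variable {m : ℕ} (p : Chart (m + 1)) (w : Fin 2 → Chart (m + 1))

lemma io_scu_comm {n : ℕ} (a : ℂˣ) (x : Ext (Fin n)) :
    io (kap (scu n a)) * x = x * io (kap (scu n a)) :=
  Ext.ext (scu_comm a _) (by simp)

lemma io_kap_mul_kap {n : ℕ} (u v : (Matrix (Fin n) (Fin n) ℂ)ˣ) :
    io (kap u) * io (kap v) = io (kap (u * v)) := by rw [map_mul, io_mul_kap]

lemma kk_sigU (n : ℕ) : io (kap (sigU n)) * io (kap (sigU n)) = 1 := by
  rw [io_kap_mul_kap, sigU_mul_sigU]; simp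

lemma ww_wu (m : ℕ) : io (kap (wu m)) * io (kap (wu m)) = io (kap (scu (m + 1) ((-1) ^ m))) := by
  rw [io_kap_mul_kap, wu_mul_wu, kap_scu_pow]; rfl

lemma wk_wu (m : ℕ) : io (kap (wu m)) * io (kap (sigU (m + 1)))
    = io (kap (scu (m + 1) ((-1) ^ m))) * io (kap (sigU (m + 1))) * io (kap (wu m)) := by
  rw [io_kap_mul_kap, io_kap_mul_kap, io_kap_mul_kap, wu_mul_sigU]

lemma io_AJ (m : ℕ) (e : ℕ → ℕ → ℕ → LogJet) : io (AJ m e)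
    = io (kap (sigU (m + 1))) * io (BJ m e) * io (kap (wu m)) * io (kap (sigU (m + 1))) := by
  rw [AJ_eq, io_mul_kap, io_mul_kap, io_kap_mul]

/-- σ and W are orthogonal matrices, hence fixed by g ↦ g^{-t}; so A^{-t} has the same shape as A,
with B^{-t} in place of B. -/
lemma tinv_AJ (m : ℕ) (e : ℕ → ℕ → ℕ → LogJet) : tinv (AJ m e)
    = kap (sigU (m + 1)) * tinv (BJ m e) * kap (wu m) * kap (sigU (m + 1)) := by
  rw [AJ_eq, map_mul, map_mul, map_mul, tinv_kap_sigU, tinv_kap_wu]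

lemma io_tinv_AJ (m : ℕ) (e : ℕ → ℕ → ℕ → LogJet) : io (tinv (AJ m e))
    = io (kap (sigU (m + 1))) * io (tinv (BJ m e)) * io (kap (wu m)) * io (kap (sigU (m + 1))) := by
  rw [tinv_AJ, io_mul_kap, io_mul_kap, io_kap_mul]

lemma io_conj {n : ℕ} (u : (Matrix (Fin n) (Fin n) ℂ)ˣ) (x : Jet (Fin n)) :
    io (kap u) * io x * (io (kap u))⁻¹ = io (kap u * x * (kap u)⁻¹) := by
  rw [← io_inv, ← map_inv, io_mul_kap, io_kap_mul]

lemma io_QJ : io (QJ p w)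
    = io (kap (scu (m + 1) (qsign m))) * io (tor (qJ p w)) * io (kap (wu m)) := by
  rw [QJ, io_mul_kap, io_kap_mul]

lemma tinv_QJ : tinv (QJ p w) = kap (scu (m + 1) (qsign m)⁻¹) * (tor (qJ p w))⁻¹ * kap (wu m) := by
  rw [QJ, map_mul, map_mul, tinv_scu, tinv_tor, tor_neg, tinv_kap_wu]

lemma io_tinv_QJ : io (tinv (QJ p w)) = (io (kap (scu (m + 1) (qsign m))))⁻¹
    * (io (tor (qJ p w)))⁻¹ * io (kap (wu m)) := by
  rw [tinv_QJ, io_mul_kap, io_kap_mul, map_inv, map_inv, io_inv, io_inv]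

/-- The constant (-1)^{(n+1)/2} in Q is there so that its square cancels the sign W² = (-1)^m; this
makes the diagonal of S equal to +1. -/
lemma qsign_sq (m : ℕ) : qsign m * qsign m * (-1) ^ m = 1 := by
  apply Units.ext
  simp only [qsign]
  push_cast
  rw [Units.val_mk0]
  have h1 : I ^ (m + 2) * I ^ (m + 2) = (-1) ^ (m + 2) := by rw [← mul_pow, I_mul_I]
  have h2 : (-1 : ℂ) ^ m * (-1) ^ m = 1 := by rw [← mul_pow]; simp
  linear_combination (-1 : ℂ) ^ (m + 1) * (-1) ^ (m + 1) * (-1) ^ m * h1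
    + ((-1 : ℂ) ^ m * (-1) ^ m + 1) * h2

/-- The logarithm of the diagonal of `W B₁ W⁻¹`. -/
def u1J (j : Fin (m + 1)) : LogJet := l1J p w (Fin.rev j)

/-- The central value at the vertex `q₀`. -/
def qval : ℂ := brv (u1J p w) (dJ p w) - brv (u1J p w) (l3J p w) - brv (dJ p w) (l3J p w)

lemma stokes_word_eq : io (QJ p w) * io (A1J p w) * io (DJ p w) * io (tinv (A3J p w)) * (io (tinv (QJ p w)))⁻¹
    = io (tor (qJ p w)) * io (kap (sigU (m + 1)) * (kap (wu m) * BJ m (XJ p w) * (kap (wu m))⁻¹)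
        * (kap (sigU (m + 1)))⁻¹) * io (DJ p w)
      * io (kap (sigU (m + 1)) * tinv (BJ m (cy (cy (XJ p w)))) * (kap (sigU (m + 1)))⁻¹) * io (tor (qJ p w)) := by
  rw [io_QJ, io_tinv_QJ, A1J, A3J, io_AJ, io_tinv_AJ]
  have hone : io (kap (1 : (Matrix (Fin (m + 1)) (Fin (m + 1)) ℂ)ˣ)) = 1 := by simp
  rw [stokes_group (κ := io (kap (scu (m + 1) ((-1) ^ m)))) (fun x => io_scu_comm _ x)
    (fun x => io_scu_comm _ x) (kk_sigU _) (ww_wu _) (wk_wu _)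
    (by rw [io_kap_mul_kap, ← map_mul, ← pow_add, ← two_mul, pow_mul]; simp)
    (by rw [io_kap_mul_kap, io_kap_mul_kap, ← map_mul, ← map_mul, qsign_sq, map_one, hone])]
  rw [io_conj, io_conj, io_conj]

/-- Q enters on both sides, and its logarithm is half of what is needed to trivialize the diagonal
of A₁DA₃^{-t} in triangular form. -/
lemma uj_mul_two : qJ p w + u1J p w + dJ p w + -l3J p w + qJ p w = 0 := by
  funext j
  simp only [Pi.add_apply, Pi.neg_apply, Pi.zero_apply, qJ, u1J]
  module

/-- The inverse of the Stokes matrix is upper triangular with logarithmic diagonal `0`. -/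
theorem stokes_word : DE (id : Fin (m + 1) → Fin (m + 1))
    (io (QJ p w) * io (A1J p w) * io (DJ p w) * io (tinv (A3J p w)) * (io (tinv (QJ p w)))⁻¹) 0 (qval p w) := by
  rw [stokes_word_eq]
  have hi : Function.Injective (id : Fin (m + 1) → Fin (m + 1)) := Function.injective_id
  have hX := XJ_bd p w
  have h1 : UT (kap (sigU (m + 1)) * (kap (wu m) * BJ m (XJ p w) * (kap (wu m))⁻¹)
        * (kap (sigU (m + 1)))⁻¹) (u1J p w) := (LT.BJ m hX).wconj.sconj
  have h3 : UT (kap (sigU (m + 1)) * tinv (BJ m (cy (cy (XJ p w)))) * (kap (sigU (m + 1)))⁻¹) (-l3J p w) :=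
    (LT.tinv (LT.BJ m hX.cy.cy)).sconj
  have hq : UT (tor (qJ p w)) (qJ p w) := DT.tor _
  have hd : UT (DJ p w) (dJ p w) := DT.tor _
  have h := (((hq.io.mul hi h1.io).mul hi hd.io).mul hi h3.io).mul hi hq.io
  rw [uj_mul_two] at h
  refine ⟨h.j, h.s.trans ?_⟩
  have e : qJ p w = (1 / 2 : ℂ) • (l3J p w - u1J p w - dJ p w) := rfl
  have hsm : ∀ u v : Fin (m + 1) → LogJet, brv ((1 / 2 : ℂ) • u) v = (1 / 2) * brv u v := fun u v => by
    simp only [brv, Pi.smul_apply, br_smul_left, Finset.mul_sum]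
  -- The first four factors have total logarithmic diagonal -q, so multiplication by the last one
  -- contributes a pairing of q with itself.
  have e2 : qJ p w + u1J p w + dJ p w + -l3J p w = -qJ p w :=
    eq_neg_of_add_eq_zero_left (uj_mul_two p w)
  rw [e2, brv_neg_left, brv_self, e]
  simp only [brv_add_left, brv_neg_right, hsm, sub_eq_add_neg, brv_neg_left, brv_self, qval]
  rw [brv_swap (dJ p w) (u1J p w), brv_swap (dJ p w) (l3J p w), brv_swap (u1J p w) (l3J p w)]
  ring

lemma io_mul_list (l : List (Jet (Fin (m + 1)))) : (l.map io).prod.j = l.prod := by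
  induction l with
  | nil => rfl
  | cons a l ih => simp [ih]

lemma UT.NJ : UT (FrobeniusStokes.NJ p w) 0 := (stokes_word p w).j

lemma NJ_word : io (QJ p w) * io (A1J p w) * io (DJ p w) * io (tinv (A3J p w)) * (io (tinv (QJ p w)))⁻¹
    = io (NJ p w) * z (qval p w) := by
  conv_lhs => rw [eq_io_mul_z (_ * _)]
  rw [(stokes_word p w).s]; rfl

def b2J : Jet (Fin (m + 1)) := kap (sigU (m + 1)) * BJ m (cy (XJ p w)) * (kap (sigU (m + 1)))⁻¹

def b2J' : Jet (Fin (m + 1)) := kap (sigU (m + 1))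
  * (kap (wu m) * tinv (BJ m (cy (XJ p w))) * (kap (wu m))⁻¹) * (kap (sigU (m + 1)))⁻¹

/-- The diagonal of `D` in the reversed order. -/
def drJ : Fin (m + 1) → LogJet := fun j => dJ p w (Fin.rev j)

def l2rJ : Fin (m + 1) → LogJet := fun j => l2J p w (Fin.rev j)

/-- The part of `M₀` with positive diagonal. -/
def M0P : Jet (Fin (m + 1)) := (DJ p w)⁻¹ * (b2J p w * tor (drJ p w) * b2J' p w)

lemma LT.b2J : LT (FrobeniusStokes.b2J p w) (l2J p w) := (LT.BJ m (XJ_bd p w).cy).sconj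

lemma LT.b2J' : LT (FrobeniusStokes.b2J' p w) (-l2rJ p w) := by
  have h := (LT.tinv (LT.BJ m (XJ_bd p w).cy)).wconj.sconj
  exact h

lemma kap_sigU_tor {n : ℕ} (Y : Fin n → LogJet) : kap (sigU n) * tor Y = tor Y * kap (sigU n) := by
  have key : ∀ d : Fin n → ℂ, sigmaMat n * diagonal d = diagonal d * sigmaMat n := fun d => by
    rw [sigmaMat, diagonal_mul_diagonal, diagonal_mul_diagonal]; simp only [mul_comm]
  refine ext_m (key _) fun k => ?_
  rw [mul_a, mul_a, kap_a, mul_zero, zero_mul, add_zero, zero_add, kap_gi, kap_m, tor_a]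
  change _ = sigmaMat n * diagonal _ * sigmaMat n
  rw [key, mul_assoc]
  have : sigmaMat n * sigmaMat n = 1 := (sigU n).mul_inv
  rw [this, mul_one]

lemma monodromy_word : io (A2J p w) * io (DJ p w) * io (tinv (A2J p w))
    = io (kap (scu (m + 1) ((-1) ^ m))) * (io (b2J p w) * io (tor (drJ p w)) * io (b2J' p w)) := by
  rw [A2J, io_AJ, io_tinv_AJ]
  have ht : ∀ Y, io (kap (sigU (m + 1))) * io (tor Y) = io (tor Y) * io (kap (sigU (m + 1))) := fun Y => by
    rw [← io_kap_mul, ← io_mul_kap, kap_sigU_tor]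
  rw [monodromy_group (d := io (DJ p w)) (κ := io (kap (scu (m + 1) ((-1) ^ m))))
    (fun x => io_scu_comm _ x) (kk_sigU _) (ww_wu _)
    (ht _) (ht _) (d' := io (tor (drJ p w)))
    (by rw [DJ, ← io_kap_mul, ← io_mul_kap, wu_mul_tor]; rfl)]
  rw [io_conj, io_conj, io_conj]; rfl

lemma M0J_eq : M0J p w = kap (scu (m + 1) ((-1) ^ m)) * M0P p w := by
  have h := congrArg Ext.j (monodromy_word p w)
  simp only [mul_j, io_j] at h
  rw [M0J, mul_assoc, mul_assoc, ← mul_assoc (A2J p w), h, M0P, ← mul_assoc, ← scu_comm, mul_assoc]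

lemma LT.M0P : LT (FrobeniusStokes.M0P p w) (-muJ p w) := by
  have hd : LT (DJ p w) (dJ p w) := DT.tor _
  have h := LT.mul (DT.inv (toDual_inj _) hd) (LT.mul (LT.mul (LT.b2J p w) (DT.tor (drJ p w))) (LT.b2J' p w))
  have e : -muJ p w = -dJ p w + (l2J p w + drJ p w + -l2rJ p w) := by
    funext j
    simp only [muJ, drJ, l2rJ, Pi.add_apply, Pi.neg_apply]
    abel
  rw [e]; exact h

lemma central_cancel {G : Type*} [Group G] {κ : G} (h : ∀ x, κ * x = x * κ) (x y d : G) :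
    κ * x * (κ * y)⁻¹ * d = x * y⁻¹ * d := by
  rw [_root_.mul_inv_rev, ← mul_assoc, mul_assoc κ, h, mul_inv_cancel_right]

/-- Once the sign is removed all factors are lower triangular, with diagonals l₂, d reversed, -l₂
reversed, μ and -d. The pairing of a vector with its own reversal is both invariant and
antisymmetric under reversal, hence zero; what survives is twice the pairing of l₂ with d. -/
lemma monodromy_val : (io (A2J p w) * io (DJ p w) * io (tinv (A2J p w)) * (io (M0J p w))⁻¹ * (io (DJ p w))⁻¹)
    = z (2 * brv (l2J p w) (dJ p w)) := by
  have hd : LT (DJ p w) (dJ p w) := DT.tor _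
  have hdr : LT (tor (drJ p w)) (drJ p w) := DT.tor _
  have hb := toDual_inj (m + 1)
  have hY := ((LT.b2J p w).io.mul hb hdr.io).mul hb (LT.b2J' p w).io
  have hT := (hY.mul hb (DT.io (DT.inv hb (LT.M0P p w)))).mul hb (DT.io (DT.inv hb hd))
  rw [monodromy_word, M0J_eq, io_kap_mul, central_cancel (io_scu_comm _), ← io_inv, ← io_inv]
  rw [eq_z_iff]
  constructor
  · simp only [mul_j, io_j, FrobeniusStokes.M0P]; group
  · refine hT.s.trans ?_
    rw [neg_neg]
    have hr : ∀ u v : Fin (m + 1) → LogJet, brv (fun j => u (Fin.rev j)) v = brv u (fun j => v (Fin.rev j)) :=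
      fun u v => by rw [← brv_rev u]; simp only [Fin.rev_rev]
    have e2 : muJ p w = dJ p w + -drJ p w + l2rJ p w + -l2J p w := by
      funext j; simp only [muJ, drJ, l2rJ, Pi.add_apply, Pi.neg_apply, sub_eq_add_neg]
    rw [e2]
    simp only [brv_add_left, brv_add_right, brv_neg_left, brv_neg_right, brv_self]
    have a1 : brv (drJ p w) (l2rJ p w) = brv (dJ p w) (l2J p w) := brv_rev _ _
    have a2 : brv (l2rJ p w) (drJ p w) = brv (l2J p w) (dJ p w) := brv_rev _ _
    have a3 : brv (l2rJ p w) (dJ p w) = brv (l2J p w) (drJ p w) := hr _ _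
    have a4 : brv (drJ p w) (l2J p w) = brv (dJ p w) (l2rJ p w) := hr _ _
    have a5 : brv (l2rJ p w) (l2J p w) = brv (l2J p w) (l2rJ p w) := hr _ _
    have a6 : brv (drJ p w) (dJ p w) = brv (dJ p w) (drJ p w) := hr _ _
    have z1 : brv (dJ p w) (drJ p w) = 0 := by
      have := brv_swap (dJ p w) (drJ p w); linear_combination (1 / 2) * this - (1 / 2) * a6
    have z2 : brv (l2J p w) (l2rJ p w) = 0 := by
      have := brv_swap (l2J p w) (l2rJ p w); linear_combination (1 / 2) * this - (1 / 2) * a5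
    have z3 : brv (l2J p w) (drJ p w) = -brv (dJ p w) (l2rJ p w) := by rw [← a3, brv_swap]
    rw [a1, a2, a3, a4, a5, a6, z1, z2, z3, brv_swap (dJ p w) (l2J p w)]
    ring

end Words

end

section

open Jet Ext

/-! ### The eigenvectors of a lower triangular matrix -/

section Eigen

open Polynomial

variable {n : ℕ} {M : Matrix (Fin n) (Fin n) ℂ} {v : Fin n → ℂ}

lemma lower_aeval (hM : M.IsLowerTriangular) (f : ℂ[X]) :
    (aeval M f).IsLowerTriangular ∧ ∀ i, (aeval M f) i i = f.eval (M i i) := by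
  induction f using Polynomial.induction_on' with
  | add f g hf hg =>
    exact ⟨by rw [map_add]; exact hf.1.add hg.1, fun i => by
      rw [map_add, Matrix.add_apply, hf.2, hg.2, eval_add]⟩
  | monomial k a =>
    have h : ∀ k, (M ^ k).IsLowerTriangular ∧ ∀ i, (M ^ k) i i = M i i ^ k := fun k => by
      induction k with
      | zero => exact ⟨by rw [pow_zero]; exact blockTriangular_one, by simp⟩
      | succ k ih =>
        rw [pow_succ]
        exact ⟨ih.1.mul hM, fun i => by
          rw [BlockTriangular.mul_diag (toDual_inj n) ih.1 hM, ih.2, pow_succ]⟩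
    rw [aeval_monomial, Algebra.algebraMap_eq_smul_one, smul_mul_assoc, one_mul]
    refine ⟨fun i j hij => ?_, fun i => ?_⟩
    · rw [Matrix.smul_apply, (h k).1 hij, smul_zero]
    · rw [Matrix.smul_apply, (h k).2, eval_monomial, smul_eq_mul]

lemma charpoly_of_lower (hM : M.IsLowerTriangular) : M.charpoly = ∏ i, (X - C (M i i)) := by
  rw [← charpoly_transpose, charpoly_of_isUpperTriangular]
  · rfl
  · intro i j hij; exact hM hij

/-- Multiplied by X - v_j, the Lagrange polynomial becomes a multiple of the characteristic
polynomial of the triangular matrix, which annihilates M by Cayley–Hamilton. -/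
lemma eigenvector (hM : M.IsLowerTriangular) (hd : ∀ i, M i i = v i) (j : Fin n) :
    M * aeval M (Lagrange.basis Finset.univ v j) = v j • aeval M (Lagrange.basis Finset.univ v j) := by
  have h1 : (X - C (v j)) * Lagrange.basis Finset.univ v j
      = C (∏ k ∈ Finset.univ.erase j, (v j - v k)⁻¹) * M.charpoly := by
    rw [Lagrange.basis, charpoly_of_lower hM, ← Finset.mul_prod_erase _ _ (Finset.mem_univ j), hd, map_prod]
    simp only [Lagrange.basisDivisor, Finset.prod_mul_distrib, hd]
    ring
  have h2 := congrArg (aeval M) h1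
  rw [map_mul, map_mul, aeval_self_charpoly, mul_zero, map_sub, aeval_X, aeval_C, sub_mul, sub_eq_zero] at h2
  rw [h2, Algebra.algebraMap_eq_smul_one, smul_mul_assoc, one_mul]

/-- Row by row: earlier rows of B vanish by induction, later ones do not enter by triangularity, and
(v_i - v_j)B_{ij} = 0 remains. -/
lemma lower_unique (hM : M.IsLowerTriangular) (hd : ∀ i, M i i = v i) (hv : Function.Injective v)
    {B : Matrix (Fin n) (Fin n) ℂ} (hB : M * B = B * diagonal v) (h0 : ∀ i, B i i = 0) : B = 0 := by
  have key : ∀ N : ℕ, ∀ i j : Fin n, (i : ℕ) < N → B i j = 0 := fun N => by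
    induction N with
    | zero => intro i j h; omega
    | succ N ih =>
      intro i j h
      have h1 := congrFun (congrFun hB i) j
      rw [Matrix.mul_apply, mul_diagonal, Finset.sum_eq_single i, hd] at h1
      · by_cases hij : i = j
        · rw [hij]; exact h0 j
        · have h2 : (v i - v j) * B i j = 0 := by linear_combination h1
          exact (mul_eq_zero.1 h2).resolve_left (sub_ne_zero.2 fun h => hij (hv h))
      · intro k _ hk
        rcases lt_or_gt_of_ne hk with h2 | h2
        · rw [ih k j (lt_of_lt_of_le (show (k : ℕ) < i from h2) (by omega)), mul_zero]
        · rw [hM (show OrderDual.toDual k < OrderDual.toDual i from h2), zero_mul]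
      · simp
  ext i j
  exact key n i j i.2

end Eigen

section Connection

variable {m : ℕ} {p : Chart (m + 1)} {w : Fin 2 → Chart (m + 1)}

lemma muJ_fst (j : Fin (m + 1)) : (muJ p w j).1 = mu j p := by rw [← mu_eq]; rfl

lemma neg_one_pow_two (m : ℕ) : (-1 : ℂ) ^ (m + 2) = (-1) ^ m := by rw [pow_add]; simp

lemma M0_val : M0 p = (-1 : ℂ) ^ m • (M0P p (0 : Fin 2 → Chart (m + 1))).m := by
  rw [HasJet.M0.val (w := 0), M0J_eq, mul_m, kap_m, scu_val, smul_mul_assoc, one_mul]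
  simp

lemma M0_lower : (M0 p).IsLowerTriangular := fun i j hij => by
  rw [M0_val, Matrix.smul_apply, (LT.M0P p 0).tri.1 hij, smul_zero]

lemma M0_diag (j : Fin (m + 1)) : M0 p j j = (mval p j)⁻¹ := by
  rw [M0_val, Matrix.smul_apply, (LT.M0P p 0).dm, Pi.neg_apply, Prod.fst_neg, muJ_fst, Complex.exp_neg, mval,
    neg_one_pow_two, mul_inv, ← inv_pow]
  norm_num

lemma mval_ne_zero {n : ℕ} (p : Chart n) (j : Fin n) : mval p j ≠ 0 :=
  mul_ne_zero (pow_ne_zero _ (by norm_num)) (exp_ne_zero _)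

lemma inv_mval_inj {n : ℕ} {p : Chart n} (hp : p ∈ regularLocus n) :
    Function.Injective fun k => (mval p k)⁻¹ := fun _ _ h => hp (inv_injective h)

lemma Lam_inv {n : ℕ} (p : Chart n) : (Lam p)⁻¹ = diagonal fun j => (mval p j)⁻¹ := by
  refine inv_eq_left_inv ?_
  rw [Lam, diagonal_mul_diagonal]
  simp [mval_ne_zero]

lemma C0_lower : (C0 p).IsLowerTriangular := fun i j hij => by
  rw [C0, of_apply, (lower_aeval M0_lower _).1 hij, mul_zero]

lemma C0_diag (hp : p ∈ regularLocus (m + 1)) (j : Fin (m + 1)) : C0 p j j = cval p j := by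
  rw [C0, of_apply, (lower_aeval M0_lower _).2, M0_diag,
    Lagrange.eval_basis_self (v := fun k => (mval p k)⁻¹) (inv_mval_inj hp).injOn (Finset.mem_univ j), mul_one]

lemma C0_eigen : M0 p * C0 p = C0 p * (Lam p)⁻¹ := by
  rw [Lam_inv]
  ext i j
  have h := congrFun (congrFun (eigenvector (v := fun k => (mval p k)⁻¹) (M0_lower (p := p)) M0_diag j) i) j
  rw [mul_diagonal, Matrix.mul_apply]
  rw [Matrix.mul_apply, Matrix.smul_apply, smul_eq_mul] at h
  simp only [C0, of_apply]
  rw [show ∀ x y z : ℂ, x * y * z = x * (z * y) from fun x y z => by ring, ← h, Finset.mul_sum]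
  exact Finset.sum_congr rfl fun k _ => by ring

/-- The spectral projectors give existence. The difference of two solutions has zero diagonal and
still intertwines M₀ with Λ⁻¹, so `lower_unique` makes it zero. -/
theorem C0_iff (hp : p ∈ regularLocus (m + 1)) (B : Matrix (Fin (m + 1)) (Fin (m + 1)) ℂ) :
    (B.IsLowerTriangular ∧ (∀ j, B j j = cval p j) ∧ M0 p * B = B * (Lam p)⁻¹) ↔ B = C0 p := by
  refine ⟨fun ⟨_, h2, h3⟩ => ?_, fun h => h ▸ ⟨C0_lower, C0_diag hp, C0_eigen⟩⟩
  refine sub_eq_zero.1 (lower_unique (v := fun k => (mval p k)⁻¹) (M0_lower (p := p)) M0_diag (inv_mval_inj hp) ?_ ?_)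
  · rw [mul_sub, h3, C0_eigen, sub_mul, ← Lam_inv]
  · intro i; rw [Matrix.sub_apply, h2, C0_diag hp, sub_self]

/-- The logarithms of the toric variables. -/
def clog {n : ℕ} (j : Fin n) (p : Chart n) : ℂ :=
  if h : (j : ℕ) < n / 2 then gam ⟨j, h⟩ p
  else if h : (Fin.rev j : ℕ) < n / 2 then -gam ⟨Fin.rev j, h⟩ p
  else 0

lemma cval_eq {n : ℕ} (p : Chart n) (j : Fin n) : cval p j = exp (clog j p) := by
  simp only [cval, clog]; split_ifs <;> simp

lemma isLinearMap_clog {n : ℕ} (j : Fin n) : IsLinearMap ℂ (clog (n := n) j) where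
  map_add u v := by simp only [clog, gam]; split_ifs <;> simp; ring
  map_smul r u := by simp only [clog, gam]; split_ifs <;> simp

lemma clog_rev {n : ℕ} (j : Fin n) (p : Chart n) : clog (Fin.rev j) p = -clog j p := by
  have hj := Fin.val_rev j
  simp only [clog, Fin.rev_rev]
  split_ifs <;> first | (exfalso; omega) | simp

lemma mu_rev {n : ℕ} (j : Fin n) (p : Chart n) : mu (Fin.rev j) p = -mu j p := by
  simp only [mu, dstar, Fin.rev_rev, neg_add, ← Finset.sum_neg_distrib]
  congr 1 <;> exact Finset.sum_congr rfl fun k _ => by ring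

lemma mval_rev {n : ℕ} (p : Chart n) (j : Fin n) : mval p (Fin.rev j) = (mval p j)⁻¹ := by
  rw [mval, mval, mu_rev, Complex.exp_neg, mul_inv, ← inv_pow]; norm_num

lemma diff_listProd {X α : Type*} [NormedAddCommGroup X] [NormedSpace ℂ X] {n : ℕ} {q : X} (l : List α)
    {f : α → X → Matrix (Fin n) (Fin n) ℂ} (h : ∀ a ∈ l, ∀ i j, DifferentiableAt ℂ (fun x => f a x i j) q) :
    ∀ i j, DifferentiableAt ℂ (fun x => (l.map fun a => f a x).prod i j) q := by
  induction l with
  | nil => intro i j; simp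
  | cons a l ih =>
    simp only [List.map_cons, List.prod_cons]
    exact diff_mul (h a (by simp)) (ih fun b hb => h b (by simp [hb]))

lemma differentiableAt_mval (j : Fin (m + 1)) : DifferentiableAt ℂ (fun q => mval q j) p := by
  simp only [mval]
  exact (IsLinearMap.diff (isLinearMap_mu j)).cexp.const_mul _

lemma differentiableAt_C0 (hp : p ∈ regularLocus (m + 1)) (i j : Fin (m + 1)) :
    DifferentiableAt ℂ (fun q => C0 q i j) p := by
  simp only [C0, of_apply, cval_eq]
  refine (IsLinearMap.diff (isLinearMap_clog j)).cexp.mul ?_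
  have hm := fun j => (differentiableAt_mval (p := p) j).inv (mval_ne_zero p j)
  -- The projector as an ordered product of factors linear in M₀, so that differentiability is
  -- inherited factor by factor; distinct eigenvalues keep the denominators away from zero.
  have e : ∀ q : Chart (m + 1), Polynomial.aeval (M0 q) (Lagrange.basis Finset.univ (fun k => (mval q k)⁻¹) j)
      = (((Finset.univ.erase j).toList).map fun k =>
        (((mval q j)⁻¹ - (mval q k)⁻¹)⁻¹ • (M0 q - diagonal fun _ => (mval q k)⁻¹))).prod := fun q => by
    rw [Lagrange.basis, ← Finset.prod_map_toList, map_list_prod, List.map_map]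
    congr 1
    refine List.map_congr_left fun k _ => ?_
    simp only [Function.comp, Lagrange.basisDivisor, map_mul, map_sub, Polynomial.aeval_C, Polynomial.aeval_X,
      Algebra.algebraMap_eq_smul_one, smul_mul_assoc, one_mul]
    rw [smul_one_eq_diagonal]
  simp only [e]
  refine diff_listProd _ (fun k hk a b => ?_) i j
  have hk : k ≠ j := by simpa using hk
  simp only [Matrix.smul_apply, Matrix.sub_apply, smul_eq_mul]
  refine (((hm j).sub (hm k)).inv (sub_ne_zero.2 fun h => hk (inv_mval_inj hp h).symm)).mul
    ((HasJet.M0.diff (w := 0) a b).sub ?_)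
  by_cases hab : a = b
  · simp only [hab, diagonal_apply_eq]; exact hm k
  · simp [hab]

end Connection

end

section

open Jet Ext

/-! ### The connection matrix -/

section Connection

variable {m : ℕ} {p : Chart (m + 1)} {w : Fin 2 → Chart (m + 1)}

variable (p w) in
def gJ (j : Fin (m + 1)) : LogJet := lev p w (clog j)

lemma isOpen_regularLocus (m : ℕ) : IsOpen (regularLocus (m + 1)) := by
  have e : regularLocus (m + 1) = ⋂ i : Fin (m + 1), ⋂ j : Fin (m + 1), ⋂ _ : i ≠ j,
      {p : Chart (m + 1) | mval p i ≠ mval p j} := by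
    ext p
    simp only [regularLocus, Function.Injective, Set.mem_ofPred_eq, Set.mem_iInter]
    exact ⟨fun h i j hij h' => hij (h h'), fun h i j hij => by_contra fun h' => h i j h' hij⟩
  have hc : ∀ j : Fin (m + 1), Continuous fun p : Chart (m + 1) => mval p j := fun j =>
    continuous_iff_continuousAt.2 fun p => (differentiableAt_mval j).continuousAt
  rw [e]
  exact isOpen_iInter_of_finite fun i => isOpen_iInter_of_finite fun j => isOpen_iInter_of_finite fun _ =>
    isOpen_ne_fun (hc i) (hc j)

/-- Entries above the diagonal vanish identically, so the derivatives are triangular too. The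
diagonal is known to be c only on the regular locus; this set is open, which suffices for the
derivative. -/
lemma exists_jet_C0 (hp : p ∈ regularLocus (m + 1)) :
    ∃ x : Jet (Fin (m + 1)), HasJet p w C0 x ∧ LT x (gJ p w) := by
  have hu : IsUnit (C0 p) := by
    rw [isUnit_iff_isUnit_det, det_of_isLowerTriangular _ C0_lower]
    refine isUnit_iff_ne_zero.2 (Finset.prod_ne_zero_iff.2 fun i _ => ?_)
    rw [C0_diag hp, cval_eq]; exact exp_ne_zero _
  obtain ⟨x, hx⟩ := HasJet.of_isUnit (w := w) (differentiableAt_C0 hp) hu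
  have hm : x.m.IsLowerTriangular := hx.val ▸ C0_lower
  have hgi : x.gi.IsLowerTriangular := by
    rw [← inv_eq_gi]
    have : Invertible x.m := (isUnit_m x).invertible
    exact blockTriangular_inv_of_blockTriangular hm
  have hd : ∀ k, (mder C0 p (w k)).IsLowerTriangular := fun k i j hij => by
    have : (fun q : Chart (m + 1) => C0 q i j) = fun _ => 0 := funext fun q => C0_lower hij
    simp only [mder, of_apply, this]; simp
  have ha : ∀ k, x.a k = x.gi * mder C0 p (w k) := fun k => by rw [hx.der, gi_mul_m_assoc]
  have hdm : ∀ i, x.m i i = exp (gJ p w i).1 := fun i => by rw [← hx.val, C0_diag hp, cval_eq]; rfl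
  refine ⟨x, hx, ⟨hm, hgi, fun k => ha k ▸ hgi.mul (hd k)⟩, hdm, fun k i => ?_⟩
  have h1 := BlockTriangular.mul_diag (toDual_inj _) hgi hm i
  rw [gi_mul_m, one_apply_eq, hdm] at h1
  rw [ha, BlockTriangular.mul_diag (toDual_inj _) hgi (hd k)]
  have h2 : mder C0 p (w k) i i = exp (gJ p w i).1 * (gJ p w i).2 k := by
    simp only [mder, of_apply]
    have e : (fun q : Chart (m + 1) => C0 q i i) =ᶠ[nhds p] fun q => exp (clog i q) := by
      filter_upwards [(isOpen_regularLocus m).mem_nhds hp] with q hq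
      rw [C0_diag hq, cval_eq]
    rw [e.fderiv_eq, ((IsLinearMap.diff (isLinearMap_clog i)).hasFDerivAt.cexp).fderiv,
      _root_.smul_apply, IsLinearMap.fderiv_eq (isLinearMap_clog i)]; rfl
  rw [h2]
  linear_combination (-(gJ p w i).2 k) * h1

end Connection

/-! ### The vertices of the graph -/

section Vertices

variable {m : ℕ} {p : Chart (m + 1)} {w : Fin 2 → Chart (m + 1)}

lemma fg_relation_XJ (p : Chart (m + 1)) (w : Fin 2 → Chart (m + 1)) :
    io (A1J p w) * io (A2J p w) * io (A3J p w) = z (phi m (XJ p w)) := fg_relation m (XJ_bd p w)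

/-- The jets of the jump matrices. -/
def jumpJ (p : Chart (m + 1)) (w : Fin 2 → Chart (m + 1)) (x : Jet (Fin (m + 1))) : Edge → Jet (Fin (m + 1))
  | .stokesR => (NJ p w)⁻¹
  | .stokesL => tinv (NJ p w)⁻¹
  | .arcTop => QJ p w
  | .arcBot => tinv (QJ p w)
  | .a1 => A1J p w
  | .a2 => A2J p w
  | .a3 => A3J p w
  | .a1' => tinv (A1J p w)
  | .a2' => tinv (A2J p w)
  | .a3' => tinv (A3J p w)
  | .dR => DJ p w
  | .dL => (DJ p w)⁻¹
  | .mono => M0J p w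
  | .circle => x
  | .inner => LamJ p w

lemma HasJet.jump {x : Jet (Fin (m + 1))} (hx : HasJet p w C0 x) (e : Edge) :
    HasJet p w (FrobeniusStokes.jump e) (jumpJ p w x e) := by
  cases e
  exacts [HasJet.S, HasJet.S.invT, HasJet.Q, HasJet.Q.invT, HasJet.A1, HasJet.A2, HasJet.A3, HasJet.A1.invT,
    HasJet.A2.invT, HasJet.A3.invT, HasJet.D, HasJet.D.inv, HasJet.M0, hx, HasJet.Lam]

def outJ (x : Jet (Fin (m + 1))) (p : Chart (m + 1)) (w : Fin 2 → Chart (m + 1)) (h : Edge × Bool) :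
    Jet (Fin (m + 1)) := if h.2 then jumpJ p w x h.1 else (jumpJ p w x h.1)⁻¹

lemma HasJet.outJ {x : Jet (Fin (m + 1))} (hx : HasJet p w C0 x) (h : Edge × Bool) :
    HasJet p w (outJump FrobeniusStokes.jump h) (FrobeniusStokes.outJ x p w h) := by
  obtain ⟨e, b⟩ := h
  cases b
  · exact (HasJet.jump hx e).inv
  · exact HasJet.jump hx e

/-- One identity in the extension has two faces: the jet component is the vertex condition, the
central component is the value of the form. -/
lemma vertex_form {x : Jet (Fin (m + 1))} (hx : HasJet p w C0 x) {star : List (Edge × Bool)} {s : ℂ}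
    (h : (star.map fun e => io (outJ x p w e)).prod = z s) :
    (star.map fun e => outJump jump e p).prod = 1 ∧
      starForm (star.map (outJump jump)) p (w 0) (w 1) = s := by
  have hj : (star.map (outJ x p w)).prod = 1 := by
    have := congrArg Ext.j h
    rw [show (star.map fun e => io (outJ x p w e)) = (star.map (outJ x p w)).map io by
      rw [List.map_map]; rfl, io_mul_list] at this
    exact this
  constructor
  · have h1 := (HasJet.listProd star fun e _ => HasJet.outJ hx e).val
    rw [hj] at h1; exact h1
  · have h1 := starForm_eq (p := p) (w := w) (star.map fun e => (outJump jump e, outJ x p w e))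
      (by intro J hJ; obtain ⟨e, -, rfl⟩ := List.mem_map.1 hJ; exact HasJet.outJ hx e)
      (by rw [List.map_map]; exact hj)
    rw [List.map_map, List.map_map] at h1
    refine h1.trans ?_
    have := congrArg Ext.s h
    exact this

/-- Up to signs that cancel, the four factors are triangular with diagonals -γ, -μ, γ, μ, and the
pairings add up to 2⟨γ, μ⟩. The derivatives of the product vanish because the relation C₀⁻¹M₀C₀Λ = 1
holds in a neighbourhood of p. -/
lemma beta_vertex {x : Jet (Fin (m + 1))} (hx : HasJet p w C0 x) (hl : LT x (gJ p w)) :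
    (io x)⁻¹ * io (M0J p w) * io x * io (LamJ p w) = z (2 * brv (gJ p w) (muJ p w)) := by
  have hb := toDual_inj (m + 1)
  have hmu : LT (tor (muJ p w)) (muJ p w) := DT.tor _
  have h := (((DT.inv hb hl).io.mul hb (LT.M0P p w).io).mul hb hl.io).mul hb hmu.io
  have e : (io x)⁻¹ * io (M0J p w) * io x * io (LamJ p w)
      = io x⁻¹ * io (M0P p w) * io x * io (tor (muJ p w)) := by
    have hκ := io_scu_comm (n := m + 1) ((-1) ^ m)
    rw [M0J_eq, LamJ, io_kap_mul, io_kap_mul, ← io_inv, ← mul_assoc (io x⁻¹), ← hκ, mul_assoc, mul_assoc,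
      mul_assoc, ← mul_assoc (io x), ← io_scu_comm, mul_assoc, ← mul_assoc (io (M0P p w)), ← io_scu_comm,
      mul_assoc (io (kap _)) (io (M0P p w)), ← mul_assoc (io x⁻¹), ← io_scu_comm, ← mul_assoc, ← mul_assoc,
      ← mul_assoc, ← mul_assoc, io_kap_mul_kap, ← map_mul, ← pow_add, show m + (m + 2) = 2 * (m + 1) by ring, pow_mul]
    simp [mul_assoc]
  rw [e, eq_z_iff]
  constructor
  · have hder : HasJet p w (fun q => (C0 q)⁻¹ * M0 q * C0 q * Lam q) (x⁻¹ * M0J p w * x * LamJ p w) :=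
      ((hx.inv.mul HasJet.M0).mul hx).mul HasJet.Lam
    have h1 : (fun q => (C0 q)⁻¹ * M0 q * C0 q * Lam q) =ᶠ[nhds p] fun _ => 1 := by
      have hdet : ∀ᶠ q in nhds p, (C0 q).det ≠ 0 :=
        (diff_det hx.diff).continuousAt.eventually_ne
          ((isUnit_iff_isUnit_det _).1 (hx.val ▸ isUnit_m x)).ne_zero
      filter_upwards [hdet] with q hq
      have hL : IsUnit (Lam q).det := by
        have := isUnit_m (LamJ q (0 : Fin 2 → Chart (m + 1)))
        rw [← HasJet.Lam.val] at this
        exact (isUnit_iff_isUnit_det _).1 this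
      rw [mul_assoc (C0 q)⁻¹, C0_eigen, ← mul_assoc, nonsing_inv_mul _ (isUnit_iff_ne_zero.2 hq), one_mul,
        nonsing_inv_mul _ hL]
    have e3 : x⁻¹ * M0J p w * x * LamJ p w = 1 := by
      refine ext_m ?_ fun k => ?_
      · rw [← hder.val, h1.eq_of_nhds]; rfl
      · have h2 := hder.der k
        have h3 : mder (fun q => (C0 q)⁻¹ * M0 q * C0 q * Lam q) p (w k) = 0 := by
          rw [← mder_const (p := p) (1 : Matrix (Fin (m + 1)) (Fin (m + 1)) ℂ) (w k)]
          ext i j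
          simp only [mder, of_apply]
          exact DFunLike.congr_fun (Filter.EventuallyEq.fderiv_eq
            (h1.mono fun q hq => congrFun (congrFun hq i) j)) _
        rw [h3, ← hder.val, h1.eq_of_nhds, one_mul] at h2
        exact h2.symm
    have := congrArg Ext.j e
    simp only [mul_j, inv_j, io_j] at this
    simp only [mul_j, io_j, ← this, e3]
  · refine h.s.trans ?_
    simp only [brv_add_left, brv_neg_left, brv_neg_right, brv_self]
    rw [brv_swap (muJ p w) (gJ p w)]
    ring

/-- q₁ and f₁ are obtained from q₀ and f₀ by `etinv` and have the same central values. At f₀ the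
outgoing product is the inverse of A₁A₂A₃, whence the minus sign before `phi`. -/
theorem vertex_conditions {x : Jet (Fin (m + 1))} (hx : HasJet p w C0 x) (hl : LT x (gJ p w)) :
    VertexConditions stokesGraph jump p ∧
      graphForm stokesGraph jump p (w 0) (w 1) = 2 * (-phi m (XJ p w)) + 2 * qval p w
        + 2 * brv (gJ p w) (muJ p w) + 2 * brv (l2J p w) (dJ p w) := by
  have hN := NJ_word p w
  have hf := fg_relation_XJ p w
  have h0 := vertex_form hx (star := [(.stokesR, true), (.arcTop, true), (.a1, true), (.dR, true), (.a3', true),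
    (.arcBot, false)]) (s := qval p w) (by
      simp only [List.map_cons, List.map_nil, List.prod_cons, List.prod_nil, outJ, jumpJ, if_true, if_false,
        mul_one, io_inv, reduceCtorEq]
      simp only [mul_assoc] at hN
      rw [hN]; group)
  have h1 := vertex_form hx (star := [(.stokesL, true), (.arcBot, true), (.a1', true), (.dL, true), (.a3, true),
    (.arcTop, false)]) (s := qval p w) (by
      have hN' := congrArg etinv hN
      have hD : tinv (DJ p w) = (DJ p w)⁻¹ := by rw [DJ, tinv_tor, tor_neg]
      simp only [map_mul, map_inv, etinv_io, tinv_tinv, etinv_z, hD] at hN'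
      simp only [List.map_cons, List.map_nil, List.prod_cons, List.prod_nil, outJ, jumpJ, if_true, if_false,
        mul_one, io_inv, map_inv, reduceCtorEq] at hN' ⊢
      simp only [mul_assoc] at hN'
      rw [hN']; group)
  have h2 := vertex_form hx (star := [(.a3, false), (.a2, false), (.a1, false)]) (s := -phi m (XJ p w)) (by
      simp only [List.map_cons, List.map_nil, List.prod_cons, List.prod_nil, outJ, jumpJ, if_false,
        mul_one, io_inv, reduceCtorEq]
      rw [z_neg, ← hf]; group)
  have h3 := vertex_form hx (star := [(.a3', false), (.a2', false), (.a1', false)]) (s := -phi m (XJ p w)) (by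
      have hf' := congrArg etinv hf
      simp only [map_mul, etinv_io, etinv_z] at hf'
      simp only [List.map_cons, List.map_nil, List.prod_cons, List.prod_nil, outJ, jumpJ, if_false,
        mul_one, io_inv, reduceCtorEq]
      rw [z_neg, ← hf']; group)
  have h4 := vertex_form hx (star := [(.a2, true), (.dL, false), (.a2', true), (.mono, false), (.dR, false)])
    (s := 2 * brv (l2J p w) (dJ p w)) (by
      simp only [List.map_cons, List.map_nil, List.prod_cons, List.prod_nil, outJ, jumpJ, if_true, if_false,
        mul_one, io_inv, inv_inv, reduceCtorEq]
      rw [← monodromy_val]; simp only [mul_assoc])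
  have h5 := vertex_form hx (star := [(.circle, false), (.mono, true), (.circle, true), (.inner, true)])
    (s := 2 * brv (gJ p w) (muJ p w)) (by
      simp only [List.map_cons, List.map_nil, List.prod_cons, List.prod_nil, outJ, jumpJ, if_true, if_false,
        mul_one, io_inv, reduceCtorEq]
      rw [← beta_vertex hx hl]; simp only [mul_assoc])
  constructor
  · intro star hs
    simp only [stokesGraph, List.mem_cons, List.not_mem_nil, or_false] at hs
    rcases hs with rfl | rfl | rfl | rfl | rfl | rfl
    exacts [h0.1, h1.1, h2.1, h3.1, h4.1, h5.1]
  · simp only [graphForm, stokesGraph, List.map_cons, List.map_nil, List.sum_cons, List.sum_nil]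
    simp only [List.map_cons, List.map_nil] at h0 h1 h2 h3 h4 h5
    rw [h0.2, h1.2, h2.2, h3.2, h4.2, h5.2]; ring

end Vertices

end

section

open Jet Ext

/-! ### The explicit expression of the form -/

section Explicit

lemma sum_antisymm {α : Type*} (s : Finset α) (B : α → α → ℂ) (X : α → LogJet) :
    ∑ t ∈ s, ∑ t' ∈ s, B t t' * br (X t) (X t')
      = (1 / 2) * ∑ t ∈ s, ∑ t' ∈ s, (B t t' - B t' t) * br (X t) (X t') := by
  have h : ∑ t ∈ s, ∑ t' ∈ s, B t' t * br (X t) (X t') = -∑ t ∈ s, ∑ t' ∈ s, B t t' * br (X t) (X t') := by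
    rw [Finset.sum_comm, ← Finset.sum_neg_distrib]
    refine Finset.sum_congr rfl fun t _ => ?_
    rw [← Finset.sum_neg_distrib]
    refine Finset.sum_congr rfl fun t' _ => ?_
    rw [br_swap]; ring
  simp only [sub_mul, Finset.sum_sub_distrib, h]
  ring

lemma br_sum_smul {α β : Type*} (s : Finset α) (s' : Finset β) (f : α → ℂ) (g : β → ℂ) (X : α → LogJet)
    (Y : β → LogJet) : br (∑ t ∈ s, f t • X t) (∑ t ∈ s', g t • Y t)
      = ∑ t ∈ s, ∑ t' ∈ s', f t * g t' * br (X t) (Y t') := by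
  rw [br_sum_left]
  refine Finset.sum_congr rfl fun t _ => ?_
  rw [br_smul_left, br_sum_right, Finset.mul_sum]
  refine Finset.sum_congr rfl fun t' _ => ?_
  rw [br_smul_right]; ring

lemma brv_sum_smul {n : ℕ} {α β : Type*} (s : Finset α) (s' : Finset β) (f : α → Fin n → ℂ) (g : β → Fin n → ℂ)
    (X : α → LogJet) (Y : β → LogJet) :
    brv (fun j => ∑ t ∈ s, f t j • X t) (fun j => ∑ t ∈ s', g t j • Y t)
      = ∑ t ∈ s, ∑ t' ∈ s', dtr (f t) (g t') * br (X t) (Y t') := by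
  simp only [brv, br_sum_smul, dtr, Finset.sum_mul]
  rw [Finset.sum_comm]
  exact Finset.sum_congr rfl fun t _ => Finset.sum_comm

variable {m : ℕ} {p : Chart (m + 1)} {w : Fin 2 → Chart (m + 1)}

lemma dtr_comm {n : ℕ} (u v : Fin n → ℂ) : dtr u v = dtr v u := by simp [dtr, mul_comm]

lemma wedge_lev {n : ℕ} {p : Chart n} {w : Fin 2 → Chart n} {f g : Chart n → ℂ} (hf : IsLinearMap ℂ f)
    (hg : IsLinearMap ℂ g) : wedge f g p (w 0) (w 1) = br (lev p w f) (lev p w g) := by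
  rw [wedge_eq_br, ev_eq_lev hf, ev_eq_lev hg]

/-- Values of the coordinates at a triple. -/
def XT (p : Chart (m + 1)) (w : Fin 2 → Chart (m + 1)) (t : ℕ × ℕ × ℕ) : LogJet := XJ p w t.1 t.2.1 t.2.2

lemma wedge_xi (t t' : ℕ × ℕ × ℕ) : wedge (xi t.1 t.2.1 t.2.2) (xi t'.1 t'.2.1 t'.2.2) p (w 0) (w 1)
    = br (XT p w t) (XT p w t') := wedge_lev (isLinearMap_xi _ _ _) (isLinearMap_xi _ _ _)

lemma wedge_xi_zeta (t : ℕ × ℕ × ℕ) (k : Fin (m + 1 - 1)) : wedge (xi t.1 t.2.1 t.2.2) (zeta k) p (w 0) (w 1)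
    = br (XT p w t) (lev p w (zeta k)) := wedge_lev (isLinearMap_xi _ _ _) (isLinearMap_zeta k)

lemma ssum_cy (m : ℕ) (e : ℕ → ℕ → ℕ → LogJet) :
    ssum m (cy e) = tsm (m + 1) fun a b c => ((m : ℂ) + 1 - b) • e a b c :=
  tsm_cyc (m + 1) fun a b c => ((m : ℂ) + 1 - b) • e a b c

lemma ssum_cy_cy (m : ℕ) (e : ℕ → ℕ → ℕ → LogJet) :
    ssum m (cy (cy e)) = tsm (m + 1) fun a b c => ((m : ℂ) + 1 - c) • e a b c := by
  rw [← tsm_cyc, ← tsm_cyc (m + 1)]; rfl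

/-- Both sides are brought to antisymmetrized double sums over triples, where coefficients can be
compared; equal triples drop out because br(X, X) = 0. -/
lemma neg_phi : -phi m (XJ p w) = omegaF p (w 0) (w 1) := by
  have e1 : ssum m (XJ p w) = ∑ t ∈ triples (m + 1), ((m : ℂ) + 1 - t.1) • XT p w t := rfl
  have e2 : ssum m (cy (XJ p w)) = ∑ t ∈ triples (m + 1), ((m : ℂ) + 1 - t.2.1) • XT p w t := ssum_cy _ _
  have e3 : ssum m (cy (cy (XJ p w))) = ∑ t ∈ triples (m + 1), ((m : ℂ) + 1 - t.2.2) • XT p w t := ssum_cy_cy _ _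
  have et : theta m (fun a b c => ((m : ℂ) + 1) • XJ p w a b c) = (1 / 2) * ∑ t ∈ triples (m + 1),
      ∑ t' ∈ triples (m + 1), ((m : ℂ) + 1) ^ 2 * (gcoef ((t'.1 : ℤ) - t.1) ((t'.2.1 : ℤ) - t.2.1) ((t'.2.2 : ℤ) - t.2.2) : ℂ)
        * br (XT p w t) (XT p w t') := by
    rw [theta, tsm]
    congr 1
    refine Finset.sum_congr rfl fun t _ => ?_
    rw [tsm]
    refine Finset.sum_congr rfl fun t' _ => ?_
    rw [br_smul_left, br_smul_right, XT, XT]; ring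
  rw [phi, et, e1, e2, e3, br_sum_smul, br_sum_smul, br_sum_smul, ← Finset.sum_add_distrib, ← Finset.sum_add_distrib]
  simp only [← Finset.sum_add_distrib, ← add_mul]
  rw [sum_antisymm (triples (m + 1)) (fun t t' => ((m : ℂ) + 1 - t.1) * (m + 1 - t'.2.1)
    + (m + 1 - t.1) * (m + 1 - t'.2.2) + (m + 1 - t.2.1) * (m + 1 - t'.2.2)), omegaF, mul_left_comm, ← mul_sub, ← mul_neg]
  congr 1
  rw [Finset.mul_sum, ← Finset.sum_sub_distrib, ← Finset.sum_neg_distrib]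
  refine Finset.sum_congr rfl ?_
  rintro ⟨a, b, c⟩ ht
  rw [Finset.mul_sum, ← Finset.sum_sub_distrib, ← Finset.sum_neg_distrib]
  refine Finset.sum_congr rfl ?_
  rintro ⟨a', b', c'⟩ ht'
  have h := mem_triples.1 ht
  have h' := mem_triples.1 ht'
  rw [wedge_xi]
  by_cases hne : a = a' ∧ b = b'
  · obtain ⟨rfl, rfl⟩ := hne
    obtain rfl : c = c' := by omega
    rw [br_self]; ring
  · rw [Fco_eq (n := m + 1) h.2.2.2 h'.2.2.2 hne]
    push_cast; ring

lemma u1J_eq : u1J p w = fun j => ∑ t ∈ triples (m + 1), hvec (m + 1) t.1 j • XT p w t := by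
  funext j
  simp only [u1J, l1J, bdiag, tsm, dstar, Fin.rev_rev]; rfl

lemma l2J_eq' : l2J p w = fun j => ∑ t ∈ triples (m + 1), dstar (hvec (m + 1) t.2.1) j • XT p w t :=
  funext fun j => l2J_eq p w j

lemma l3J_eq' : l3J p w = fun j => ∑ t ∈ triples (m + 1), dstar (hvec (m + 1) t.2.2) j • XT p w t :=
  funext fun j => l3J_eq p w j

lemma dJ_eq' : dJ p w = fun j => ∑ k : Fin (m + 1 - 1), alpha (m + 1) (k + 1) j • lev p w (zeta k) := rfl

lemma qval_eq : qval p w = omegaQ p (w 0) (w 1) := by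
  rw [qval, omegaQ, brv_swap (dJ p w) (l3J p w), sub_neg_eq_add, sub_add_eq_add_sub, u1J_eq, l3J_eq', dJ_eq', brv_sum_smul,
    brv_sum_smul, brv_sum_smul, ← Finset.sum_add_distrib, Finset.sum_comm (s := Finset.univ), sub_eq_add_neg]
  congr 1
  · refine Finset.sum_congr rfl fun t _ => ?_
    rw [← Finset.sum_add_distrib]
    refine Finset.sum_congr rfl fun k _ => ?_
    rw [wedge_xi_zeta, ← add_mul]
    congr 1
    simp only [dtr, ← Finset.sum_add_distrib, Pi.add_apply]
    exact Finset.sum_congr rfl fun j _ => by ring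
  · rw [← Finset.sum_neg_distrib]
    simp only [← Finset.sum_neg_distrib, ← neg_mul]
    rw [sum_antisymm]
    congr 1
    refine Finset.sum_congr rfl fun t _ => Finset.sum_congr rfl fun t' _ => ?_
    rw [wedge_xi, dtr_comm (dstar _) (hvec _ _)]; ring

lemma s_val_eq : 2 * brv (l2J p w) (dJ p w) = omegaS p (w 0) (w 1) := by
  rw [omegaS, l2J_eq', dJ_eq', brv_sum_smul, Finset.sum_comm (s := Finset.univ)]
  congr 1
  refine Finset.sum_congr rfl fun t _ => Finset.sum_congr rfl fun k _ => ?_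
  rw [wedge_xi_zeta, dtr_comm]

lemma sum_half_add {n : ℕ} {A : Type*} [AddCommMonoid A] (f : Fin n → A)
    (h0 : ∀ j : Fin n, ¬ (j : ℕ) < n / 2 → ¬ (Fin.rev j : ℕ) < n / 2 → f j = 0) :
    ∑ j, f j = ∑ k : Fin (n / 2), (f (halfIdx k) + f (Fin.rev (halfIdx k))) := by
  have key : ∀ g : Fin n → A, ∑ j : Fin n, (if (j : ℕ) < n / 2 then g j else 0) = ∑ k : Fin (n / 2), g (halfIdx k) := by
    intro g
    rw [← Finset.sum_filter]
    symm
    refine Finset.sum_bij (fun k _ => halfIdx k) (fun k _ => ?_) (fun k _ k' _ h => ?_) (fun j hj => ?_) fun _ _ => rfl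
    · simp [halfIdx]
    · exact Fin.ext (by simpa [halfIdx] using h)
    · exact ⟨⟨j, (Finset.mem_filter.1 hj).2⟩, Finset.mem_univ _, rfl⟩
  rw [Finset.sum_add_distrib, ← key, ← key fun j => f (Fin.rev j),
    ← Equiv.sum_comp Fin.revPerm fun j => if (j : ℕ) < n / 2 then f (Fin.rev j) else 0, ← Finset.sum_add_distrib]
  refine Finset.sum_congr rfl fun j _ => ?_
  have hj := Fin.val_rev j
  simp only [Fin.revPerm_apply, Fin.rev_rev]
  split_ifs with h1 h2 h2
  · omega
  · rw [add_zero]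
  · rw [zero_add]
  · rw [h0 j h1 h2, add_zero]

lemma clog_mid {n : ℕ} (j : Fin n) (h1 : ¬ (j : ℕ) < n / 2) (h2 : ¬ (Fin.rev j : ℕ) < n / 2) : clog j = 0 := by
  funext q; simp only [clog, dif_neg h1, dif_neg h2]; rfl

lemma clog_halfIdx {n : ℕ} (k : Fin (n / 2)) : clog (halfIdx k) = gam (n := n) k := by
  funext q; exact dif_pos k.2

/-- γ and μ are both odd under reversal of the index, so opposite places contribute equally: the
factor 2 over all places becomes 4 over half of them. -/
lemma beta_val_eq : 2 * brv (gJ p w) (muJ p w) = omegaBeta p (w 0) (w 1) := by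
  rw [omegaBeta, brv, sum_half_add _ fun j h1 h2 => by rw [gJ, clog_mid j h1 h2, map_zero, br_zero_left],
    Finset.mul_sum, Finset.mul_sum]
  refine Finset.sum_congr rfl fun k _ => ?_
  have e1 : gJ p w (Fin.rev (halfIdx k)) = -gJ p w (halfIdx k) := by
    rw [gJ, show clog (Fin.rev (halfIdx k)) = -clog (n := m + 1) (halfIdx k) from funext fun q => clog_rev _ _, map_neg]; rfl
  have e2 : muJ p w (Fin.rev (halfIdx k)) = -muJ p w (halfIdx k) := by
    rw [← mu_eq, ← mu_eq, show mu (Fin.rev (halfIdx k)) = -mu (n := m + 1) (halfIdx k) from funext fun q => mu_rev _ _, map_neg]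
  rw [e1, e2, wedge_lev (isLinearMap_gam k) (isLinearMap_mu _), mu_eq, gJ, clog_halfIdx]
  simp; ring

theorem OmegaSigma_eq (hp : p ∈ regularLocus (m + 1)) (u v : Chart (m + 1)) :
    OmegaSigma p u v = omegaExplicit p u v := by
  obtain ⟨x, hx, hl⟩ := exists_jet_C0 (w := ![u, v]) hp
  have h := (vertex_conditions hx hl).2
  rw [neg_phi, qval_eq, s_val_eq, beta_val_eq] at h
  exact h

end Explicit

/-! ### The Stokes matrix -/

section Parametrization

variable {m : ℕ} (p : Chart (m + 1))

lemma A123 : A1 p * A2 p * A3 p = 1 := by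
  have h := congrArg (fun x => x.j.m) (fg_relation_XJ p 0)
  have h1 := HasJet.A1 (p := p) (w := 0)
  have h2 := HasJet.A2 (p := p) (w := 0)
  have h3 := HasJet.A3 (p := p) (w := 0)
  rw [h1.val, h2.val, h3.val]
  exact h

lemma Smat_unipotent : IsUpperUnipotent (Smat p) := by
  rw [HasJet.S.val (w := 0)]
  have h : UT (NJ p 0)⁻¹ (-0) := DT.inv Function.injective_id (UT.NJ p 0)
  exact ⟨h.tri.1, fun i => by rw [h.dm]; simp⟩

lemma det_ne_of_jet {w : Fin 2 → Chart (m + 1)} {J : Chart (m + 1) → Matrix (Fin (m + 1)) (Fin (m + 1)) ℂ} {x : Jet (Fin (m + 1))}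
    (h : HasJet p w J x) : IsUnit (J p).det := (isUnit_iff_isUnit_det _).1 (h.val ▸ isUnit_m x)

/-- The diagonal entries are d_j² R_{jj} with R independent of d, and the diagonal of QP⁻¹ is one
solution. -/
lemma normalization_iff (d : Fin (m + 1) → ℂ) :
    (∀ j, (Matrix.diagonal d * Pmat (m + 1) * A1 p * Dmat p * ((A3 p)⁻¹)ᵀ *
          (Matrix.diagonal d * Pmat (m + 1))ᵀ) j j = 1) ↔ ∀ j, d j ^ 2 = qdiag p j ^ 2 := by
  set R := Pmat (m + 1) * A1 p * Dmat p * ((A3 p)⁻¹)ᵀ * (Pmat (m + 1))ᵀ with hR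
  have key : ∀ d : Fin (m + 1) → ℂ, ∀ j, (Matrix.diagonal d * Pmat (m + 1) * A1 p * Dmat p * ((A3 p)⁻¹)ᵀ *
          (Matrix.diagonal d * Pmat (m + 1))ᵀ) j j = d j ^ 2 * R j j := fun d j => by
    have : Matrix.diagonal d * Pmat (m + 1) * A1 p * Dmat p * ((A3 p)⁻¹)ᵀ *
          (Matrix.diagonal d * Pmat (m + 1))ᵀ = diagonal d * R * diagonal d := by
      rw [transpose_mul, diagonal_transpose, hR]; simp only [mul_assoc]
    rw [this, mul_diagonal, diagonal_mul]; ring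
  have hq : ∀ j, qdiag p j ^ 2 * R j j = 1 := fun j => by
    rw [← key]
    have := HasJet.N.val (p := p) (w := 0)
    have h2 := (UT.NJ p 0).dm j
    rw [← this] at h2
    simpa [Qmat] using h2
  refine forall_congr' fun j => ?_
  rw [key]
  have hR0 : R j j ≠ 0 := fun h => by have := hq j; rw [h, mul_zero] at this; exact zero_ne_one this
  rw [← hq j]
  exact mul_left_inj' hR0

/-- In S S^{-t} the inner factors Q cancel; inserting A₁ = A₃⁻¹A₂⁻¹ makes M₀ appear. The identity is
verified for jets, where g ↦ g^{-t} is an automorphism. -/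
lemma S_mul_invT : Smat p * ((Smat p)⁻¹)ᵀ =
    ((Qmat p)⁻¹)ᵀ * (A3 p)ᵀ * M0 p * ((A3 p)⁻¹)ᵀ * (Qmat p)ᵀ := by
  have hS := HasJet.S (p := p) (w := 0)
  have hQ := HasJet.Q (p := p) (w := 0)
  have h3 := HasJet.A3 (p := p) (w := 0)
  have hM := HasJet.M0 (p := p) (w := 0)
  have e1 := (hS.mul hS.invT).val
  have e2 := ((((hQ.invT.mul h3.transpose).mul hM).mul h3.invT).mul hQ.transpose).val
  rw [e1, e2]
  congr 1
  have hA : A1J p (0 : Fin 2 → Chart (m + 1)) * A2J p 0 * A3J p 0 = 1 := congrArg Ext.j (fg_relation_XJ p 0)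
  have hA' : A1J p (0 : Fin 2 → Chart (m + 1)) = (A3J p 0)⁻¹ * (A2J p 0)⁻¹ := by
    rw [← _root_.mul_inv_rev]; exact eq_inv_of_mul_eq_one_left (by rw [← mul_assoc]; exact hA)
  have hD : tinv (DJ p (0 : Fin 2 → Chart (m + 1))) = (DJ p 0)⁻¹ := by rw [DJ, tinv_tor, tor_neg]
  rw [NJ, M0J, hA']
  simp only [map_mul, map_inv, tinv_tinv, hD]
  group

/-- S^{-t}S and S S^{-t} have the same characteristic polynomial, and the latter matrix is conjugate
to M₀. Its eigenvalues are the 1/m_j, which are the m_j in reversed order. -/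
lemma charpoly_S : (((Smat p)⁻¹)ᵀ * Smat p).charpoly = ∏ j, (Polynomial.X - Polynomial.C (mval p j)) := by
  rw [charpoly_mul_comm, S_mul_invT]
  have hQ := HasJet.Q (p := p) (w := 0)
  have h3 := HasJet.A3 (p := p) (w := 0)
  have hG := h3.invT.mul hQ.transpose
  have e := (hG.inv.mul (HasJet.M0 (p := p) (w := 0))).mul hG
  have e' : ((Qmat p)⁻¹)ᵀ * (A3 p)ᵀ * M0 p * ((A3 p)⁻¹)ᵀ * (Qmat p)ᵀ
      = (((A3 p)⁻¹)ᵀ * (Qmat p)ᵀ)⁻¹ * M0 p * (((A3 p)⁻¹)ᵀ * (Qmat p)ᵀ) := by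
    rw [Matrix.mul_inv_rev, transpose_nonsing_inv, transpose_nonsing_inv, nonsing_inv_nonsing_inv _
      (by rw [det_transpose]; exact det_ne_of_jet p h3)]
    simp only [mul_assoc]
  rw [e', hG.val, inv_eq_gi]
  have := charpoly_units_conj' (tinv (A3J p 0) * (tinv (QJ p 0))⁻¹).g (M0 p)
  rw [show (tinv (A3J p 0) * (tinv (QJ p 0))⁻¹).gi = (tinv (A3J p 0) * (tinv (QJ p 0))⁻¹).m⁻¹ from (inv_eq_gi _).symm]
  refine this.trans ?_
  rw [charpoly_of_lower M0_lower, ← Equiv.prod_comp Fin.revPerm]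
  refine Finset.prod_congr rfl fun j _ => ?_
  rw [M0_diag, Fin.revPerm_apply, mval_rev, inv_inv]

end Parametrization

end

section

open Jet Ext

/-! ### Rigidity of the triangular words -/

lemma mul_elm_apply {n : ℕ} (M : Matrix (Fin n) (Fin n) ℂ) (r : Fin n) (s : ℕ) (i j : Fin n) :
    (M * elm n r s) i j = if (j : ℕ) = s then M i r else 0 := by
  rw [Matrix.mul_apply, Finset.sum_eq_single r]
  · simp [elm_apply]
  · intro k _ hk
    rw [elm_apply, if_neg fun h => hk (Fin.ext h.1), mul_zero]
  · simp

/-- The torus of each letter is constant on the places where the earlier root factors act, so all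
torus parts move to the left and the other factor is a constant matrix. -/
lemma strip_split (n t : ℕ) (Y : ℕ → LogJet) (p : ℕ) :
    prodUp (fun j => letter n (t + j) (Y j)) p
      = tor (∑ j ∈ Finset.range p, low n (t + j + 2) (-Y j))
        * kap (prodUp (fun j => fu n (t + j)) p) := by
  induction p with
  | zero => simp [prodUp]
  | succ p ih =>
    have hc : tor (low n (t + p + 2) (-Y p)) * prodUp (fun j => kap (fu n (t + j))) p
        = prodUp (fun j => kap (fu n (t + j))) p * tor (low n (t + p + 2) (-Y p)) :=
      commute_prodUp fun i hi => tor_root_comm _ _ _ fun a b ha hb => by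
        simp [low, show (a : ℕ) < t + p + 2 by omega, show (b : ℕ) < t + p + 2 by omega]
    rw [prodUp_succ, ih, Finset.sum_range_succ, tor_add, prodUp_succ, map_mul, map_prodUp,
      letter]
    simp only [mul_assoc]
    rw [← mul_assoc _ _ (kap (fu n (t + p))), ← hc]
    simp only [mul_assoc]

lemma prodUp_fu_val (n t p : ℕ) :
    ((prodUp (fun j => fu n (t + j)) p : (Matrix (Fin n) (Fin n) ℂ)ˣ) : Matrix (Fin n) (Fin n) ℂ)
      = 1 + ∑ j ∈ Finset.range p, elm n (t + j + 1) (t + j) := by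
  induction p with
  | zero => simp [prodUp]
  | succ p ih =>
    have h0 : (∑ j ∈ Finset.range p, elm n (t + j + 1) (t + j)) * elm n (t + p + 1) (t + p) = 0 := by
      rw [Finset.sum_mul]
      exact Finset.sum_eq_zero fun j hj => elm_mul_elm_ne (by
        have := Finset.mem_range.1 hj; omega)
    rw [prodUp_succ, Units.val_mul, ih, Finset.sum_range_succ, fu, root_val, one_smul, mul_add,
      mul_one, add_mul, one_mul, h0, add_zero, add_assoc]

/-- Propagation along the columns from t on: column j of c determines column j + 1, and
triangularity forces consecutive entries of a to agree. -/
lemma rigid_column {m t : ℕ} (ht : t ≤ m) {c : Matrix (Fin (m + 1)) (Fin (m + 1)) ℂ}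
    {a : Fin (m + 1) → ℂ} (hl : ∀ i j : Fin (m + 1), i < j → c i j = 0)
    (hc : ∀ i j : Fin (m + 1), (j : ℕ) = t → i ≠ j → c i j = 0)
    (h : c * (1 + ∑ j ∈ Finset.range (m - t), elm (m + 1) (t + j + 1) (t + j))
      = (1 + ∑ j ∈ Finset.range (m - t), elm (m + 1) (t + j + 1) (t + j)) * diagonal a) :
    c = diagonal a ∧ ∀ j : Fin (m + 1), t ≤ j → a j = a ⟨t, by omega⟩ := by
  have hs : ∀ i j : Fin (m + 1), t ≤ j → ∀ hj : (j : ℕ) < m, c i j + c i ⟨j + 1, by omega⟩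
      = ((if i = j then 1 else 0) + if (i : ℕ) = j + 1 then 1 else 0) * a j := by
    intro i j htj hj
    have h1 := congrFun (congrFun h i) j
    rw [mul_add, mul_one, Matrix.add_apply, Finset.mul_sum, Matrix.sum_apply, mul_diagonal,
      Matrix.add_apply, Matrix.sum_apply, Finset.sum_eq_single ((j : ℕ) - t),
      Finset.sum_eq_single ((j : ℕ) - t)] at h1
    · rw [show t + ((j : ℕ) - t) = j by omega] at h1
      rw [show ((j : ℕ) + 1) = ((⟨j + 1, by omega⟩ : Fin (m + 1)) : ℕ) from rfl, mul_elm_apply,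
        if_pos rfl, Matrix.one_apply, elm_apply] at h1
      simpa using h1
    · intro k _ hk
      rw [elm_apply, if_neg (by omega)]
    · intro hk; exact absurd (Finset.mem_range.2 (by omega)) hk
    · intro k hk hk'
      have := Finset.mem_range.1 hk
      rw [show (t + k + 1) = ((⟨t + k + 1, by omega⟩ : Fin (m + 1)) : ℕ) from rfl,
        mul_elm_apply, if_neg (by omega)]
    · intro hk; exact absurd (Finset.mem_range.2 (by omega)) hk
  have hn : ∀ i j : Fin (m + 1), ((j : ℕ) < t ∨ (j : ℕ) = m) →
      c i j = (if i = j then 1 else 0) * a j := by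
    intro i j hj
    have h1 := congrFun (congrFun h i) j
    rw [mul_add, mul_one, Matrix.add_apply, Finset.mul_sum, Matrix.sum_apply, mul_diagonal,
      Matrix.add_apply, Matrix.sum_apply, Finset.sum_eq_zero, Finset.sum_eq_zero] at h1
    · rwa [add_zero, add_zero, Matrix.one_apply] at h1
    · intro k hk
      have := Finset.mem_range.1 hk
      rw [elm_apply, if_neg (by omega)]
    · intro k hk
      have := Finset.mem_range.1 hk
      rw [show (t + k + 1) = ((⟨t + k + 1, by omega⟩ : Fin (m + 1)) : ℕ) from rfl,
        mul_elm_apply, if_neg (by omega)]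
  set T : Fin (m + 1) := ⟨t, by omega⟩ with hT
  have hP : ∀ q, t ≤ q → ∀ hq : q < m + 1, (∀ i, c i ⟨q, hq⟩ = if i = ⟨q, hq⟩ then a T else 0) := by
    intro q hq
    induction q, hq using Nat.le_induction with
    | base =>
      intro hq i
      split_ifs with hi
      · subst hi
        rcases Nat.lt_or_ge t m with h1 | h1
        · have := hs T T le_rfl h1
          rw [hl T ⟨T + 1, _⟩ (by simp [Fin.lt_def])] at this
          simpa [hT] using this
        · have := hn T T (Or.inr (by simp [hT]; omega))
          simpa [hT] using this
      · exact hc _ _ rfl hi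
    | succ q hq ih =>
      intro hq1 i
      have ih := ih (by omega)
      have h1 := hs ⟨q, by omega⟩ ⟨q, by omega⟩ hq (by simp; omega)
      rw [ih, if_pos rfl, hl _ _ (by simp [Fin.lt_def])] at h1
      have h2 := hs i ⟨q, by omega⟩ hq (by simp; omega)
      rw [ih] at h2
      simp only [Fin.ext_iff] at h1 h2 ⊢
      simp only [add_zero, if_true, show ¬ (q = q + 1) by omega, if_false, one_mul] at h1
      rw [← h1] at h2
      have h3 : ¬ ((i : ℕ) = q ∧ (i : ℕ) = q + 1) := by omega
      by_cases e1 : (i : ℕ) = q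
      · have e2 : ¬ ((i : ℕ) = q + 1) := by omega
        simp only [e1, if_true, show ¬ (q = q + 1) by omega, if_false] at h2 ⊢
        linear_combination h2
      · simp only [e1, if_false] at h2
        split_ifs at h2 ⊢ with e2
        · linear_combination h2
        · linear_combination h2
  have ha : ∀ j : Fin (m + 1), t ≤ j → a j = a T := by
    intro j hj
    have h1 := hP j hj j.2 j
    rw [if_pos rfl] at h1
    rcases Nat.lt_or_ge j m with h2 | h2
    · have := hs j j hj h2
      rw [hl j ⟨j + 1, _⟩ (by simp [Fin.lt_def]), h1] at this
      simpa using this.symm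
    · have := hn j j (Or.inr (by omega))
      rw [h1] at this
      simpa using this.symm
  refine ⟨?_, ha⟩
  ext i j
  rcases Nat.lt_or_ge j t with h1 | h1
  · rw [hn i j (Or.inl h1), diagonal_apply]; split_ifs with e <;> simp [e]
  · rw [hP j h1 j.2 i, diagonal_apply]; split_ifs with e
    · rw [e, ha j h1]
    · rfl

/-- The hypothesis says dM = Ma - δM. Removing the constant factor leads to `rigid_column`; removing
the torus shifts a by the derivative of ν. The remaining factor R satisfies an equation of the same
kind, which makes the induction possible. -/
lemma strip_rigid {m t : ℕ} (ht : t ≤ m) {R M : Jet (Fin (m + 1))} {ν : Fin (m + 1) → LogJet}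
    {k : Fin 2} {a δ : Fin (m + 1) → ℂ}
    (hM : M = R * (tor ν * kap (prodUp (fun j => fu (m + 1) (t + j)) (m - t))))
    (hl : R ∈ Tri (OrderDual.toDual : Fin (m + 1) → (Fin (m + 1))ᵒᵈ))
    (hc : R ∈ Tri (fun i : Fin (m + 1) => if (i : ℕ) = t then (0 : ℕ) else 1))
    (h : M.a k = diagonal a - M.gi * diagonal δ * M.m) :
    (∀ j : Fin (m + 1), t ≤ j → a j = a ⟨t, by omega⟩) ∧
      R.a k = diagonal (fun j => a j - (ν j).2 k) - R.gi * diagonal δ * R.m := by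
  set B := prodUp (fun j => fu (m + 1) (t + j)) (m - t) with hB
  set Q := R * tor ν with hQ
  have hlQ := mul_mem hl (tor_mem_tri (OrderDual.toDual : Fin (m + 1) → (Fin (m + 1))ᵒᵈ) ν)
  have hcQ := mul_mem hc (tor_mem_tri (fun i : Fin (m + 1) => if (i : ℕ) = t then (0 : ℕ) else 1) ν)
  rw [← hQ] at hlQ hcQ
  have hM' : M = Q * kap B := by rw [hM, mul_assoc]
  have hBB : (B : Matrix (Fin (m + 1)) (Fin (m + 1)) ℂ) * (kap B).gi = 1 := (kap B).m_mul_gi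
  have hBB' : (kap B).gi * (B : Matrix (Fin (m + 1)) (Fin (m + 1)) ℂ) = 1 := (kap B).gi_mul_m
  have key : (Q.a k + Q.gi * diagonal δ * Q.m) * (B : Matrix (Fin (m + 1)) (Fin (m + 1)) ℂ)
      = B * diagonal a := by
    rw [hM'] at h
    simp only [mul_a, mul_gi, mul_m, kap_a, add_zero, kap_m] at h
    have h2 := congrArg (fun X => (B : Matrix (Fin (m + 1)) (Fin (m + 1)) ℂ) * X) h
    simp only [mul_sub, ← mul_assoc, hBB, one_mul] at h2
    rw [add_mul, h2]; simp only [mul_assoc]; abel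
  have hD : ∀ {α : Type} [LinearOrder α] (b : Fin (m + 1) → α), Q ∈ Tri b →
      (Q.a k + Q.gi * diagonal δ * Q.m).BlockTriangular b := fun b hb =>
    (hb.2.2 k).add ((hb.2.1.mul (blockTriangular_diagonal δ)).mul hb.1)
  rw [hB, prodUp_fu_val] at key
  obtain ⟨h1, h2⟩ := rigid_column (c := Q.a k + Q.gi * diagonal δ * Q.m) ht (fun i j hij => hD _ hlQ hij)
    (fun i j hj hij => hD _ hcQ (by
      have : (i : ℕ) ≠ t := fun e => hij (Fin.ext (by omega))
      change (if (j : ℕ) = t then (0 : ℕ) else 1) < (if (i : ℕ) = t then (0 : ℕ) else 1)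
      rw [if_pos hj, if_neg this]; exact Nat.zero_lt_one)) key
  refine ⟨h2, ?_⟩
  have e : R = Q * tor (-ν) := by rw [hQ, tor_neg]; group
  have h3 : Q.a k = diagonal a - Q.gi * diagonal δ * Q.m := by exact eq_sub_of_add_eq h1
  have hT : ∀ v : Fin (m + 1) → ℂ, (tor (-ν)).gi * diagonal v * (tor (-ν)).m = diagonal v := by
    intro v
    rw [tor_gi, tor_m, diagonal_mul_diagonal, diagonal_mul_diagonal]
    congr 1; funext i
    have : exp (-((-ν) i).1) * exp (((-ν) i).1) = 1 := by rw [← Complex.exp_add]; simp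
    linear_combination v i * this
  rw [e]
  simp only [mul_a, mul_gi, mul_m]
  rw [h3, mul_sub, sub_mul, hT]
  have e2 : (tor (-ν)).a k = diagonal fun j => -(ν j).2 k := rfl
  rw [e2]
  have e3 : (diagonal fun j => a j - (ν j).2 k : Matrix (Fin (m + 1)) (Fin (m + 1)) ℂ)
      = diagonal a + diagonal fun j => -(ν j).2 k := by
    rw [diagonal_add]; congr 1
  rw [e3]; simp only [mul_assoc]; abel

/-- The number d counts the factors N_k, removed from the right. Both a and its shift by the
derivative of ν are constant on the tail, hence so is that derivative, and its jump between
neighbouring places is the derivative of a single coordinate of the strip. -/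
lemma Lw_rigid_aux {m : ℕ} {y : ℕ → ℕ → ℕ → LogJet} (hy : Bd y) {k : Fin 2} {δ : Fin (m + 1) → ℂ}
    (d : ℕ) : d ≤ m → ∀ a : Fin (m + 1) → ℂ,
    (prodDn (fun q => Nk m (m + 1) 0 y (m - d + q)) d).a k = diagonal a
      - (prodDn (fun q => Nk m (m + 1) 0 y (m - d + q)) d).gi * diagonal δ
        * (prodDn (fun q => Nk m (m + 1) 0 y (m - d + q)) d).m →
    (∀ j : Fin (m + 1), m - d ≤ j → a j = a ⟨m - d, by omega⟩) ∧
      ∀ a' b' c', a' + b' + c' = m + 1 → m - d < c' → (y a' b' c').2 k = 0 := by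
  induction d with
  | zero =>
    intro _ a _
    refine ⟨fun j hj => congrArg a (Fin.ext (by simp only [Nat.sub_zero] at hj ⊢; omega)), ?_⟩
    intro a' b' c' h1 h2
    rcases Nat.eq_zero_or_pos a' with rfl | h
    · rw [(hy b' c').1]; rfl
    · rcases Nat.eq_zero_or_pos b' with rfl | h'
      · rw [(hy a' c').2.1]; rfl
      · omega
  | succ d ih =>
    intro hd a h
    set t := m - (d + 1) with ht
    set R := prodDn (fun q => Nk m (m + 1) 0 y (m - d + q)) d with hR
    have e0 : prodDn (fun q => Nk m (m + 1) 0 y (t + q)) (d + 1)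
        = R * Nk m (m + 1) 0 y t := by
      rw [prodDn_succ', hR]
      congr 1
      exact prodDn_congr fun i _ => by rw [show t + (i + 1) = m - d + i by omega]
    set ν := ∑ j ∈ Finset.range (m - t), low (m + 1) (t + j + 2) (-y (m - 1 - t - j) (j + 1) (t + 1))
      with hν
    have e1 : Nk m (m + 1) 0 y t = tor ν * kap (prodUp (fun j => fu (m + 1) (t + j)) (m - t)) := by
      rw [hν, ← strip_split, Nk]; simp only [zero_add]
    rw [e1] at e0
    have hl : R ∈ Tri (OrderDual.toDual : Fin (m + 1) → (Fin (m + 1))ᵒᵈ) :=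
      prodDn_mem _ fun _ _ => Nk_mem _ _ _ _ _
    -- The factors to the left of the strip only involve places beyond t, so column t of R is
    -- diagonal; this is triangularity for a two-valued order.
    have hc : R ∈ Tri (fun i : Fin (m + 1) => if (i : ℕ) = t then (0 : ℕ) else 1) := by
      refine prodDn_mem _ fun q _ => prodUp_mem _ fun j _ => mul_mem (tor_mem_tri _ _) ?_
      refine kap_mem_tri _ ?_ ?_ <;> intro r s hrs
      all_goals
        have hs : (s : ℕ) = t ∧ (r : ℕ) ≠ t := by
          by_contra hcon
          simp only at hrs
          split_ifs at hrs <;> omega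
        have h1 : r ≠ s := fun e => hs.2 (e ▸ hs.1)
        have h2 : ¬ ((r : ℕ) = 0 + (m - d + q) + j + 1 ∧ (s : ℕ) = 0 + (m - d + q) + j) := by omega
        simp [-Matrix.coe_units_inv, fu, elm_apply, one_apply_ne h1]
        omega
    obtain ⟨h1, h2⟩ := strip_rigid (by omega) e0 hl hc h
    obtain ⟨h3, h4⟩ := ih (by omega) _ h2
    refine ⟨h1, fun a' b' c' habc hc' => ?_⟩
    rcases Nat.lt_or_ge (m - d) c' with h5 | h5
    · exact h4 a' b' c' habc h5
    rcases Nat.eq_zero_or_pos a' with rfl | ha'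
    · rw [(hy b' c').1]; rfl
    rcases Nat.eq_zero_or_pos b' with rfl | hb'
    · rw [(hy a' c').2.1]; rfl
    have hν' : ∀ p q : Fin (m + 1), t + 1 ≤ p → t + 1 ≤ q → (ν p).2 k = (ν q).2 k := by
      intro p q hp hq
      have e3 := h3 p (by omega)
      have e4 := h3 q (by omega)
      rw [h1 p (by omega)] at e3
      rw [h1 q (by omega)] at e4
      linear_combination e4 - e3
    have hval : ∀ p : Fin (m + 1), (ν p).2 k = ∑ j ∈ Finset.range (m - t),
        if (p : ℕ) < t + j + 2 then -(y (m - 1 - t - j) (j + 1) (t + 1)).2 k else 0 := by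
      intro p
      rw [hν, Finset.sum_apply, Prod.snd_sum, Finset.sum_apply]
      refine Finset.sum_congr rfl fun j _ => ?_
      simp only [low]; split_ifs <;> rfl
    -- The two places are separated by exactly one letter, the one with coordinate (a', b', t + 1).
    have e5 := hν' ⟨t + b', by omega⟩ ⟨t + b' + 1, by omega⟩ (by simp; omega) (by simp)
    rw [hval, hval, ← sub_eq_zero, ← Finset.sum_sub_distrib,
      Finset.sum_eq_single (b' - 1)] at e5
    · simp only at e5
      rw [if_pos (by omega), if_neg (by omega), sub_zero, neg_eq_zero] at e5
      rwa [show m - 1 - t - (b' - 1) = a' by omega, show b' - 1 + 1 = b' by omega,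
        show t + 1 = c' by omega] at e5
    · intro j _ hj
      by_cases h6 : t + b' < t + j + 2
      · rw [if_pos h6, if_pos (by simp; omega), sub_self]
      · rw [if_neg h6, if_neg (by simp; omega), sub_self]
    · intro hj; exact absurd (Finset.mem_range.2 (by omega)) hj

/-- A word whose logarithmic derivative is generated by diagonal matrices on the two sides does not
vary. -/
lemma Lw_rigid {m : ℕ} {y : ℕ → ℕ → ℕ → LogJet} (hy : Bd y) {k : Fin 2} {a δ : Fin (m + 1) → ℂ}
    (h : (Lw m (m + 1) 0 y).a k
      = diagonal a - (Lw m (m + 1) 0 y).gi * diagonal δ * (Lw m (m + 1) 0 y).m) :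
    (∀ j, a j = a 0) ∧ ∀ a' b' c', a' + b' + c' = m + 1 → (y a' b' c').2 k = 0 := by
  have := Lw_rigid_aux hy (k := k) (δ := δ) m le_rfl a (by simpa [Lw] using h)
  refine ⟨fun j => by simpa using this.1 j (by omega), fun a' b' c' habc => ?_⟩
  rcases Nat.eq_zero_or_pos c' with rfl | hc
  · rw [(hy a' b').2.2]; rfl
  · exact this.2 a' b' c' habc (by omega)

end

section

open Jet Ext

/-! ### The form in terms of the Stokes matrix -/

/-- Substituting the vertex relations into S S^{-t} = N⁻¹N'⁻¹ eliminates A₁, A₂ and M. The central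
elements are collected with the multiplicities of the graph, so the total form becomes the central
defect of one relation. -/
lemma glue_group {G : Type*} [Group G] {Q A1 A2 A3 D M N x L q a1 a2 a3 N' f s b e : G}
    (he : ∀ x, e * x = x * e) (hf : ∀ x, f⁻¹ * x = x * f⁻¹) (hs : ∀ x, s * x = x * s)
    (hb : ∀ x, b * x = x * b)
    (h1 : Q * A1 * D * a3 * q⁻¹ = N * e) (h2 : q * a1 * D⁻¹ * A3 * Q⁻¹ = N' * e)
    (h3 : A1 * A2 * A3 = f) (h4 : a1 * a2 * a3 = f) (h5 : A2 * D * a2 * M⁻¹ * D⁻¹ = s)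
    (h6 : x⁻¹ * M * x * L = b) :
    N⁻¹ * N'⁻¹ = e * e * f⁻¹ * f⁻¹ * s * b * ((x⁻¹ * a3 * q⁻¹)⁻¹ * L⁻¹ * (x⁻¹ * a3 * q⁻¹)) := by
  have e1 : N⁻¹ = e * (q * a3⁻¹ * D⁻¹ * A1⁻¹ * Q⁻¹) := by
    rw [show N = Q * A1 * D * a3 * q⁻¹ * e⁻¹ by rw [h1]; group]; group
  have e2 : N'⁻¹ = e * (Q * A3⁻¹ * D * a1⁻¹ * q⁻¹) := by
    rw [show N' = q * a1 * D⁻¹ * A3 * Q⁻¹ * e⁻¹ by rw [h2]; group]; group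
  have e3 : A1⁻¹ * A3⁻¹ = f⁻¹ * A2 := by
    have : A2 = A1⁻¹ * (f * A3⁻¹) := by rw [← h3]; group
    rw [this, ← mul_assoc, hf]; group
  have e4 : a1⁻¹ = f⁻¹ * (a2 * a3) := by rw [hf, ← h4]; group
  have e5 : D⁻¹ * A2 * D * a2 = s * M := by
    have : A2 * D * a2 = s * D * M := by rw [← h5]; group
    rw [mul_assoc, mul_assoc, ← mul_assoc A2, this, hs]; simp only [mul_assoc, hs]; group
  have e6 : M = b * (x * L⁻¹ * x⁻¹) := by rw [← mul_assoc, ← mul_assoc, hb, ← h6]; group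
  calc N⁻¹ * N'⁻¹ = e * e * (q * a3⁻¹ * D⁻¹ * (A1⁻¹ * A3⁻¹) * D * a1⁻¹ * q⁻¹) := by
        rw [e1, e2, mul_assoc e, ← mul_assoc _ e, ← he]; group
    _ = e * e * f⁻¹ * f⁻¹ * (q * a3⁻¹ * (D⁻¹ * A2 * D * a2) * a3 * q⁻¹) := by
        rw [e3, e4]; simp only [mul_assoc, move_central hf]
    _ = e * e * f⁻¹ * f⁻¹ * s * (q * a3⁻¹ * M * a3 * q⁻¹) := by
        rw [e5]; simp only [mul_assoc, move_central hs]
    _ = e * e * f⁻¹ * f⁻¹ * s * b * ((x⁻¹ * a3 * q⁻¹)⁻¹ * L⁻¹ * (x⁻¹ * a3 * q⁻¹)) := by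
        rw [e6]; simp only [mul_assoc, move_central hb, _root_.mul_inv_rev, inv_inv]

lemma central_conj {G : Type*} [Group G] {c : G} (h : ∀ x, c * x = x * c) (g l : G) :
    (c * g)⁻¹ * l * (c * g) = g⁻¹ * l * g := by
  calc (c * g)⁻¹ * l * (c * g) = g⁻¹ * (c⁻¹ * (l * c)) * g := by group
    _ = _ := by rw [← h]; group

section Glue

variable {m : ℕ} {p : Chart (m + 1)} {w : Fin 2 → Chart (m + 1)}

/-- The connection matrix in the frame of the Stokes matrix. -/
def glueJ (p : Chart (m + 1)) (w : Fin 2 → Chart (m + 1)) (x : Jet (Fin (m + 1))) : Jet (Fin (m + 1)) :=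
  x⁻¹ * tinv (A3J p w) * (tinv (QJ p w))⁻¹

/-- The whole form is carried by the relation `S S^{-t} = G⁻¹ Λ⁻¹ G`. -/
lemma glue_relation {x : Jet (Fin (m + 1))} (hx : HasJet p w C0 x) (hl : LT x (gJ p w)) :
    io (NJ p w)⁻¹ * io (tinv (NJ p w)⁻¹) = (io (glueJ p w x))⁻¹ * (io (LamJ p w))⁻¹ * io (glueJ p w x)
      * z (OmegaSigma p (w 0) (w 1)) := by
  have hN := NJ_word p w
  have hN' := congrArg etinv hN
  have hD : tinv (DJ p w) = (DJ p w)⁻¹ := by rw [DJ, tinv_tor, tor_neg]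
  simp only [map_mul, map_inv, etinv_io, tinv_tinv, etinv_z, hD, io_inv] at hN'
  have hf := fg_relation_XJ p w
  have hf' := congrArg etinv hf
  simp only [map_mul, etinv_io, etinv_z] at hf'
  have h := glue_group (fun y => z_comm _ y) (fun y => by rw [← z_neg, z_comm]) (fun y => z_comm _ y)
    (fun y => z_comm _ y) hN hN' hf hf' (monodromy_val p w) (beta_vertex hx hl)
  obtain ⟨s, hG⟩ : ∃ s, (io x)⁻¹ * io (tinv (A3J p w)) * (io (tinv (QJ p w)))⁻¹ = z s * io (glueJ p w x) := by
    exact ⟨_, by rw [z_comm]; exact eq_io_mul_z _⟩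
  rw [hG, central_conj (z_comm s)] at h
  rw [io_inv, map_inv, io_inv, h, OmegaSigma, (vertex_conditions hx hl).2, ← z_neg, ← z_add, ← z_add, ← z_add,
    ← z_add, ← z_add, z_comm]
  congr 2; ring

end Glue

end

/-! ### Contraction of the form carried by S S^{-t} = G⁻¹Λ⁻¹G -/

section

open Jet Ext

section GlueForm

variable {n : ℕ}

/-- Conjugation by D multiplies the (i, j) entry by d_i/d_j, which is 1 exactly when i = j. -/
lemma diagonal_of_commutator {K D D' : Matrix (Fin n) (Fin n) ℂ} {d d' r : Fin n → ℂ}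
    (hD : D = diagonal d) (hD' : D' = diagonal d') (hd : ∀ i, d i * d' i = 1)
    (hi : Function.Injective d) (h : K - D * K * D' = diagonal r) :
    r = 0 ∧ ∀ i j, i ≠ j → K i j = 0 := by
  have e : ∀ i j, K i j - d i * K i j * d' j = diagonal r i j := fun i j => by
    rw [← h, hD, hD', Matrix.sub_apply, mul_diagonal, diagonal_mul]
  refine ⟨funext fun i => ?_, fun i j hij => ?_⟩
  · have h1 := e i i
    rw [diagonal_apply_eq] at h1
    rw [Pi.zero_apply, ← h1]
    linear_combination (-(K i i)) * hd i
  · have h1 := e i j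
    rw [diagonal_apply_ne _ hij] at h1
    have h2 : K i j * (d j - d i) = 0 := by
      linear_combination d j * h1 + (K i j * d i) * hd j
    rcases mul_eq_zero.1 h2 with h3 | h3
    · exact h3
    · exact absurd (hi (sub_eq_zero.1 h3)).symm hij

lemma diag_conj {K D D' : Matrix (Fin n) (Fin n) ℂ} {d d' : Fin n → ℂ}
    (hD : D = diagonal d) (hD' : D' = diagonal d') (hd : ∀ i, d i * d' i = 1)
    (h : ∀ i j, i ≠ j → K i j = 0) : D * K * D' = K ∧ D' * K * D = K := by
  constructor <;>
  · ext i j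
    rw [hD, hD', mul_diagonal, diagonal_mul]
    by_cases hij : i = j
    · subst hij; linear_combination (K i i) * hd i
    · rw [h i j hij]; ring

lemma trace_conj' (y : Jet (Fin n)) (M : Matrix (Fin n) (Fin n) ℂ) :
    trace (y.m * M * y.gi) = trace M := by
  rw [trace_mul_comm, ← mul_assoc, gi_mul_m, one_mul]

/-- A factorization `y tinv(y) = G⁻¹ L⁻¹ G` with `L` diagonal. -/
structure Glued (y G L : Jet (Fin n)) (Ω : ℂ) (d : Fin n → ℂ) (r : Fin 2 → Fin n → ℂ) : Prop where
  rel : io y * io (tinv y) = (io G)⁻¹ * (io L)⁻¹ * io G * z Ω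
  lm : L.m = diagonal d
  la : ∀ k, L.a k = diagonal (r k)
  inj : Function.Injective d

variable {y G L : Jet (Fin n)} {Ω : ℂ} {d : Fin n → ℂ} {r : Fin 2 → Fin n → ℂ}

namespace Glued

lemma jet (h : Glued y G L Ω d r) : y * tinv y = G⁻¹ * L⁻¹ * G := by
  simpa using congrArg Ext.j h.rel

lemma lgi (h : Glued y G L Ω d r) : ∃ d' : Fin n → ℂ, (∀ i, d i * d' i = 1) ∧ L.gi = diagonal d' := by
  have h1 := L.m_mul_gi
  have h2 : ∀ i j, d i * L.gi i j = (1 : Matrix (Fin n) (Fin n) ℂ) i j := fun i j => by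
    rw [← h1, h.lm, diagonal_mul]
  have h3 : ∀ i, d i ≠ 0 := fun i hi => by simpa [hi] using h2 i i
  refine ⟨fun i => L.gi i i, fun i => by simpa using h2 i i, ?_⟩
  ext i j
  by_cases hij : i = j
  · subst hij; simp
  · rw [diagonal_apply_ne _ hij]
    have := h2 i j
    rw [one_apply_ne hij] at this
    exact (mul_eq_zero.1 this).resolve_left (h3 i)

/-- The logarithmic derivative of `G` on the other side. -/
def kk (G : Jet (Fin n)) (k : Fin 2) : Matrix (Fin n) (Fin n) ℂ := G.m * G.a k * G.gi

/-- In the frame of G, the variation of G⁻¹L⁻¹G splits into the part moving the frame, a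
commutator-type term in dG G⁻¹, and the part moving the eigenvalues. -/
lemma der (h : Glued y G L Ω d r) (k : Fin 2) : G.m * (y * tinv y).a k * G.gi
    = kk G k - L.m * kk G k * L.gi - diagonal (r k) := by
  obtain ⟨d', hd, hd'⟩ := h.lgi
  have e : L.m * diagonal (r k) * L.gi = diagonal (r k) :=
    (diag_conj h.lm hd' hd fun i j hij => diagonal_apply_ne _ hij).1
  rw [h.jet]
  simp only [mul_a, inv_gi, inv_a, inv_m, h.la, e, kk]
  simp only [mul_add, add_mul, mul_neg, neg_mul, mul_assoc, m_mul_gi, m_mul_gi_assoc, mul_one]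
  simp only [← mul_assoc]; abel

lemma mat (h : Glued y G L Ω d r) : y.m * y.giᵀ = G.gi * L.gi * G.m := by
  have := congrArg Jet.m h.jet
  simpa using this

lemma mat' (h : Glued y G L Ω d r) : y.mᵀ * y.gi = G.gi * L.m * G.m := by
  have := congrArg Jet.gi h.jet
  simpa [mul_assoc] using this

/-- Comparison of central components in `rel`: Ω is the cocycle of the left side minus the two
cocycles on the right, expressed through dG G⁻¹. -/
lemma val (h : Glued y G L Ω d r) : Ω = c y (tinv y)
    - (trace (kk G 0 * diagonal (r 1)) - trace (kk G 1 * diagonal (r 0)))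
    + (trace (L.m * kk G 0 * L.gi * kk G 1) - trace (L.m * kk G 1 * L.gi * kk G 0)
      - trace (kk G 0 * diagonal (r 1)) + trace (kk G 1 * diagonal (r 0))) := by
  obtain ⟨d', hd, hd'⟩ := h.lgi
  have e : ∀ k, L.m * diagonal (r k) * L.gi = diagonal (r k) := fun k =>
    (diag_conj h.lm hd' hd fun i j hij => diagonal_apply_ne _ hij).1
  have h1 := congrArg Ext.s h.rel
  simp only [mul_s, io_s, inv_s, mul_j, io_j, inv_j, z_s, z_j, c_one_right] at h1
  have c1 : c G⁻¹ L⁻¹ = trace (kk G 0 * diagonal (r 1)) - trace (kk G 1 * diagonal (r 0)) := by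
    have h2 : ∀ k l, trace (L.m * kk G k * L.gi * diagonal (r l)) = trace (kk G k * diagonal (r l)) := by
      intro k l
      conv_lhs => rw [← e l]
      rw [← trace_conj' L (kk G k * diagonal (r l))]; simp only [mul_assoc, gi_mul_m_assoc]
    simp only [c, inv_gi, inv_a, inv_m, h.la, e, mul_neg, neg_mul, neg_neg]
    exact congrArg₂ _ (h2 0 1) (h2 1 0)
  have c2 : c (G⁻¹ * L⁻¹) G = -trace (L.m * kk G 0 * L.gi * kk G 1) - trace (kk G 1 * diagonal (r 0))
      + (trace (L.m * kk G 1 * L.gi * kk G 0) + trace (kk G 0 * diagonal (r 1))) := by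
    have h2 : ∀ (X : Matrix (Fin n) (Fin n) ℂ) k, trace (G.gi * X * G.m * G.a k) = trace (X * kk G k) := by
      intro X k
      rw [← Jet.trace_conj G (X * kk G k), kk]; simp only [mul_assoc, gi_mul_m, mul_one]
    have h3 : ∀ k, (G⁻¹ * L⁻¹).a k = -(L.m * kk G k * L.gi) - diagonal (r k) := fun k => by
      simp only [mul_a, inv_gi, inv_a, inv_m, h.la, e, kk, mul_neg, neg_mul]; abel
    rw [c, h2, h2, h3, h3, sub_mul, sub_mul, neg_mul, neg_mul, trace_sub, trace_sub, trace_neg, trace_neg,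
      trace_mul_comm (diagonal (r 0)), trace_mul_comm (diagonal (r 1))]
    ring
  rw [c1, c2] at h1
  linear_combination -h1

/-- Differentiation along `dy = E y + y Eᵀ`. -/
lemma contraction (h : Glued y G L Ω d r) {E : Matrix (Fin n) (Fin n) ℂ}
    (hE : y.a 0 = y.gi * E * y.m + Eᵀ) : r 0 = 0 ∧
      (∀ i j, i ≠ j → (kk G 0 + G.m * E * G.gi) i j = 0) ∧
      Ω = 2 * trace (Eᵀ * y.a 1) - 2 * trace (E * (y.m * y.a 1 * y.gi))
        - 2 * ∑ i, (kk G 0 + G.m * E * G.gi) i i * r 1 i := by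
  obtain ⟨d', hd, hd'⟩ := h.lgi
  -- Infinitesimal form of the fact that y ↦ e^{τE} y e^{τE^t} conjugates y y^{-t} by e^{τE}.
  have hT : (y * tinv y).a 0 = (G.gi * L.m * G.m) * E * (G.gi * L.gi * G.m) - E := by
    rw [← h.mat, ← h.mat', mul_a, tinv_gi, tinv_a, tinv_m, hE]
    have h1 : (y.m)ᵀ * y.giᵀ = 1 := by rw [← transpose_mul]; simp
    simp only [transpose_add, transpose_mul, transpose_transpose, mul_add, add_mul, mul_assoc]
    abel
  set F := G.m * E * G.gi with hF
  set K := kk G 0 + F with hK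
  -- K measures how far the frame G is from being moved by the conjugation alone. It commutes with L
  -- up to a diagonal matrix, so with distinct eigenvalues it is diagonal and the eigenvalues are
  -- stationary.
  have h0 : K - L.m * K * L.gi = diagonal (r 0) := by
    have h1 := h.der 0
    rw [hT] at h1
    have h2 : G.m * (G.gi * L.m * G.m * E * (G.gi * L.gi * G.m) - E) * G.gi = L.m * F * L.gi - F := by
      simp only [hF, mul_sub, sub_mul, mul_assoc, m_mul_gi_assoc, m_mul_gi, mul_one]
    rw [h2] at h1
    rw [hK, mul_add, add_mul]
    have := congrArg (fun M => M + diagonal (r 0) + F - L.m * F * L.gi) h1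
    calc _ = kk G 0 - L.m * kk G 0 * L.gi - diagonal (r 0) + diagonal (r 0) + F - L.m * F * L.gi := by abel
      _ = _ := by rw [← this]; abel
  obtain ⟨hr, hKd⟩ := diagonal_of_commutator h.lm hd' hd h.inj h0
  refine ⟨hr, hKd, ?_⟩
  obtain ⟨hc1, hc2⟩ := diag_conj h.lm hd' hd hKd
  obtain ⟨he1, he2⟩ := diag_conj h.lm hd' hd (K := diagonal (r 1)) fun i j hij => diagonal_apply_ne _ hij
  have hv := h.val
  set k1 := kk G 1 with hk1
  set P := G.m * (y * tinv y).a 1 * G.gi with hP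
  have hP1 : P = k1 - L.m * k1 * L.gi - diagonal (r 1) := h.der 1
  have hk0 : kk G 0 = K - F := by rw [hK]; abel
  have tc : ∀ X Y : Matrix (Fin n) (Fin n) ℂ, trace (L.m * X * L.gi * Y) = trace (X * (L.gi * Y * L.m)) := by
    intro X Y
    rw [← trace_conj' L (X * (L.gi * Y * L.m))]; simp only [mul_assoc, m_mul_gi, mul_one]
  have hP2 : L.gi * P * L.m = L.gi * k1 * L.m - k1 - diagonal (r 1) := by
    rw [hP1, mul_sub, mul_sub, sub_mul, sub_mul, he2]
    simp only [mul_assoc, gi_mul_m, gi_mul_m_assoc, mul_one]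
  -- Being diagonal, K survives only in the pairing with the variation of the eigenvalues.
  have h3 : Ω = c y (tinv y) - 2 * trace (K * diagonal (r 1)) - trace (F * P)
      - trace (F * (L.gi * P * L.m)) := by
    have t1 : trace (L.m * k1 * L.gi * K) = trace (K * k1) := by
      rw [tc, hc2, trace_mul_comm]
    have t2 : trace (L.m * k1 * L.gi * F) = trace (F * (L.m * k1 * L.gi)) := trace_mul_comm _ _
    have t3 : trace (L.m * F * L.gi * k1) = trace (F * (L.gi * k1 * L.m)) := tc _ _
    rw [hP2, hP1, hv, hr, hk0]
    have hz : diagonal (0 : Fin n → ℂ) = 0 := diagonal_zero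
    rw [hz]
    simp only [mul_sub, sub_mul, trace_sub, mul_zero, trace_zero, hc1, t1, t2, t3]
    ring
  have h4 : trace (F * P) = trace (E * (y * tinv y).a 1) := by
    rw [← trace_conj' G (E * (y * tinv y).a 1), hF, hP]; simp only [mul_assoc, gi_mul_m_assoc]
  have h5 : trace (F * (L.gi * P * L.m))
      = trace (E * ((y.m * y.giᵀ) * (y * tinv y).a 1 * (y.mᵀ * y.gi))) := by
    rw [h.mat, h.mat', ← trace_conj' G (E * _), hF, hP]; simp only [mul_assoc, m_mul_gi, mul_one]
  have h6 : trace (K * diagonal (r 1)) = ∑ i, K i i * r 1 i := by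
    simp [trace, mul_diagonal]
  have u2 : y.giᵀ * y.mᵀ = 1 := by rw [← transpose_mul]; simp
  have u2' : ∀ M, y.giᵀ * (y.mᵀ * M) = M := fun M => by rw [← mul_assoc, u2, one_mul]
  set v := y.a 1 with hv1
  have hτ : (y * tinv y).a 1 = y.mᵀ * v * y.giᵀ - vᵀ := by
    rw [mul_a, tinv_gi, tinv_a, tinv_m, sub_eq_add_neg]
  have w1 : trace (y.mᵀ * (y.gi * (E * (y.m * (y.giᵀ * vᵀ)))))
      = trace (E * (y.m * (y.giᵀ * (vᵀ * (y.mᵀ * y.gi))))) := by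
    rw [← mul_assoc, trace_mul_comm]; simp only [mul_assoc]
  have w2 : trace (y.mᵀ * (Eᵀ * (y.giᵀ * vᵀ))) = trace (E * (y.m * (v * y.gi))) := by
    rw [← trace_transpose]
    simp only [transpose_mul, transpose_transpose, mul_assoc]
    rw [← mul_assoc, trace_mul_comm]; simp only [mul_assoc]
  have w3 : trace (y.mᵀ * (v * (Eᵀ * y.giᵀ))) = trace (Eᵀ * v) := by
    rw [trace_mul_comm]; simp only [mul_assoc, u2, mul_one]; rw [trace_mul_comm]
  have w4 : trace (y.mᵀ * (v * (y.giᵀ * E))) = trace (E * (y.mᵀ * (v * y.giᵀ))) := by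
    rw [trace_mul_comm E]; simp only [mul_assoc]
  have w5 : trace (E * vᵀ) = trace (Eᵀ * v) := by
    rw [← trace_transpose, transpose_mul, transpose_transpose, trace_mul_comm]
  have w6 : c y (tinv y) = -trace (E * (y.m * (y.giᵀ * (vᵀ * (y.mᵀ * y.gi)))))
      - trace (E * (y.m * (v * y.gi))) + trace (Eᵀ * v) + trace (E * (y.mᵀ * (v * y.giᵀ))) := by
    simp only [c, tinv_gi, tinv_m, tinv_a, hE, ← hv1, transpose_add, transpose_mul, transpose_transpose,
      mul_neg, trace_neg, mul_add, add_mul, trace_add, mul_assoc, u2', w1, w2, w3, w4]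
    ring
  rw [h3, h4, h5, h6, hτ, w6]
  simp only [mul_sub, sub_mul, trace_sub, mul_assoc, u2', w5]
  ring

end Glued

end GlueForm

end

section

open Jet Ext Glued

/-! ### The kernel of the differential of the Stokes matrix -/

section Kernel

lemma kk_mul {n : ℕ} (x y : Jet (Fin n)) (k : Fin 2) :
    kk (x * y) k = kk x k + x.m * kk y k * x.gi := by
  simp only [kk, mul_m, mul_a, mul_gi, mul_add, add_mul, mul_assoc, m_mul_gi_assoc]

lemma kk_tinv {n : ℕ} (x : Jet (Fin n)) (k : Fin 2) : kk (tinv x) k = -(kk x k)ᵀ := by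
  simp [kk, mul_assoc]

lemma kk_kap_conj {n : ℕ} (u v : (Matrix (Fin n) (Fin n) ℂ)ˣ) (x : Jet (Fin n)) (k : Fin 2) :
    kk (kap u * x * kap v) k = (u : Matrix (Fin n) (Fin n) ℂ) * kk x k * (u⁻¹ : (Matrix (Fin n) (Fin n) ℂ)ˣ) := by
  have h : ∀ u : (Matrix (Fin n) (Fin n) ℂ)ˣ, kk (kap u) k = 0 := fun u => by simp [kk]
  rw [mul_assoc, kk_mul, kk_mul, h, h, kap_gi, kap_m]; simp

lemma kk_tri {n : ℕ} {α : Type*} [LinearOrder α] {b : Fin n → α} {x : Jet (Fin n)} (h : x ∈ Tri b) (k : Fin 2) :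
    (kk x k).BlockTriangular b := (h.1.mul (h.2.2 k)).mul h.2.1

lemma connection_group {G : Type*} [Group G] {s κ c σ t w q : G} (hs : ∀ x, s * x = x * s)
    (hκ : ∀ x, κ * x = x * κ) (hc : ∀ x, c * x = x * c) (hw : w * σ = κ * σ * w) (hq : σ * q = q * σ) :
    s * σ * t * w * σ * (c⁻¹ * q⁻¹ * w)⁻¹ = (κ * c * σ) * (t * (s * q)) * σ := by
  calc _ = s * σ * t * (w * σ) * w⁻¹ * q * c := by group
    _ = κ * (s * (σ * (t * (σ * q)))) * c := by
        rw [hw]; simp only [mul_assoc, move_central hκ, mul_inv_cancel_left]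
    _ = _ := by
      rw [← hc, hq]; simp only [mul_assoc]
      rw [move_central hc κ, move_central hs σ, move_central hs t]

variable {m : ℕ} {p : Chart (m + 1)} {w : Fin 2 → Chart (m + 1)}

lemma glued {p : Chart (m + 1)} (hp : p ∈ regularLocus (m + 1)) (w : Fin 2 → Chart (m + 1)) :
    ∃ x, HasJet p w C0 x ∧ LT x (gJ p w) ∧ Glued (NJ p w)⁻¹ (glueJ p w x) (LamJ p w)
      (OmegaSigma p (w 0) (w 1)) (mval p) fun k j => (muJ p w j).2 k := by
  obtain ⟨x, hx, hl⟩ := exists_jet_C0 (w := w) hp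
  refine ⟨x, hx, hl, glue_relation hx hl, ?_, fun k => ?_, hp⟩
  · rw [← HasJet.Lam.val, Lam]
  · rw [LamJ, mul_a, kap_a, mul_zero, zero_mul, zero_add, tor_a]

/-- The scalar factor of `A₃`. -/
def s3J (p : Chart (m + 1)) (w : Fin 2 → Chart (m + 1)) : LogJet :=
  tsm (m + 1) fun a b c => ((m : ℂ) + 1 - a) • cy (cy (XJ p w)) a b c

/-- The triangular factor of `A₃`. -/
def w3J (p : Chart (m + 1)) (w : Fin 2 → Chart (m + 1)) : Jet (Fin (m + 1)) :=
  Lw m (m + 1) 0 (fun a b c => ((m : ℂ) + 1) • cy (cy (XJ p w)) a b c)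

/-- The antidiagonals of A₃ and Q cancel: A₃^{-t}Q^t is upper triangular up to scalars and the signs
σ. -/
lemma connection_eq : ∃ c : ℂˣ, tinv (A3J p w) * (tinv (QJ p w))⁻¹
    = kap (scu (m + 1) c) * kap (sigU (m + 1))
      * (tinv (w3J p w) * tor (fun j => qJ p w j - s3J p w)) * kap (sigU (m + 1)) := by
  refine ⟨(-1) ^ m * qsign m, ?_⟩
  have hA : tinv (A3J p w) = scal (m + 1) (-s3J p w) * kap (sigU (m + 1)) * tinv (w3J p w) * kap (wu m)
      * kap (sigU (m + 1)) := by
    rw [A3J, AJ]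
    change tinv (scal (m + 1) (s3J p w) * (kap (sigU (m + 1)) * (w3J p w * kap (wu m)) * kap (sigU (m + 1)))) = _
    simp only [map_mul, tinv_kap_sigU, tinv_kap_wu]
    rw [scal, tinv_tor, scal]
    simp only [mul_assoc]; rfl
  have ht : tor (fun j => qJ p w j - s3J p w) = scal (m + 1) (-s3J p w) * tor (qJ p w) := by
    rw [scal, ← tor_add]; congr 1; funext j; simp only [Pi.add_apply]; abel
  rw [hA, tinv_QJ, map_inv, map_inv, ht, map_mul, map_mul]
  exact connection_group (fun x => scal_comm _ x) (fun x => scu_comm _ x) (fun x => scu_comm _ x)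
    (by rw [← map_mul, ← map_mul, ← map_mul, wu_mul_sigU]) (kap_sigU_tor _)

lemma sum_alpha_smul {E : Type*} [AddCommGroup E] [Module ℂ E] (f : Fin m → E) (j : Fin (m + 1)) :
    ∑ k : Fin m, alpha (m + 1) (k + 1) j • f k
      = (if h : (j : ℕ) < m then f ⟨j, h⟩ else 0) - if h : 0 < (j : ℕ) then f ⟨j - 1, by omega⟩ else 0 := by
  have e : ∀ k : Fin m, alpha (m + 1) (k + 1) j • f k
      = (if (j : ℕ) = k then f k else 0) - if (j : ℕ) = k + 1 then f k else 0 := fun k => by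
    simp only [alpha, Nat.add_right_cancel_iff]
    split_ifs <;> first | omega | simp
  simp only [e, Finset.sum_sub_distrib]
  congr 1
  · split_ifs with h
    · rw [Finset.sum_eq_single ⟨j, h⟩]
      · simp
      · intro k _ hk; rw [if_neg fun h' => hk (Fin.ext h'.symm)]
      · simp
    · exact Finset.sum_eq_zero fun k _ => if_neg (by omega)
  · split_ifs with h
    · rw [Finset.sum_eq_single ⟨j - 1, by omega⟩]
      · simp only; rw [if_pos (by omega)]
      · intro k _ hk; rw [if_neg fun h' => hk (Fin.ext (by simp; omega))]
      · simp
    · exact Finset.sum_eq_zero fun k _ => if_neg (by omega)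

lemma sum_alpha (n k : ℕ) (hk : k + 1 < n) : ∑ j : Fin n, alpha n (k + 1) j = 0 := by
  have e : ∀ j : Fin n, alpha n (k + 1) j = (if (j : ℕ) = k then 1 else 0) - if (j : ℕ) = k + 1 then 1 else 0 := by
    intro j
    simp only [alpha, Nat.add_right_cancel_iff]
    split_ifs <;> first | omega | simp
  simp only [e, Finset.sum_sub_distrib]
  rw [sum_fin_eq n k (by omega), sum_fin_eq n (k + 1) hk, sub_self]

/-- If dG G⁻¹ is diagonal, C₀G = A₃^{-t}Q^t has a lower triangular right logarithmic derivative; by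
`connection_eq` this derivative is also upper triangular, hence diagonal. The word in A₃ then varies
only by torus elements on its two sides, `Lw_rigid` stops the ξ, and the vanishing trace of the α_k
stops the ζ. -/
lemma kernel_coords {x : Jet (Fin (m + 1))} (hl : LT x (gJ p w))
    (hK : ∀ i j, i ≠ j → kk (glueJ p w x) 0 i j = 0) :
    (∀ a b c, xi a b c (w 0) = 0) ∧ ∀ k, zeta k (w 0) = 0 := by
  set G' := tinv (A3J p w) * (tinv (QJ p w))⁻¹ with hG'
  have e : G' = x * glueJ p w x := by rw [glueJ, hG']; group
  have hlow : (kk G' 0).BlockTriangular (OrderDual.toDual : Fin (m + 1) → (Fin (m + 1))ᵒᵈ) := by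
    have hd : (kk (glueJ p w x) 0).BlockTriangular (OrderDual.toDual : Fin (m + 1) → (Fin (m + 1))ᵒᵈ) :=
      fun i j hij => hK i j (ne_of_lt (show i < j from hij))
    rw [e, kk_mul]
    exact (kk_tri hl.tri 0).add ((hl.tri.1.mul hd).mul hl.tri.2.1)
  obtain ⟨c, hc⟩ := connection_eq (p := p) (w := w)
  set Y := tinv (w3J p w) * tor (fun j => qJ p w j - s3J p w) with hY
  have hup : (kk Y 0).BlockTriangular (id : Fin (m + 1) → Fin (m + 1)) :=
    kk_tri (mul_mem (LT.Lw m (m + 1) 0 ((XJ_bd p w).cy.cy.smul _)).tinv.tri (tor_mem_tri _ _)) 0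
  have hconj : ∀ i j, kk G' 0 i j = (-1 : ℂ) ^ ((i : ℕ) + (j : ℕ)) * kk Y 0 i j := by
    intro i j
    rw [← sigU_conj_apply, hG', hc, ← map_mul, kk_kap_conj]
    have : (scu (m + 1) c * sigU (m + 1))⁻¹ = (sigU (m + 1))⁻¹ * scu (m + 1) c⁻¹ := by
      rw [_root_.mul_inv_rev, map_inv]
    rw [this, Units.val_mul, Units.val_mul, scu_val, scu_val]
    simp [-Matrix.coe_units_inv]
  have hdiag : kk Y 0 = diagonal fun j => kk Y 0 j j := by
    ext i j
    rcases lt_trichotomy i j with h | h | h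
    · rw [diagonal_apply_ne _ h.ne]
      have := hlow (i := i) (j := j) h
      rw [hconj] at this
      exact (mul_eq_zero.1 this).resolve_left (pow_ne_zero _ (by norm_num))
    · subst h; simp
    · rw [diagonal_apply_ne _ h.ne', hup h]
  set δ : Fin (m + 1) → ℂ := fun j => kk Y 0 j j
  set ρ : Fin (m + 1) → ℂ := fun j => (qJ p w j - s3J p w).2 0 with hρ
  have key : (w3J p w).a 0 = diagonal ρ - (w3J p w).gi * diagonal δ * (w3J p w).m := by
    have ht : kk (tor fun j => qJ p w j - s3J p w) 0 = diagonal ρ := by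
      rw [kk, tor_m, tor_gi, tor_a, diagonal_mul_diagonal, diagonal_mul_diagonal]
      congr 1; funext j
      have : exp ((qJ p w j - s3J p w).1) * exp (-(qJ p w j - s3J p w).1) = 1 := by
        rw [← Complex.exp_add]; simp
      linear_combination (ρ j) * this
    rw [hY, kk_mul, kk_tinv, ht, tinv_m, tinv_gi] at hdiag
    have h1 := congrArg transpose hdiag
    simp only [transpose_add, transpose_neg, transpose_mul, transpose_transpose, diagonal_transpose] at h1
    have h2 : kk (w3J p w) 0 = (w3J p w).m * diagonal ρ * (w3J p w).gi - diagonal δ := by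
      rw [← h1]; simp only [mul_assoc]; abel
    have h3 : (w3J p w).a 0 = (w3J p w).gi * kk (w3J p w) 0 * (w3J p w).m := by
      simp only [kk, mul_assoc, gi_mul_m_assoc, gi_mul_m, mul_one]
    rw [h3, h2, mul_sub, sub_mul]
    simp only [mul_assoc, gi_mul_m_assoc, gi_mul_m, mul_one]
  obtain ⟨r1, r2⟩ := Lw_rigid ((XJ_bd p w).cy.cy.smul _) key
  have hm : (m : ℂ) + 1 ≠ 0 := by exact_mod_cast Nat.succ_ne_zero m
  have hxi : ∀ a b c, xi a b c (w 0) = 0 := by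
    intro a b c
    by_cases h : a + b + c = m + 1
    · have := r2 c a b (by omega)
      exact (mul_eq_zero.1 (show ((m : ℂ) + 1) * xi a b c (w 0) = 0 from this)).resolve_left hm
    · rw [xi, dif_neg fun h' => h (mem_triples.1 h').2.2.2]
  have hX : ∀ a b c, (XJ p w a b c).2 0 = 0 := hxi
  have hts : ∀ f : ℕ → ℕ → ℕ → LogJet, (∀ a b c, (f a b c).2 0 = 0) → (tsm (m + 1) f).2 0 = 0 := by
    intro f hf
    rw [tsm, Prod.snd_sum, Finset.sum_apply]
    exact Finset.sum_eq_zero fun t _ => hf _ _ _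
  have hs3 : (s3J p w).2 0 = 0 := hts _ fun a b c => by
    change _ * (XJ p w b c a).2 0 = 0
    rw [hX, mul_zero]
  have hb : ∀ y, (∀ a b c, (y a b c : LogJet).2 0 = 0) → ∀ j, (bdiag m y j).2 0 = 0 := fun y hy j =>
    hts _ fun a b c => by
      change _ * (y a b c).2 0 = 0
      rw [hy, mul_zero]
  have hd : ∀ j, ρ j = -(1 / 2) * (dJ p w j).2 0 := by
    intro j
    have h1 := hb (XJ p w) hX (Fin.rev j)
    have h2 := hb (cy (cy (XJ p w))) (fun a b c => hX b c a) j
    simp only [hρ, qJ, l3J, l1J, Prod.snd_sub, Prod.smul_snd, Pi.sub_apply, Pi.smul_apply, smul_eq_mul, hs3, h1, h2]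
    ring
  -- By `Lw_rigid` the torus on the right varies by a scalar; since the α_k are traceless, this
  -- scalar is zero.
  have hd0 : ∀ j, (dJ p w j).2 0 = (dJ p w 0).2 0 := fun j => by
    have := r1 j
    rw [hd, hd] at this
    linear_combination -2 * this
  have hdz : ∀ j, (dJ p w j).2 0 = ∑ k : Fin m, alpha (m + 1) (k + 1) j • zeta (n := m + 1) k (w 0) := fun j => by
    rw [dJ, Prod.snd_sum, Finset.sum_apply]; rfl
  have hsum : ∑ j, (dJ p w j).2 0 = 0 := by
    simp only [hdz, smul_eq_mul]
    rw [Finset.sum_comm]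
    exact Finset.sum_eq_zero fun k _ => by rw [← Finset.sum_mul, sum_alpha _ _ (by omega), zero_mul]
  have hd1 : ∀ j, (dJ p w j).2 0 = 0 := by
    simp only [hd0, Finset.sum_const, Finset.card_univ, Fintype.card_fin, nsmul_eq_mul] at hsum
    intro j
    rw [hd0]
    exact (mul_eq_zero.1 hsum).resolve_left (by exact_mod_cast Nat.succ_ne_zero m)
  refine ⟨hxi, ?_⟩
  have hz : ∀ k, ∀ hk : k < m, zeta (n := m + 1) ⟨k, hk⟩ (w 0) = 0 := by
    intro k
    induction k with
    | zero =>
      intro hk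
      have := hdz ⟨0, by omega⟩
      rw [hd1, sum_alpha_smul, dif_pos hk, dif_neg (by simp)] at this
      simpa using this.symm
    | succ k ih =>
      intro hk
      have := hdz ⟨k + 1, by omega⟩
      rw [hd1, sum_alpha_smul, dif_pos hk, dif_pos (by simp)] at this
      have h1 := ih (by omega)
      simp only [Nat.add_sub_cancel, h1, sub_zero] at this
      exact this.symm
  exact fun k => hz k k.2

end Kernel

end

section

open Jet Ext Glued

/-! ### Coordinates on the Stokes matrices -/

section Coordinates

lemma Smat_congr {n : ℕ} {p q : Chart n} (hx : ∀ a b c, xi a b c p = xi a b c q)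
    (hz : ∀ k, zeta k p = zeta k q) : Smat p = Smat q := by
  have hQ : Qmat p = Qmat q := by
    rw [Qmat, Qmat]; congr 2; funext j; simp only [qdiag, hx, hz]
  have hD : Dmat p = Dmat q := by simp only [Dmat, hz]
  have h1 : A1 p = A1 q := by simp only [A1, hx]
  have h3 : A3 p = A3 q := by simp only [A3, hx]
  rw [Smat, Smat, hQ, hD, h1, h3]

lemma xi_eq_coord {n : ℕ} (t : (triples n : Finset (ℕ × ℕ × ℕ))) (u : Chart n) :
    xi t.1.1 t.1.2.1 t.1.2.2 u = u (Sum.inl t) := by rw [xi, dif_pos t.2]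

variable {m : ℕ} {p : Chart (m + 1)}

/-- The part of a tangent vector along the Stokes matrices vanishes. -/
def StokesFree {n : ℕ} (u : Chart n) : Prop := (∀ a b c, xi a b c u = 0) ∧ ∀ k, zeta k u = 0

lemma stokesFree_iff {n : ℕ} (u : Chart n) : StokesFree u ↔
    ∀ i : (triples n : Finset (ℕ × ℕ × ℕ)) ⊕ Fin (n - 1),
      u (i.elim Sum.inl fun k => Sum.inr (Sum.inl k)) = 0 := by
  refine ⟨fun h i => ?_, fun h => ⟨fun a b c => ?_, fun k => h (Sum.inr k)⟩⟩
  · rcases i with t | k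
    · exact (xi_eq_coord t u).symm.trans (h.1 _ _ _)
    · exact h.2 k
  · rw [xi]; split_ifs with ht
    · exact h (Sum.inl ⟨_, ht⟩)
    · rfl

lemma Smat_shift {u : Chart (m + 1)} (h : StokesFree u) (p : Chart (m + 1)) (τ : ℂ) : Smat (p + τ • u) = Smat p := by
  refine Smat_congr (fun a b c => ?_) fun k => ?_
  · rw [(isLinearMap_xi a b c).map_add, (isLinearMap_xi a b c).map_smul, h.1, smul_zero, add_zero]
  · rw [(isLinearMap_zeta k).map_add, (isLinearMap_zeta k).map_smul, h.2, smul_zero, add_zero]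

lemma diff_Smat (p : Chart (m + 1)) (i j : Fin (m + 1)) : DifferentiableAt ℂ (fun q => Smat q i j) p :=
  (HasJet.S (w := 0)).diff i j

lemma mder_eq_zero_of_shift {X ι : Type*} [NormedAddCommGroup X] [NormedSpace ℂ X] [Fintype ι]
    {J : X → Matrix ι ι ℂ} {p u : X} (hd : ∀ i j, DifferentiableAt ℂ (fun q => J q i j) p)
    (h : ∀ τ : ℂ, J (p + τ • u) = J p) : mder J p u = 0 := by
  ext i j
  change fderiv ℂ (fun q => J q i j) p u = 0
  rw [← (hd i j).lineDeriv_eq_fderiv, lineDeriv]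
  simp only [h, deriv_const]

/-- A direction that does not move S is the case E = 0 of `Glued.contraction`: dG G⁻¹ is diagonal
and `kernel_coords` applies. -/
theorem mder_Smat_eq_zero (hp : p ∈ regularLocus (m + 1)) (u : Chart (m + 1)) :
    mder Smat p u = 0 ↔ StokesFree u := by
  refine ⟨fun h => ?_, fun h => mder_eq_zero_of_shift (diff_Smat p) (Smat_shift h p)⟩
  obtain ⟨x, -, hl, hg⟩ := glued hp (fun _ => u)
  have h0 : (NJ p fun _ => u)⁻¹.a 0 = 0 := by
    have h1 := (HasJet.S (p := p) (w := fun _ => u)).der 0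
    rw [h] at h1
    rw [← gi_mul_m_assoc (NJ p fun _ => u)⁻¹ ((NJ p fun _ => u)⁻¹.a 0), ← h1, mul_zero]
  have h2 := (hg.contraction (E := 0) (by rw [h0]; simp)).2.1
  simp only [mul_zero, zero_mul, add_zero] at h2
  exact kernel_coords hl h2

/-- The kernel of dS consists of the γ-directions, and these are visible in the logarithmic diagonal
of C₀. -/
theorem immersion (hp : p ∈ regularLocus (m + 1)) (u : Chart (m + 1)) (hS : mder Smat p u = 0)
    (hC : mder C0 p u = 0) : u = 0 := by
  have h := (stokesFree_iff u).1 ((mder_Smat_eq_zero hp u).1 hS)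
  obtain ⟨x, hx, hl, -⟩ := glued hp (fun _ => u)
  have h0 : x.a 0 = 0 := by
    have h1 := hx.der 0
    rw [hC] at h1
    rw [← gi_mul_m_assoc x (x.a 0), ← h1, mul_zero]
  funext i
  rcases i with t | k | k
  · exact h (Sum.inl t)
  · exact h (Sum.inr k)
  · have h1 := hl.da 0 (halfIdx k)
    rw [h0] at h1
    have h2 : clog (halfIdx k) u = 0 := h1.symm
    rwa [clog_halfIdx] at h2

lemma mder_add (J : Chart (m + 1) → Matrix (Fin (m + 1)) (Fin (m + 1)) ℂ) (u v : Chart (m + 1)) :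
    mder J p (u + v) = mder J p u + mder J p v := by
  ext i j; simp [mder]

lemma mder_smul (J : Chart (m + 1) → Matrix (Fin (m + 1)) (Fin (m + 1)) ℂ) (r : ℂ) (v : Chart (m + 1)) :
    mder J p (r • v) = r • mder J p v := by
  ext i j; simp [mder]

/-- The differential of the Stokes matrix. -/
def dS (p : Chart (m + 1)) : Chart (m + 1) →ₗ[ℂ] StokesSpace (m + 1) where
  toFun u := stokesCoords (mder Smat p u)
  map_add' u v := by rw [mder_add]; rfl
  map_smul' r v := by rw [mder_smul]; rfl

lemma mder_Smat_lower (p u : Chart (m + 1)) {i j : Fin (m + 1)} (h : j ≤ i) : mder Smat p u i j = 0 := by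
  change fderiv ℂ (fun q => Smat q i j) p u = 0
  have : ∀ q : Chart (m + 1), Smat q i j = (1 : Matrix (Fin (m + 1)) (Fin (m + 1)) ℂ) i j := fun q => by
    rcases h.eq_or_lt with h | h
    · subst h; rw [(Smat_unipotent q).2, one_apply_eq]
    · rw [(Smat_unipotent q).1 h, one_apply_ne h.ne']
  simp [this]

lemma dS_eq_zero (hp : p ∈ regularLocus (m + 1)) (u : Chart (m + 1)) : dS p u = 0 ↔ StokesFree u := by
  rw [← mder_Smat_eq_zero hp]
  refine ⟨fun h => ?_, fun h => by rw [dS, LinearMap.coe_mk, AddHom.coe_mk, h]; rfl⟩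
  ext i j
  rcases lt_or_ge i j with h' | h'
  · exact congrFun h ⟨(i, j), h'⟩
  · exact mder_Smat_lower p u h'

/-- With places counted from 0, the entry (i, j) with i > 0 goes to the triple (i, j - i, n - j),
and the entry (0, j) to ζ_j. An inequality is enough for the dimension count. -/
lemma card_stokesIdx (m : ℕ) : Fintype.card (StokesIdx (m + 1))
    ≤ Fintype.card ((triples (m + 1) : Finset (ℕ × ℕ × ℕ)) ⊕ Fin (m + 1 - 1)) := by
  refine Fintype.card_le_of_injective (fun a : StokesIdx (m + 1) => if h : (a.1.1 : ℕ) = 0 then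
    Sum.inr ⟨(a.1.2 : ℕ) - 1, by have := a.2; have := a.1.2.2; have : (a.1.1 : ℕ) < a.1.2 := a.2; omega⟩
    else Sum.inl ⟨((a.1.1 : ℕ), (a.1.2 : ℕ) - a.1.1, m + 1 - (a.1.2 : ℕ)), mem_triples.2 (by
      have h1 : (a.1.1 : ℕ) < a.1.2 := a.2
      have h2 := a.1.2.2
      omega)⟩) ?_
  rintro ⟨⟨i, j⟩, h⟩ ⟨⟨i', j'⟩, h'⟩ e
  have h1 : (i : ℕ) < j := h
  have h2 : (i' : ℕ) < j' := h'
  have h3 := j.2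
  have h4 := j'.2
  simp only at e
  split_ifs at e with c c' c'
  · simp only [Sum.inr.injEq, Fin.mk.injEq] at e
    simp only [Subtype.mk.injEq, Prod.mk.injEq, Fin.ext_iff]; omega
  · simp only [Sum.inl.injEq, Subtype.mk.injEq, Prod.mk.injEq] at e
    simp only [Subtype.mk.injEq, Prod.mk.injEq, Fin.ext_iff]; omega

/-- Tangent vectors without `γ`-component. -/
def stokesPart (m : ℕ) : (((triples (m + 1) : Finset (ℕ × ℕ × ℕ)) ⊕ Fin (m + 1 - 1)) → ℂ) →ₗ[ℂ] Chart (m + 1) where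
  toFun v := Sum.elim (fun t => v (Sum.inl t)) (Sum.elim (fun k => v (Sum.inr k)) fun _ => 0)
  map_add' u v := by funext i; rcases i with t | k | k <;> simp
  map_smul' r v := by funext i; rcases i with t | k | k <;> simp

/-- dS is injective on the (ξ, ζ)-directions, and the target has no larger dimension. -/
theorem dS_surjective (hp : p ∈ regularLocus (m + 1)) : Function.Surjective (dS p) := by
  have hinj : Function.Injective ((dS p).comp (stokesPart m)) := by
    rw [injective_iff_map_eq_zero]
    intro v hv
    have h := (stokesFree_iff _).1 ((dS_eq_zero hp _).1 hv)
    funext i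
    rcases i with t | k
    · exact h (Sum.inl t)
    · exact h (Sum.inr k)
  have h1 := LinearMap.finrank_le_finrank_of_injective hinj
  have h2 := card_stokesIdx m
  have h3 := (LinearMap.injective_iff_surjective_of_finrank_eq_finrank (f := (dS p).comp (stokesPart m))
    (by rw [Module.finrank_fintype_fun_eq_card, Module.finrank_fintype_fun_eq_card] at h1 ⊢; omega)).1 hinj
  intro v
  obtain ⟨u, hu⟩ := h3 v
  exact ⟨_, hu⟩

end Coordinates

end

section

open Jet Ext Glued

/-! ### Ugaglia's bracket -/

section Ugaglia

variable {n : ℕ}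

/-- The columns of the generator. -/
def ugA (S : Matrix (Fin n) (Fin n) ℂ) (j l a : Fin n) : ℂ :=
  if j < a then S a l else if a = j then S j l / 2 else 0

def ugB (S : Matrix (Fin n) (Fin n) ℂ) (j l a : Fin n) : ℂ :=
  if a < l then S j a else if a = l then S j l / 2 else 0

/-- The halves in `ugA` and `ugB` are chosen for this: the generator moves S inside the upper
unipotent matrices. -/
lemma ug_lower {S : Matrix (Fin n) (Fin n) ℂ} (hS : IsUpperUnipotent S) {j l a b : Fin n} (hjl : j < l)
    (hab : b ≤ a) : ugA S j l a * S j b - ugB S j l a * S l b + (S a j * ugA S j l b - S a l * ugB S j l b) = 0 := by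
  have h0 : ∀ x y : Fin n, y < x → S x y = 0 := fun x y h => hS.1 h
  have h1 := hS.2
  unfold ugA ugB
  rcases lt_trichotomy a j with h2 | h2 | h2 <;> rcases lt_trichotomy a l with h3 | h3 | h3 <;>
    rcases lt_trichotomy b j with h4 | h4 | h4 <;> rcases lt_trichotomy b l with h5 | h5 | h5 <;>
    first | (exfalso; omega) | grind

/-- The variation of S under the generator attached to s_{jl} is Ugaglia's tensor; a finite check
over the relative positions of the four indices. -/
lemma ug_upper {S : Matrix (Fin n) (Fin n) ℂ} (hS : IsUpperUnipotent S) {j l a b : Fin n} (hjl : j < l)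
    (hab : a < b) : ugA S j l a * S j b - ugB S j l a * S l b + (S a j * ugA S j l b - S a l * ugB S j l b)
      = -(1 / 2) * ugagliaTensor (stokesCoords S) ⟨(j, l), hjl⟩ ⟨(a, b), hab⟩ := by
  have h0 : ∀ x y : Fin n, y < x → S x y = 0 := fun x y h => hS.1 h
  have h1 := hS.2
  have he : ∀ x y : Fin n, x < y → entry (stokesCoords S) x y = S x y := fun x y h => by
    rw [entry, dif_pos h]; rfl
  unfold ugagliaTensor ugagliaHalf ugA ugB
  simp only
  rcases lt_trichotomy a j with h2 | h2 | h2 <;> rcases lt_trichotomy a l with h3 | h3 | h3 <;>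
    rcases lt_trichotomy b j with h4 | h4 | h4 <;> rcases lt_trichotomy b l with h5 | h5 | h5 <;>
    first | (exfalso; omega) | grind

end Ugaglia

/-! ### The constant form -/

section ConstantForm

variable {m : ℕ} {p : Chart (m + 1)}

lemma wedge_add_right {n : ℕ} (f g : Chart n → ℂ) (p u v v' : Chart n) :
    wedge f g p u (v + v') = wedge f g p u v + wedge f g p u v' := by
  simp only [wedge, map_add]; ring

lemma wedge_smul_right {n : ℕ} (f g : Chart n → ℂ) (p u : Chart n) (r : ℂ) (v : Chart n) :
    wedge f g p u (r • v) = r * wedge f g p u v := by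
  simp only [wedge, map_smul, smul_eq_mul]; ring

lemma wedge_swap {n : ℕ} (f g : Chart n → ℂ) (p u v : Chart n) : wedge f g p u v = -wedge f g p v u := by
  simp only [wedge]; ring

lemma wedge_of_linear {n : ℕ} {f g : Chart n → ℂ} (hf : IsLinearMap ℂ f) (hg : IsLinearMap ℂ g)
    (p u v : Chart n) : wedge f g p u v = f u * g v - f v * g u := by
  simp only [wedge, IsLinearMap.fderiv_eq hf, IsLinearMap.fderiv_eq hg]

lemma isLinearMap_omega (p u : Chart (m + 1)) : IsLinearMap ℂ (omegaExplicit p u) where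
  map_add v v' := by
    simp only [omegaExplicit, omegaF, omegaQ, omegaBeta, omegaS, wedge_add_right, mul_add, Finset.sum_add_distrib]
    ring
  map_smul r v := by
    simp only [omegaExplicit, omegaF, omegaQ, omegaBeta, omegaS, wedge_smul_right, smul_eq_mul,
      mul_left_comm _ r, ← Finset.mul_sum]
    ring

lemma omega_swap (p u v : Chart (m + 1)) : omegaExplicit p u v = -omegaExplicit p v u := by
  simp only [omegaExplicit, omegaF, omegaQ, omegaBeta, omegaS, wedge_swap _ _ p u v, mul_neg,
    Finset.sum_neg_distrib]
  ring

lemma omega_const (p q u v : Chart (m + 1)) : omegaExplicit p u v = omegaExplicit q u v := by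
  simp only [omegaExplicit, omegaF, omegaQ, omegaBeta, omegaS, wedge_of_linear (isLinearMap_xi _ _ _) (isLinearMap_xi _ _ _),
    wedge_of_linear (isLinearMap_xi _ _ _) (isLinearMap_zeta _), wedge_of_linear (isLinearMap_gam _) (isLinearMap_mu _)]

lemma mu_of_stokesFree {u : Chart (m + 1)} (h : StokesFree u) (j : Fin (m + 1)) : mu j u = 0 := by
  simp only [mu, h.1, h.2, zero_mul, Finset.sum_const_zero, add_zero]

/-- Contraction with a vector tangent to the fibres. -/
lemma omega_stokesFree {u : Chart (m + 1)} (h : StokesFree u) (p v : Chart (m + 1)) :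
    omegaExplicit p u v = 4 * ∑ k, gam k u * mu (halfIdx k) v := by
  simp only [omegaExplicit, omegaF, omegaQ, omegaBeta, omegaS, wedge_of_linear (isLinearMap_xi _ _ _) (isLinearMap_xi _ _ _),
    wedge_of_linear (isLinearMap_xi _ _ _) (isLinearMap_zeta _), wedge_of_linear (isLinearMap_gam _) (isLinearMap_mu _),
    h.1, h.2, mu_of_stokesFree h]
  simp

/-- Only the ζ_k are used: they are the partial sums of y/2, so the α_k telescope to y/2. Oddness of
y makes the total sum vanish, and subtracting the reversed place doubles the result. -/
lemma mu_surjective (y : Fin (m + 1) → ℂ) (hy : ∀ j, y (Fin.rev j) = -y j) :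
    ∃ e : Chart (m + 1), ∀ j, mu j e = y j := by
  set z : ℕ → ℂ := fun k => ∑ l : Fin (m + 1), if (l : ℕ) < k then y l / 2 else 0 with hz
  have hy0 : z (m + 1) = 0 := by
    have h1 : ∑ l, y (Fin.rev l) = ∑ l, y l := Fintype.sum_equiv Fin.revPerm _ _ fun _ => rfl
    simp only [hy, Finset.sum_neg_distrib] at h1
    simp only [hz, Fin.is_lt, if_true, ← Finset.sum_div]
    linear_combination -(1 / 4) * h1
  have hzs : ∀ j : Fin (m + 1), z (j + 1) - z j = y j / 2 := by
    intro j
    simp only [hz, ← Finset.sum_sub_distrib]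
    rw [Finset.sum_eq_single j]
    · simp
    · intro l _ hl
      have : (l : ℕ) ≠ j := fun h => hl (Fin.ext h)
      by_cases h : (l : ℕ) < j
      · rw [if_pos h, if_pos (by omega), sub_self]
      · rw [if_neg h, if_neg (by omega), sub_self]
    · simp
  refine ⟨Sum.elim (fun _ => 0) (Sum.elim (fun k => z (k + 1)) fun _ => 0), fun j => ?_⟩
  have hx : ∀ a b c, xi a b c (Sum.elim (fun _ => 0) (Sum.elim (fun k : Fin (m + 1 - 1) => z (k + 1)) fun _ => 0)
      : Chart (m + 1)) = 0 := fun a b c => by rw [xi]; split_ifs <;> rfl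
  have hd : ∀ j : Fin (m + 1), ∑ k : Fin m, alpha (m + 1) (k + 1) j • z (k + 1) = y j / 2 := by
    intro j
    rw [sum_alpha_smul, ← hzs]
    congr 1
    · split_ifs with h
      · rfl
      · rw [show (j : ℕ) + 1 = m + 1 by omega, hy0]
    · split_ifs with h
      · simp only; rw [Nat.sub_add_cancel h]
      · rw [show (j : ℕ) = 0 by omega]; simp [hz]
  have h1 := hd j
  have h2 := hd (Fin.rev j)
  rw [hy] at h2
  simp only [mu, hx, zero_mul, Finset.sum_const_zero, add_zero, dstar, mul_sub, Finset.sum_sub_distrib, sub_zero]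
  simp only [smul_eq_mul, mul_comm _ (z _)] at h1 h2
  change ∑ k : Fin m, z (k + 1) * alpha (m + 1) (k + 1) j
    - ∑ k : Fin m, z (k + 1) * alpha (m + 1) (k + 1) (Fin.rev j) = y j
  rw [h1, h2]; ring

lemma mu_surjective_half (y : Fin ((m + 1) / 2) → ℂ) : ∃ e : Chart (m + 1), ∀ k, mu (halfIdx k) e = y k := by
  obtain ⟨e, he⟩ := mu_surjective (fun j => clog j (Sum.elim (fun _ => 0) (Sum.elim (fun _ => 0) y)))
    fun j => clog_rev j _
  exact ⟨e, fun k => by rw [he, clog_halfIdx]; rfl⟩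

lemma mu_eq_zero {v : Chart (m + 1)} (h : ∀ k, mu (halfIdx k) v = 0) (j : Fin (m + 1)) : mu j v = 0 := by
  have hj := Fin.val_rev j
  by_cases h1 : (j : ℕ) < (m + 1) / 2
  · exact h ⟨j, h1⟩
  by_cases h2 : (Fin.rev j : ℕ) < (m + 1) / 2
  · rw [← Fin.rev_rev j, mu_rev]
    exact neg_eq_zero.2 (h ⟨Fin.rev j, h2⟩)
  · have h3 : Fin.rev j = j := Fin.ext (by omega)
    have h4 := mu_rev j v
    rw [h3] at h4
    exact self_eq_neg.1 h4

/-- Along a line on which the μ_j move with the distinct speeds 2j - m, each quotient m_i/m_j is an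
exponential with nonzero derivative and avoids 1 for small t ≠ 0. -/
theorem dense_regularLocus (m : ℕ) : Dense (regularLocus (m + 1)) := by
  obtain ⟨e, he⟩ := mu_surjective (m := m) (fun j => 2 * (j : ℕ) - (m : ℂ)) fun j => by
    rw [Fin.val_rev, Nat.cast_sub (by omega)]; push_cast; ring
  intro p
  have hmv : ∀ (t : ℝ) (j : Fin (m + 1)), mval (p + (t : ℂ) • e) j
      = (-1) ^ (m + 2) * exp (mu j p + t * (2 * (j : ℕ) - (m : ℂ))) := fun t j => by
    rw [mval, (isLinearMap_mu j).map_add, (isLinearMap_mu j).map_smul, he, smul_eq_mul]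
  have h1 : ∀ᶠ t : ℝ in nhdsWithin 0 {0}ᶜ, p + (t : ℂ) • e ∈ regularLocus (m + 1) := by
    have h2 : ∀ i j : Fin (m + 1), ∀ᶠ t : ℝ in nhdsWithin 0 {0}ᶜ, i ≠ j →
        mval (p + (t : ℂ) • e) i ≠ mval (p + (t : ℂ) • e) j := by
      intro i j
      by_cases hij : i = j
      · exact Filter.Eventually.of_forall fun t h => absurd hij h
      set φ : ℝ → ℂ := fun t => exp ((mu i p - mu j p) + t * (2 * ((i : ℕ) - (j : ℕ) : ℂ))) with hφ
      have hd : HasDerivAt φ (exp ((mu i p - mu j p) + (0 : ℝ) * (2 * ((i : ℕ) - (j : ℕ) : ℂ)))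
          * (1 * (2 * ((i : ℕ) - (j : ℕ) : ℂ)))) (0 : ℝ) :=
        (((Complex.ofRealCLM.hasDerivAt (x := (0 : ℝ))).mul_const _).const_add _).cexp
      have hne : (i : ℂ) - (j : ℕ) ≠ 0 := sub_ne_zero.2 (by exact_mod_cast fun h => hij (Fin.ext h))
      have h3 := hd.eventually_ne (c := 1) (mul_ne_zero (exp_ne_zero _) (mul_ne_zero one_ne_zero
        (mul_ne_zero two_ne_zero hne)))
      filter_upwards [h3] with t ht _ heq
      apply ht
      rw [hmv, hmv] at heq
      have h4 := mul_left_cancel₀ (pow_ne_zero _ (by norm_num)) heq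
      have h5 : φ t * exp (mu j p + t * (2 * (j : ℕ) - (m : ℂ))) = exp (mu i p + t * (2 * (i : ℕ) - (m : ℂ))) := by
        rw [hφ, ← Complex.exp_add]; congr 1; ring
      rw [h4] at h5
      exact mul_right_cancel₀ (exp_ne_zero _) (h5.trans (one_mul _).symm)
    have h3 := Filter.eventually_all.2 fun i => Filter.eventually_all.2 (h2 i)
    filter_upwards [h3] with t ht i j hij
    by_contra hne
    exact ht i j hne hij
  have h2 : Filter.Tendsto (fun t : ℝ => p + (t : ℂ) • e) (nhdsWithin 0 {0}ᶜ) (nhds p) := by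
    have : Continuous fun t : ℝ => p + (t : ℂ) • e := by fun_prop
    have h3 := this.tendsto 0
    simp only [ofReal_zero, zero_smul, add_zero] at h3
    exact h3.mono_left nhdsWithin_le_nhds
  exact mem_closure_of_tendsto h2 h1

end ConstantForm

end

/-! ### Hamiltonian fields, nondegeneracy and reduction -/

section

open Jet Ext Glued

section Symplectic

variable {m : ℕ} {p : Chart (m + 1)}

/-- The tangent vector along the fibre with given components. -/
def fibreVec (m : ℕ) (y : Fin ((m + 1) / 2) → ℂ) : Chart (m + 1) :=
  Sum.elim (fun _ => 0) (Sum.elim (fun _ => 0) y)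

lemma fibreVec_free (y : Fin ((m + 1) / 2) → ℂ) : StokesFree (fibreVec m y) :=
  (stokesFree_iff _).2 fun i => by rcases i with t | k <;> rfl

lemma eq_fibreVec {u : Chart (m + 1)} (h : StokesFree u) : u = fibreVec m fun k => gam k u := by
  have h' := (stokesFree_iff u).1 h
  funext i
  rcases i with t | k | k
  · exact h' (Sum.inl t)
  · exact h' (Sum.inr k)
  · rfl

/-- A linear functional vanishing where all `dμ_k` vanish is contraction with a vector tangent to the fibres. -/
lemma exists_fibre {φ : Chart (m + 1) → ℂ} (hφ : IsLinearMap ℂ φ)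
    (h : ∀ v, (∀ k, mu (halfIdx k) v = 0) → φ v = 0) :
    ∃ c : Fin ((m + 1) / 2) → ℂ, ∀ v, φ v = ∑ k, c k * mu (halfIdx k) v := by
  have h1 : hφ.mk' ∈ Submodule.span ℂ (Set.range fun k => (isLinearMap_mu (m := m) (halfIdx k)).mk') := by
    refine mem_span_of_iInf_ker_le_ker fun v hv => h v fun k => ?_
    exact (Submodule.mem_iInf _).1 hv k
  obtain ⟨c, hc⟩ := (Submodule.mem_span_range_iff_exists_fun ℂ).1 h1
  refine ⟨c, fun v => ?_⟩
  have := LinearMap.congr_fun hc v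
  simpa using this.symm

/-- The generator is built so that both traces in `Glued.contraction` give ds_{jl}. Thus Ω(X, ·) = 2
ds_{jl} up to a combination of the dμ_k, which a vector along the fibre corrects. That vector does
not change dS X, and `ug_upper` identifies dS X. -/
lemma stokes_hamiltonian (hp : p ∈ regularLocus (m + 1)) (b : StokesIdx (m + 1)) :
    ∃ X : Chart (m + 1), (∀ v, omegaExplicit p X v = dS p v b) ∧
      ∀ a, dS p X a = -(1 / 8) * ugagliaTensor (stokesCoords (Smat p)) a b := by
  obtain ⟨⟨j, l⟩, hjl⟩ := b
  have hjl' : j < l := hjl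
  set S := Smat p with hS
  have hSu := Smat_unipotent (p := p)
  rw [← hS] at hSu
  set y : Matrix (Fin (m + 1)) (Fin (m + 1)) ℂ := Matrix.of fun a i =>
    (if i = j then ugA S j l a else 0) - if i = l then ugB S j l a else 0 with hy
  have hyS : ∀ a b, (y * S + S * yᵀ) a b = ugA S j l a * S j b - ugB S j l a * S l b
      + (S a j * ugA S j l b - S a l * ugB S j l b) := fun a b => by
    rw [Matrix.add_apply, Matrix.mul_apply, Matrix.mul_apply]
    simp [hy, sub_mul, mul_sub, Finset.sum_sub_distrib]
  -- With -1/2 each trace term contributes exactly ds_{jl}. Together with the -1/2 of `ug_upper` and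
  -- the halving of X at the end this produces the coefficient 1/8.
  set E := (-(1 / 2) : ℂ) • y with hE
  have hES : E * S + S * Eᵀ = (-(1 / 2) : ℂ) • (y * S + S * yᵀ) := by
    rw [hE, transpose_smul, smul_mul_assoc, mul_smul_comm, smul_add]
  obtain ⟨X, hX⟩ := dS_surjective hp (stokesCoords (E * S + S * Eᵀ))
  have hX' : mder Smat p X = E * S + S * Eᵀ := by
    ext a b
    rcases lt_or_ge a b with h | h
    · exact congrFun hX ⟨(a, b), h⟩
    · rw [mder_Smat_lower p X h, hES, Matrix.smul_apply, hyS, ug_lower hSu hjl' h, smul_zero]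
  have key : ∀ v, (∀ k, mu (halfIdx k) v = 0) → omegaExplicit p X v - 2 * dS p v ⟨(j, l), hjl⟩ = 0 := by
    intro v hv
    obtain ⟨x, -, -, hg⟩ := glued hp ![X, v]
    set Y := (NJ p ![X, v])⁻¹ with hY
    have hj : HasJet p ![X, v] Smat Y := HasJet.S
    have hm : Y.m = S := hj.val.symm
    have h0 : Y.a 0 = Y.gi * E * Y.m + Eᵀ := by
      have h1 := hj.der 0
      rw [show (![X, v] : Fin 2 → Chart (m + 1)) 0 = X from rfl, hX', ← hm] at h1
      rw [← gi_mul_m_assoc Y (Y.a 0), ← h1, mul_add, gi_mul_m_assoc, mul_assoc]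
    have hdv : Y.m * Y.a 1 = mder Smat p v := (hj.der 1).symm
    obtain ⟨-, -, h2⟩ := hg.contraction h0
    have h3 : ∀ i, (muJ p ![X, v] i).2 1 = 0 := fun i => by
      rw [← mu_eq]; exact mu_eq_zero hv i
    simp only [h3, mul_zero, Finset.sum_const_zero, sub_zero] at h2
    rw [OmegaSigma_eq hp, hdv] at h2
    have hup : UT Y (-0) := DT.inv Function.injective_id (UT.NJ p _)
    have ha : ∀ k i : Fin (m + 1), i ≤ k → Y.a 1 k i = 0 := fun k i hik => by
      rcases hik.eq_or_lt with h | h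
      · subst h; rw [hup.da, neg_zero]; rfl
      · exact hup.tri.2.2 1 h
    have hw : ∀ k i : Fin (m + 1), i ≤ k → (mder Smat p v * Y.gi) k i = 0 := fun k i hik => by
      rw [Matrix.mul_apply]
      refine Finset.sum_eq_zero fun q _ => ?_
      rcases le_or_gt q k with h | h
      · rw [mder_Smat_lower p v h, zero_mul]
      · rw [hup.tri.2.1 (show i < q from hik.trans_lt h), mul_zero]
    -- S⁻¹dS is strictly upper triangular, so only the entries above place l in column l of y count;
    -- they reproduce (S · S⁻¹dS)_{jl}.
    have t1 : trace (yᵀ * Y.a 1) = -dS p v ⟨(j, l), hjl⟩ := by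
      have e1 : trace (yᵀ * Y.a 1) = ∑ k, (ugA S j l k * Y.a 1 k j - ugB S j l k * Y.a 1 k l) := by
        simp only [trace, diag_apply, Matrix.mul_apply, transpose_apply, hy, of_apply, sub_mul]
        rw [Finset.sum_comm]
        simp [Finset.sum_sub_distrib]
      have e2 : dS p v ⟨(j, l), hjl⟩ = ∑ k, S j k * Y.a 1 k l := by
        rw [← Matrix.mul_apply, ← hm, hdv]; rfl
      rw [e1, e2, ← Finset.sum_neg_distrib]
      refine Finset.sum_congr rfl fun k _ => ?_
      have f1 : ugA S j l k * Y.a 1 k j = 0 := by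
        rcases le_or_gt j k with h | h
        · rw [ha k j h, mul_zero]
        · rw [ugA, if_neg h.not_gt, if_neg h.ne, zero_mul]
      rcases lt_or_ge k l with h | h
      · rw [f1, ugB, if_pos h, zero_sub]
      · rw [f1, ha k l h]; ring
    -- dS S⁻¹ is strictly upper triangular as well; here the entries below place j in column j of y
    -- count and give (dS S⁻¹ · S)_{jl}.
    have t2 : trace (y * (mder Smat p v * Y.gi)) = dS p v ⟨(j, l), hjl⟩ := by
      set W := mder Smat p v * Y.gi with hW
      have e1 : trace (y * W) = ∑ a, (ugA S j l a * W j a - ugB S j l a * W l a) := by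
        simp only [trace, diag_apply, Matrix.mul_apply, hy, of_apply, sub_mul]
        simp [Finset.sum_sub_distrib]
      have e2 : dS p v ⟨(j, l), hjl⟩ = ∑ a, W j a * S a l := by
        rw [← Matrix.mul_apply, ← hm, hW, mul_assoc, gi_mul_m, mul_one]; rfl
      rw [e1, e2]
      refine Finset.sum_congr rfl fun k _ => ?_
      have f1 : ugB S j l k * W l k = 0 := by
        rcases le_or_gt k l with h | h
        · rw [hw l k h, mul_zero]
        · rw [ugB, if_neg h.not_gt, if_neg h.ne', zero_mul]
      rcases lt_or_ge j k with h | h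
      · rw [f1, ugA, if_pos h]; ring
      · rw [f1, hw j k h]; ring
    rw [hE, transpose_smul, smul_mul_assoc, smul_mul_assoc, trace_smul, trace_smul, t1, t2] at h2
    change omegaExplicit p X v = _ at h2
    rw [h2]; simp only [smul_eq_mul]; ring
  have hlin : IsLinearMap ℂ fun v => omegaExplicit p X v - 2 * dS p v ⟨(j, l), hjl⟩ :=
    ⟨fun u v => by rw [(isLinearMap_omega p X).map_add, map_add, Pi.add_apply]; ring,
      fun r v => by rw [(isLinearMap_omega p X).map_smul, map_smul, Pi.smul_apply]; simp only [smul_eq_mul]; ring⟩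
  obtain ⟨c, hc⟩ := exists_fibre hlin key
  -- Contraction with a fibre vector is 4 Σ γ_k dμ_k, whence the components -c_k/4.
  set F := fibreVec m fun k => -(c k) / 4 with hF
  have hFf : StokesFree F := fibreVec_free _
  have hFo : ∀ v, omegaExplicit p F v = -∑ k, c k * mu (halfIdx k) v := fun v => by
    rw [omega_stokesFree hFf, Finset.mul_sum, ← Finset.sum_neg_distrib]
    refine Finset.sum_congr rfl fun k _ => ?_
    change 4 * (-(c k) / 4 * _) = _
    ring
  refine ⟨(1 / 2 : ℂ) • (X + F), fun v => ?_, fun a => ?_⟩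
  · rw [omega_swap, (isLinearMap_omega p v).map_smul, (isLinearMap_omega p v).map_add, omega_swap p v X,
      omega_swap p v F, hFo, ← hc, smul_eq_mul]
    ring
  · obtain ⟨⟨a, b⟩, hab⟩ := a
    rw [map_smul, map_add, (dS_eq_zero hp F).2 hFf, add_zero, hX, Pi.smul_apply, stokesCoords, hES,
      Matrix.smul_apply, hyS, ug_upper hSu hjl' hab]
    simp only [ugagliaTensor, smul_eq_mul]; ring

/-- Nondegeneracy. -/
theorem omega_nondegenerate (hp : p ∈ regularLocus (m + 1)) (q : Chart (m + 1)) {u : Chart (m + 1)}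
    (h : ∀ v, omegaExplicit q u v = 0) : u = 0 := by
  have h0 : ∀ v, omegaExplicit p u v = 0 := fun v => by rw [omega_const p q, h]
  -- Pairing u with the Hamiltonian field of every s_{jl} shows dS u = 0.
  have h1 : StokesFree u := by
    rw [← dS_eq_zero hp]
    funext b
    obtain ⟨X, hX, -⟩ := stokes_hamiltonian hp b
    rw [← hX, omega_swap, h0, neg_zero]; rfl
  rw [eq_fibreVec h1]
  -- On fibre vectors the form is the pairing of γ_k with dμ_k, and the μ_k take arbitrary values.
  have h2 : ∀ k, gam k u = 0 := by
    intro k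
    obtain ⟨e, he⟩ := mu_surjective_half (m := m) (Pi.single k 1)
    have h3 := h0 e
    rw [omega_stokesFree h1] at h3
    simpa [he, Pi.single_apply] using h3
  funext i
  rcases i with t | k | k
  · rfl
  · rfl
  · exact h2 k

lemma chart_sum {n : ℕ} (u : Chart n) : u = ∑ i, u i • basisVec i := by
  funext j; simp [basisVec, Finset.sum_apply, Pi.single_apply]

lemma omega_basis (p u v : Chart (m + 1)) :
    omegaExplicit p u v = ∑ i, u i * omegaExplicit p (basisVec i) v := by
  rw [omega_swap]
  conv_lhs => rw [chart_sum u]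
  rw [← (isLinearMap_omega p v).mk'_apply, map_sum, ← Finset.sum_neg_distrib]
  refine Finset.sum_congr rfl fun i _ => ?_
  rw [map_smul, IsLinearMap.mk'_apply, omega_swap p v, smul_eq_mul]; ring

lemma formMatrix_eq (hp : p ∈ regularLocus (m + 1)) :
    formMatrix OmegaSigma p = formMatrix omegaExplicit (0 : Chart (m + 1)) := by
  ext i j
  simp only [formMatrix, of_apply]
  rw [OmegaSigma_eq hp, omega_const p 0]

/-- The coefficients are constant, so nondegeneracy at one regular point is enough; the base point 0
itself need not be regular. -/
lemma isUnit_formMatrix (m : ℕ) : IsUnit (formMatrix omegaExplicit (0 : Chart (m + 1))).det := by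
  obtain ⟨p, hp⟩ := (dense_regularLocus m).nonempty
  rw [isUnit_iff_ne_zero]
  intro h
  obtain ⟨v, hv, h1⟩ := exists_vecMul_eq_zero_iff.2 h
  refine hv (omega_nondegenerate hp 0 fun w => ?_)
  have h2 : ∀ j, omegaExplicit 0 v (basisVec j) = 0 := fun j => by
    rw [omega_basis]; exact congrFun h1 j
  conv_lhs => rw [chart_sum w]
  rw [← (isLinearMap_omega 0 v).mk'_apply, map_sum]
  exact Finset.sum_eq_zero fun j _ => by rw [map_smul, IsLinearMap.mk'_apply, h2, smul_zero]

/-- The bracket is the derivative along the Hamiltonian vector field. -/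
lemma poisson_eq (hp : p ∈ regularLocus (m + 1)) (f : Chart (m + 1) → ℂ) {g : Chart (m + 1) → ℂ} {Y : Chart (m + 1)}
    (hY : ∀ v, omegaExplicit p Y v = fderiv ℂ g p v) : poisson OmegaSigma f g p = fderiv ℂ f p Y := by
  rw [poisson, formMatrix_eq hp]
  set M := formMatrix omegaExplicit (0 : Chart (m + 1)) with hM
  have h1 : ∀ i, ∑ j, fderiv ℂ g p (basisVec j) * M⁻¹ j i = Y i := by
    have h2 : (fun j => fderiv ℂ g p (basisVec j)) = Y ᵥ* M := by
      funext j
      rw [← hY, omega_const p 0, omega_basis]; rfl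
    intro i
    have h3 : (Y ᵥ* M) ᵥ* M⁻¹ = Y := by
      rw [vecMul_vecMul, mul_nonsing_inv _ (isUnit_formMatrix m), vecMul_one]
    rw [← h2] at h3
    exact congrFun h3 i
  conv_rhs => rw [chart_sum Y, map_sum]
  refine Finset.sum_congr rfl fun i _ => ?_
  rw [map_smul, ← h1, smul_eq_mul, Finset.sum_mul]
  exact Finset.sum_congr rfl fun j _ => by rw [transpose_apply]; ring

/-- In logarithmic coordinates the Poisson tensor is a constant antisymmetric matrix, and the
differential of e^q is e^q dq. -/
lemma log_canonical (m : ℕ) : ∃ B : Matrix (Coord (m + 1)) (Coord (m + 1)) ℂ, Bᵀ = -B ∧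
    ∀ p ∈ regularLocus (m + 1), ∀ i j,
      poisson OmegaSigma (fun q => Complex.exp (q i)) (fun q => Complex.exp (q j)) p =
        B i j * Complex.exp (p i) * Complex.exp (p j) := by
  set M := formMatrix omegaExplicit (0 : Chart (m + 1)) with hM
  refine ⟨(M⁻¹)ᵀ, ?_, fun p hp i j => ?_⟩
  · have h1 : Mᵀ = -M := by
      ext i j; simp only [hM, formMatrix, transpose_apply, of_apply, Matrix.neg_apply]; exact omega_swap _ _ _
    have h2 : (-M)⁻¹ = -M⁻¹ := inv_eq_left_inv (by
      rw [neg_mul_neg, nonsing_inv_mul _ (isUnit_formMatrix m)])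
    rw [transpose_transpose, transpose_nonsing_inv, h1, h2, neg_neg]
  · have hd : ∀ i k : Coord (m + 1), fderiv ℂ (fun q : Chart (m + 1) => Complex.exp (q i)) p (basisVec k)
        = if i = k then Complex.exp (p i) else 0 := fun i k => by
      have h1 : HasFDerivAt (fun q : Chart (m + 1) => q i) (ContinuousLinearMap.proj i) p :=
        (ContinuousLinearMap.proj (R := ℂ) (φ := fun _ : Coord (m + 1) => ℂ) i).hasFDerivAt
      rw [h1.cexp.fderiv]
      simp [basisVec, Pi.single_apply]
    rw [poisson, formMatrix_eq hp, ← hM]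
    simp [hd]

lemma hamiltonian_mu (hp : p ∈ regularLocus (m + 1)) (k : Fin ((m + 1) / 2)) (v : Chart (m + 1)) :
    OmegaSigma p ((1 / 4 : ℂ) • basisVec (Sum.inr (Sum.inr k))) v = fderiv ℂ (mu (halfIdx k)) p v := by
  have h : StokesFree ((1 / 4 : ℂ) • basisVec (Sum.inr (Sum.inr k)) : Chart (m + 1)) :=
    (stokesFree_iff _).2 fun i => by rcases i with t | k <;> simp [basisVec]
  rw [OmegaSigma_eq hp, omega_stokesFree h, IsLinearMap.fderiv_eq (isLinearMap_mu _), Finset.sum_eq_single k]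
  · simp [gam, basisVec]
  · intro l _ hl
    simp [gam, basisVec, hl]
  · simp

section Bracket

variable {f g : StokesSpace (m + 1) → ℂ}

lemma hasFDerivAt_S (p : Chart (m + 1)) : ∃ L : Chart (m + 1) →L[ℂ] StokesSpace (m + 1),
    HasFDerivAt (fun q => stokesCoords (Smat q)) L p ∧ ∀ v, L v = dS p v :=
  ⟨ContinuousLinearMap.pi fun a => fderiv ℂ (fun q => Smat q a.1.1 a.1.2) p,
    hasFDerivAt_pi.2 fun a => (diff_Smat p a.1.1 a.1.2).hasFDerivAt, fun _ => rfl⟩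

lemma fderiv_comp_S (hf : DifferentiableAt ℂ f (stokesCoords (Smat p))) (v : Chart (m + 1)) :
    fderiv ℂ (fun q => f (stokesCoords (Smat q))) p v = fderiv ℂ f (stokesCoords (Smat p)) (dS p v) := by
  obtain ⟨L, hL, hv⟩ := hasFDerivAt_S p
  have h : HasFDerivAt (fun q => f (stokesCoords (Smat q))) ((fderiv ℂ f (stokesCoords (Smat p))).comp L) p :=
    HasFDerivAt.comp p hf.hasFDerivAt hL
  rw [h.fderiv, ContinuousLinearMap.comp_apply, hv]

lemma stokes_sum {n : ℕ} (w : StokesSpace n) : w = ∑ a, w a • Pi.single a (1 : ℂ) := by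
  funext j; simp [Finset.sum_apply, Pi.single_apply]

/-- The Hamiltonian vector field of a function of the Stokes matrix. -/
lemma hamiltonian_S (hp : p ∈ regularLocus (m + 1)) (hg : DifferentiableAt ℂ g (stokesCoords (Smat p))) :
    ∃ Y : Chart (m + 1), (∀ v, omegaExplicit p Y v = fderiv ℂ (fun q => g (stokesCoords (Smat q))) p v) ∧
      ∀ a, dS p Y a = -(1 / 8) * ∑ b, ugagliaTensor (stokesCoords (Smat p)) a b
        * fderiv ℂ g (stokesCoords (Smat p)) (Pi.single b 1) := by
  choose X hX hX' using stokes_hamiltonian hp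
  refine ⟨∑ b, fderiv ℂ g (stokesCoords (Smat p)) (Pi.single b 1) • X b, fun v => ?_, fun a => ?_⟩
  · rw [fderiv_comp_S hg, omega_swap, ← (isLinearMap_omega p v).mk'_apply, map_sum, ← Finset.sum_neg_distrib]
    conv_rhs => rw [stokes_sum (dS p v), map_sum]
    refine Finset.sum_congr rfl fun b _ => ?_
    rw [map_smul, map_smul, IsLinearMap.mk'_apply, omega_swap p v, hX, smul_eq_mul, smul_eq_mul]; ring
  · rw [map_sum, Finset.sum_apply, Finset.mul_sum]
    refine Finset.sum_congr rfl fun b _ => ?_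
    rw [map_smul, Pi.smul_apply, hX', smul_eq_mul]; ring

/-- The bracket on Σ is the derivative of f along the Hamiltonian field of g, and dS maps that field
to -1/8 times Ugaglia's tensor contracted with dg. -/
theorem ugaglia_eq (hp : p ∈ regularLocus (m + 1)) (hf : DifferentiableAt ℂ f (stokesCoords (Smat p)))
    (hg : DifferentiableAt ℂ g (stokesCoords (Smat p))) : ugaglia f g (stokesCoords (Smat p))
      = -8 * poisson OmegaSigma (fun q => f (stokesCoords (Smat q))) (fun q => g (stokesCoords (Smat q))) p := by
  obtain ⟨Y, hY, hY'⟩ := hamiltonian_S hp hg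
  rw [poisson_eq hp _ hY, fderiv_comp_S hf, stokes_sum (dS p Y), map_sum, ugaglia, Finset.mul_sum]
  refine Finset.sum_congr rfl fun a _ => ?_
  rw [map_smul, hY', smul_eq_mul, Finset.mul_sum, Finset.sum_mul, Finset.mul_sum]
  exact Finset.sum_congr rfl fun b _ => by ring

/-- If Y is the Hamiltonian field of f∘S, then {f, g}_U = 8 dg(dS Y). This vanishes for all g
exactly when Y is tangent to the fibres, that is, when d(f∘S) = Ω(Y, ·) is a combination of the
dμ_k. -/
theorem casimir_iff (hp : p ∈ regularLocus (m + 1)) (hf : DifferentiableAt ℂ f (stokesCoords (Smat p))) :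
    (∀ g : StokesSpace (m + 1) → ℂ, DifferentiableAt ℂ g (stokesCoords (Smat p)) →
        ugaglia f g (stokesCoords (Smat p)) = 0) ↔
      ∃ c : Fin ((m + 1) / 2) → ℂ, ∀ v : Chart (m + 1),
        fderiv ℂ (fun q => f (stokesCoords (Smat q))) p v = ∑ k, c k * fderiv ℂ (mu (halfIdx k)) p v := by
  have key : ∀ Y : Chart (m + 1), (∀ v, omegaExplicit p Y v = fderiv ℂ (fun q => f (stokesCoords (Smat q))) p v) →
      ∀ g : StokesSpace (m + 1) → ℂ, DifferentiableAt ℂ g (stokesCoords (Smat p)) →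
        ugaglia f g (stokesCoords (Smat p)) = 8 * fderiv ℂ g (stokesCoords (Smat p)) (dS p Y) := by
    intro Y hY g hg
    obtain ⟨Z, hZ, -⟩ := hamiltonian_S hp hg
    rw [ugaglia_eq hp hf hg, poisson_eq hp _ hZ, ← hY, omega_swap, hZ, fderiv_comp_S hg]; ring
  simp only [IsLinearMap.fderiv_eq (isLinearMap_mu _)]
  constructor
  · intro h
    obtain ⟨Y, hY, -⟩ := hamiltonian_S hp hf
    have h1 : StokesFree Y := by
      rw [← dS_eq_zero hp]
      funext a
      have h2 : HasFDerivAt (fun s : StokesSpace (m + 1) => s a) (ContinuousLinearMap.proj a) (stokesCoords (Smat p)) :=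
        (ContinuousLinearMap.proj (R := ℂ) (φ := fun _ : StokesIdx (m + 1) => ℂ) a).hasFDerivAt
      have h3 := h _ h2.differentiableAt
      rw [key Y hY _ h2.differentiableAt, h2.fderiv] at h3
      simpa using h3
    refine ⟨fun k => 4 * gam k Y, fun v => ?_⟩
    rw [← hY, omega_stokesFree h1, Finset.mul_sum]
    exact Finset.sum_congr rfl fun k _ => by ring
  · rintro ⟨c, hc⟩ g hg
    have h1 := fibreVec_free (m := m) fun k => c k / 4
    rw [key (fibreVec m fun k => c k / 4) (fun v => ?_) g hg, (dS_eq_zero hp _).2 h1, map_zero, mul_zero]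
    rw [omega_stokesFree h1, hc, Finset.mul_sum]
    refine Finset.sum_congr rfl fun k _ => ?_
    change 4 * (c k / 4 * _) = _
    ring

end Bracket

end Symplectic

end

/-! ### Stokes matrices of the differential equation -/

section

open Filter Topology

section StokesPair

attribute [local instance] Matrix.linftyOpNormedRing Matrix.linftyOpNormedAlgebra

variable {n : ℕ} {u : Fin n → ℂ} {V : Matrix (Fin n) (Fin n) ℂ}

lemma hasDerivAt_matrix {F : ℂ → Matrix (Fin n) (Fin n) ℂ} {F' : Matrix (Fin n) (Fin n) ℂ} {z : ℂ} :
    HasDerivAt F F' z ↔ ∀ i j, HasDerivAt (fun w => F w i j) (F' i j) z := by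
  constructor
  · intro h i j
    exact (hasDerivAt_pi.1 (hasDerivAt_pi.1 h i) j)
  · intro h
    exact hasDerivAt_pi.2 fun i => hasDerivAt_pi.2 fun j => h i j

lemma tendsto_matrix {α : Type*} {l : Filter α} {F : α → Matrix (Fin n) (Fin n) ℂ}
    {A : Matrix (Fin n) (Fin n) ℂ} :
    Tendsto F l (𝓝 A) ↔ ∀ i j, Tendsto (fun r => F r i j) l (𝓝 (A i j)) := by
  constructor
  · intro h i j
    exact (tendsto_pi_nhds.1 (tendsto_pi_nhds.1 h i) j)
  · intro h
    exact tendsto_pi_nhds.2 fun i => tendsto_pi_nhds.2 fun j => h i j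

/-- The pairing of a solution at `-z` with a solution at `z` is locally constant. -/
lemma pairing_deriv (hV : Vᵀ = -V) {F G : ℂ → Matrix (Fin n) (Fin n) ℂ} {z : ℂ}
    (hF : HasDerivAt F ((diagonal u + (-z)⁻¹ • V) * F (-z)) (-z))
    (hG : HasDerivAt G ((diagonal u + z⁻¹ • V) * G z) z) :
    HasDerivAt (fun w => (F (-w))ᵀ * G w) 0 z := by
  have h1 : HasDerivAt (fun w => (F (-w))ᵀ)
      (-((diagonal u + (-z)⁻¹ • V) * F (-z)))ᵀ z := by
    rw [hasDerivAt_matrix] at hF ⊢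
    intro i j
    exact ((hF j i).scomp z (hasDerivAt_neg z)).congr_deriv (by simp)
  refine (h1.mul hG).congr_deriv ?_
  rw [transpose_neg, transpose_mul, transpose_add, diagonal_transpose, transpose_smul, hV, inv_neg,
    neg_smul, smul_neg, neg_neg]
  noncomm_ring

/-- The plane cut along the closed negative imaginary half-line. -/
def upperDomain : Set ℂ := {z | z.re ≠ 0 ∨ 0 < z.im}

lemma isOpen_upperDomain : IsOpen upperDomain :=
  (isOpen_ne_fun continuous_re continuous_const).union (isOpen_lt continuous_const continuous_im)

/-- The cut plane is star-shaped about i, the removed half-line lying on the opposite side of the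
origin. -/
lemma isPreconnected_upperDomain : IsPreconnected upperDomain := by
  have : StarConvex ℝ I upperDomain := by
    intro z hz a b ha hb hab
    rcases hb.eq_or_lt with rfl | hb
    · right
      simp at hab
      simp [hab]
    · rcases hz with hz | hz
      · left
        simp [hz, hb.ne']
      · right
        simp
        positivity
  exact (this.isPathConnected (Or.inr (by simp))).isConnected.isPreconnected

/-- The real axis belongs to both closed half-planes, so the leading term of the expansion is
available there for both solutions. -/
lemma tendsto_sectorial {Y : ℕ → Matrix (Fin n) (Fin n) ℂ} {ε : ℝ}
    {Ψ : ℂ → Matrix (Fin n) (Fin n) ℂ} (h : IsSectorialSolution u V Y ε Ψ) (hY : Y 0 = 1)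
    {l : Filter ℝ} {s : ℝ → ℝ} (hs : Tendsto (fun r => (s r : ℂ)) l (Bornology.cobounded ℂ)) :
    Tendsto (fun r => Ψ (s r) * diagonal fun k => exp (-(s r * u k))) l (𝓝 1) := by
  rw [tendsto_matrix]
  intro i j
  have h1 : Tendsto (fun r => (s r : ℂ)) l
      (Bornology.cobounded ℂ ⊓ 𝓟 {z : ℂ | 0 ≤ ε * z.im}) :=
    tendsto_inf.2 ⟨hs, tendsto_principal.2 (.of_forall fun r => by simp)⟩
  have h2 := ((h.asymp 0 i j).comp_tendsto h1).trans_tendsto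
    (by simpa using (tendsto_inv₀_cobounded (α := ℂ)).comp hs)
  rw [← zero_add ((1 : Matrix (Fin n) (Fin n) ℂ) i j)]
  refine (h2.add_const ((1 : Matrix (Fin n) (Fin n) ℂ) i j)).congr fun r => ?_
  simp [hY]

/-- The (i, j) entry of e^{rU}Me^{-rU} tends to δ_{ij}. If r Re(u_j - u_i) ≤ 0, the factor undoing
the conjugation is bounded, so M_{ij} = δ_{ij}. -/
lemma entry_of_tendsto {l : Filter ℝ} [l.NeBot] {F G : ℝ → Matrix (Fin n) (Fin n) ℂ}
    {M : Matrix (Fin n) (Fin n) ℂ} (hM : ∀ᶠ r in l, (F r)ᵀ * G r = M)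
    (hF : Tendsto (fun r => F r * diagonal fun k => exp (r * u k)) l (𝓝 1))
    (hG : Tendsto (fun r => G r * diagonal fun k => exp (-(r * u k))) l (𝓝 1))
    {i j : Fin n} (hij : ∀ᶠ r in l, r * ((u j).re - (u i).re) ≤ 0) :
    M i j = (1 : Matrix (Fin n) (Fin n) ℂ) i j := by
  have h1 : Tendsto (fun r : ℝ => (F r * diagonal fun k => exp (r * u k))ᵀ *
      (G r * diagonal fun k => exp (-(r * u k)))) l (𝓝 1) := by
    simpa using (((continuous_id.matrix_transpose).tendsto _).comp hF).mul hG
  have h2 := (tendsto_matrix.1 h1 i j).sub_const ((1 : Matrix (Fin n) (Fin n) ℂ) i j)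
  rw [sub_self] at h2
  have h3 : Tendsto (fun _ : ℝ => M i j - (1 : Matrix (Fin n) (Fin n) ℂ) i j) l (𝓝 0) := by
    refine squeeze_zero_norm' ?_ (tendsto_zero_iff_norm_tendsto_zero.1 h2)
    filter_upwards [hM, hij] with r hr hij
    have h4 : M i j - (1 : Matrix (Fin n) (Fin n) ℂ) i j = exp (r * (u j - u i)) *
        (((F r * diagonal fun k => exp (r * u k))ᵀ *
          (G r * diagonal fun k => exp (-(r * u k)))) i j - (1 : Matrix (Fin n) (Fin n) ℂ) i j) := by
      rw [transpose_mul, diagonal_transpose, Matrix.mul_assoc, ← Matrix.mul_assoc _ (G r), hr,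
        diagonal_mul, mul_diagonal]
      have h5 : exp (r * (u j - u i)) * (exp (r * u i) * (M i j * exp (-(r * u j)))) = M i j := by
        calc _ = exp (r * (u j - u i) + r * u i + -(r * u j)) * M i j := by
              rw [exp_add, exp_add]; ring
          _ = M i j := by rw [show r * (u j - u i) + r * u i + -(r * u j) = 0 by ring]; simp
      rw [mul_sub, h5]
      rcases eq_or_ne i j with rfl | h
      · simp
      · simp [h]
    rw [h4, norm_mul]
    refine mul_le_of_le_one_left (norm_nonneg _) ?_
    rw [norm_exp]
    simpa using hij
  exact sub_eq_zero.1 (tendsto_nhds_unique tendsto_const_nhds h3)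

variable {Y : ℕ → Matrix (Fin n) (Fin n) ℂ} {Ψup Ψlow : ℂ → Matrix (Fin n) (Fin n) ℂ}

/-- The pairing is constant on a connected domain reaching both ends of the real axis. Since Re u
increases, r → -∞ determines the entries with i ≤ j and r → +∞ those with j ≤ i. -/
lemma pairing_eq_one (hu : StrictMono fun j => (u j).re) (hV : Vᵀ = -V) (hY : Y 0 = 1)
    (hup : IsSectorialSolution u V Y 1 Ψup) (hlow : IsSectorialSolution u V Y (-1) Ψlow)
    {z : ℂ} (hz : z ∈ upperDomain) : (Ψlow (-z))ᵀ * Ψup z = 1 := by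
  have hd : ∀ w ∈ upperDomain, HasDerivAt (fun w => (Ψlow (-w))ᵀ * Ψup w) 0 w := fun w hw =>
    pairing_deriv hV
      (hasDerivAt_matrix.2 (hlow.ode (-w) (hw.imp (by simp) (by simp))))
      (hasDerivAt_matrix.2 (hup.ode w (hw.imp id (by simp))))
  obtain ⟨M, hM⟩ := isOpen_upperDomain.exists_is_const_of_deriv_eq_zero isPreconnected_upperDomain
    (fun w hw => (hd w hw).differentiableAt.differentiableWithinAt) (fun w hw => (hd w hw).deriv)
  rw [hM z hz]
  have key : ∀ (l : Filter ℝ) [l.NeBot], Tendsto (fun r : ℝ => (r : ℂ)) l (Bornology.cobounded ℂ) →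
      (∀ᶠ r in l, r ≠ 0) → ∀ i j, (∀ᶠ r in l, r * ((u j).re - (u i).re) ≤ 0) →
      M i j = (1 : Matrix (Fin n) (Fin n) ℂ) i j := by
    intro l _ hl h0 i j hij
    have hneg : Tendsto (fun r : ℝ => ((-r : ℝ) : ℂ)) l (Bornology.cobounded ℂ) := by
      simpa [Function.comp_def] using tendsto_neg_cobounded.comp hl
    refine entry_of_tendsto (F := fun r => Ψlow ((-r : ℝ) : ℂ)) (G := fun r => Ψup r) (l := l) (u := u)
      ?_ ?_ (tendsto_sectorial hup hY hl) hij
    · filter_upwards [h0] with r hr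
      simpa using hM r (Or.inl (by simpa using hr))
    · simpa using tendsto_sectorial hlow hY hneg
  ext i j
  rcases le_total i j with h | h
  · refine key atBot (RCLike.tendsto_ofReal_atBot_cobounded ℂ) (eventually_ne_atBot 0) i j ?_
    filter_upwards [eventually_le_atBot 0] with r hr
    exact mul_nonpos_of_nonpos_of_nonneg hr (sub_nonneg.2 (hu.monotone h))
  · refine key atTop (RCLike.tendsto_ofReal_atTop_cobounded ℂ) (eventually_ne_atTop 0) i j ?_
    filter_upwards [eventually_ge_atTop 0] with r hr
    exact mul_nonpos_of_nonneg_of_nonpos hr (sub_nonpos.2 (hu.monotone h))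

/-- This pairing equals S_+ for r > 0 only, so one end of the axis is available and only the entries
on and below the diagonal are determined. -/
lemma upperUnipotent_of_sectorial (hu : StrictMono fun j => (u j).re) (hY : Y 0 = 1)
    (hup : IsSectorialSolution u V Y 1 Ψup) {Sp : Matrix (Fin n) (Fin n) ℂ}
    (h : ∀ r : ℝ, 0 < r → (Ψup (-r))ᵀ * Ψup r = Sp) {i j : Fin n} (hij : j ≤ i) :
    Sp i j = (1 : Matrix (Fin n) (Fin n) ℂ) i j := by
  have hneg : Tendsto (fun r : ℝ => ((-r : ℝ) : ℂ)) atTop (Bornology.cobounded ℂ) := by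
    simpa [Function.comp_def] using
      tendsto_neg_cobounded.comp (RCLike.tendsto_ofReal_atTop_cobounded ℂ)
  refine entry_of_tendsto (F := fun r => Ψup ((-r : ℝ) : ℂ)) (G := fun r => Ψup r) (l := atTop)
    (u := u) ?_ ?_ (tendsto_sectorial hup hY (RCLike.tendsto_ofReal_atTop_cobounded ℂ)) ?_
  · filter_upwards [eventually_gt_atTop 0] with r hr
    simpa using h r hr
  · simpa using tendsto_sectorial hup hY hneg
  · filter_upwards [eventually_ge_atTop 0] with r hr
    exact mul_nonpos_of_nonneg_of_nonpos hr (sub_nonpos.2 (hu.monotone hij))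

/-- Conjugation of a constant matrix by the flow `exp(iθV)`. -/
def flowConj (V : Matrix (Fin n) (Fin n) ℂ) (A : Matrix (Fin n) (Fin n) ℂ) (θ : ℝ) :
    Matrix (Fin n) (Fin n) ℂ :=
  NormedSpace.exp ((θ : ℂ) • (-I • V)) * A * NormedSpace.exp ((θ : ℂ) • (I • V))

lemma exp_flow_inv (θ : ℝ) : NormedSpace.exp ((θ : ℂ) • (I • V)) *
    NormedSpace.exp ((θ : ℂ) • (-I • V)) = 1 := by
  rw [← Matrix.exp_add_of_commute]
  · rw [← smul_add, ← add_smul, add_neg_cancel, zero_smul, smul_zero, NormedSpace.exp_zero]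
  · exact (((Commute.refl V).smul_right _).smul_left _).smul_right _ |>.smul_left _

/-- The solution transported back along a half-circle of radius `r`. -/
def circleFlow (V : Matrix (Fin n) (Fin n) ℂ) (Ψ : ℂ → Matrix (Fin n) (Fin n) ℂ) (r θ : ℝ) :
    Matrix (Fin n) (Fin n) ℂ :=
  NormedSpace.exp ((θ : ℂ) • (-I • V)) * Ψ (r * exp (θ * I)) * (Ψ r)⁻¹

/-- Along the circle V/z contributes iV dθ, which the exponential prefactor removes; what is left
comes from U and carries the factor r. -/
lemma circleFlow_deriv {Ψ : ℂ → Matrix (Fin n) (Fin n) ℂ} {r θ : ℝ} (hr : 0 < r)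
    (h : HasDerivAt Ψ ((diagonal u + (r * exp (θ * I))⁻¹ • V) * Ψ (r * exp (θ * I)))
      (r * exp (θ * I))) :
    HasDerivAt (circleFlow V Ψ r)
      ((r * exp (θ * I) * I) • (flowConj V (diagonal u) θ * circleFlow V Ψ r θ)) θ := by
  have h1 : HasDerivAt (fun t : ℂ => r * exp (t * I)) (r * exp (θ * I) * I) (θ : ℂ) := by
    simpa [mul_assoc] using ((hasDerivAt_mul_const I).cexp (x := (θ : ℂ))).const_mul (r : ℂ)
  have h2 := h.scomp (θ : ℂ) h1
  have h3 := hasDerivAt_exp_smul_const (-I • V) (θ : ℂ)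
  have h4 := ((h3.mul h2).mul_const ((Ψ r)⁻¹)).scomp θ ofRealCLM.hasDerivAt
  refine h4.congr_deriv ?_
  rw [ofRealCLM_apply, ofReal_one, one_smul]
  have hne : (r : ℂ) * exp (θ * I) ≠ 0 := mul_ne_zero (by exact_mod_cast hr.ne') (exp_ne_zero _)
  have h5 : (r * exp (θ * I) * I) • ((r * exp (θ * I))⁻¹ • V) = I • V := by
    rw [smul_smul, mul_right_comm, mul_inv_cancel₀ hne, one_mul]
  set c := r * exp (θ * I) * I
  set E := NormedSpace.exp ((θ : ℂ) • (-I • V)) with hE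
  set Z := Ψ (r * exp (θ * I))
  have h6 : flowConj V (diagonal u) θ * circleFlow V Ψ r θ = E * diagonal u * (Z * (Ψ r)⁻¹) := by
    rw [flowConj, circleFlow, Matrix.mul_assoc E Z, Matrix.mul_assoc _ _ (E * _),
      ← Matrix.mul_assoc _ E, exp_flow_inv, Matrix.one_mul]
  have h7 : c • ((diagonal u + (r * exp (θ * I))⁻¹ • V) * Z) =
      c • (diagonal u * Z) + I • (V * Z) := by
    rw [Matrix.add_mul, smul_add, ← Matrix.smul_mul c (_ • V), h5, Matrix.smul_mul]
  rw [h6]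
  change (E * (-I • V) * Z + E * (c • ((diagonal u + (r * exp (θ * I))⁻¹ • V) * Z))) * (Ψ r)⁻¹ = _
  rw [h7]
  simp only [neg_smul, Matrix.mul_neg, Matrix.neg_mul, Matrix.mul_add, Matrix.add_mul,
    Matrix.smul_mul, Matrix.mul_smul, Matrix.mul_assoc]
  abel

lemma mem_upperDomain_circle {r θ : ℝ} (hr : 0 < r) (h0 : 0 ≤ θ) (h1 : θ ≤ Real.pi) :
    (r : ℂ) * exp (θ * I) ∈ upperDomain := by
  rcases h1.eq_or_lt with rfl | h1
  · left
    simp [exp_pi_mul_I, hr.ne']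
  rcases h0.eq_or_lt with rfl | h0
  · left
    simp [hr.ne']
  · right
    rw [im_ofReal_mul, exp_ofReal_mul_I_im]
    exact mul_pos hr (Real.sin_pos_of_pos_of_lt_pi h0 h1)

/-- The reduced equation on the circle of radius r has a coefficient of size O(r), so by Gronwall
its flow stays near the identity: close to the pole only the residue matters. -/
lemma circleFlow_bound (hup : IsSectorialSolution u V Y 1 Ψup)
    (hdet : ∀ r : ℝ, 0 < r → IsUnit (Ψup r).det) :
    ∃ C : ℝ, 0 < C ∧ ∀ r : ℝ, 0 < r → ‖circleFlow V Ψup r Real.pi - 1‖ ≤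
        ‖(1 : Matrix (Fin n) (Fin n) ℂ)‖ * (Real.exp (r * C * Real.pi) - 1) := by
  have hcont : Continuous fun θ : ℝ => flowConj V (diagonal u) θ := by
    unfold flowConj
    have h := NormedSpace.exp_continuous (𝔸 := Matrix (Fin n) (Fin n) ℂ)
    fun_prop
  obtain ⟨C, hC⟩ := (isCompact_Icc (a := (0 : ℝ)) (b := Real.pi)).exists_bound_of_continuousOn
    hcont.continuousOn
  have hC0 : 0 ≤ C := (norm_nonneg _).trans (hC 0 ⟨le_rfl, Real.pi_pos.le⟩)
  -- C + 1 instead of C, because the Gronwall bound is used in the form that divides by a nonzero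
  -- constant.
  refine ⟨C + 1, by positivity, fun r hr => ?_⟩
  have hd : ∀ θ ∈ Set.Icc 0 Real.pi, HasDerivAt (circleFlow V Ψup r)
      ((r * exp (θ * I) * I) • (flowConj V (diagonal u) θ * circleFlow V Ψup r θ)) θ := fun θ hθ =>
    circleFlow_deriv hr (hasDerivAt_matrix.2 (hup.ode _
      ((mem_upperDomain_circle hr hθ.1 hθ.2).imp id (by simp))))
  have h := norm_le_gronwallBound_of_norm_deriv_right_le (f := fun θ => circleFlow V Ψup r θ - 1)
    (a := 0) (b := Real.pi) (δ := 0) (K := r * (C + 1))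
    (ε := r * (C + 1) * ‖(1 : Matrix (Fin n) (Fin n) ℂ)‖)
    (fun θ hθ => ((hd θ hθ).sub_const 1).continuousAt.continuousWithinAt)
    (fun θ hθ => ((hd θ (Set.Ico_subset_Icc_self hθ)).sub_const 1).hasDerivWithinAt)
    (by simp [circleFlow, Matrix.mul_nonsing_inv _ (hdet r hr)])
    (fun θ hθ => by
      rw [norm_smul, ← mul_add, mul_assoc r]
      have e1 : ‖(r : ℂ) * exp (θ * I) * I‖ = r := by
        simp [norm_exp_ofReal_mul_I, abs_of_pos hr]
      rw [e1]
      refine mul_le_mul_of_nonneg_left ((norm_mul_le _ _).trans ?_) hr.le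
      refine mul_le_mul ((hC θ (Set.Ico_subset_Icc_self hθ)).trans (by linarith)) ?_
        (norm_nonneg _) (by positivity)
      calc _ = ‖circleFlow V Ψup r θ - 1 + 1‖ := by rw [sub_add_cancel]
        _ ≤ _ := norm_add_le _ _)
    Real.pi ⟨Real.pi_pos.le, le_rfl⟩
  rw [gronwallBound_of_K_ne_0 (by positivity)] at h
  refine h.trans (le_of_eq ?_)
  have : r * (C + 1) ≠ 0 := by positivity
  simp only [sub_zero]
  field_simp
  ring

/-- The monodromy along a small half-circle. -/
lemma tendsto_halfCircle (hup : IsSectorialSolution u V Y 1 Ψup)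
    (hdet : ∀ r : ℝ, 0 < r → IsUnit (Ψup r).det) :
    Tendsto (fun r : ℝ => Ψup (-r) * (Ψup r)⁻¹) (𝓝[>] 0)
      (𝓝 (NormedSpace.exp ((Real.pi : ℂ) • (I • V)))) := by
  obtain ⟨C, hC0, hC⟩ := circleFlow_bound hup hdet
  have h1 : Tendsto (fun r : ℝ => circleFlow V Ψup r Real.pi - 1) (𝓝[>] 0) (𝓝 0) := by
    refine squeeze_zero_norm' (eventually_mem_nhdsWithin.mono hC) ?_
    have : Tendsto (fun r : ℝ => ‖(1 : Matrix (Fin n) (Fin n) ℂ)‖ *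
        (Real.exp (r * C * Real.pi) - 1)) (𝓝 0) (𝓝 (‖(1 : Matrix (Fin n) (Fin n) ℂ)‖ *
        (Real.exp (0 * C * Real.pi) - 1))) := Continuous.tendsto (by fun_prop) 0
    simpa using this.mono_left nhdsWithin_le_nhds
  have h2 := (h1.add_const 1).const_mul (NormedSpace.exp ((Real.pi : ℂ) • (I • V)))
  simp only [sub_add_cancel, zero_add, mul_one] at h2
  refine h2.congr fun r => ?_
  rw [circleFlow, exp_pi_mul_I, mul_neg_one, Matrix.mul_assoc, ← Matrix.mul_assoc, exp_flow_inv,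
    Matrix.one_mul]

end StokesPair

/-- The determinant of the pencil xA - B involves no inverse, which is convenient for passing to the
limit. -/
lemma eval_charpoly_inv_mul {n : ℕ} {A : Matrix (Fin n) (Fin n) ℂ} (hA : IsUnit A.det)
    (B : Matrix (Fin n) (Fin n) ℂ) (x : ℂ) :
    A.det * (A⁻¹ * B).charpoly.eval x = (x • A - B).det := by
  rw [Matrix.eval_charpoly, ← det_mul, Matrix.mul_sub, ← Matrix.mul_assoc, mul_nonsing_inv _ hA,
    Matrix.one_mul, Matrix.scalar_apply, ← Matrix.smul_one_eq_diagonal, Matrix.mul_smul,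
    Matrix.mul_one]

/-- The Stokes matrices of a Fuchsian point with skew-symmetric residue. -/
theorem stokes_pair {n : ℕ} {u : Fin n → ℂ} {V Sp Sm : Matrix (Fin n) (Fin n) ℂ}
    (hu : StrictMono fun j => (u j).re) (hV : Vᵀ = -V) (h : IsStokesPair u V Sp Sm) :
    IsUpperUnipotent Sp ∧ Sm = (Sp⁻¹)ᵀ ∧
      ((Sp⁻¹)ᵀ * Sp).charpoly =
        (NormedSpace.exp ((2 * (Real.pi : ℂ) * Complex.I) • V)).charpoly := by
  obtain ⟨Y, Ψup, Ψlow, hY, hup, hlow, hp, hm⟩ := h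
  have hA : ∀ r : ℝ, r ≠ 0 → (Ψlow (-r))ᵀ * Ψup r = 1 := fun r hr =>
    pairing_eq_one hu hV hY hup hlow (Or.inl (by simpa using hr))
  -- The pairing at -r, transposed, cancels Ψ_low in Ψ_up = Ψ_low S_+.
  have hB : ∀ r : ℝ, 0 < r → (Ψup (-r))ᵀ * Ψup r = Sp := by
    intro r hr
    have h1 := congrArg transpose (hA (-r) (neg_ne_zero.2 hr.ne'))
    simp only [ofReal_neg, neg_neg, transpose_mul, transpose_transpose, transpose_one] at h1
    rw [hp r hr, ← Matrix.mul_assoc, h1, Matrix.one_mul]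
  have hS : ∀ i j, j ≤ i → Sp i j = (1 : Matrix (Fin n) (Fin n) ℂ) i j := fun i j hij =>
    upperUnipotent_of_sectorial hu hY hup hB hij
  have hU : IsUpperUnipotent Sp := by
    refine ⟨fun i j hij => ?_, fun i => ?_⟩
    · exact (hS i j (le_of_lt hij)).trans (one_apply_ne (ne_of_gt hij))
    · rw [hS i i le_rfl, one_apply_eq]
  have hdS : Sp.det = 1 := by
    rw [det_of_isUpperTriangular hU.1]
    exact Finset.prod_eq_one fun i _ => hU.2 i
  have hSm : Sm = (Sp⁻¹)ᵀ := by
    have h1 := hA 1 one_ne_zero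
    have h2 := hm (-1) (by norm_num)
    push_cast at h1 h2
    rw [h2, transpose_mul, Matrix.mul_assoc] at h1
    have h3 := hB 1 one_pos
    push_cast at h3
    rw [h3] at h1
    rw [inv_eq_left_inv h1, transpose_transpose]
  refine ⟨hU, hSm, ?_⟩
  have hdet : ∀ r : ℝ, 0 < r → IsUnit (Ψup r).det := fun r hr =>
    (isUnit_iff_isUnit_det _).1 (IsUnit.of_mul_eq_one_right _ (hA r hr.ne'))
  set E := NormedSpace.exp ((Real.pi : ℂ) • (I • V)) with hE
  have hET : Eᵀ = E⁻¹ := by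
    rw [hE, ← Matrix.exp_transpose, transpose_smul, transpose_smul, hV, smul_neg, smul_neg,
      Matrix.exp_neg]
  have hEdet : IsUnit E.det := (isUnit_iff_isUnit_det _).1 (Matrix.isUnit_exp _)
  -- With P = Ψ_up(-r)Ψ_up(r)⁻¹ and g = Ψ_up(r) one has S_+ = g^tP^tg and S_+^t = g^tPg, so the
  -- pencil xP - P^t carries the characteristic polynomial of S_+^{-t}S_+. The matrix P has a limit
  -- as r → 0.
  have hP : ∀ x : ℂ, ∀ r : ℝ, 0 < r →
      (x • (Ψup (-r) * (Ψup r)⁻¹) - (Ψup (-r) * (Ψup r)⁻¹)ᵀ).det =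
        (Ψup (-r) * (Ψup r)⁻¹).det * ((Sp⁻¹)ᵀ * Sp).charpoly.eval x := by
    intro x r hr
    have h1 : IsUnit (Ψup r).det := hdet r hr
    set g := Ψup r
    set P := Ψup (-r) * g⁻¹ with hPd
    have h2 : Ψup (-r) = P * g := by rw [hPd, Matrix.mul_assoc, nonsing_inv_mul _ h1, Matrix.mul_one]
    have h3 : Sp = gᵀ * Pᵀ * g := by rw [← hB r hr, h2, transpose_mul]
    have h4 : Spᵀ = gᵀ * P * g := by
      rw [h3]; simp [Matrix.mul_assoc]
    have h5 := eval_charpoly_inv_mul (A := Spᵀ) (by rw [det_transpose, hdS]; exact isUnit_one) Sp x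
    rw [det_transpose, hdS, one_mul] at h5
    rw [transpose_nonsing_inv, h5, h4, h3]
    have h6 : x • (gᵀ * P * g) - gᵀ * Pᵀ * g = gᵀ * (x • P - Pᵀ) * g := by
      rw [Matrix.mul_sub, Matrix.sub_mul, Matrix.mul_smul, Matrix.smul_mul]
    have h7 := congrArg det h4
    rw [det_transpose, hdS] at h7
    rw [h6]
    simp only [det_mul, det_transpose] at h7 ⊢
    linear_combination (x • P - Pᵀ).det * h7
  have hlim := tendsto_halfCircle (V := V) hup hdet
  have hE2 : ∀ x : ℂ, (x • E - Eᵀ).det = E.det * ((Sp⁻¹)ᵀ * Sp).charpoly.eval x := by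
    intro x
    have c1 : Continuous fun P : Matrix (Fin n) (Fin n) ℂ => (x • P - Pᵀ).det := by fun_prop
    have c2 : Continuous fun P : Matrix (Fin n) (Fin n) ℂ =>
      P.det * ((Sp⁻¹)ᵀ * Sp).charpoly.eval x := by fun_prop
    refine tendsto_nhds_unique_of_eventuallyEq ((c1.tendsto _).comp hlim) ((c2.tendsto _).comp hlim) ?_
    exact eventually_mem_nhdsWithin.mono (hP x)
  have hfin : ((Sp⁻¹)ᵀ * Sp).charpoly = (E⁻¹ * Eᵀ).charpoly := by
    refine Polynomial.funext fun x => mul_left_cancel₀ hEdet.ne_zero ?_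
    rw [← hE2, eval_charpoly_inv_mul hEdet]
  -- V is skew-symmetric, so E^t = E⁻¹ and E⁻¹E^t = (E²)^t with E² = e^{2πiV}.
  rw [hfin, hET, ← hET, ← transpose_mul, charpoly_transpose, hE, ← Matrix.exp_add_of_commute _ _ (Commute.refl _),
    ← two_smul ℂ, smul_smul, smul_smul]

end

end FrobeniusStokes

end

open FrobeniusStokes in
theorem mainTheorem8 (n : ℕ) (hn : 2 ≤ n) :
    -- the Stokes matrices of the differential equation
    (∀ (u : Fin n → ℂ) (V Sp Sm : Matrix (Fin n) (Fin n) ℂ),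
      StrictMono (fun j => (u j).re) → Vᵀ = -V → IsStokesPair u V Sp Sm →
        IsUpperUnipotent Sp ∧ Sm = (Sp⁻¹)ᵀ ∧
        ((Sp⁻¹)ᵀ * Sp).charpoly =
          (NormedSpace.exp ((2 * (Real.pi : ℂ) * Complex.I) • V)).charpoly) ∧
    -- the parametrization: Stokes matrix, local monodromy, eigenvalues
    (∀ p : Chart n,
      A1 p * A2 p * A3 p = 1 ∧
      IsUpperUnipotent (Smat p) ∧
      (∀ d : Fin n → ℂ,
        (∀ j, (Matrix.diagonal d * Pmat n * A1 p * Dmat p * ((A3 p)⁻¹)ᵀ *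
          (Matrix.diagonal d * Pmat n)ᵀ) j j = 1) ↔ ∀ j, d j ^ 2 = qdiag p j ^ 2) ∧
      (M0 p).IsLowerTriangular ∧
      (∀ j, M0 p j j = (mval p j)⁻¹) ∧
      (∀ j, mval p (Fin.rev j) = (mval p j)⁻¹) ∧
      Smat p * ((Smat p)⁻¹)ᵀ =
        ((Qmat p)⁻¹)ᵀ * (A3 p)ᵀ * M0 p * ((A3 p)⁻¹)ᵀ * (Qmat p)ᵀ ∧
      (((Smat p)⁻¹)ᵀ * Smat p).charpoly =
        ∏ j, (Polynomial.X - Polynomial.C (mval p j))) ∧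
    -- the regular locus is generic
    IsOpen (regularLocus n) ∧ Dense (regularLocus n) ∧
    -- the connection matrix, and the vertex conditions
    (∀ p ∈ regularLocus n,
      (∀ C : Matrix (Fin n) (Fin n) ℂ,
        (C.IsLowerTriangular ∧ (∀ j, C j j = cval p j) ∧
          M0 p * C = C * (Lam p)⁻¹) ↔ C = C0 p) ∧
      VertexConditions stokesGraph jump p) ∧
    -- `ξ, ζ` are local coordinates on the Stokes matrices, and `γ` are coordinates on the fibres
    (∀ p ∈ regularLocus n,
      (∀ i j, DifferentiableAt ℂ (fun q => Smat q i j) p) ∧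
      (∀ i j, DifferentiableAt ℂ (fun q => C0 q i j) p) ∧
      (∀ w : StokesSpace n, ∃ u : Chart n, stokesCoords (mder Smat p u) = w) ∧
      (∀ u : Chart n, mder Smat p u = 0 ↔
        ∀ i : (triples n : Finset (ℕ × ℕ × ℕ)) ⊕ Fin (n - 1),
          u (i.elim Sum.inl fun k => Sum.inr (Sum.inl k)) = 0) ∧
      (∀ u : Chart n, mder Smat p u = 0 → mder C0 p u = 0 → u = 0)) ∧
    -- the explicit expression of the form, which is nondegenerate
    (∀ p ∈ regularLocus n, ∀ u v : Chart n, OmegaSigma p u v = omegaExplicit p u v) ∧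
    (∀ p ∈ regularLocus n, ∀ u : Chart n, (∀ v, OmegaSigma p u v = 0) → u = 0) ∧
    -- the coordinates are log-canonical
    (∃ B : Matrix (Coord n) (Coord n) ℂ, Bᵀ = -B ∧ ∀ p ∈ regularLocus n, ∀ i j,
      poisson OmegaSigma (fun q => Complex.exp (q i)) (fun q => Complex.exp (q j)) p =
        B i j * Complex.exp (p i) * Complex.exp (p j)) ∧
    -- the torus action: `μ_k` generates a shift of `γ_k`, which does not change the Stokes matrix
    (∀ p ∈ regularLocus n, ∀ (k : Fin (n / 2)) (v : Chart n),
      OmegaSigma p ((1 / 4 : ℂ) • basisVec (Sum.inr (Sum.inr k))) v =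
        fderiv ℂ (mu (halfIdx k)) p v) ∧
    (∀ (p : Chart n) (k : Fin (n / 2)) (τ : ℂ),
      Smat (p + τ • basisVec (Sum.inr (Sum.inr k))) = Smat p) ∧
    -- the reduced bracket is Ugaglia's
    (∀ p ∈ regularLocus n, ∀ f g : StokesSpace n → ℂ,
      DifferentiableAt ℂ f (stokesCoords (Smat p)) →
      DifferentiableAt ℂ g (stokesCoords (Smat p)) →
        ugaglia f g (stokesCoords (Smat p)) =
          -8 * poisson OmegaSigma (fun q => f (stokesCoords (Smat q)))
            (fun q => g (stokesCoords (Smat q))) p) ∧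
    -- its Casimirs are the eigenvalues
    (∀ p ∈ regularLocus n, ∀ f : StokesSpace n → ℂ,
      DifferentiableAt ℂ f (stokesCoords (Smat p)) →
        ((∀ g : StokesSpace n → ℂ, DifferentiableAt ℂ g (stokesCoords (Smat p)) →
            ugaglia f g (stokesCoords (Smat p)) = 0) ↔
          ∃ c : Fin (n / 2) → ℂ, ∀ v : Chart n,
            fderiv ℂ (fun q => f (stokesCoords (Smat q))) p v =
              ∑ k, c k * fderiv ℂ (mu (halfIdx k)) p v)) := by
  obtain ⟨m, rfl⟩ : ∃ m, n = m + 1 := ⟨n - 1, by omega⟩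
  exact ⟨fun u V Sp Sm hu hV h => stokes_pair hu hV h,
    fun p => ⟨A123 p, Smat_unipotent p, normalization_iff p, M0_lower, M0_diag, mval_rev p,
      S_mul_invT p, charpoly_S p⟩,
    isOpen_regularLocus m, dense_regularLocus m,
    fun p hp => ⟨C0_iff hp, by
      obtain ⟨x, hx, hl⟩ := exists_jet_C0 (w := fun _ => 0) hp
      exact (vertex_conditions hx hl).1⟩,
    fun p hp => ⟨diff_Smat p, differentiableAt_C0 hp, dS_surjective hp,
      fun u => (mder_Smat_eq_zero hp u).trans (stokesFree_iff u), immersion hp⟩,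
    fun p hp => OmegaSigma_eq hp,
    fun p hp u h => omega_nondegenerate hp p fun v => (OmegaSigma_eq hp u v).symm.trans (h v),
    log_canonical m,
    fun p hp => hamiltonian_mu hp,
    fun p k τ => Smat_shift
      ((stokesFree_iff _).2 fun i => by rcases i with t | k <;> simp [basisVec]) p τ,
    fun p hp f g hf hg => ugaglia_eq hp hf hg,
    fun p hp f hf => casimir_iff hp hf⟩
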